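/- **Setup.** A two-dimensional partition $\lambda=(\lambda_1\ge\lambda_2\ge\dots)$ is identified with its set of boxes $\{(b_1,b_2)\in\mathbb Z_{\ge0}^2: b_2<\lambda_{b_1+1}\}$; $\lambda^t$ is the conjugate partition, $|\lambda|=\sum_i\lambda_i$, $\|\lambda\|^2=\sum_i\lambda_i^2$, and a box $\square=(b_1,b_2)$ has arm length $a(\square)=\lambda_{b_1+1}-b_2-1$ and leg length $l(\square)=\lambda^t_{b_2+1}-b_1-1$. A three-dimensional partition is a (possibly infinite) subset $\pi\subset\mathbb Z_{\ge0}^3$, closed under decreasing coordinates, such that for some $B$ every box of $\pi$ has at most one coordinate larger than $B$. Its asymptotics are $$\pi^{(1)}=\{(b_1,b_2):(b,b_1,b_2)\in\pi\ \forall b\},\quad \pi^{(2)}=\{(b_1,b_2):(b_2,b,b_1)\in\pi\ \forall b\},\quad \pi^{(3)}=\{(b_1,b_2):(b_1,b_2,b)\in\pi\ \forall b\}.$$ Let $P(\lambda,\mu,\nu)$ be the set of $\pi$ with $(\pi^{(1)},\pi^{(2)},\pi^{(3)})=(\lambda,\mu,\nu)$, and let $\chi(\pi)=\sum_{\square\in\pi}(1-\#\{\text{infinite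 legs of }\pi\text{ containing }\square\})$. Let $O_\pi=\sum_{(b_1,b_2,b_3)\in\pi}t_1^{-b_1}t_2^{-b_2}t_3^{-b_3}$, regarded as a rational function, let $f^\vee(t_1,t_2,t_3)=f(t_1^{-1},t_2^{-1},t_3^{-1})$, and put $$T^{\mathrm{vir}}_\pi=O_\pi-O_\pi^\vee t_1t_2t_3-O_\pi O_\pi^\vee(1-t_1)(1-t_2)(1-t_3),\qquad V_\pi=T^{\mathrm{vir}}_\pi-\sum_{k=1}^3\frac{T_{\pi^{(k)}}(t_{k+1},t_{k+2})}{1-t_k^{-1}},$$ where indices are taken modulo $3$ and $T_\lambda(u,v)=\sum_{\square\in\lambda}\big(u^{-l(\square)}v^{a(\square)+1}+u^{l(\square)+1}v^{-a(\square)}\big)$. Each $V_\pi$ is a Laurent polynomial with integer coefficients. For $V=\sum_w m_w w$, a finite sum over Laurent monomials $w$ in $t_1,t_2,t_3$, set $\hat a(V)=\prod_w(w^{1/2}-w^{-1/2})^{-m_w}$. The K-theoretic vertex and its normalization are the Laurent series in $Q$ $$\hat V(\lambda,\mu,\nu)=\sum_{\pi\in P(\lambda,\mu,\nu)}Q^{\chi(\pi)}\hat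 a(V_\pi),\qquad \hat V'(\lambda,\mu,\nu)=\frac{\hat V(\lambda,\mu,\nu)}{\hat V(\emptyset,\emptyset,\emptyset)},$$ whose coefficients are functions on the double cover of the torus of $(t_1,t_2,t_3)$ on which $\kappa^{1/2}=(t_1t_2t_3)^{1/2}$ is defined. For integers $r_1+r_2+r_3=0$ let $\sigma=\sigma(r_1,r_2,r_3)$ be the one-parameter subgroup $z\mapsto(z^{r_1},z^{r_2},z^{r_3})$; it fixes $\kappa$, and it acts on the double cover with $\kappa^{1/2}$ fixed. Write $\hat V'(\lambda,\mu,\nu)^\sigma$ for the limit of $\hat V'(\lambda,\mu,\nu)(\sigma(z)t)$ as $z\to0$, taken coefficient by coefficient in $Q$. Set $t=-Q\kappa^{1/2}$, $q=-Q\kappa^{-1/2}$ and $$C(\lambda,\mu,\nu)(t,q)=\frac{t^{-\|\lambda^t\|^2/2}\,q^{-\|\mu\|^2/2}}{\prod_{\square\in\nu}\big(1-q^{l(\square)}t^{a(\square)+1}\big)}\sum_\eta\Big(\frac qt\Big)^{|\eta|/2}s_{\lambda/\eta}\big(t^{-\rho}q^{-\nu^t}\big)\,s_{\mu^t/\eta}\big(q^{-\rho}t^{-\nu}\big),$$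 expanded in positive powers of $q$ and $t$. Here $\eta$ runs over all partitions, $s_{\lambda/\eta}$ is the skew Schur function (zero unless $\eta\subset\lambda$), and $t^{-\rho}q^{-\nu^t}$ is the sequence $(t^{i-1/2}q^{-\nu^t_i})_{i\ge1}$, and $q^{-\rho}t^{-\nu}$ the sequence $(q^{i-1/2}t^{-\nu_i})_{i\ge1}$. $C(\lambda,\mu,\nu)(q,t)$ is obtained by exchanging $t$ and $q$. **Proposition.** For all two-dimensional partitions $\lambda,\mu,\nu$, the limits of the normalized vertex under preferred slopes exist and are $$\begin{array}{c|c}\sigma=\sigma(r_1,r_2,r_3)&\hat V'(\lambda,\mu,\nu)(t_1,t_2,t_3)^\sigma\\\hline r_1\gg r_3>0\gg r_2&C(\lambda,\mu,\nu)(t,q)\\ r_1\gg0>r_3\gg r_2&C(\mu^t,\lambda^t,\nu^t)(q,t)\\ r_2\gg r_3>0\gg r_1&C(\mu^t,\lambda^t,\nu^t)(t,q)\\ r_2\gg0>r_3\gg r_1&C(\lambda,\mu,\nu)(q,t)\end{array}$$ Here the conditions with $\gg$ mean the following: for each power of $Q$ there is an integer $M$, depending only on $\lambda,\mu,\nu$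 and that power, such that the coefficient of this power of $Q$ has the stated limit for all $(r_1,r_2,r_3)$ with $r_1+r_2+r_3=0$, with $|r_1|,|r_2|>M|r_3|$ and with $r_1,r_2,r_3$ of the signs indicated in that row. -/

import Mathlib

open Filter Topology

/-! ### Partitions

A two-dimensional partition is a `YoungDiagram`: the box `(b₁, b₂)` belongs to `lam` iff
`b₂ < lam.rowLen b₁`, so `lam.rowLen i` is the part with (zero-based) index `i`. -/

namespace YoungDiagram

/-- Arm length of a box `c = (b₁, b₂)` of `lam`. -/
def armLen (lam : YoungDiagram) (c : ℕ × ℕ) : ℕ := lam.rowLen c.1 - c.2 - 1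

/-- Leg length of a box `c = (b₁, b₂)` of `lam`. -/
def legLen (lam : YoungDiagram) (c : ℕ × ℕ) : ℕ := lam.colLen c.2 - c.1 - 1

/-- `‖lam‖²`, the sum of the squares of the parts of `lam`. -/
def normSq (lam : YoungDiagram) : ℕ := (lam.rowLens.map (fun a => a ^ 2)).sum

end YoungDiagram

/-- Three-dimensional partitions, possibly infinite, with finite asymptotics along the axes.
The coordinates `b₁, b₂, b₃` of a box `s` are `s 0, s 1, s 2`. -/
structure Partition3D where
  boxes : Set (Fin 3 → ℕ)
  lower : IsLowerSet boxes
  bounded : ∃ B : ℕ, ∀ s ∈ boxes, ∀ i j : Fin 3, B < s i → B < s j → i = j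

namespace Partition3D

/-- The set of pairs `(b₁, b₂)` such that every box whose coordinate `k + 1` (mod 3) is `b₁` and
whose coordinate `k + 2` (mod 3) is `b₂` belongs to `π`. -/
def asympSet (π : Partition3D) (k : Fin 3) : Set (ℕ × ℕ) :=
  {c | ∀ s : Fin 3 → ℕ, s (k + 1) = c.1 → s (k + 2) = c.2 → s ∈ π.boxes}

theorem asympSet_finite (π : Partition3D) (k : Fin 3) : (π.asympSet k).Finite := by
  obtain ⟨B, hB⟩ := π.bounded
  refine ((Set.finite_Iic B).prod (Set.finite_Iic B)).subset ?_
  rintro ⟨a, b⟩ h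
  have hs := h ![![B + 1, b, a] k, ![a, B + 1, b] k, ![b, a, B + 1] k]
    (by fin_cases k <;> rfl) (by fin_cases k <;> rfl)
  have h1 := hB _ hs k (k + 1)
  have h2 := hB _ hs k (k + 2)
  simp only [Set.mem_prod, Set.mem_Iic]
  constructor
  · by_contra hc
    fin_cases k <;> simp at h1 hc <;> omega
  · by_contra hc
    fin_cases k <;> simp at h2 hc <;> omega

theorem asympSet_isLowerSet (π : Partition3D) (k : Fin 3) : IsLowerSet (π.asympSet k) := by
  rintro ⟨a, b⟩ ⟨a', b'⟩ hle h s h1 h2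
  obtain ⟨ha, hb⟩ := Prod.mk_le_mk.1 hle
  have hs := h ![![s 0, b, a] k, ![a, s 1, b] k, ![b, a, s 2] k]
    (by fin_cases k <;> rfl) (by fin_cases k <;> rfl)
  refine π.lower ?_ hs
  intro i
  fin_cases k <;> fin_cases i <;> simp at h1 h2 ⊢ <;> omega

/-- The two-dimensional partition `π⁽ᵏ⁾` describing the asymptotics of `π` along the axis `k`
(axes are numbered `0, 1, 2`). -/
noncomputable def asymp (π : Partition3D) (k : Fin 3) : YoungDiagram where
  cells := (π.asympSet_finite k).toFinset
  isLowerSet := by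
    rw [Set.Finite.coe_toFinset]
    exact π.asympSet_isLowerSet k

/-- The number of infinite legs of `π` that contain the box `s`. -/
noncomputable def legCount (π : Partition3D) (s : Fin 3 → ℕ) : ℕ :=
  (Finset.univ.filter (fun k : Fin 3 => (s (k + 1), s (k + 2)) ∈ (π.asymp k).cells)).card

/-- The renormalized volume `χ(π)` (only finitely many boxes contribute). -/
noncomputable def chi (π : Partition3D) : ℤ :=
  ∑ᶠ s ∈ π.boxes, (1 - (π.legCount s : ℤ))

/-- The set `P(lam, mu, nu)` of three-dimensional partitions with given asymptotics. -/
def withAsymp (lam mu nu : YoungDiagram) : Set Partition3D :=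
  {π | π.asymp 0 = lam ∧ π.asymp 1 = mu ∧ π.asymp 2 = nu}

/-! ### The virtual tangent character and the vertex -/

/-- The character `O_π = ∑_{s ∈ π} t₁^{-b₁} t₂^{-b₂} t₃^{-b₃}` as a rational function of `t`: each
infinite leg is summed as a geometric series, and the remaining finitely many boxes are counted
with the multiplicity (one minus the number of legs containing the box). -/
noncomputable def boxChar {F : Type*} [Field F] (π : Partition3D) (t : Fin 3 → F) : F :=
  (∑ k : Fin 3, (∑ c ∈ (π.asymp k).cells, (t (k + 1))⁻¹ ^ c.1 * (t (k + 2))⁻¹ ^ c.2) /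
      (1 - (t k)⁻¹)) +
    ∑ᶠ s ∈ π.boxes, (1 - (π.legCount s : F)) * ∏ i, (t i)⁻¹ ^ s i

/-- `T^vir_π = O_π - O_π^∨ t₁t₂t₃ - O_π O_π^∨ (1 - t₁)(1 - t₂)(1 - t₃)`. -/
noncomputable def virTangent {F : Type*} [Field F] (π : Partition3D) (t : Fin 3 → F) : F :=
  π.boxChar t - π.boxChar t⁻¹ * ∏ i, t i - π.boxChar t * π.boxChar t⁻¹ * ∏ i, (1 - t i)

end Partition3D

/-- The character `T_lam(u, v)` of the tangent space to the Hilbert scheme of points of the plane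
at the fixed point `lam`. -/
noncomputable def hilbTangent {F : Type*} [Field F] (lam : YoungDiagram) (u v : F) : F :=
  ∑ c ∈ lam.cells,
    (u ^ (-(lam.legLen c : ℤ)) * v ^ ((lam.armLen c : ℤ) + 1) +
      u ^ ((lam.legLen c : ℤ) + 1) * v ^ (-(lam.armLen c : ℤ)))

/-- The value at the point `t` of the Laurent monomial `t₁^{w₁} t₂^{w₂} t₃^{w₃}`. -/
def laurentMonomial {F : Type*} [Field F] (t : Fin 3 → F) (w : Fin 3 → ℤ) : F := ∏ i, t i ^ w i

/-- The field `ℚ(t₁, t₂, t₃)`. -/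
abbrev RatFun3 : Type := FractionRing (MvPolynomial (Fin 3) ℚ)

/-- The coordinate functions `t₁, t₂, t₃` in `ℚ(t₁, t₂, t₃)`. -/
noncomputable def genericT (i : Fin 3) : RatFun3 :=
  algebraMap (MvPolynomial (Fin 3) ℚ) RatFun3 (MvPolynomial.X i)

namespace Partition3D

/-- The Laurent polynomial with integral coefficients `V` (a finitely supported function on the
lattice of weights) is equal, in `ℚ(t₁, t₂, t₃)`, to the rational function
`T^vir_π - ∑ₖ T_{π⁽ᵏ⁾}(t_{k+1}, t_{k+2}) / (1 - t_k⁻¹)`. -/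
def IsVertexChar (π : Partition3D) (V : (Fin 3 → ℤ) →₀ ℤ) : Prop :=
  (V.sum fun w m => (m : RatFun3) * laurentMonomial genericT w) =
    π.virTangent genericT -
      ∑ k : Fin 3, hilbTangent (π.asymp k) (genericT (k + 1)) (genericT (k + 2)) /
        (1 - (genericT k)⁻¹)

/-- The vertex character `V_π`: the unique Laurent polynomial satisfying `IsVertexChar`. -/
noncomputable def vertexChar (π : Partition3D) : (Fin 3 → ℤ) →₀ ℤ :=
  Classical.epsilon π.IsVertexChar

end Partition3D

/-- `â(V) = ∏_w (w^{1/2} - w^{-1/2})^{-m_w}` for `V = ∑_w m_w w`, as a function of the square roots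
`x i` of the torus coordinates `t i`. -/
noncomputable def aHat {F : Type*} [Field F] (V : (Fin 3 → ℤ) →₀ ℤ) (x : Fin 3 → F) : F :=
  V.prod fun w m => (laurentMonomial x w - (laurentMonomial x w)⁻¹) ^ (-m)

/-- The K-theoretic equivariant vertex `∑_π Q^{χ(π)} â(V_π)`, `π ∈ P(lam, mu, nu)`, at the point
with `t i = (x i)²`. The box-counting variable `Q` is an element of a field of Laurent series and
the sum is taken in the adic topology of that field. -/
noncomputable def vertexSeries {F : Type*} [Field F] (lam mu nu : YoungDiagram)
    (Q : LaurentSeries F) (x : Fin 3 → F) : LaurentSeries F :=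
  ∑' π : Partition3D.withAsymp lam mu nu,
    Q ^ π.1.chi * HahnSeries.C (aHat π.1.vertexChar x)

/-- The normalized vertex. -/
noncomputable def normalizedVertex {F : Type*} [Field F] (lam mu nu : YoungDiagram)
    (Q : LaurentSeries F) (x : Fin 3 → F) : LaurentSeries F :=
  vertexSeries lam mu nu Q x / vertexSeries ⊥ ⊥ ⊥ Q x

/-! ### Skew Schur functions and the refined vertex -/

/-- Semistandard fillings of the skew shape `lam / eta` by natural numbers: weakly increasing along
rows and strictly increasing down columns. -/
def IsSkewTableau (lam eta : YoungDiagram)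
    (T : {c : ℕ × ℕ // c ∈ lam.cells \ eta.cells} → ℕ) : Prop :=
  (∀ c d, c.1.1 = d.1.1 → c.1.2 ≤ d.1.2 → T c ≤ T d) ∧
    (∀ c d, c.1.2 = d.1.2 → c.1.1 < d.1.1 → T c < T d)

open Classical in
/-- The skew Schur function `s_{lam/eta}(y₀, y₁, y₂, …)` evaluated at a sequence of Laurent series;
it is zero unless `eta` is contained in `lam`. -/
noncomputable def skewSchur {F : Type*} [Field F] (lam eta : YoungDiagram)
    (y : ℕ → LaurentSeries F) : LaurentSeries F :=
  if eta ≤ lam then ∑' T : {T // IsSkewTableau lam eta T}, ∏ c, y (T.1 c) else 0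

/-- The series `C(lam, mu, nu)(t, q)` as a function of `a = t^{1/2}` and `b = q^{1/2}`. -/
noncomputable def refinedC {F : Type*} [Field F] (lam mu nu : YoungDiagram)
    (a b : LaurentSeries F) : LaurentSeries F :=
  a ^ (-(lam.transpose.normSq : ℤ)) * b ^ (-(mu.normSq : ℤ)) /
      (∏ c ∈ nu.cells, (1 - b ^ (2 * nu.legLen c) * a ^ (2 * (nu.armLen c + 1)))) *
    ∑ᶠ eta : YoungDiagram, (b / a) ^ eta.card *
      skewSchur lam eta
        (fun i => a ^ (2 * i + 1) * b ^ (-(2 * (nu.transpose.rowLen i : ℤ)))) *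
      skewSchur mu.transpose eta
        (fun i => b ^ (2 * i + 1) * a ^ (-(2 * (nu.rowLen i : ℤ))))

/-! ### Limits under preferred slopes -/

/-- Let `P` be the formal variable of `ℂ((P))`, and put `Q = -P²`. For a point `x` of the torus
(`t i = (x i)²`, so `κ^{1/2} = x₁x₂x₃`) and `k` with `k² = κ^{1/2}`, put `t^{1/2} = kP` and
`q^{1/2} = k⁻¹P`; then `t = -Qκ^{1/2}` and `q = -Qκ^{-1/2}`.

The statement is that every coefficient of `f` converges along the slope `σ(r₁, r₂, r₃)`, to the
same coefficient of `g(t^{1/2}, q^{1/2})`, as soon as the slope lies sufficiently deep in the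
`chamber` (a region depending on a threshold `M`, which may depend on the coefficient only). The
substitution `x i ↦ z^{r i} x i` acts on `t` as `σ(z²)` and fixes `κ^{1/2}`. -/
def HasSlopeLimit (chamber : ℕ → (Fin 3 → ℤ) → Prop)
    (f : LaurentSeries ℂ → (Fin 3 → ℂ) → LaurentSeries ℂ)
    (g : LaurentSeries ℂ → LaurentSeries ℂ → LaurentSeries ℂ) : Prop :=
  ∀ m : ℤ, ∃ M : ℕ, ∀ r : Fin 3 → ℤ, r 0 + r 1 + r 2 = 0 → chamber M r →
    ∀ (x : Fin 3 → ℂ) (k : ℂ), (∀ i, x i ≠ 0) → k ^ 2 = x 0 * x 1 * x 2 →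
      Tendsto
        (fun z : ℂ => (f (-(HahnSeries.single 1 1) ^ 2) (fun i => z ^ r i * x i)).coeff m)
        (𝓝[≠] 0)
        (𝓝 ((g (HahnSeries.single 1 k) (HahnSeries.single 1 k⁻¹)).coeff m))

/-!
The limit of the vertex is computed term by term, and the resulting generating series of
three-dimensional partitions is evaluated by a combinatorial form of the transfer matrix method.

**The limit of a single term.** The arm-leg formula `hilbTangent_eq` shows that `V_π` is a Laurent
polynomial, `Partition3D.vertexPoly`, which satisfies `κ V^∨ = -V` (`Partition3D.dual_vertexPoly`)
and contains no power of `κ = t₁t₂t₃` (`Partition3D.coeff_const`). The factors of `â(V_π)` are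
therefore paired, and along a slope of the first chamber each pair tends to a power of `-κ^{1/2}`.
The total exponent is the index of `π`: the sum of the coefficients of `V_π` at the weights that
are positive for `slopeSign` (`Partition3D.tendsto_aHat_of_pos`). In the opposite chamber the
index changes its sign, and the two remaining chambers are obtained from the reflection that
exchanges the first two axes. Only finitely many `π` contribute to a given power of `Q`
(`Partition3D.finite_chi_le`), so the bound on the slopes can be chosen uniformly, and the
coefficients converge to those of `Partition3D.limitSeries`, the sum over `π` of
`t^{(χ+index)/2} q^{(χ-index)/2}`.

**The index.** When a box is added to `π`, the index changes by `1` or `-1`. The sign depends only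
on the content of the box, and is read off from the direction of the step of the boundary path of
the third leg `ν` at this content (`Partition3D.IsInsert.slopeSign_vertexPoly`). Every `π` is
compared with a cube with three infinite legs, whose vertex character is computed directly; the
result is `Partition3D.index_eq`. Up to a monomial depending on `λ` and `μ`, the term of `π` is
therefore a product over the boxes outside of the third leg, each of which contributes `t` or `q`
according to its content.

**Slices.** The diagonal slices of `π` outside of the third leg are partitions that interlace in
the directions given by the boundary path of `ν`, they connect `μᵗ` to `λ`, and every such
sequence occurs (`Partition3D.exists_sliceEquiv`). By `Partition3D.IsContentCutoff.zpow_eq_prod`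
the limit series becomes a limit of weighted sums over chains of interlacing partitions. The
commutation relations of the transfer operators are realized by bijections: a local maximum of a
chain is exchanged with a local minimum and a number (`YoungDiagram.peakEquiv`), and the weights
of two successive steps in the same direction are exchanged by an involution
(`YoungDiagram.middleToggle`). Sorting the word of steps in this way
(`YoungDiagram.chainReduces_sortWord`) leaves a sum over sorted chains, times a product of factors
`(1 - q^i t^j)⁻¹` over the inversions of the word.

**The two factors.** The product over the inversions, divided by the same product for `ν = ∅`,
tends to the product over the boxes of `ν` (`Partition3D.tendsto_invProd_div`). To see this, the
pairs of steps at a given distance `L` are viewed as the ends of a window moving along the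
boundary path of `ν`. The number of steps of a given direction inside of the window performs a
walk. The inversions are the descents of this walk and the boxes of `ν` with hook length `L` are
its ascents, so that the two products differ by boundary terms; the quotient of those for `ν` and
for `∅` tends to `1`. The sorted chains, on the other hand, descend from `μᵗ` to a partition `η`
and then ascend to `λ`; both parts are semistandard tableaux (`YoungDiagram.exists_tableauEquiv`),
and the sum over them tends to the sum of products of skew Schur functions in the refined vertex.
-/


/-! ### The tangent space of the Hilbert scheme of the plane -/

namespace YoungDiagram

theorem sum_cells_row_ge {M : Type*} [AddCommMonoid M] (lam : YoungDiagram) (i : ℕ)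
    (f : ℕ → ℕ → M) :
    ∑ c ∈ lam.cells with i ≤ c.1, f c.1 c.2 =
      (∑ j ∈ Finset.range (lam.rowLen i), f i j) +
        ∑ c ∈ lam.cells with i + 1 ≤ c.1, f c.1 c.2 := by
  rw [← Finset.sum_filter_add_sum_filter_not (lam.cells.filter (i ≤ ·.1)) (fun c => c.1 = i)]
  congr 1
  · symm
    refine Finset.sum_bij' (fun j _ => (i, j)) (fun c _ => c.2) ?_ ?_ ?_ ?_ ?_
    · intro j hj
      simp only [Finset.mem_filter, mem_cells, mem_iff_lt_rowLen]
      exact ⟨⟨Finset.mem_range.1 hj, le_rfl⟩, trivial⟩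
    · rintro ⟨a, b⟩ hc
      simp only [Finset.mem_filter, mem_cells, mem_iff_lt_rowLen] at hc
      obtain ⟨⟨h1, -⟩, rfl⟩ := hc
      exact Finset.mem_range.2 h1
    · simp
    · rintro ⟨a, b⟩ hc
      simp only [Finset.mem_filter] at hc
      simp [hc.2]
    · simp
  · rw [Finset.filter_filter]
    refine Finset.sum_congr (Finset.filter_congr fun c _ => ?_) fun _ _ => rfl
    omega

theorem sum_cells_row_gt {M : Type*} [AddCommMonoid M] (lam : YoungDiagram) (i : ℕ)
    (f : ℕ → ℕ → M) :
    ∑ c ∈ lam.cells with i + 1 ≤ c.1, f c.1 c.2 =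
      ∑ j ∈ Finset.range (lam.rowLen i), ∑ m ∈ Finset.range (lam.colLen j - (i + 1)),
        f (m + (i + 1)) j := by
  rw [Finset.sum_sigma']
  refine Finset.sum_bij' (fun c _ => ⟨c.2, c.1 - (i + 1)⟩) (fun p _ => (p.2 + (i + 1), p.1))
    ?_ ?_ ?_ ?_ ?_
  · rintro ⟨a, b⟩ hc
    simp only [Finset.mem_filter, mem_cells] at hc
    have h1 := mem_iff_lt_colLen.1 hc.1
    have h2 : (i, b) ∈ lam := lam.up_left_mem (by omega) le_rfl hc.1
    have h3 := mem_iff_lt_rowLen.1 h2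
    simp only [Finset.mem_sigma, Finset.mem_range]
    omega
  · rintro ⟨b, m⟩ hp
    simp only [Finset.mem_sigma, Finset.mem_range] at hp
    simp only [Finset.mem_filter, mem_cells, mem_iff_lt_colLen]
    omega
  · rintro ⟨a, b⟩ hc
    simp only [Finset.mem_filter] at hc
    ext <;> simp; omega
  · rintro ⟨b, m⟩ _
    simp
  · rintro ⟨a, b⟩ hc
    simp only [Finset.mem_filter] at hc
    have : a - (i + 1) + (i + 1) = a := by omega
    simp [this]

end YoungDiagram

/-- The arm-leg formula: `T_lam = L + uv L* - (1-u)(1-v) L L*`, where `L = ∑ u⁻ᵃ v⁻ᵇ` over the boxes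
`(a, b)`. It is proved row by row: the diagram made of the rows `≥ i` satisfies the formula, by
descending induction on `i`. -/
theorem hilbTangent_eq {F : Type*} [Field F] (lam : YoungDiagram) {u v : F} (hu : u ≠ 0)
    (hv : v ≠ 0) :
    hilbTangent lam u v =
      (∑ c ∈ lam.cells, u⁻¹ ^ c.1 * v⁻¹ ^ c.2) + u * v * (∑ c ∈ lam.cells, u ^ c.1 * v ^ c.2) -
        (∑ c ∈ lam.cells, u⁻¹ ^ c.1 * v⁻¹ ^ c.2) * (∑ c ∈ lam.cells, u ^ c.1 * v ^ c.2) *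
          ((1 - u) * (1 - v)) := by
  set L : ℕ → F := fun i => ∑ c ∈ lam.cells with i ≤ c.1, u⁻¹ ^ (c.1 - i) * v⁻¹ ^ c.2 with hL
  set L' : ℕ → F := fun i => ∑ c ∈ lam.cells with i ≤ c.1, u ^ (c.1 - i) * v ^ c.2 with hL'
  set T : ℕ → F := fun i => ∑ c ∈ lam.cells with i ≤ c.1,
    (u ^ (-((lam.colLen c.2 - c.1 - 1 : ℕ) : ℤ)) * v ^ (((lam.rowLen c.1 - c.2 - 1 : ℕ) : ℤ) + 1) +
      u ^ (((lam.colLen c.2 - c.1 - 1 : ℕ) : ℤ) + 1) *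
        v ^ (-((lam.rowLen c.1 - c.2 - 1 : ℕ) : ℤ))) with hT
  have key : ∀ n i, lam.colLen 0 = i + n →
      T i = L i + u * v * L' i - L i * L' i * ((1 - u) * (1 - v)) := by
    intro n
    induction n with
    | zero =>
      intro i hi
      have : lam.cells.filter (i ≤ ·.1) = ∅ := by
        refine Finset.filter_eq_empty_iff.2 ?_
        rintro ⟨a, b⟩ hc hle
        have h0 : (a, 0) ∈ lam := lam.up_left_mem le_rfl (Nat.zero_le b)
          ((YoungDiagram.mem_cells _).1 hc)
        have := YoungDiagram.mem_iff_lt_colLen.1 h0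
        simp only at hle
        omega
      simp [hL, hL', hT, this]
    | succ n ih =>
      intro i hi
      have ih := ih (i + 1) (by omega)
      set A : F := ∑ j ∈ Finset.range (lam.rowLen i), v⁻¹ ^ j with hA
      set A' : F := ∑ j ∈ Finset.range (lam.rowLen i), v ^ j with hA'
      set B : F := ∑ j ∈ Finset.range (lam.rowLen i), v⁻¹ ^ j * u⁻¹ ^ (lam.colLen j - (i + 1)) with hB
      set B' : F := ∑ j ∈ Finset.range (lam.rowLen i), v ^ j * u ^ (lam.colLen j - (i + 1)) with hB'
      have eL : L i = A + u⁻¹ * L (i + 1) := by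
        simp only [hL]
        rw [lam.sum_cells_row_ge i (fun a b => u⁻¹ ^ (a - i) * v⁻¹ ^ b), Finset.mul_sum]
        congr 1
        · simp [hA]
        · refine Finset.sum_congr rfl fun c hc => ?_
          have := (Finset.mem_filter.1 hc).2
          rw [show c.1 - i = (c.1 - (i + 1)) + 1 by omega]
          ring
      have eL' : L' i = A' + u * L' (i + 1) := by
        simp only [hL']
        rw [lam.sum_cells_row_ge i (fun a b => u ^ (a - i) * v ^ b), Finset.mul_sum]
        congr 1
        · simp [hA']
        · refine Finset.sum_congr rfl fun c hc => ?_
          have := (Finset.mem_filter.1 hc).2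
          rw [show c.1 - i = (c.1 - (i + 1)) + 1 by omega]
          ring
      have eB : B = A - (1 - u⁻¹) * L (i + 1) := by
        simp only [hL]
        rw [lam.sum_cells_row_gt i (fun a b => u⁻¹ ^ (a - (i + 1)) * v⁻¹ ^ b), hB, hA,
          Finset.mul_sum, ← Finset.sum_sub_distrib]
        refine Finset.sum_congr rfl fun j _ => ?_
        simp only [Nat.add_sub_cancel]
        rw [← Finset.sum_mul]
        linear_combination (v⁻¹ ^ j) * mul_neg_geom_sum u⁻¹ (lam.colLen j - (i + 1))
      have eB' : B' = A' - (1 - u) * L' (i + 1) := by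
        simp only [hL']
        rw [lam.sum_cells_row_gt i (fun a b => u ^ (a - (i + 1)) * v ^ b), hB', hA',
          Finset.mul_sum, ← Finset.sum_sub_distrib]
        refine Finset.sum_congr rfl fun j _ => ?_
        simp only [Nat.add_sub_cancel]
        rw [← Finset.sum_mul]
        linear_combination (v ^ j) * mul_neg_geom_sum u (lam.colLen j - (i + 1))
      have eT : T i = v ^ lam.rowLen i * B + u * v * (v⁻¹ ^ lam.rowLen i * B') + T (i + 1) := by
        simp only [hT]
        rw [lam.sum_cells_row_ge i (fun a b =>
          (u ^ (-((lam.colLen b - a - 1 : ℕ) : ℤ)) * v ^ (((lam.rowLen a - b - 1 : ℕ) : ℤ) + 1) +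
            u ^ (((lam.colLen b - a - 1 : ℕ) : ℤ) + 1) *
              v ^ (-((lam.rowLen a - b - 1 : ℕ) : ℤ))))]
        congr 1
        rw [hB, hB', Finset.mul_sum, Finset.mul_sum, Finset.mul_sum, ← Finset.sum_add_distrib]
        refine Finset.sum_congr rfl fun j hj => ?_
        have hj := Finset.mem_range.1 hj
        obtain ⟨m, hm⟩ : ∃ m, lam.rowLen i = j + m + 1 := ⟨lam.rowLen i - j - 1, by omega⟩
        have hc := YoungDiagram.mem_iff_lt_colLen.1 (YoungDiagram.mem_iff_lt_rowLen.2 hj)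
        obtain ⟨l, hl⟩ : ∃ l, lam.colLen j = i + l + 1 := ⟨lam.colLen j - i - 1, by omega⟩
        rw [hm, hl, show j + m + 1 - j - 1 = m by omega, show i + l + 1 - i - 1 = l by omega,
          show i + l + 1 - (i + 1) = l by omega]
        simp only [zpow_neg, zpow_natCast, zpow_add_one₀ hu, zpow_add_one₀ hv, inv_pow, pow_add, pow_one]
        field_simp
      have gA : (1 - v) * A' = 1 - v ^ lam.rowLen i := mul_neg_geom_sum v _
      have gA2 : (1 - v⁻¹) * A = 1 - v⁻¹ ^ lam.rowLen i := mul_neg_geom_sum v⁻¹ _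
      have hv1 : v * v⁻¹ = 1 := mul_inv_cancel₀ hv
      have hu1 : u * u⁻¹ = 1 := mul_inv_cancel₀ hu
      rw [eT, ih, eL, eL', show v ^ lam.rowLen i = 1 - (1 - v) * A' by rw [gA]; ring,
        show v⁻¹ ^ lam.rowLen i = 1 - (1 - v⁻¹) * A by rw [gA2]; ring, eB, eB']
      generalize L (i + 1) = P
      generalize L' (i + 1) = P'
      field_simp
      ring
  have h0 := key (lam.colLen 0) 0 (by omega)
  simpa [hL, hL', hT, hilbTangent, YoungDiagram.legLen, YoungDiagram.armLen] using h0

/-! ### Laurent polynomials in three variables -/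

/-- Laurent polynomials in `t₁, t₂, t₃` with integral coefficients. -/
abbrev LaurentPoly3 : Type := AddMonoidAlgebra ℤ (Fin 3 → ℤ)

namespace LaurentPoly3

/-- The monomial of weight `w`. -/
noncomputable def mono (w : Fin 3 → ℤ) : LaurentPoly3 := AddMonoidAlgebra.single w 1

theorem mono_mul (v w : Fin 3 → ℤ) : mono v * mono w = mono (v + w) := by
  simp [mono, AddMonoidAlgebra.single_mul_single]

theorem mono_zero : mono 0 = 1 := rfl

/-- The coordinate `tᵢ`. -/
noncomputable def var (i : Fin 3) : LaurentPoly3 := mono (Pi.single i 1)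

/-- The inverse coordinate `tᵢ⁻¹`. -/
noncomputable def varInv (i : Fin 3) : LaurentPoly3 := mono (Pi.single i (-1))

theorem var_mul_varInv (i : Fin 3) : var i * varInv i = 1 := by
  rw [var, varInv, mono_mul, ← Pi.single_add]
  simp [mono_zero]

/-- The involution `f ↦ f^∨` that inverts the coordinates. -/
noncomputable def dual : LaurentPoly3 →+* LaurentPoly3 :=
  AddMonoidAlgebra.mapDomainRingHom ℤ (negAddMonoidHom : (Fin 3 → ℤ) →+ (Fin 3 → ℤ))

theorem dual_single (w : Fin 3 → ℤ) (m : ℤ) :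
    dual (AddMonoidAlgebra.single w m) = AddMonoidAlgebra.single (-w) m := by
  simp [dual]

theorem dual_mono (w : Fin 3 → ℤ) : dual (mono w) = mono (-w) := dual_single w 1

theorem dual_var (i : Fin 3) : dual (var i) = varInv i := by
  rw [var, dual_mono, ← Pi.single_neg, varInv]

theorem dual_varInv (i : Fin 3) : dual (varInv i) = var i := by
  rw [varInv, dual_mono, ← Pi.single_neg, neg_neg, var]

theorem dual_dual (f : LaurentPoly3) : dual (dual f) = f := by
  induction f using AddMonoidAlgebra.induction_linear with
  | zero => simp
  | add x y hx hy => rw [map_add, map_add, hx, hy]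
  | single w m => rw [dual_single, dual_single, neg_neg]

/-- The value of a Laurent polynomial at a point of the torus. -/
noncomputable def evalAt {F : Type*} [Field F] (t : Fin 3 → F) (ht : ∀ i, t i ≠ 0) :
    LaurentPoly3 →+* F :=
  (AddMonoidAlgebra.lift ℤ F (Fin 3 → ℤ)
    { toFun := fun w => laurentMonomial t w.toAdd
      map_one' := by simp [laurentMonomial]
      map_mul' := fun v w => by
        simp [laurentMonomial, zpow_add₀ (ht _), Finset.prod_mul_distrib] } :
    LaurentPoly3 →ₐ[ℤ] F).toRingHom

variable {F : Type*} [Field F] {t : Fin 3 → F} (ht : ∀ i, t i ≠ 0)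

theorem evalAt_apply (f : LaurentPoly3) :
    evalAt t ht f = f.coeff.sum fun w m => (m : F) * laurentMonomial t w := by
  simp [evalAt, AddMonoidAlgebra.lift_apply]
  rfl

theorem evalAt_single (w : Fin 3 → ℤ) (m : ℤ) :
    evalAt t ht (AddMonoidAlgebra.single w m) = m * laurentMonomial t w := by
  simp [evalAt]
  exact Or.inl rfl

theorem evalAt_mono (w : Fin 3 → ℤ) : evalAt t ht (mono w) = laurentMonomial t w := by
  simp [mono, evalAt_single]

theorem laurentMonomial_single (i : Fin 3) (n : ℤ) :
    laurentMonomial t (Pi.single i n) = t i ^ n := by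
  rw [laurentMonomial, Finset.prod_eq_single i]
  · simp
  · intro j _ hj
    simp [hj]
  · simp

theorem laurentMonomial_add (ht : ∀ i, t i ≠ 0) (v w : Fin 3 → ℤ) :
    laurentMonomial t (v + w) = laurentMonomial t v * laurentMonomial t w := by
  simp [laurentMonomial, zpow_add₀ (ht _), Finset.prod_mul_distrib]

theorem laurentMonomial_ne_zero (ht : ∀ i, t i ≠ 0) (w : Fin 3 → ℤ) : laurentMonomial t w ≠ 0 :=
  Finset.prod_ne_zero_iff.2 fun i _ => zpow_ne_zero _ (ht i)

theorem evalAt_var (i : Fin 3) : evalAt t ht (var i) = t i := by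
  rw [var, evalAt_mono, laurentMonomial_single, zpow_one]

theorem evalAt_varInv (i : Fin 3) : evalAt t ht (varInv i) = (t i)⁻¹ := by
  rw [varInv, evalAt_mono, laurentMonomial_single, zpow_neg_one]

theorem genericT_ne_zero (i : Fin 3) : genericT i ≠ 0 := by
  rw [genericT]
  intro h
  rw [map_eq_zero_iff _ (IsFractionRing.injective (MvPolynomial (Fin 3) ℚ) RatFun3)] at h
  exact MvPolynomial.X_ne_zero i h

/-- Distinct Laurent monomials in the generic coordinates are linearly independent. -/
theorem evalAt_genericT_injective :
    Function.Injective (evalAt genericT genericT_ne_zero) := by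
  rw [injective_iff_map_eq_zero]
  intro f hf
  -- multiplying by a large monomial turns `f` into a polynomial
  obtain ⟨B, hB⟩ : ∃ B : ℕ, ∀ w ∈ f.coeff.support, ∀ i, 0 ≤ w i + B := by
    refine ⟨f.coeff.support.sup fun w => Finset.univ.sup fun i => (w i).natAbs, fun w hw i => ?_⟩
    have h1 := (Finset.le_sup (f := fun i => (w i).natAbs) (Finset.mem_univ i)).trans
      (Finset.le_sup (f := fun w : Fin 3 → ℤ => Finset.univ.sup fun i => (w i).natAbs) hw)
    omega
  let e : (Fin 3 → ℤ) → (Fin 3 →₀ ℕ) := fun w => Finsupp.equivFunOnFinite.symm fun i => (w i + B).toNat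
  have hmon : ∀ w ∈ f.coeff.support, laurentMonomial genericT w *
      laurentMonomial genericT (fun _ => (B : ℤ)) =
        algebraMap (MvPolynomial (Fin 3) ℚ) RatFun3 (MvPolynomial.monomial (e w) 1) := by
    intro w hw
    rw [← laurentMonomial_add genericT_ne_zero, MvPolynomial.monomial_eq, Finsupp.prod_fintype _ _
      (by simp)]
    simp only [laurentMonomial, map_prod, map_one, one_mul, map_pow, Pi.add_apply]
    refine Finset.prod_congr rfl fun i _ => ?_
    have : w i + B = ((e w i : ℕ) : ℤ) := by simp [e, Int.toNat_of_nonneg (hB w hw i)]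
    rw [this, zpow_natCast]
    rfl
  have hpoly : (f.coeff.sum fun w m => MvPolynomial.monomial (e w) (m : ℚ)) = 0 := by
    apply IsFractionRing.injective (MvPolynomial (Fin 3) ℚ) RatFun3
    rw [map_zero, Finsupp.sum, map_sum]
    rw [evalAt_apply, Finsupp.sum] at hf
    have := congrArg (· * laurentMonomial genericT (fun _ => (B : ℤ))) hf
    simp only [zero_mul, Finset.sum_mul] at this
    rw [← this]
    refine Finset.sum_congr rfl fun w hw => ?_
    rw [mul_assoc, hmon w hw, show (MvPolynomial.monomial (e w) ((f.coeff w : ℤ) : ℚ)) =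
      ((f.coeff w : ℤ) : MvPolynomial (Fin 3) ℚ) * MvPolynomial.monomial (e w) 1 by
        rw [show ((f.coeff w : ℤ) : MvPolynomial (Fin 3) ℚ) = MvPolynomial.C ((f.coeff w : ℤ) : ℚ) by
          simp, MvPolynomial.C_mul_monomial, mul_one], map_mul, map_intCast]
  ext w
  by_contra hw
  have hws : w ∈ f.coeff.support := Finsupp.mem_support_iff.2 hw
  have h1 := congrArg (MvPolynomial.coeff (e w)) hpoly
  rw [Finsupp.sum, MvPolynomial.coeff_sum, Finset.sum_eq_single w] at h1
  · simp at h1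
    exact hw (by simpa using h1)
  · intro v hv hvw
    rw [MvPolynomial.coeff_monomial, if_neg]
    intro h
    refine hvw (funext fun i => ?_)
    have h2 := DFunLike.congr_fun h i
    simp only [e, Finsupp.equivFunOnFinite_symm_apply_apply] at h2
    have := hB v hv i
    have := hB w hws i
    omega
  · intro h
    exact absurd hws h

end LaurentPoly3

/-! ### Cutoffs -/

namespace Partition3D

theorem mem_asymp {π : Partition3D} {k : Fin 3} {c : ℕ × ℕ} :
    c ∈ (π.asymp k).cells ↔
      ∀ s : Fin 3 → ℕ, s (k + 1) = c.1 → s (k + 2) = c.2 → s ∈ π.boxes := by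
  simp [asymp, asympSet]

theorem ext_boxes {π π' : Partition3D} (h : π.boxes = π'.boxes) : π = π' := by
  cases π; cases π'; simp_all

/-- Outside of the cube `[0, N)³` the partition consists of its infinite legs, and the profiles of
the legs fit into the square `[0, N)²`. -/
def IsCutoff (π : Partition3D) (N : ℕ) : Prop :=
  (∀ s ∈ π.boxes, ∀ k, N ≤ s k → (s (k + 1), s (k + 2)) ∈ (π.asymp k).cells) ∧
    ∀ k, ∀ c ∈ (π.asymp k).cells, c.1 < N ∧ c.2 < N

theorem IsCutoff.mono {π : Partition3D} {N N' : ℕ} (h : π.IsCutoff N) (hN : N ≤ N') :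
    π.IsCutoff N' :=
  ⟨fun s hs k hk => h.1 s hs k (hN.trans hk), fun k c hc =>
    ⟨(h.2 k c hc).1.trans_le hN, (h.2 k c hc).2.trans_le hN⟩⟩

theorem exists_isCutoff (π : Partition3D) : ∃ N, π.IsCutoff N := by
  obtain ⟨B, hB⟩ := π.bounded
  -- rows that are not part of a leg are finite
  have h1 : ∀ k : Fin 3, ∀ c : ℕ × ℕ, ∃ m : ℕ, c ∉ (π.asymp k).cells → ∀ s ∈ π.boxes,
      s (k + 1) = c.1 → s (k + 2) = c.2 → s k < m := by
    intro k c
    by_cases hc : c ∈ (π.asymp k).cells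
    · exact ⟨0, fun h => absurd hc h⟩
    · rw [mem_asymp] at hc
      push Not at hc
      obtain ⟨s, hs1, hs2, hs3⟩ := hc
      refine ⟨s k, fun _ s' hs' h1' h2' => ?_⟩
      by_contra hle
      refine hs3 (π.lower (fun i => ?_) hs')
      have : i = k ∨ i = k + 1 ∨ i = k + 2 := by fin_cases k <;> fin_cases i <;> decide
      change s i ≤ s' i
      rcases this with rfl | rfl | rfl <;> omega
  choose m hm using h1
  refine ⟨(B + 1) + ((Finset.univ : Finset (Fin 3)).sup fun k =>
    ((Finset.range (B + 1) ×ˢ Finset.range (B + 1)).sup fun c => m k c) +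
      ((π.asymp k).cells.sup fun c => c.1 + c.2 + 1)), fun s hs k hk => ?_, fun k c hc => ?_⟩
  · by_contra hc
    have h2 := hm k _ hc s hs rfl rfl
    have h3 : s (k + 1) ≤ B := by
      by_contra h
      have := hB s hs k (k + 1) (by omega) (by omega)
      revert this; fin_cases k <;> decide
    have h4 : s (k + 2) ≤ B := by
      by_contra h
      have := hB s hs k (k + 2) (by omega) (by omega)
      revert this; fin_cases k <;> decide
    have h5 : m k (s (k + 1), s (k + 2)) ≤
        (Finset.range (B + 1) ×ˢ Finset.range (B + 1)).sup fun c => m k c :=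
      Finset.le_sup (f := fun c => m k c)
        (by simp only [Finset.mem_product, Finset.mem_range]; omega)
    have h6 := Finset.le_sup (f := fun k : Fin 3 =>
      ((Finset.range (B + 1) ×ˢ Finset.range (B + 1)).sup fun c => m k c) +
      ((π.asymp k).cells.sup fun c => c.1 + c.2 + 1)) (Finset.mem_univ k)
    omega
  · have h5 : c.1 + c.2 + 1 ≤ (π.asymp k).cells.sup fun c => c.1 + c.2 + 1 :=
      Finset.le_sup (f := fun c : ℕ × ℕ => c.1 + c.2 + 1) hc
    have h6 := Finset.le_sup (f := fun k : Fin 3 =>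
      ((Finset.range (B + 1) ×ˢ Finset.range (B + 1)).sup fun c => m k c) +
      ((π.asymp k).cells.sup fun c => c.1 + c.2 + 1)) (Finset.mem_univ k)
    omega

/-- The cube `[0, N)³`. -/
def cube (N : ℕ) : Finset (Fin 3 → ℕ) := Fintype.piFinset fun _ => Finset.range N

theorem mem_cube {N : ℕ} {s : Fin 3 → ℕ} : s ∈ cube N ↔ ∀ i, s i < N := by
  simp [cube]

open Classical in
/-- The boxes of `π` in the cube `[0, N)³`. -/
noncomputable def coreBoxes (π : Partition3D) (N : ℕ) : Finset (Fin 3 → ℕ) :=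
  (cube N).filter (· ∈ π.boxes)

theorem mem_coreBoxes {π : Partition3D} {N : ℕ} {s : Fin 3 → ℕ} :
    s ∈ π.coreBoxes N ↔ (∀ i, s i < N) ∧ s ∈ π.boxes := by
  simp [coreBoxes, mem_cube]

theorem legCount_of_le {π : Partition3D} {N : ℕ} (h : π.IsCutoff N) {s : Fin 3 → ℕ}
    (hs : s ∈ π.boxes) {k : Fin 3} (hk : N ≤ s k) : π.legCount s = 1 := by
  rw [legCount, Finset.card_eq_one]
  refine ⟨k, Finset.eq_singleton_iff_unique_mem.2 ⟨?_, ?_⟩⟩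
  · simpa using h.1 s hs k hk
  · intro j hj
    have hj := h.2 j _ (Finset.mem_filter.1 hj).2
    by_contra hjk
    have : k = j + 1 ∨ k = j + 2 := by
      revert hjk; fin_cases k <;> fin_cases j <;> decide
    rcases this with rfl | rfl <;> simp only at hj <;> omega

theorem finsum_mem_boxes {M : Type*} [AddCommMonoid M] {π : Partition3D} {N : ℕ}
    (h : π.IsCutoff N) (f : (Fin 3 → ℕ) → M) (hf : ∀ s, π.legCount s = 1 → f s = 0) :
    ∑ᶠ s ∈ π.boxes, f s = ∑ s ∈ π.coreBoxes N, f s := by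
  refine finsum_mem_eq_sum_of_inter_support_eq f ?_
  ext s
  simp only [Set.mem_inter_iff, Finset.mem_coe, mem_coreBoxes, Function.mem_support]
  constructor
  · rintro ⟨h1, h2⟩
    refine ⟨⟨fun k => ?_, h1⟩, h2⟩
    by_contra hk
    exact h2 (hf s (legCount_of_le h h1 (not_lt.1 hk)))
  · rintro ⟨h1, h2⟩
    exact ⟨h1.2, h2⟩

theorem chi_eq {π : Partition3D} {N : ℕ} (h : π.IsCutoff N) :
    π.chi = ∑ s ∈ π.coreBoxes N, (1 - (π.legCount s : ℤ)) :=
  finsum_mem_boxes h _ fun s hs => by simp [hs]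

end Partition3D

/-! ### The vertex character as a Laurent polynomial -/

open LaurentPoly3

/-- The character of the profile `lam` of a leg along the axis `k`. -/
noncomputable def legPoly (lam : YoungDiagram) (k : Fin 3) : LaurentPoly3 :=
  ∑ c ∈ lam.cells, mono (Pi.single (k + 1) (-(c.1 : ℤ)) + Pi.single (k + 2) (-(c.2 : ℤ)))

/-- The expression for the vertex character in terms of the characters `l k` of the profiles of the
legs, of the character `r` of the remaining boxes, and of their duals `l'`, `r'`. -/
def vertexExpr {A : Type*} [CommRing A] (t l l' : Fin 3 → A) (r r' : A) : A :=
  r - r' * ∏ i, t i - r * r' * ∏ i, (1 - t i) +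
    ∑ k, (t k * l k * r' - l' k * r) * ((1 - t (k + 1)) * (1 - t (k + 2))) +
    ∑ k, (t k * l k * l' (k + 1) + t (k + 1) * l (k + 1) * l' k) * (1 - t (k + 2))

theorem map_vertexExpr {A B : Type*} [CommRing A] [CommRing B] (φ : A →+* B)
    (t l l' : Fin 3 → A) (r r' : A) :
    φ (vertexExpr t l l' r r') =
      vertexExpr (φ ∘ t) (φ ∘ l) (φ ∘ l') (φ r) (φ r') := by
  simp [vertexExpr, map_sum, map_prod]

/-- The poles of the rational function defining the vertex character cancel. -/
theorem vertexExpr_eq {F : Type*} [Field F] (t l l' : Fin 3 → F) (r r' : F)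
    (h0 : ∀ i, t i ≠ 0) (h1 : ∀ i, t i ≠ 1) :
    (∑ k, l k / (1 - (t k)⁻¹) + r) - (∑ k, l' k / (1 - t k) + r') * ∏ i, t i -
        (∑ k, l k / (1 - (t k)⁻¹) + r) * (∑ k, l' k / (1 - t k) + r') * ∏ i, (1 - t i) -
      ∑ k, (l k + t (k + 1) * t (k + 2) * l' k -
        l k * l' k * ((1 - t (k + 1)) * (1 - t (k + 2)))) / (1 - (t k)⁻¹) =
      vertexExpr t l l' r r' := by
  have e : ∀ k, (1 - (t k)⁻¹) = -(1 - t k) * (t k)⁻¹ := fun k => by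
    have := h0 k
    field_simp
    ring
  have h2 : ∀ i, 1 - t i ≠ 0 := fun i => sub_ne_zero.2 (h1 i).symm
  have a0 := h0 0
  have a1 := h0 1
  have a2 := h0 2
  have b0 := h2 0
  have b1 := h2 1
  have b2 := h2 2
  simp only [e, vertexExpr, Fin.sum_univ_three, Fin.prod_univ_three, Fin.isValue, zero_add,
    show (1 : Fin 3) + 1 = 2 from rfl, show (1 : Fin 3) + 2 = 0 from rfl,
    show (2 : Fin 3) + 1 = 0 from rfl, show (2 : Fin 3) + 2 = 1 from rfl]
  generalize t 0 = t0 at *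
  generalize t 1 = t1 at *
  generalize t 2 = t2 at *
  generalize l 0 = l0
  generalize l 1 = l1
  generalize l 2 = l2
  generalize l' 0 = m0
  generalize l' 1 = m1
  generalize l' 2 = m2
  field_simp
  ring

namespace Partition3D

/-- The character of the boxes of `π`, counted with one minus the number of legs through them. -/
noncomputable def corePoly (π : Partition3D) : LaurentPoly3 :=
  ∑ᶠ s ∈ π.boxes, ((1 - (π.legCount s : ℤ)) : ℤ) • mono fun i => -(s i : ℤ)

/-- The vertex character, as an element of the ring of Laurent polynomials. -/
noncomputable def vertexPoly (π : Partition3D) : LaurentPoly3 :=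
  vertexExpr var (fun k => legPoly (π.asymp k) k) (fun k => dual (legPoly (π.asymp k) k))
    π.corePoly (dual π.corePoly)

theorem corePoly_eq {π : Partition3D} {N : ℕ} (h : π.IsCutoff N) :
    π.corePoly = ∑ s ∈ π.coreBoxes N,
      ((1 - (π.legCount s : ℤ)) : ℤ) • mono fun i => -(s i : ℤ) :=
  finsum_mem_boxes h _ fun s hs => by simp [hs]

variable {F : Type*} [Field F] {t : Fin 3 → F}

theorem boxChar_eq (π : Partition3D) (ht : ∀ i, t i ≠ 0) :
    π.boxChar t = (∑ k, evalAt t ht (legPoly (π.asymp k) k) / (1 - (t k)⁻¹)) +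
      evalAt t ht π.corePoly := by
  obtain ⟨N, hN⟩ := π.exists_isCutoff
  rw [boxChar, corePoly_eq hN, finsum_mem_boxes hN _ fun s hs => by simp [hs]]
  congr 1
  · refine Finset.sum_congr rfl fun k _ => ?_
    congr 1
    rw [legPoly, map_sum]
    refine Finset.sum_congr rfl fun c _ => ?_
    rw [evalAt_mono, laurentMonomial_add ht, laurentMonomial_single, laurentMonomial_single]
    simp
  · rw [map_sum]
    refine Finset.sum_congr rfl fun s _ => ?_
    rw [map_zsmul, evalAt_mono, laurentMonomial]
    simp

theorem evalAt_dual (ht : ∀ i, t i ≠ 0) (ht' : ∀ i, t⁻¹ i ≠ 0) (f : LaurentPoly3) :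
    evalAt t ht (dual f) = evalAt t⁻¹ ht' f := by
  induction f using AddMonoidAlgebra.induction_linear with
  | zero => simp
  | add x y hx hy => rw [map_add, map_add, map_add, hx, hy]
  | single w m =>
    rw [dual_single, evalAt_single, evalAt_single]
    simp [laurentMonomial]

theorem evalAt_dual_legPoly (ht : ∀ i, t i ≠ 0) (lam : YoungDiagram) (k : Fin 3) :
    evalAt t ht (dual (legPoly lam k)) = ∑ c ∈ lam.cells, t (k + 1) ^ c.1 * t (k + 2) ^ c.2 := by
  rw [legPoly, map_sum, map_sum]
  refine Finset.sum_congr rfl fun c _ => ?_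
  rw [dual_mono, evalAt_mono, neg_add, ← Pi.single_neg, ← Pi.single_neg, laurentMonomial_add ht,
    laurentMonomial_single, laurentMonomial_single]
  simp

theorem evalAt_legPoly (ht : ∀ i, t i ≠ 0) (lam : YoungDiagram) (k : Fin 3) :
    evalAt t ht (legPoly lam k) =
      ∑ c ∈ lam.cells, (t (k + 1))⁻¹ ^ c.1 * (t (k + 2))⁻¹ ^ c.2 := by
  rw [legPoly, map_sum]
  refine Finset.sum_congr rfl fun c _ => ?_
  rw [evalAt_mono, laurentMonomial_add ht, laurentMonomial_single, laurentMonomial_single]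
  simp

theorem evalAt_vertexPoly (π : Partition3D) (ht : ∀ i, t i ≠ 0) (h1 : ∀ i, t i ≠ 1) :
    evalAt t ht π.vertexPoly = π.virTangent t -
      ∑ k : Fin 3, hilbTangent (π.asymp k) (t (k + 1)) (t (k + 2)) / (1 - (t k)⁻¹) := by
  have ht' : ∀ i, t⁻¹ i ≠ 0 := fun i => inv_ne_zero (ht i)
  rw [vertexPoly, map_vertexExpr, virTangent, boxChar_eq π ht, boxChar_eq π ht']
  simp only [Pi.inv_apply, inv_inv, ← evalAt_dual ht ht']
  have hv : (evalAt t ht) ∘ var = t := funext fun i => evalAt_var ht i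
  rw [hv, ← vertexExpr_eq _ _ _ _ _ ht h1]
  simp only [Function.comp_apply, hilbTangent_eq _ (ht _) (ht _), evalAt_dual_legPoly,
    evalAt_legPoly]

theorem genericT_ne_one (i : Fin 3) : genericT i ≠ 1 := by
  rw [genericT, ← map_one (algebraMap (MvPolynomial (Fin 3) ℚ) RatFun3)]
  intro h
  have h := IsFractionRing.injective (MvPolynomial (Fin 3) ℚ) RatFun3 h
  have := congrArg (MvPolynomial.eval 0) h
  simp at this

theorem isVertexChar_iff {π : Partition3D} {V : (Fin 3 → ℤ) →₀ ℤ} :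
    π.IsVertexChar V ↔ V = π.vertexPoly.coeff := by
  rw [IsVertexChar, ← evalAt_vertexPoly π genericT_ne_zero genericT_ne_one,
    show (V.sum fun w m => (m : RatFun3) * laurentMonomial genericT w) =
      evalAt genericT genericT_ne_zero (AddMonoidAlgebra.ofCoeff V) from (evalAt_apply _ _).symm,
    evalAt_genericT_injective.eq_iff]
  constructor
  · rintro h
    rw [← h]
  · rintro rfl
    rfl

theorem vertexChar_eq (π : Partition3D) : π.vertexChar = π.vertexPoly.coeff :=
  isVertexChar_iff.1 (Classical.epsilon_spec ⟨_, isVertexChar_iff.2 rfl⟩)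

/-- The symmetry of the vertex character under Serre duality. -/
theorem dual_vertexPoly (π : Partition3D) :
    (∏ i, var i) * dual π.vertexPoly = -π.vertexPoly := by
  apply evalAt_genericT_injective
  have hv : (evalAt genericT genericT_ne_zero) ∘ var = genericT := funext fun i => evalAt_var _ i
  have hv' : ((evalAt genericT genericT_ne_zero) ∘ fun i => dual (var i)) = genericT⁻¹ :=
    funext fun i => by simp [dual_var, evalAt_varInv]
  rw [map_mul, map_neg, vertexPoly, map_vertexExpr, map_vertexExpr, map_vertexExpr, map_prod]
  have hv2 : ⇑(evalAt genericT genericT_ne_zero) ∘ ⇑dual ∘ var = genericT⁻¹ := hv'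
  rw [hv, hv2]
  simp only [vertexExpr, Fin.sum_univ_three, Fin.prod_univ_three, Fin.isValue, zero_add,
    show (1 : Fin 3) + 1 = 2 from rfl, show (1 : Fin 3) + 2 = 0 from rfl,
    show (2 : Fin 3) + 1 = 0 from rfl, show (2 : Fin 3) + 2 = 1 from rfl, Function.comp_apply,
    dual_dual, evalAt_var, Pi.inv_apply]
  have a0 := genericT_ne_zero 0
  have a1 := genericT_ne_zero 1
  have a2 := genericT_ne_zero 2
  field_simp
  ring

end Partition3D

/-! ### The character of the complement -/

namespace LaurentPoly3

/-- The coefficient of `t₁⁻ˣ t₂⁻ʸ t₃⁻ᶻ`. -/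
def boxCoeff (f : LaurentPoly3) (x y z : ℤ) : ℤ := f.coeff ![-x, -y, -z]

theorem boxCoeff_add (f g : LaurentPoly3) (x y z : ℤ) :
    boxCoeff (f + g) x y z = boxCoeff f x y z + boxCoeff g x y z := rfl

theorem boxCoeff_sub (f g : LaurentPoly3) (x y z : ℤ) :
    boxCoeff (f - g) x y z = boxCoeff f x y z - boxCoeff g x y z := by
  simp [boxCoeff]

theorem boxCoeff_mul_one_sub_varInv_zero (f : LaurentPoly3) (x y z : ℤ) :
    boxCoeff (f * (1 - varInv 0)) x y z = boxCoeff f x y z - boxCoeff f (x - 1) y z := by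
  rw [mul_sub, mul_one, boxCoeff_sub]
  congr 1
  rw [boxCoeff, varInv, mono, AddMonoidAlgebra.coeff_mul_single_apply, mul_one, boxCoeff]
  congr 1
  funext i
  fin_cases i <;> simp
  ring

theorem boxCoeff_mul_one_sub_varInv_one (f : LaurentPoly3) (x y z : ℤ) :
    boxCoeff (f * (1 - varInv 1)) x y z = boxCoeff f x y z - boxCoeff f x (y - 1) z := by
  rw [mul_sub, mul_one, boxCoeff_sub]
  congr 1
  rw [boxCoeff, varInv, mono, AddMonoidAlgebra.coeff_mul_single_apply, mul_one, boxCoeff]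
  congr 1
  funext i
  fin_cases i <;> simp
  ring

theorem boxCoeff_mul_one_sub_varInv_two (f : LaurentPoly3) (x y z : ℤ) :
    boxCoeff (f * (1 - varInv 2)) x y z = boxCoeff f x y z - boxCoeff f x y (z - 1) := by
  rw [mul_sub, mul_one, boxCoeff_sub]
  congr 1
  rw [boxCoeff, varInv, mono, AddMonoidAlgebra.coeff_mul_single_apply, mul_one, boxCoeff]
  congr 1
  funext i
  fin_cases i <;> simp
  ring

theorem boxCoeff_mono (v : Fin 3 → ℤ) (x y z : ℤ) :
    boxCoeff (mono v) x y z = if v 0 = -x ∧ v 1 = -y ∧ v 2 = -z then 1 else 0 := by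
  rw [boxCoeff, mono, AddMonoidAlgebra.coeff_single, Finsupp.single_apply]
  congr 1
  simp [funext_iff, Fin.forall_fin_succ]

theorem boxCoeff_zsmul (m : ℤ) (f : LaurentPoly3) (x y z : ℤ) :
    boxCoeff (m • f) x y z = m * boxCoeff f x y z := by
  rw [boxCoeff, AddMonoidAlgebra.coeff_smul_apply, smul_eq_mul, boxCoeff]

theorem boxCoeff_sum {ι : Type*} (s : Finset ι) (f : ι → LaurentPoly3) (x y z : ℤ) :
    boxCoeff (∑ i ∈ s, f i) x y z = ∑ i ∈ s, boxCoeff (f i) x y z := by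
  simp [boxCoeff, AddMonoidAlgebra.coeff_sum]

/-- The linear functional `∑ m_w w ↦ ∑ m_w φ(w)`. -/
noncomputable def weightSum (φ : (Fin 3 → ℤ) → ℤ) : LaurentPoly3 →+ ℤ where
  toFun f := f.coeff.sum fun w m => m * φ w
  map_zero' := by simp
  map_add' f g := by
    rw [AddMonoidAlgebra.coeff_add]
    exact Finsupp.sum_add_index' (by simp) (by intros; ring)

theorem weightSum_single (φ : (Fin 3 → ℤ) → ℤ) (w : Fin 3 → ℤ) (m : ℤ) :
    weightSum φ (AddMonoidAlgebra.single w m) = m * φ w := by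
  change (AddMonoidAlgebra.single w m).coeff.sum (fun w m => m * φ w) = _
  simp

theorem weightSum_mono (φ : (Fin 3 → ℤ) → ℤ) (w : Fin 3 → ℤ) : weightSum φ (mono w) = φ w := by
  simp [mono, weightSum_single]

theorem weightSum_kappa_dual {φ : (Fin 3 → ℤ) → ℤ} (hφ : ∀ w, φ (1 - w) = -φ w)
    (f : LaurentPoly3) : weightSum φ (mono 1 * dual f) = -weightSum φ f := by
  induction f using AddMonoidAlgebra.induction_linear with
  | zero => simp
  | add x y hx hy => rw [map_add, mul_add, map_add, map_add, hx, hy]; ring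
  | single w m =>
    rw [dual_single, mono, AddMonoidAlgebra.single_mul_single, weightSum_single, weightSum_single,
      ← sub_eq_add_neg, hφ]
    ring

theorem prod_var : ∏ i, var i = mono 1 := by
  rw [Fin.prod_univ_three, var, var, var, mono_mul, mono_mul]
  congr 1
  funext i
  fin_cases i <;> simp

theorem eq_sum_boxCoeff {f : LaurentPoly3} {a b a' b' a'' b'' : ℤ}
    (hf : ∀ x y z, boxCoeff f x y z ≠ 0 →
      (a < x ∧ x ≤ b) ∧ (a' < y ∧ y ≤ b') ∧ (a'' < z ∧ z ≤ b'')) :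
    f = ∑ x ∈ Finset.Ioc a b, ∑ y ∈ Finset.Ioc a' b', ∑ z ∈ Finset.Ioc a'' b'',
      boxCoeff f x y z • mono ![-x, -y, -z] := by
  ext w
  obtain ⟨x, y, z, rfl⟩ : ∃ x y z : ℤ, w = ![-x, -y, -z] :=
    ⟨-w 0, -w 1, -w 2, by funext i; fin_cases i <;> simp⟩
  change boxCoeff f x y z = boxCoeff _ x y z
  simp only [boxCoeff_sum, boxCoeff_zsmul, boxCoeff_mono]
  simp only [Matrix.cons_val_zero, Matrix.cons_val_one, Matrix.cons_val, neg_inj, ite_and,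
    mul_ite, mul_one, mul_zero, Finset.sum_ite_irrel, Finset.sum_const_zero, Finset.sum_ite_eq',
    Finset.mem_Ioc]
  by_cases h : boxCoeff f x y z = 0
  · simp [h]
  · have := hf x y z h
    simp [this]

theorem weightSum_mono_mul_dual (φ : (Fin 3 → ℤ) → ℤ) {f : LaurentPoly3}
    {a b a' b' a'' b'' : ℤ}
    (hf : ∀ x y z, boxCoeff f x y z ≠ 0 →
      (a < x ∧ x ≤ b) ∧ (a' < y ∧ y ≤ b') ∧ (a'' < z ∧ z ≤ b''))
    (v : Fin 3 → ℤ) :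
    weightSum φ (mono v * dual f) =
      ∑ x ∈ Finset.Ioc a b, ∑ y ∈ Finset.Ioc a' b', ∑ z ∈ Finset.Ioc a'' b'',
        boxCoeff f x y z * φ ![v 0 + x, v 1 + y, v 2 + z] := by
  conv_lhs => rw [eq_sum_boxCoeff hf]
  simp only [map_sum, Finset.mul_sum, map_zsmul, mul_smul_comm, dual_mono, mono_mul,
    weightSum_mono, smul_eq_mul]
  refine Finset.sum_congr rfl fun x _ => Finset.sum_congr rfl fun y _ =>
    Finset.sum_congr rfl fun z _ => ?_
  congr 2
  funext i
  fin_cases i <;> simp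

end LaurentPoly3


open Classical in
/-- The indicator function of the complement of `lam` in the quadrant, extended by zero. -/
noncomputable def YoungDiagram.outInd (lam : YoungDiagram) (x y : ℤ) : ℤ :=
  if 0 ≤ x ∧ 0 ≤ y ∧ (x.toNat, y.toNat) ∉ lam.cells then 1 else 0

open Classical in
/-- The indicator function of `lam`, extended by zero. -/
noncomputable def YoungDiagram.inInd (lam : YoungDiagram) (x y : ℤ) : ℤ :=
  if 0 ≤ x ∧ 0 ≤ y ∧ (x.toNat, y.toNat) ∈ lam.cells then 1 else 0

/-- The indicator function of the nonnegative integers. -/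
def nonnegInd (x : ℤ) : ℤ := if 0 ≤ x then 1 else 0

theorem boxCoeff_one (x y z : ℤ) : boxCoeff 1 x y z =
    (nonnegInd x - nonnegInd (x - 1)) * (nonnegInd y - nonnegInd (y - 1)) *
      (nonnegInd z - nonnegInd (z - 1)) := by
  have h : ∀ x : ℤ, nonnegInd x - nonnegInd (x - 1) = if 0 = -x then 1 else 0 := by
    intro x
    unfold nonnegInd
    split_ifs <;> omega
  rw [← mono_zero, boxCoeff_mono, h, h, h]
  simp only [Pi.zero_apply, ite_and]
  split_ifs <;> simp

theorem boxCoeff_legPoly (lam : YoungDiagram) (x y z : ℤ) :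
    boxCoeff (legPoly lam 0) x y z = (nonnegInd x - nonnegInd (x - 1)) * lam.inInd y z ∧
    boxCoeff (legPoly lam 1) x y z = (nonnegInd y - nonnegInd (y - 1)) * lam.inInd z x ∧
    boxCoeff (legPoly lam 2) x y z = (nonnegInd z - nonnegInd (z - 1)) * lam.inInd x y := by
  have h : ∀ x : ℤ, nonnegInd x - nonnegInd (x - 1) = if x = 0 then 1 else 0 := by
    intro x
    unfold nonnegInd
    split_ifs <;> omega
  have h2 : ∀ x y z : ℤ, (∑ c ∈ lam.cells, if x = 0 ∧ (c.1 : ℤ) = y ∧ (c.2 : ℤ) = z then 1 else 0)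
      = (nonnegInd x - nonnegInd (x - 1)) * lam.inInd y z := by
    intro x y z
    rw [h]
    by_cases hx : x = 0
    · by_cases hyz : 0 ≤ y ∧ 0 ≤ z
      · obtain ⟨a, rfl⟩ := Int.eq_ofNat_of_zero_le hyz.1
        obtain ⟨b, rfl⟩ := Int.eq_ofNat_of_zero_le hyz.2
        have : ∀ c : ℕ × ℕ, ((c.1 : ℤ) = a ∧ (c.2 : ℤ) = b) ↔ c = (a, b) := by
          rintro ⟨c, d⟩
          simp
        simp only [hx, true_and, this, YoungDiagram.inInd, Finset.sum_ite_eq', if_true, one_mul,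
          Int.natCast_nonneg, Int.toNat_natCast]
      · have h3 : ∀ c : ℕ × ℕ, ¬ ((c.1 : ℤ) = y ∧ (c.2 : ℤ) = z) := by
          rintro c ⟨rfl, rfl⟩
          exact hyz ⟨by positivity, by positivity⟩
        have h4 : lam.inInd y z = 0 := if_neg fun h => hyz ⟨h.1, h.2.1⟩
        simp [h3, h4]
    · simp [hx]
  have a1 : (1 : Fin 3) + 1 = 2 := rfl
  have a2 : (1 : Fin 3) + 2 = 0 := rfl
  have a3 : (2 : Fin 3) + 1 = 0 := rfl
  have a4 : (2 : Fin 3) + 2 = 1 := rfl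
  refine ⟨?_, ?_, ?_⟩
  · rw [← h2, legPoly, boxCoeff_sum]
    refine Finset.sum_congr rfl fun c _ => ?_
    rw [boxCoeff_mono]
    congr 1
    simp
  · rw [← h2, legPoly, boxCoeff_sum]
    refine Finset.sum_congr rfl fun c _ => ?_
    rw [boxCoeff_mono, a1, a2]
    congr 1
    simp
    tauto
  · rw [← h2, legPoly, boxCoeff_sum]
    refine Finset.sum_congr rfl fun c _ => ?_
    rw [boxCoeff_mono, a3, a4]
    congr 1
    simp
    tauto

namespace Partition3D

open Classical in
/-- The indicator function of the complement of `π` in the octant, extended by zero. -/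
noncomputable def outInd (π : Partition3D) (x y z : ℤ) : ℤ :=
  if 0 ≤ x ∧ 0 ≤ y ∧ 0 ≤ z ∧ ![x.toNat, y.toNat, z.toNat] ∉ π.boxes then 1 else 0

theorem mem_boxes_of_mem_asymp {π : Partition3D} {k : Fin 3} {s : Fin 3 → ℕ}
    (h : (s (k + 1), s (k + 2)) ∈ (π.asymp k).cells) : s ∈ π.boxes :=
  mem_asymp.1 h s rfl rfl

theorem legCount_eq_sum (π : Partition3D) (a b c : ℕ) :
    (π.legCount ![a, b, c] : ℤ) = (π.asymp 0).inInd b c + (π.asymp 1).inInd c a +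
      (π.asymp 2).inInd a b := by
  rw [legCount, Finset.card_filter, Fin.sum_univ_three]
  simp [YoungDiagram.inInd, show (1 : Fin 3) + 1 = 2 from rfl, show (1 : Fin 3) + 2 = 0 from rfl,
    show (2 : Fin 3) + 1 = 0 from rfl, show (2 : Fin 3) + 2 = 1 from rfl]

open Classical in
theorem boxCoeff_corePoly (π : Partition3D) (x y z : ℤ) :
    boxCoeff π.corePoly x y z = nonnegInd x * nonnegInd y * nonnegInd z - π.outInd x y z -
      (nonnegInd x * (π.asymp 0).inInd y z + nonnegInd y * (π.asymp 1).inInd z x +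
        nonnegInd z * (π.asymp 2).inInd x y) := by
  obtain ⟨N, hN⟩ := π.exists_isCutoff
  rw [corePoly_eq hN, boxCoeff_sum]
  simp only [boxCoeff_zsmul, boxCoeff_mono, neg_inj]
  by_cases h : 0 ≤ x ∧ 0 ≤ y ∧ 0 ≤ z
  · obtain ⟨hx, hy, hz⟩ := h
    obtain ⟨a, rfl⟩ := Int.eq_ofNat_of_zero_le hx
    obtain ⟨b, rfl⟩ := Int.eq_ofNat_of_zero_le hy
    obtain ⟨c, rfl⟩ := Int.eq_ofNat_of_zero_le hz
    have h1 : ∀ s : Fin 3 → ℕ, ((s 0 : ℤ) = a ∧ (s 1 : ℤ) = b ∧ (s 2 : ℤ) = c) ↔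
        s = ![a, b, c] := by
      intro s
      simp [funext_iff, Fin.forall_fin_succ]
    simp only [h1, mul_ite, mul_one, mul_zero, Finset.sum_ite_eq']
    simp only [nonnegInd, Int.natCast_nonneg, if_true, one_mul, outInd, true_and, Int.toNat_natCast,
      mul_one]
    by_cases hb : ![a, b, c] ∈ π.boxes
    · rw [if_neg (not_not.2 hb), ← legCount_eq_sum]
      split_ifs with hc
      · ring
      · rw [mem_coreBoxes] at hc
        push Not at hc
        have : ∃ i, N ≤ ![a, b, c] i := by
          by_contra hcon
          push Not at hcon
          exact hc hcon hb
        obtain ⟨i, hi⟩ := this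
        rw [legCount_of_le hN hb hi]
        simp
    · rw [if_pos hb, ← legCount_eq_sum, if_neg fun h => hb (mem_coreBoxes.1 h).2, legCount,
        Finset.card_eq_zero.2]
      · simp
      · refine Finset.filter_eq_empty_iff.2 fun k _ hk => hb (mem_boxes_of_mem_asymp hk)
  · rw [outInd, if_neg (fun h' => h ⟨h'.1, h'.2.1, h'.2.2.1⟩), Finset.sum_eq_zero]
    · have h0 : nonnegInd x * nonnegInd y * nonnegInd z = 0 := by
        simp only [nonnegInd]
        split_ifs <;> simp
        omega
      have h1 : ∀ (lam : YoungDiagram) {x y z : ℤ}, ¬ (0 ≤ x ∧ 0 ≤ y ∧ 0 ≤ z) →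
          nonnegInd x * lam.inInd y z = 0 := by
        intro lam x y z h
        simp only [nonnegInd, YoungDiagram.inInd]
        split_ifs with h1 h2 <;> simp
        exact h ⟨h1, h2.1, h2.2.1⟩
      rw [h0, h1 _ h, h1 _ (x := y) (by tauto), h1 _ (x := z) (by tauto)]
      simp
    · intro s _
      rw [if_neg, mul_zero]
      rintro ⟨rfl, rfl, rfl⟩
      exact h ⟨by positivity, by positivity, by positivity⟩

/-- The numerator of the character of the complement of `π`, which is
`cornerPoly / ∏ i, (1 - tᵢ⁻¹)`. -/
noncomputable def cornerPoly (π : Partition3D) : LaurentPoly3 :=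
  1 - (∑ k, legPoly (π.asymp k) k * (1 - varInv (k + 1)) * (1 - varInv (k + 2))) -
    π.corePoly * (1 - varInv 0) * (1 - varInv 1) * (1 - varInv 2)

/-- The coefficients of `cornerPoly` are the mixed differences of the indicator function of the
complement, so they are determined locally. -/
theorem boxCoeff_cornerPoly (π : Partition3D) (x y z : ℤ) :
    boxCoeff π.cornerPoly x y z =
      (π.outInd x y z - π.outInd (x - 1) y z - π.outInd x (y - 1) z +
          π.outInd (x - 1) (y - 1) z) -
        (π.outInd x y (z - 1) - π.outInd (x - 1) y (z - 1) - π.outInd x (y - 1) (z - 1) +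
          π.outInd (x - 1) (y - 1) (z - 1)) := by
  rw [cornerPoly, boxCoeff_sub, boxCoeff_sub, Fin.sum_univ_three, boxCoeff_add, boxCoeff_add]
  simp only [zero_add, show (1 : Fin 3) + 1 = 2 from rfl, show (1 : Fin 3) + 2 = 0 from rfl,
    show (2 : Fin 3) + 1 = 0 from rfl, show (2 : Fin 3) + 2 = 1 from rfl,
    boxCoeff_mul_one_sub_varInv_zero, boxCoeff_mul_one_sub_varInv_one,
    boxCoeff_mul_one_sub_varInv_two, boxCoeff_corePoly, boxCoeff_one,
    (boxCoeff_legPoly _ _ _ _).1, (boxCoeff_legPoly _ _ _ _).2.1, (boxCoeff_legPoly _ _ _ _).2.2]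
  ring

end Partition3D

/-! ### The boundary path of a diagram -/

namespace YoungDiagram

theorem exists_le_sub_rowLen (nu : YoungDiagram) (c : ℤ) : ∃ k : ℕ, c ≤ k - nu.rowLen k := by
  refine ⟨c.toNat + nu.rowLen 0, ?_⟩
  have := nu.rowLen_anti 0 (c.toNat + nu.rowLen 0) (Nat.zero_le _)
  omega

/-- The first coordinate of the first point outside of `nu` on the diagonal `{(x, y) | x - y = c}`.
The points `(path c, path c - c)` form the boundary path of `nu`. -/
noncomputable def path (nu : YoungDiagram) (c : ℤ) : ℕ := Nat.find (nu.exists_le_sub_rowLen c)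

theorem path_le_iff (nu : YoungDiagram) (c : ℤ) (k : ℕ) :
    nu.path c ≤ k ↔ c ≤ k - nu.rowLen k := by
  constructor
  · intro h
    have h1 := Nat.find_spec (nu.exists_le_sub_rowLen c)
    have h2 := nu.rowLen_anti _ _ h
    rw [path] at h h2
    omega
  · exact fun h => Nat.find_min' _ h

theorem path_succ (nu : YoungDiagram) (c : ℤ) :
    nu.path (c + 1) = nu.path c ∨ nu.path (c + 1) = nu.path c + 1 := by
  have h1 := (nu.path_le_iff c _).1 le_rfl
  have h2 := (nu.path_le_iff (c + 1) (nu.path c + 1)).2 (by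
    have := nu.rowLen_anti _ _ (Nat.le_succ (nu.path c))
    push_cast
    simp only [Nat.succ_eq_add_one] at this
    omega)
  have h3 := (nu.path_le_iff c (nu.path (c + 1))).2 (by
    have := (nu.path_le_iff (c + 1) _).1 le_rfl
    omega)
  omega

theorem outInd_eq (nu : YoungDiagram) (x y : ℤ) :
    nu.outInd x y = if (nu.path (x - y) : ℤ) ≤ x then 1 else 0 := by
  rw [outInd]
  congr 1
  rw [eq_iff_iff]
  by_cases hx : 0 ≤ x
  · obtain ⟨a, rfl⟩ := Int.eq_ofNat_of_zero_le hx
    have := nu.path_le_iff (a - y) a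
    rw [Nat.cast_le, this, mem_cells, mem_iff_lt_rowLen]
    simp only [Int.toNat_natCast]
    omega
  · constructor
    · exact fun h => absurd h.1 hx
    · intro h
      omega

end YoungDiagram

/-! ### The sign of a weight along a preferred slope -/

/-- The sign of the weight `w` along a slope with `r₁ ≫ r₃ > 0 ≫ r₂`. -/
def slopeSign (w : Fin 3 → ℤ) : ℤ :=
  if w 0 = w 1 then (w 2 - w 0).sign else (w 0 - w 1).sign

theorem slopeSign_vec (a b c : ℤ) :
    slopeSign ![a, b, c] = if a = b then (c - a).sign else (a - b).sign := rfl

theorem slopeSign_one_sub (w : Fin 3 → ℤ) : slopeSign (1 - w) = -slopeSign w := by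
  simp only [slopeSign, Pi.sub_apply, Pi.one_apply]
  by_cases h : w 0 = w 1
  · rw [if_pos (by omega), if_pos h, ← Int.sign_neg]
    congr 1
    ring
  · rw [if_neg (by omega), if_neg h, ← Int.sign_neg]
    congr 1
    ring

/-! ### Telescoping sums -/

theorem sum_Ioc_succ {a b : ℤ} (hab : a ≤ b) (f : ℤ → ℤ) :
    ∑ x ∈ Finset.Ioc a (b + 1), f x = (∑ x ∈ Finset.Ioc a b, f x) + f (b + 1) := by
  have : Finset.Ioc a (b + 1) = insert (b + 1) (Finset.Ioc a b) := by
    ext x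
    simp only [Finset.mem_Ioc, Finset.mem_insert]
    omega
  rw [this, Finset.sum_insert (by simp), add_comm]

theorem sum_Ioc_telescope {a b : ℤ} (hab : a ≤ b) (g : ℤ → ℤ) :
    ∑ x ∈ Finset.Ioc a b, (g x - g (x - 1)) = g b - g a := by
  induction b, hab using Int.leInduction with
  | base => simp
  | succ b hab ih =>
    rw [sum_Ioc_succ hab, ih]
    simp

/-- Summation of differences against a step function `s` jumping at `m`. -/
theorem sum_Ioc_step {a b m : ℤ} (ha : a < m) (hb : m ≤ b) (g s : ℤ → ℤ)
    (h1 : ∀ x < m, s x = -1) (h2 : ∀ x, m < x → s x = 1) :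
    ∑ x ∈ Finset.Ioc a b, (g x - g (x - 1)) * s x =
      g b + g a - (1 - s m) * g m - (1 + s m) * g (m - 1) := by
  have h3 : ∀ b, a ≤ b → b < m → ∑ x ∈ Finset.Ioc a b, (g x - g (x - 1)) * s x = g a - g b := by
    intro b hab hbm
    rw [← neg_sub (g b), ← sum_Ioc_telescope hab, ← Finset.sum_neg_distrib]
    refine Finset.sum_congr rfl fun x hx => ?_
    rw [h1 x ((Finset.mem_Ioc.1 hx).2.trans_lt hbm)]
    ring
  induction b, hb using Int.leInduction with
  | base =>
    have := sum_Ioc_succ (a := a) (b := m - 1) (by omega) fun x => (g x - g (x - 1)) * s x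
    rw [sub_add_cancel] at this
    rw [this, h3 _ (by omega) (by omega)]
    ring
  | succ b hb ih =>
    rw [sum_Ioc_succ (by omega), ih, h2 (b + 1) (by omega)]
    ring_nf

/-- The sum of the mixed differences of `f` against `slopeSign`, seen from an addable box
`b = (b₁, b₂, b₃)`: only the behaviour of `f` on the diagonal through `b` and the limit of `f` in
the third direction matter. -/
theorem sum_mixedDiff_slopeSign (f : ℤ → ℤ → ℤ → ℤ) (nu : YoungDiagram) (b₁ b₂ b₃ M : ℤ)
    (hM : |b₁| + |b₂| + |b₃| + 2 + nu.path (b₁ - b₂) < M) (hM' : nu.rowLen 0 ≤ M)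
    (hlow : ∀ x y, f x y (-9 * M) = 0)
    (hhigh : ∀ x y, f x y (9 * M) = nu.outInd x y)
    (h0 : ∀ a, f (b₁ + a) (b₂ + a) (b₃ + a) = nonnegInd a)
    (h1 : ∀ a, f (b₁ + a - 1) (b₂ + a) (b₃ + a) = nonnegInd (a - 1))
    (h2 : ∀ a, f (b₁ + a) (b₂ + a - 1) (b₃ + a) = nonnegInd (a - 1))
    (h12 : ∀ a, f (b₁ + a - 1) (b₂ + a - 1) (b₃ + a) = nonnegInd (a - 1))
    (h3 : ∀ a, f (b₁ + a) (b₂ + a) (b₃ + a - 1) = nonnegInd (a - 1))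
    (h13 : ∀ a, f (b₁ + a - 1) (b₂ + a) (b₃ + a - 1) = nonnegInd (a - 1))
    (h23 : ∀ a, f (b₁ + a) (b₂ + a - 1) (b₃ + a - 1) = nonnegInd (a - 1))
    (h123 : ∀ a, f (b₁ + a - 1) (b₂ + a - 1) (b₃ + a - 1) = nonnegInd (a - 1)) :
    ∑ x ∈ Finset.Ioc (-3 * M) (3 * M), ∑ y ∈ Finset.Ioc (-M) M,
      ∑ z ∈ Finset.Ioc (-9 * M) (9 * M),
        ((f x y z - f (x - 1) y z - f x (y - 1) z + f (x - 1) (y - 1) z) -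
          (f x y (z - 1) - f (x - 1) y (z - 1) - f x (y - 1) (z - 1) +
            f (x - 1) (y - 1) (z - 1))) * slopeSign ![x - b₁, y - b₂, z - b₃] =
      -2 * ((nu.path (b₁ - b₂) : ℤ) - nu.path (b₁ - b₂ - 1)) := by
  have hb1 := le_abs_self b₁
  have hb1' := neg_abs_le b₁
  have hb2 := le_abs_self b₂
  have hb2' := neg_abs_le b₂
  have hb3 := le_abs_self b₃
  have hb3' := neg_abs_le b₃
  set σ : ℤ → ℤ := fun d => if 0 ≤ d then 1 else -1 with hσ
  set H : ℤ → ℤ → ℤ := fun x y => nu.outInd x y - nu.outInd x (y - 1) with hH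
  -- summation in the third direction
  have hz : ∀ x ∈ Finset.Ioc (-3 * M) (3 * M), ∀ y,
      ∑ z ∈ Finset.Ioc (-9 * M) (9 * M),
        ((f x y z - f (x - 1) y z - f x (y - 1) z + f (x - 1) (y - 1) z) -
          (f x y (z - 1) - f (x - 1) y (z - 1) - f x (y - 1) (z - 1) +
            f (x - 1) (y - 1) (z - 1))) * slopeSign ![x - b₁, y - b₂, z - b₃] =
        (H x y - H (x - 1) y) * σ (x - (b₁ - b₂ + y)) -
          if x = b₁ then (if y = b₂ then 1 else 0) else 0 := by
    intro x hx y
    rw [Finset.mem_Ioc] at hx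
    by_cases hd : x - b₁ = y - b₂
    · obtain ⟨a, rfl⟩ : ∃ a, x = b₁ + a := ⟨x - b₁, by ring⟩
      obtain rfl : y = b₂ + a := by linarith
      have := sum_Ioc_step (a := -9 * M) (b := 9 * M) (m := b₃ + a) (by omega) (by omega)
        (fun z => f (b₁ + a) (b₂ + a) z - f (b₁ + a - 1) (b₂ + a) z - f (b₁ + a) (b₂ + a - 1) z +
          f (b₁ + a - 1) (b₂ + a - 1) z)
        (fun z => slopeSign ![b₁ + a - b₁, b₂ + a - b₂, z - b₃])
        (fun z hz => by
          rw [slopeSign_vec]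
          rw [if_pos (by ring)]
          exact Int.sign_eq_neg_one_of_neg (by omega))
        (fun z hz => by
          rw [slopeSign_vec]
          rw [if_pos (by ring)]
          exact Int.sign_eq_one_of_pos (by omega))
      have hs : slopeSign ![b₁ + a - b₁, b₂ + a - b₂, b₃ + a - b₃] = 0 := by
        simp [slopeSign]
      simp only [hs, h0, h1, h2, h12, h3, h13, h23, h123, hlow, hhigh] at this
      rw [this]
      have hn : nonnegInd a - nonnegInd (a - 1) = if a = 0 then 1 else 0 := by
        unfold nonnegInd
        split_ifs <;> omega
      have hσ0 : σ (b₁ + a - (b₁ - b₂ + (b₂ + a))) = 1 := by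
        simp only [hσ]
        rw [if_pos (by linarith)]
      rw [hσ0]
      simp only [hH, add_eq_left]
      have : (if a = 0 then if a = 0 then (1 : ℤ) else 0 else 0) = if a = 0 then 1 else 0 := by
        split_ifs <;> rfl
      rw [this, ← hn]
      ring
    · have hs : ∀ z, slopeSign ![x - b₁, y - b₂, z - b₃] = σ (x - (b₁ - b₂ + y)) := by
        intro z
        rw [slopeSign_vec]
        simp only [hσ]
        rw [if_neg hd]
        split_ifs
        · exact Int.sign_eq_one_of_pos (by omega)
        · exact Int.sign_eq_neg_one_of_neg (by omega)
      simp only [hs]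
      rw [← Finset.sum_mul, sum_Ioc_telescope (a := -9 * M) (b := 9 * M) (by omega)
        (fun z => f x y z - f (x - 1) y z - f x (y - 1) z + f (x - 1) (y - 1) z)]
      simp only [hlow, hhigh]
      have : (if x = b₁ then (if y = b₂ then (1 : ℤ) else 0) else 0) = 0 := by
        split_ifs <;> omega
      rw [this]
      simp only [hH]
      ring
  rw [Finset.sum_congr rfl fun x hx => Finset.sum_congr rfl fun y _ => hz x hx y]
  simp only [Finset.sum_sub_distrib]
  have hlast : ∑ x ∈ Finset.Ioc (-3 * M) (3 * M), ∑ y ∈ Finset.Ioc (-M) M,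
      (if x = b₁ then (if y = b₂ then (1 : ℤ) else 0) else 0) = 1 := by
    simp only [Finset.sum_ite_irrel, Finset.sum_ite_eq', Finset.sum_const_zero, Finset.mem_Ioc]
    rw [if_pos ⟨by omega, by omega⟩, if_pos ⟨by omega, by omega⟩]
  rw [hlast, Finset.sum_comm]
  -- summation in the first direction
  have hx : ∀ y ∈ Finset.Ioc (-M) M, ∑ x ∈ Finset.Ioc (-3 * M) (3 * M),
      (H x y - H (x - 1) y) * σ (x - (b₁ - b₂ + y)) =
        H (3 * M) y - 2 * H (b₁ - b₂ + y - 1) y := by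
    intro y hy
    rw [Finset.mem_Ioc] at hy
    rw [sum_Ioc_step (m := b₁ - b₂ + y) (by omega) (by omega) (fun x => H x y)
      (fun x => σ (x - (b₁ - b₂ + y))) (fun x hx => if_neg (by omega))
      (fun x hx => if_pos (by omega))]
    have h1 : σ (b₁ - b₂ + y - (b₁ - b₂ + y)) = 1 := if_pos (by omega)
    have h2 : H (-3 * M) y = 0 := by
      simp only [hH, YoungDiagram.outInd]
      rw [if_neg (by omega), if_neg (by omega), sub_zero]
    rw [h1, h2]
    ring
  rw [Finset.sum_congr rfl hx, Finset.sum_sub_distrib, ← Finset.mul_sum]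
  have e1 : ∑ y ∈ Finset.Ioc (-M) M, H (3 * M) y = 1 := by
    rw [sum_Ioc_telescope (by omega) (fun y => nu.outInd (3 * M) y)]
    have h1 : nu.outInd (3 * M) (-M) = 0 := if_neg (by omega)
    have h2 : nu.outInd (3 * M) M = 1 := by
      refine if_pos ⟨by omega, by omega, ?_⟩
      rw [YoungDiagram.mem_cells, YoungDiagram.mem_iff_lt_rowLen]
      have := nu.rowLen_anti 0 (3 * M).toNat (Nat.zero_le _)
      omega
    rw [h1, h2]
    ring
  have e2 : ∑ y ∈ Finset.Ioc (-M) M, H (b₁ - b₂ + y - 1) y =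
      (nu.path (b₁ - b₂) : ℤ) - nu.path (b₁ - b₂ - 1) := by
    have hp : ∀ y, H (b₁ - b₂ + y - 1) y =
        (if (nu.path (b₁ - b₂ - 1) : ℤ) ≤ b₁ - b₂ + y - 1 then 1 else 0) -
          if (nu.path (b₁ - b₂) : ℤ) ≤ b₁ - b₂ + y - 1 then 1 else 0 := by
      intro y
      simp only [hH, YoungDiagram.outInd_eq]
      rw [show b₁ - b₂ + y - 1 - y = b₁ - b₂ - 1 by ring,
        show b₁ - b₂ + y - 1 - (y - 1) = b₁ - b₂ by ring]
    simp only [hp]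
    have hs := nu.path_succ (b₁ - b₂ - 1)
    rw [sub_add_cancel] at hs
    rcases hs with hs | hs
    · rw [hs]
      simp
    · rw [hs]
      have : ∀ y, ((if (nu.path (b₁ - b₂ - 1) : ℤ) ≤ b₁ - b₂ + y - 1 then 1 else 0) -
          if ((nu.path (b₁ - b₂ - 1) + 1 : ℕ) : ℤ) ≤ b₁ - b₂ + y - 1 then 1 else 0) =
          if y = nu.path (b₁ - b₂ - 1) + 1 - (b₁ - b₂) then (1 : ℤ) else 0 := by
        intro y
        push_cast
        split_ifs <;> omega
      simp only [this, Finset.sum_ite_eq', Finset.mem_Ioc]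
      rw [if_pos ⟨by omega, by omega⟩]
      push_cast
      ring
  rw [e1, e2]
  ring

/-! ### Adding a box -/

namespace LaurentPoly3

theorem coeff_mono_mul_dual (v w : Fin 3 → ℤ) (f : LaurentPoly3) :
    (mono v * dual f).coeff w = f.coeff (v - w) := by
  induction f using AddMonoidAlgebra.induction_linear with
  | zero => simp
  | add x y hx hy => simp only [map_add, mul_add, AddMonoidAlgebra.coeff_add, Finsupp.add_apply, hx, hy]
  | single u m =>
    rw [dual_single, mono, AddMonoidAlgebra.single_mul_single, AddMonoidAlgebra.coeff_single,
      AddMonoidAlgebra.coeff_single, Finsupp.single_apply, Finsupp.single_apply, one_mul]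
    congr 1
    rw [eq_iff_iff]
    constructor
    · rintro rfl
      abel
    · rintro rfl
      abel

theorem weightSum_indicator (v : Fin 3 → ℤ) (f : LaurentPoly3) :
    weightSum (fun w => if w = v then 1 else 0) f = f.coeff v := by
  induction f using AddMonoidAlgebra.induction_linear with
  | zero => simp
  | add x y hx hy => simp only [map_add, AddMonoidAlgebra.coeff_add, Finsupp.add_apply, hx, hy]
  | single u m =>
    rw [weightSum_single, AddMonoidAlgebra.coeff_single, Finsupp.single_apply]
    simp

theorem prod_one_sub_var : ∏ i, (1 - var i) = mono ![0, 0, 0] - mono ![1, 0, 0] - mono ![0, 1, 0] -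
    mono ![0, 0, 1] + mono ![1, 1, 0] + mono ![1, 0, 1] + mono ![0, 1, 1] - mono ![1, 1, 1] := by
  have h : ∀ i, var i = mono (Pi.single i 1) := fun i => rfl
  have e0 : (mono ![0, 0, 0] : LaurentPoly3) = 1 := by
    rw [← mono_zero]; congr 1; funext i; fin_cases i <;> rfl
  have e1 : (mono ![1, 0, 0] : LaurentPoly3) = var 0 := by
    rw [h]; congr 1; funext i; fin_cases i <;> rfl
  have e2 : (mono ![0, 1, 0] : LaurentPoly3) = var 1 := by
    rw [h]; congr 1; funext i; fin_cases i <;> rfl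
  have e3 : (mono ![0, 0, 1] : LaurentPoly3) = var 2 := by
    rw [h]; congr 1; funext i; fin_cases i <;> rfl
  have e4 : (mono ![1, 1, 0] : LaurentPoly3) = var 0 * var 1 := by
    rw [h, h, mono_mul]; congr 1; funext i; fin_cases i <;> simp
  have e5 : (mono ![1, 0, 1] : LaurentPoly3) = var 0 * var 2 := by
    rw [h, h, mono_mul]; congr 1; funext i; fin_cases i <;> simp
  have e6 : (mono ![0, 1, 1] : LaurentPoly3) = var 1 * var 2 := by
    rw [h, h, mono_mul]; congr 1; funext i; fin_cases i <;> simp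
  have e7 : (mono ![1, 1, 1] : LaurentPoly3) = var 0 * var 1 * var 2 := by
    rw [h, h, h, mono_mul, mono_mul]; congr 1; funext i; fin_cases i <;> simp
  rw [Fin.prod_univ_three, e0, e1, e2, e3, e4, e5, e6, e7]
  ring

end LaurentPoly3

namespace Partition3D

/-- `π'` is obtained from `π` by adding the box `b`. -/
def IsInsert (π : Partition3D) (b : Fin 3 → ℕ) (π' : Partition3D) : Prop :=
  b ∉ π.boxes ∧ π'.boxes = insert b π.boxes

variable {π π' : Partition3D} {b : Fin 3 → ℕ}

theorem IsInsert.asymp_eq (h : π.IsInsert b π') (k : Fin 3) : π'.asymp k = π.asymp k := by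
  apply YoungDiagram.ext
  ext c
  rw [mem_asymp, mem_asymp]
  constructor
  · intro hc s h1 h2
    have hs := hc s h1 h2
    rw [h.2] at hs
    rcases hs with rfl | hs
    · -- the next box on the same line lies in `π`
      have h3 := hc (s + Pi.single k 1) (by fin_cases k <;> simpa using h1)
        (by fin_cases k <;> simpa using h2)
      rw [h.2] at h3
      rcases h3 with h3 | h3
      · have := congrFun h3 k
        simp at this
      · refine π.lower ?_ h3
        intro i
        simp
    · exact hs
  · intro hc s h1 h2
    rw [h.2]
    exact Or.inr (hc s h1 h2)

theorem IsInsert.legCount_eq (h : π.IsInsert b π') (s : Fin 3 → ℕ) :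
    π'.legCount s = π.legCount s := by
  simp only [legCount, h.asymp_eq]

theorem legCount_of_notMem (hb : b ∉ π.boxes) : π.legCount b = 0 := by
  rw [legCount, Finset.card_eq_zero]
  exact Finset.filter_eq_empty_iff.2 fun k _ hk => hb (mem_boxes_of_mem_asymp hk)

theorem IsInsert.isCutoff (h : π.IsInsert b π') {N : ℕ} (hN : π'.IsCutoff N) : π.IsCutoff N := by
  refine ⟨fun s hs k hk => ?_, fun k c hc => ?_⟩
  · rw [← h.asymp_eq]
    exact hN.1 s (h.2 ▸ Or.inr hs) k hk
  · rw [← h.asymp_eq] at hc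
    exact hN.2 k c hc

theorem IsInsert.coreBoxes_eq (h : π.IsInsert b π') {N : ℕ} (hN : π'.IsCutoff N) :
    b ∉ π.coreBoxes N ∧ π'.coreBoxes N = insert b (π.coreBoxes N) := by
  refine ⟨fun hb => h.1 (mem_coreBoxes.1 hb).2, ?_⟩
  ext s
  rw [Finset.mem_insert, mem_coreBoxes, mem_coreBoxes, h.2, Set.mem_insert_iff]
  constructor
  · rintro ⟨h1, h2 | h2⟩
    · exact Or.inl h2
    · exact Or.inr ⟨h1, h2⟩
  · rintro (rfl | h1)
    · refine ⟨fun i => ?_, Or.inl rfl⟩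
      by_contra hi
      have := hN.1 s (h.2 ▸ Or.inl rfl) i (not_lt.1 hi)
      rw [h.asymp_eq] at this
      exact h.1 (mem_boxes_of_mem_asymp this)
    · exact ⟨h1.1, Or.inr h1.2⟩

theorem IsInsert.corePoly_eq (h : π.IsInsert b π') :
    π'.corePoly = π.corePoly + mono fun i => -(b i : ℤ) := by
  obtain ⟨N, hN⟩ := π'.exists_isCutoff
  rw [Partition3D.corePoly_eq hN, Partition3D.corePoly_eq (h.isCutoff hN), (h.coreBoxes_eq hN).2,
    Finset.sum_insert (h.coreBoxes_eq hN).1, h.legCount_eq, legCount_of_notMem h.1, add_comm]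
  simp [h.legCount_eq]

theorem dual_cornerPoly (π : Partition3D) : dual π.cornerPoly =
    1 - (∑ k, dual (legPoly (π.asymp k) k) * (1 - var (k + 1)) * (1 - var (k + 2))) -
      dual π.corePoly * (1 - var 0) * (1 - var 1) * (1 - var 2) := by
  simp only [cornerPoly, map_sub, map_mul, map_sum, map_one, dual_varInv]

/-- The change of the vertex character when a box is added. -/
theorem IsInsert.vertexPoly_sub (h : π.IsInsert b π') :
    π'.vertexPoly - π.vertexPoly =
      (mono fun i => -(b i : ℤ)) * dual π.cornerPoly -
        mono 1 * dual ((mono fun i => -(b i : ℤ)) * dual π.cornerPoly) - ∏ i, (1 - var i) := by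
  rw [← prod_var, map_mul dual, dual_dual, vertexPoly, vertexPoly]
  simp only [h.asymp_eq]
  rw [h.corePoly_eq, map_add, dual_cornerPoly, cornerPoly]
  have hm : (mono fun i => -(b i : ℤ)) * dual (mono fun i => -(b i : ℤ)) = 1 := by
    rw [dual_mono, mono_mul, add_neg_cancel, mono_zero]
  have v0 := var_mul_varInv 0
  have v1 := var_mul_varInv 1
  have v2 := var_mul_varInv 2
  simp only [vertexExpr, Fin.sum_univ_three, Fin.prod_univ_three, Fin.isValue, zero_add,
    show (1 : Fin 3) + 1 = 2 from rfl, show (1 : Fin 3) + 2 = 0 from rfl,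
    show (2 : Fin 3) + 1 = 0 from rfl, show (2 : Fin 3) + 2 = 1 from rfl]
  generalize (mono fun i => -(b i : ℤ)) = m at *
  generalize dual m = m' at *
  generalize π.corePoly = r
  generalize dual r = r'
  generalize legPoly (π.asymp 0) 0 = l0
  generalize legPoly (π.asymp 1) 1 = l1
  generalize legPoly (π.asymp 2) 2 = l2
  generalize dual l0 = l0'
  generalize dual l1 = l1'
  generalize dual l2 = l2'
  generalize var 0 = x at *
  generalize var 1 = y at *
  generalize var 2 = z at *
  generalize varInv 0 = x' at *
  generalize varInv 1 = y' at *
  generalize varInv 2 = z' at *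
  have e0 : x * (1 - x') = -(1 - x) := by linear_combination -v0
  have e1 : y * (1 - y') = -(1 - y) := by linear_combination -v1
  have e2 : z * (1 - z') = -(1 - z) := by linear_combination -v2
  have e3 : x * y * z * (1 - (l0 * (1 - y') * (1 - z') + l1 * (1 - z') * (1 - x') +
      l2 * (1 - x') * (1 - y')) - r * (1 - x') * (1 - y') * (1 - z')) =
      x * y * z - (l0 * x * ((1 - y) * (1 - z)) + l1 * y * ((1 - z) * (1 - x)) +
        l2 * z * ((1 - x) * (1 - y))) + r * ((1 - x) * (1 - y) * (1 - z)) := by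
    calc _ = x * y * z - (l0 * x * ((y * (1 - y')) * (z * (1 - z'))) +
          l1 * y * ((z * (1 - z')) * (x * (1 - x'))) + l2 * z * ((x * (1 - x')) * (y * (1 - y')))) -
          r * ((x * (1 - x')) * (y * (1 - y')) * (z * (1 - z'))) := by ring
      _ = _ := by rw [e0, e1, e2]; ring
  linear_combination -((1 - x) * (1 - y) * (1 - z)) * hm + m' * e3

theorem IsInsert.weightSum_vertexPoly (h : π.IsInsert b π') {φ : (Fin 3 → ℤ) → ℤ}
    (hφ : ∀ w, φ (1 - w) = -φ w) :
    weightSum φ π'.vertexPoly - weightSum φ π.vertexPoly =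
      2 * weightSum φ ((mono fun i => -(b i : ℤ)) * dual π.cornerPoly) -
        weightSum φ (∏ i, (1 - var i)) := by
  rw [← map_sub, h.vertexPoly_sub, map_sub, map_sub, weightSum_kappa_dual hφ]
  ring

theorem outInd_eq_one (hb : b ∉ π.boxes) {x y z : ℤ} (hx : b 0 ≤ x) (hy : b 1 ≤ y)
    (hz : b 2 ≤ z) : π.outInd x y z = 1 := by
  refine if_pos ⟨by omega, by omega, by omega, fun h => hb (π.lower ?_ h)⟩
  intro i
  fin_cases i <;> simp <;> omega

theorem IsInsert.outInd_eq_zero (h : π.IsInsert b π') {x y z : ℤ} (hx : x ≤ b 0) (hy : y ≤ b 1)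
    (hz : z ≤ b 2) (hne : x ≠ b 0 ∨ y ≠ b 1 ∨ z ≠ b 2) : π.outInd x y z = 0 := by
  refine if_neg ?_
  rintro ⟨h1, h2, h3, h4⟩
  have h5 : ![x.toNat, y.toNat, z.toNat] ∈ π'.boxes := by
    refine π'.lower ?_ (h.2 ▸ Or.inl rfl : b ∈ π'.boxes)
    intro i
    fin_cases i <;> simp <;> omega
  rw [h.2] at h5
  rcases h5 with h5 | h5
  · have a0 := congrFun h5 0
    have a1 := congrFun h5 1
    have a2 := congrFun h5 2
    simp only [Matrix.cons_val_zero, Matrix.cons_val_one, Matrix.cons_val] at a0 a1 a2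
    omega
  · exact h4 h5

/-- Near the diagonal through an addable box, the complement looks like an octant. -/
theorem IsInsert.outInd_diag (h : π.IsInsert b π') (a : ℤ) :
    π.outInd (b 0 + a) (b 1 + a) (b 2 + a) = nonnegInd a ∧
    ∀ d : Fin 3 → ℤ, (∀ i, d i = 0 ∨ d i = 1) → (d 0 = 1 ∨ d 1 = 1 ∨ d 2 = 1) →
      π.outInd (b 0 + a - d 0) (b 1 + a - d 1) (b 2 + a - d 2) = nonnegInd (a - 1) := by
  constructor
  · unfold nonnegInd
    split_ifs with ha
    · exact outInd_eq_one h.1 (by omega) (by omega) (by omega)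
    · exact h.outInd_eq_zero (by omega) (by omega) (by omega) (by omega)
  · intro d hd hd'
    have d0 := hd 0
    have d1 := hd 1
    have d2 := hd 2
    unfold nonnegInd
    split_ifs with ha
    · exact outInd_eq_one h.1 (by omega) (by omega) (by omega)
    · exact h.outInd_eq_zero (by omega) (by omega) (by omega) (by omega)

theorem IsCutoff.outInd_eq {N : ℕ} (hN : π.IsCutoff N) (x y z : ℤ) :
    ((N : ℤ) ≤ x → π.outInd x y z = (π.asymp 0).outInd y z) ∧
    ((N : ℤ) ≤ y → π.outInd x y z = (π.asymp 1).outInd z x) ∧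
    ((N : ℤ) ≤ z → π.outInd x y z = (π.asymp 2).outInd x y) := by
  have key : ∀ k : Fin 3, ∀ s : Fin 3 → ℕ, N ≤ s k →
      (s ∈ π.boxes ↔ (s (k + 1), s (k + 2)) ∈ (π.asymp k).cells) := fun k s hk =>
    ⟨fun h => hN.1 s h k hk, mem_boxes_of_mem_asymp⟩
  refine ⟨fun h => ?_, fun h => ?_, fun h => ?_⟩
  · have := key 0 ![x.toNat, y.toNat, z.toNat] (by simp; omega)
    simp only [outInd, YoungDiagram.outInd, this]
    congr 1
    simp only [eq_iff_iff]
    constructor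
    · rintro ⟨-, h1, h2, h3⟩
      exact ⟨h1, h2, h3⟩
    · rintro ⟨h1, h2, h3⟩
      exact ⟨by omega, h1, h2, h3⟩
  · have := key 1 ![x.toNat, y.toNat, z.toNat] (by simp; omega)
    simp only [outInd, YoungDiagram.outInd, this]
    congr 1
    simp only [eq_iff_iff]
    constructor
    · rintro ⟨h0, h1, h2, h3⟩
      exact ⟨h2, h0, h3⟩
    · rintro ⟨h1, h2, h3⟩
      exact ⟨h2, by omega, h1, h3⟩
  · have := key 2 ![x.toNat, y.toNat, z.toNat] (by simp; omega)
    simp only [outInd, YoungDiagram.outInd, this]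
    congr 1
    simp only [eq_iff_iff]
    constructor
    · rintro ⟨h0, h1, h2, h3⟩
      exact ⟨h0, h1, h3⟩
    · rintro ⟨h1, h2, h3⟩
      exact ⟨h1, h2, by omega, h3⟩

theorem outInd_neg (π : Partition3D) {x y z : ℤ} (h : x < 0 ∨ y < 0 ∨ z < 0) :
    π.outInd x y z = 0 := if_neg (by omega)

theorem IsCutoff.boxCoeff_cornerPoly_ne_zero {N : ℕ} (hN : π.IsCutoff N) {x y z : ℤ}
    (h : boxCoeff π.cornerPoly x y z ≠ 0) :
    (0 ≤ x ∧ x ≤ N) ∧ (0 ≤ y ∧ y ≤ N) ∧ (0 ≤ z ∧ z ≤ N) := by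
  rw [boxCoeff_cornerPoly] at h
  refine ⟨⟨?_, ?_⟩, ⟨?_, ?_⟩, ⟨?_, ?_⟩⟩
  · by_contra hx
    exact h (by simp only [π.outInd_neg (Or.inl (show x < 0 by omega)),
      π.outInd_neg (Or.inl (show x - 1 < 0 by omega))]; ring)
  · by_contra hx
    exact h (by
      simp only [fun y z => (hN.outInd_eq x y z).1 (by omega),
        fun y z => (hN.outInd_eq (x - 1) y z).1 (by omega)]; ring)
  · by_contra hx
    exact h (by simp only [fun x z => π.outInd_neg (x := x) (z := z) (Or.inr (Or.inl (show y < 0 by omega))),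
      fun x z => π.outInd_neg (x := x) (z := z) (Or.inr (Or.inl (show y - 1 < 0 by omega)))]; ring)
  · by_contra hx
    exact h (by
      simp only [fun x z => (hN.outInd_eq x y z).2.1 (by omega),
        fun x z => (hN.outInd_eq x (y - 1) z).2.1 (by omega)]; ring)
  · by_contra hx
    exact h (by simp only [fun x y => π.outInd_neg (x := x) (y := y) (Or.inr (Or.inr (show z < 0 by omega))),
      fun x y => π.outInd_neg (x := x) (y := y) (Or.inr (Or.inr (show z - 1 < 0 by omega)))]; ring)
  · by_contra hx
    exact h (by
      simp only [fun x y => (hN.outInd_eq x y z).2.2 (by omega),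
        fun x y => (hN.outInd_eq x y (z - 1)).2.2 (by omega)]; ring)

/-- Adding a box of content `c` changes `weightSum slopeSign` by `±2`, the sign being given by the
step of the boundary path of the third leg before the diagonal `c`. -/
theorem IsInsert.slopeSign_vertexPoly (h : π.IsInsert b π') :
    weightSum slopeSign π'.vertexPoly - weightSum slopeSign π.vertexPoly =
      2 * (1 - 2 * (((π.asymp 2).path ((b 0 : ℤ) - b 1) : ℤ) -
        (π.asymp 2).path ((b 0 : ℤ) - b 1 - 1))) := by
  obtain ⟨N, hN⟩ := π.exists_isCutoff
  set M : ℤ := |(b 0 : ℤ)| + |(b 1 : ℤ)| + |(b 2 : ℤ)| + 3 +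
    (π.asymp 2).path ((b 0 : ℤ) - b 1) + (π.asymp 2).rowLen 0 + N with hM
  have hp := abs_nonneg (b 0 : ℤ)
  have hp1 := abs_nonneg (b 1 : ℤ)
  have hp2 := abs_nonneg (b 2 : ℤ)
  rw [h.weightSum_vertexPoly slopeSign_one_sub, weightSum_mono_mul_dual slopeSign
    (a := -3 * M) (b := 3 * M) (a' := -M) (b' := M) (a'' := -9 * M) (b'' := 9 * M)
    (fun x y z hne => by
      have := hN.boxCoeff_cornerPoly_ne_zero hne
      omega)]
  have key := sum_mixedDiff_slopeSign π.outInd (π.asymp 2) (b 0) (b 1) (b 2) M (by omega)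
    (by omega) (fun x y => π.outInd_neg (by omega))
    (fun x y => (hN.outInd_eq x y _).2.2 (by omega))
    (fun a => (h.outInd_diag a).1)
    (fun a => by simpa using (h.outInd_diag a).2 ![1, 0, 0] (by simp [Fin.forall_fin_succ]) (by simp))
    (fun a => by simpa using (h.outInd_diag a).2 ![0, 1, 0] (by simp [Fin.forall_fin_succ]) (by simp))
    (fun a => by simpa using (h.outInd_diag a).2 ![1, 1, 0] (by simp [Fin.forall_fin_succ]) (by simp))
    (fun a => by simpa using (h.outInd_diag a).2 ![0, 0, 1] (by simp [Fin.forall_fin_succ]) (by simp))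
    (fun a => by simpa using (h.outInd_diag a).2 ![1, 0, 1] (by simp [Fin.forall_fin_succ]) (by simp))
    (fun a => by simpa using (h.outInd_diag a).2 ![0, 1, 1] (by simp [Fin.forall_fin_succ]) (by simp))
    (fun a => by simpa using (h.outInd_diag a).2 ![1, 1, 1] (by simp [Fin.forall_fin_succ]) (by simp))
  have e : weightSum slopeSign (∏ i, (1 - var i)) = -2 := by
    rw [prod_one_sub_var]
    simp only [map_add, map_sub, weightSum_mono, slopeSign_vec]
    rfl
  simp only [boxCoeff_cornerPoly]
  simp only [neg_add_eq_sub]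
  rw [key, e]
  ring

theorem one_sub_eq_const_iff (w : Fin 3 → ℤ) (n : ℤ) :
    (1 - w = fun _ => n) ↔ w = fun _ => 1 - n := by
  constructor
  · intro h
    funext i
    have := congrFun h i
    simp at this
    omega
  · rintro rfl
    funext i
    simp

/-- Adding a box does not change the multiplicities of the powers of `κ = t₁t₂t₃`. -/
theorem IsInsert.kappa_vertexPoly (h : π.IsInsert b π') (n : ℤ) :
    (π'.vertexPoly.coeff fun _ => n) - (π'.vertexPoly.coeff fun _ => 1 - n) =
      (π.vertexPoly.coeff fun _ => n) - π.vertexPoly.coeff fun _ => 1 - n := by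
  set φ : (Fin 3 → ℤ) → ℤ := fun w =>
    (if w = fun _ => n then 1 else 0) - if w = fun _ => 1 - n then 1 else 0 with hφ
  have hws : ∀ f, weightSum φ f = (f.coeff fun _ => n) - f.coeff fun _ => 1 - n := by
    intro f
    rw [← weightSum_indicator, ← weightSum_indicator]
    induction f using AddMonoidAlgebra.induction_linear with
    | zero => simp
    | add x y hx hy => rw [map_add, map_add, map_add, hx, hy]; ring
    | single w m => simp only [weightSum_single, hφ]; ring
  have hodd : ∀ w, φ (1 - w) = -φ w := by
    intro w
    simp only [hφ, one_sub_eq_const_iff, sub_sub_cancel]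
    ring
  have hcoeff : ∀ a : ℤ, (((mono fun i => -(b i : ℤ)) * dual π.cornerPoly).coeff fun _ => a) =
      nonnegInd a - nonnegInd (a - 1) := by
    intro a
    rw [coeff_mono_mul_dual]
    have : ((fun i => -(b i : ℤ)) - fun _ => a) = ![-(b 0 + a), -(b 1 + a), -(b 2 + a)] := by
      funext i
      fin_cases i <;> simp <;> ring
    rw [this]
    change boxCoeff π.cornerPoly (b 0 + a) (b 1 + a) (b 2 + a) = _
    have h0 := (h.outInd_diag a).1
    have h1 := (h.outInd_diag a).2 ![1, 0, 0] (by simp [Fin.forall_fin_succ]) (by simp)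
    have h2 := (h.outInd_diag a).2 ![0, 1, 0] (by simp [Fin.forall_fin_succ]) (by simp)
    have h3 := (h.outInd_diag a).2 ![1, 1, 0] (by simp [Fin.forall_fin_succ]) (by simp)
    have h4 := (h.outInd_diag a).2 ![0, 0, 1] (by simp [Fin.forall_fin_succ]) (by simp)
    have h5 := (h.outInd_diag a).2 ![1, 0, 1] (by simp [Fin.forall_fin_succ]) (by simp)
    have h6 := (h.outInd_diag a).2 ![0, 1, 1] (by simp [Fin.forall_fin_succ]) (by simp)
    have h7 := (h.outInd_diag a).2 ![1, 1, 1] (by simp [Fin.forall_fin_succ]) (by simp)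
    simp only [Matrix.cons_val_zero, Matrix.cons_val_one, Matrix.cons_val, sub_zero] at h1 h2 h3 h4 h5 h6 h7
    rw [boxCoeff_cornerPoly, h0, h1, h2, h3, h4, h5, h6, h7]
    ring
  have e : ∀ a : ℤ, ((∏ i, (1 - var i) : LaurentPoly3).coeff fun _ => a) =
      (nonnegInd a - nonnegInd (a - 1)) - (nonnegInd (1 - a) - nonnegInd (1 - a - 1)) := by
    intro a
    rw [← weightSum_indicator, prod_one_sub_var]
    simp only [map_add, map_sub, weightSum_mono, funext_iff, Fin.forall_fin_succ,
      Fin.isValue, nonnegInd]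
    simp
    split_ifs <;> omega
  have := h.weightSum_vertexPoly hodd
  rw [hws, hws, hws, hws, hcoeff, hcoeff, e, e] at this
  rw [sub_sub_cancel] at this
  linear_combination this

end Partition3D

/-! ### The index of the vertex character -/

namespace Partition3D

/-- The point whose coordinate `k` is `n` and whose coordinates `k + 1`, `k + 2` are given by `c`. -/
def linePoint (k : Fin 3) (n : ℕ) (c : ℕ × ℕ) : Fin 3 → ℕ :=
  fun i => if i = k then n else if i = k + 1 then c.1 else c.2

theorem linePoint_self (k : Fin 3) (n : ℕ) (c : ℕ × ℕ) : linePoint k n c k = n := by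
  simp [linePoint]

theorem linePoint_one (k : Fin 3) (n : ℕ) (c : ℕ × ℕ) : linePoint k n c (k + 1) = c.1 := by
  simp [linePoint]

theorem linePoint_two (k : Fin 3) (n : ℕ) (c : ℕ × ℕ) : linePoint k n c (k + 2) = c.2 := by
  simp [linePoint]

theorem eq_linePoint (k : Fin 3) (s : Fin 3 → ℕ) : s = linePoint k (s k) (s (k + 1), s (k + 2)) := by
  funext i
  have : i = k ∨ i = k + 1 ∨ i = k + 2 := by fin_cases k <;> fin_cases i <;> decide
  rcases this with rfl | rfl | rfl
  · rw [linePoint_self]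
  · rw [linePoint_one]
  · rw [linePoint_two]

theorem sum_cube_leg {M : Type*} [AddCommMonoid M] {lam : YoungDiagram} {N : ℕ}
    (h : ∀ c ∈ lam.cells, c.1 < N ∧ c.2 < N) (k : Fin 3) (f : (Fin 3 → ℕ) → M) :
    ∑ s ∈ cube N with (s (k + 1), s (k + 2)) ∈ lam.cells, f s =
      ∑ c ∈ lam.cells, ∑ n ∈ Finset.range N, f (linePoint k n c) := by
  rw [← Finset.sum_product']
  refine Finset.sum_bij' (fun s _ => ((s (k + 1), s (k + 2)), s k))
    (fun p _ => linePoint k p.2 p.1) ?_ ?_ ?_ ?_ ?_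
  · intro s hs
    rw [Finset.mem_filter, mem_cube] at hs
    exact Finset.mem_product.2 ⟨hs.2, Finset.mem_range.2 (hs.1 k)⟩
  · rintro ⟨c, n⟩ hp
    obtain ⟨hc, hn⟩ := Finset.mem_product.1 hp
    rw [Finset.mem_range] at hn
    rw [Finset.mem_filter, mem_cube]
    refine ⟨fun i => ?_, ?_⟩
    · have := h c hc
      simp only [linePoint]
      split_ifs <;> omega
    · rw [linePoint_one, linePoint_two]
      exact hc
  · intro s _
    exact (eq_linePoint k s).symm
  · rintro ⟨c, n⟩ _
    simp only [linePoint_self, linePoint_one, linePoint_two]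
  · intro s _
    rw [← eq_linePoint k s]

/-- The union of the cube `[0, N)³` and of infinite legs with given profiles. -/
def full (lam mu nu : YoungDiagram) (N : ℕ) : Partition3D where
  boxes := {s | (∀ i, s i < N) ∨ (s 1, s 2) ∈ lam ∨ (s 2, s 0) ∈ mu ∨ (s 0, s 1) ∈ nu}
  lower := by
    intro s s' hle hs
    have h0 := hle 0
    have h1 := hle 1
    have h2 := hle 2
    rcases hs with hs | hs | hs | hs
    · exact Or.inl fun i => (hle i).trans_lt (hs i)
    · exact Or.inr (Or.inl (lam.up_left_mem h1 h2 hs))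
    · exact Or.inr (Or.inr (Or.inl (mu.up_left_mem h2 h0 hs)))
    · exact Or.inr (Or.inr (Or.inr (nu.up_left_mem h0 h1 hs)))
  bounded := by
    have key : ∀ (lam : YoungDiagram) (a b : ℕ), (a, b) ∈ lam →
        a < lam.colLen 0 ∧ b < lam.rowLen 0 := fun lam a b h =>
      ⟨YoungDiagram.mem_iff_lt_colLen.1 (lam.up_left_mem le_rfl (Nat.zero_le b) h),
        YoungDiagram.mem_iff_lt_rowLen.1 (lam.up_left_mem (Nat.zero_le a) le_rfl h)⟩
    refine ⟨N + lam.colLen 0 + lam.rowLen 0 + mu.colLen 0 + mu.rowLen 0 + nu.colLen 0 +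
      nu.rowLen 0, ?_⟩
    rintro s (hs | hs | hs | hs) i j hi hj
    · have := hs i
      omega
    all_goals
      have := key _ _ _ hs
      fin_cases i <;> fin_cases j <;> simp at hi hj ⊢ <;> omega

theorem mem_full {lam mu nu : YoungDiagram} {N : ℕ} {s : Fin 3 → ℕ} :
    s ∈ (full lam mu nu N).boxes ↔
      (∀ i, s i < N) ∨ (s 1, s 2) ∈ lam ∨ (s 2, s 0) ∈ mu ∨ (s 0, s 1) ∈ nu := Iff.rfl

/-- The profile `lam` fits into the square `[0, N)²`. -/
def FitsIn (lam : YoungDiagram) (N : ℕ) : Prop := ∀ c ∈ lam.cells, c.1 < N ∧ c.2 < N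

theorem fitsIn_bot (N : ℕ) : FitsIn ⊥ N := by simp [FitsIn]

variable {lam mu nu : YoungDiagram} {N : ℕ}

theorem full_asymp (B : ℕ) (hl : FitsIn lam B) (hm : FitsIn mu B) (hn : FitsIn nu B) (N : ℕ) :
    (full lam mu nu N).asymp 0 = lam ∧ (full lam mu nu N).asymp 1 = mu ∧
      (full lam mu nu N).asymp 2 = nu := by
  refine ⟨?_, ?_, ?_⟩ <;> apply YoungDiagram.ext <;> ext ⟨a, b⟩ <;> rw [mem_asymp] <;> constructor
  · intro h
    rcases mem_full.1 (h ![N + B, a, b] rfl rfl) with h1 | h1 | h1 | h1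
    · have := h1 0
      simp at this
    · exact h1
    · have := (hm _ h1).2
      simp at this
    · have := (hn _ h1).1
      simp at this
  · intro h s h1 h2
    refine mem_full.2 (Or.inr (Or.inl ?_))
    simp only [zero_add] at h1 h2
    rw [h1, h2]
    exact h
  · intro h
    rcases mem_full.1 (h ![b, N + B, a] rfl rfl) with h1 | h1 | h1 | h1
    · have := h1 1
      simp at this
    · have := (hl _ h1).1
      simp at this
    · exact h1
    · have := (hn _ h1).2
      simp at this
  · intro h s h1 h2
    refine mem_full.2 (Or.inr (Or.inr (Or.inl ?_)))
    rw [show (1 : Fin 3) + 1 = 2 from rfl] at h1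
    rw [show (1 : Fin 3) + 2 = 0 from rfl] at h2
    rw [h1, h2]
    exact h
  · intro h
    rcases mem_full.1 (h ![a, b, N + B] rfl rfl) with h1 | h1 | h1 | h1
    · have := h1 2
      simp at this
    · have := (hl _ h1).2
      simp at this
    · have := (hm _ h1).1
      simp at this
    · exact h1
  · intro h s h1 h2
    refine mem_full.2 (Or.inr (Or.inr (Or.inr ?_)))
    rw [show (2 : Fin 3) + 1 = 0 from rfl] at h1
    rw [show (2 : Fin 3) + 2 = 1 from rfl] at h2
    rw [h1, h2]
    exact h

theorem mem_of_fin_three (π : Partition3D) (s : Fin 3 → ℕ) :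
    (∃ k, (s (k + 1), s (k + 2)) ∈ (π.asymp k).cells) ↔
      (s 1, s 2) ∈ π.asymp 0 ∨ (s 2, s 0) ∈ π.asymp 1 ∨ (s 0, s 1) ∈ π.asymp 2 := by
  simp [Fin.exists_fin_succ, show (1 : Fin 3) + 1 = 2 from rfl, show (1 : Fin 3) + 2 = 0 from rfl,
    show (2 : Fin 3) + 1 = 0 from rfl, show (2 : Fin 3) + 2 = 1 from rfl]

theorem full_isCutoff {B : ℕ} (hl : FitsIn lam B) (hm : FitsIn mu B) (hn : FitsIn nu B) {N : ℕ}
    (hN' : FitsIn lam N ∧ FitsIn mu N ∧ FitsIn nu N) {N' : ℕ} (hN : N' ≤ N) :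
    (full lam mu nu N').IsCutoff N := by
  obtain ⟨e0, e1, e2⟩ := full_asymp B hl hm hn N'
  constructor
  · intro s hs k hk
    have h1 : ∃ k, (s (k + 1), s (k + 2)) ∈ ((full lam mu nu N').asymp k).cells := by
      rw [mem_of_fin_three, e0, e1, e2]
      exact (mem_full.1 hs).resolve_left fun h => by
        have := h k
        omega
    obtain ⟨j, hj⟩ := h1
    have hb : s (j + 1) < N ∧ s (j + 2) < N := by
      fin_cases j
      · exact hN'.1 _ (e0 ▸ hj)
      · exact hN'.2.1 _ (e1 ▸ hj)
      · exact hN'.2.2 _ (e2 ▸ hj)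
    have : k = j ∨ k = j + 1 ∨ k = j + 2 := by fin_cases k <;> fin_cases j <;> decide
    rcases this with rfl | rfl | rfl
    · exact hj
    · omega
    · omega
  · intro k
    fin_cases k
    · exact fun c hc => hN'.1 c (e0 ▸ hc)
    · exact fun c hc => hN'.2.1 c (e1 ▸ hc)
    · exact fun c hc => hN'.2.2 c (e2 ▸ hc)

/-- The partition `π` with the box `b` added. -/
def insertBox (π : Partition3D) (b : Fin 3 → ℕ) (h : ∀ s ≤ b, s ≠ b → s ∈ π.boxes) :
    Partition3D where
  boxes := insert b π.boxes
  lower := by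
    rintro s s' hle (rfl | hs)
    · by_cases he : s' = s
      · exact Or.inl he
      · exact Or.inr (h s' hle he)
    · exact Or.inr (π.lower hle hs)
  bounded := by
    obtain ⟨B, hB⟩ := π.bounded
    refine ⟨B + b 0 + b 1 + b 2, ?_⟩
    rintro s (rfl | hs) i j hi hj
    · fin_cases i <;> simp at hi <;> omega
    · exact hB s hs i j (by omega) (by omega)

/-- A function on partitions that changes by `g (content)` when a box is added. -/
theorem sub_eq_sum_sdiff {F : Partition3D → ℤ} {g : ℤ → ℤ} {nu : YoungDiagram}
    (hF : ∀ π b π', IsInsert π b π' → π.asymp 2 = nu → F π' - F π = g ((b 0 : ℤ) - b 1))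
    (n : ℕ) : ∀ {π π' : Partition3D}, (π'.coreBoxes N \ π.coreBoxes N).card = n →
      π.boxes ⊆ π'.boxes → (∀ k, π.asymp k = π'.asymp k) → π'.asymp 2 = nu → π'.IsCutoff N →
      F π' - F π = ∑ s ∈ π'.coreBoxes N \ π.coreBoxes N, g ((s 0 : ℤ) - s 1) := by
  induction n with
  | zero =>
    intro π π' hn hle has hnu hN
    rw [Finset.card_eq_zero] at hn
    have : π = π' := by
      refine ext_boxes (hle.antisymm fun s hs => ?_)
      by_contra hs'
      have h1 : s ∈ π'.coreBoxes N := by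
        refine mem_coreBoxes.2 ⟨fun i => ?_, hs⟩
        by_contra hi
        have := hN.1 s hs i (not_lt.1 hi)
        rw [← has] at this
        exact hs' (mem_boxes_of_mem_asymp this)
      have := Finset.sdiff_eq_empty_iff_subset.1 hn h1
      exact hs' (mem_coreBoxes.1 this).2
    subst this
    simp
  | succ n ih =>
    intro π π' hn hle has hnu hN
    -- a minimal missing box
    obtain ⟨b, hb⟩ := (π'.coreBoxes N \ π.coreBoxes N).exists_minimal
      (Finset.card_pos.1 (by omega))
    have hb1 := Finset.mem_sdiff.1 hb.1
    have hb2 := mem_coreBoxes.1 hb1.1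
    have hbπ : b ∉ π.boxes := fun h => hb1.2 (mem_coreBoxes.2 ⟨hb2.1, h⟩)
    have hlow : ∀ s ≤ b, s ≠ b → s ∈ π.boxes := by
      intro s hs hne
      by_contra hsπ
      have h1 : s ∈ π'.coreBoxes N \ π.coreBoxes N :=
        Finset.mem_sdiff.2 ⟨mem_coreBoxes.2 ⟨fun i => (hs i).trans_lt (hb2.1 i),
          π'.lower hs hb2.2⟩, fun h => hsπ (mem_coreBoxes.1 h).2⟩
      exact hne (le_antisymm hs (hb.2 h1 hs))
    have hins : IsInsert π b (insertBox π b hlow) := ⟨hbπ, rfl⟩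
    have hle' : (insertBox π b hlow).boxes ⊆ π'.boxes :=
      Set.insert_subset hb2.2 hle
    have has' : ∀ k, (insertBox π b hlow).asymp k = π'.asymp k := fun k =>
      (hins.asymp_eq k).trans (has k)
    have hN' : (insertBox π b hlow).IsCutoff N := by
      refine ⟨fun s hs k hk => ?_, fun k c hc => hN.2 k c (has' k ▸ hc)⟩
      rw [has']
      exact hN.1 s (hle' hs) k hk
    have hcore := hins.coreBoxes_eq hN'
    have hsd : π'.coreBoxes N \ π.coreBoxes N =
        insert b (π'.coreBoxes N \ (insertBox π b hlow).coreBoxes N) := by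
      rw [hcore.2]
      ext s
      simp only [Finset.mem_sdiff, Finset.mem_insert]
      constructor
      · rintro ⟨h1, h2⟩
        by_cases h3 : s = b
        · exact Or.inl h3
        · exact Or.inr ⟨h1, by tauto⟩
      · rintro (rfl | h1)
        · exact hb1
        · exact ⟨h1.1, fun h => h1.2 (Or.inr h)⟩
    have hnot : b ∉ π'.coreBoxes N \ (insertBox π b hlow).coreBoxes N := by
      rw [hcore.2]
      simp
    rw [hsd, Finset.card_insert_of_notMem hnot] at hn
    have h1 := ih (by omega) hle' has' hnu hN
    have h2 := hF _ _ _ hins ((has 2).trans hnu)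
    rw [hsd, Finset.sum_insert hnot]
    linarith

end Partition3D

/-! ### The vertex character of a cube with three legs -/

/-- The character of the segment of length `N` along the axis `i`. -/
noncomputable def segPoly (N : ℕ) (i : Fin 3) : LaurentPoly3 :=
  ∑ n ∈ Finset.range N, mono (Pi.single i (-(n : ℤ)))

/-- The vertex expression of a cube with three legs, whose sides have characters
`s k = ∑_{n < N} t_k ^ (-n)`; here `T k = t_k ^ N`. The terms linear and quadratic in the characters
of the legs are separated. -/
theorem vertexExpr_cube {F : Type*} [Field F] (t T l l' s s' : Fin 3 → F)
    (h0 : ∀ i, t i ≠ 0) (h1 : ∀ i, t i ≠ 1) (hT : ∀ i, T i ≠ 0)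
    (hs : ∀ i, s i * (1 - (t i)⁻¹) = 1 - (T i)⁻¹) (hs' : ∀ i, s' i * (1 - t i) = 1 - T i) :
    vertexExpr t l l' (∏ i, s i - ∑ k, l k * s k) (∏ i, s' i - ∑ k, l' k * s' k) =
      vertexExpr t 0 0 (∏ i, s i) (∏ i, s' i) +
      ∑ k, (l k * s k * (T (k + 1) * T (k + 2) - T (k + 1) - T (k + 2)) -
        (∏ i, t i) * (l' k * s' k * ((T (k + 1))⁻¹ * (T (k + 2))⁻¹ - (T (k + 1))⁻¹ -
          (T (k + 2))⁻¹))) +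
      ∑ k, (t k * T (k + 1) * (T k)⁻¹ * l k * l' (k + 1) +
        t (k + 1) * T k * (T (k + 1))⁻¹ * l (k + 1) * l' k) * (1 - t (k + 2)) := by
  have h2 : ∀ i, 1 - t i ≠ 0 := fun i => sub_ne_zero.2 (h1 i).symm
  have e : ∀ k, (1 - (t k)⁻¹) = -(1 - t k) * (t k)⁻¹ := fun k => by
    have := h0 k
    field_simp
    ring
  have es : ∀ i, s i = - (1 - (T i)⁻¹) * t i / (1 - t i) := fun i => by
    rw [← hs, e]
    have := h0 i
    have := h2 i
    field_simp
  have es' : ∀ i, s' i = (1 - T i) / (1 - t i) := fun i => by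
    rw [← hs']
    have := h2 i
    field_simp
  have a0 := h0 0
  have a1 := h0 1
  have a2 := h0 2
  have b0 := h2 0
  have b1 := h2 1
  have b2 := h2 2
  have c0 := hT 0
  have c1 := hT 1
  have c2 := hT 2
  simp only [es, es', vertexExpr, Fin.sum_univ_three, Fin.prod_univ_three, Fin.isValue, zero_add,
    show (1 : Fin 3) + 1 = 2 from rfl, show (1 : Fin 3) + 2 = 0 from rfl,
    show (2 : Fin 3) + 1 = 0 from rfl, show (2 : Fin 3) + 2 = 1 from rfl, Pi.zero_apply]
  generalize t 0 = t0 at *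
  generalize t 1 = t1 at *
  generalize t 2 = t2 at *
  generalize T 0 = T0 at *
  generalize T 1 = T1 at *
  generalize T 2 = T2 at *
  generalize l 0 = l0
  generalize l 1 = l1
  generalize l 2 = l2
  generalize l' 0 = m0
  generalize l' 1 = m1
  generalize l' 2 = m2
  field_simp
  ring

namespace Partition3D

variable {lam mu nu : YoungDiagram} {N : ℕ}

theorem full_corePoly (hl : FitsIn lam N) (hm : FitsIn mu N) (hn : FitsIn nu N) :
    (full lam mu nu N).corePoly = ∏ i, segPoly N i -
      ∑ k, legPoly ((full lam mu nu N).asymp k) k * segPoly N k := by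
  have hN := full_isCutoff hl hm hn ⟨hl, hm, hn⟩ le_rfl
  have hcore : (full lam mu nu N).coreBoxes N = cube N := by
    ext s
    rw [mem_coreBoxes, mem_cube]
    exact ⟨fun h => h.1, fun h => ⟨h, Or.inl h⟩⟩
  rw [corePoly_eq hN, hcore]
  have hleg : ∀ s, ((full lam mu nu N).legCount s : ℤ) =
      ∑ k, if (s (k + 1), s (k + 2)) ∈ ((full lam mu nu N).asymp k).cells then 1 else 0 := by
    intro s
    rw [legCount, Finset.card_filter]
    push_cast
    rfl
  simp only [sub_smul, one_smul, Finset.sum_sub_distrib, hleg, Finset.sum_smul, ite_smul, zero_smul]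
  congr 1
  · simp only [segPoly]
    rw [Finset.prod_univ_sum, cube]
    refine Finset.sum_congr rfl fun s _ => ?_
    rw [Fin.prod_univ_three, mono_mul, mono_mul]
    congr 1
    funext i
    fin_cases i <;> simp
  · rw [Finset.sum_comm]
    refine Finset.sum_congr rfl fun k _ => ?_
    rw [← Finset.sum_filter, sum_cube_leg (hN.2 k), legPoly, segPoly, Finset.sum_mul_sum]
    refine Finset.sum_congr rfl fun c _ => Finset.sum_congr rfl fun n _ => ?_
    rw [mono_mul]
    congr 1
    funext i
    fin_cases k <;> fin_cases i <;> simp [linePoint]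

theorem full_vertexPoly (hl : FitsIn lam N) (hm : FitsIn mu N) (hn : FitsIn nu N) :
    (full lam mu nu N).vertexPoly =
      vertexExpr var 0 0 (∏ i, segPoly N i) (dual (∏ i, segPoly N i)) +
      ∑ k, (legPoly ((full lam mu nu N).asymp k) k * segPoly N k *
          (mono (Pi.single (k + 1) (N : ℤ)) * mono (Pi.single (k + 2) (N : ℤ)) -
            mono (Pi.single (k + 1) (N : ℤ)) - mono (Pi.single (k + 2) (N : ℤ))) -
        mono 1 * dual (legPoly ((full lam mu nu N).asymp k) k * segPoly N k *
          (mono (Pi.single (k + 1) (N : ℤ)) * mono (Pi.single (k + 2) (N : ℤ)) -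
            mono (Pi.single (k + 1) (N : ℤ)) - mono (Pi.single (k + 2) (N : ℤ))))) +
      ∑ k, (mono (Pi.single k (1 - N : ℤ) + Pi.single (k + 1) (N : ℤ)) *
          legPoly ((full lam mu nu N).asymp k) k *
            dual (legPoly ((full lam mu nu N).asymp (k + 1)) (k + 1)) +
        mono (Pi.single (k + 1) (1 - N : ℤ) + Pi.single k (N : ℤ)) *
          legPoly ((full lam mu nu N).asymp (k + 1)) (k + 1) *
            dual (legPoly ((full lam mu nu N).asymp k) k)) * (1 - var (k + 2)) := by
  rw [vertexPoly, full_corePoly hl hm hn]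
  generalize (full lam mu nu N).asymp = L
  apply evalAt_genericT_injective
  set ev := evalAt genericT genericT_ne_zero with hev
  have hinv : ∀ i, genericT⁻¹ i ≠ 0 := fun i => inv_ne_zero (genericT_ne_zero i)
  have hmono : ∀ (i : Fin 3) (n : ℤ), ev (mono (Pi.single i n)) = genericT i ^ n := fun i n => by
    rw [hev, evalAt_mono, laurentMonomial_single]
  have hmono' : ∀ (i : Fin 3) (n : ℤ), ev (dual (mono (Pi.single i n))) = (genericT i ^ n)⁻¹ :=
    fun i n => by rw [dual_mono, ← Pi.single_neg, hmono, zpow_neg]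
  have hs : ∀ i, ev (segPoly N i) * (1 - (genericT i)⁻¹) = 1 - (genericT i ^ (N : ℤ))⁻¹ := fun i => by
    rw [segPoly, map_sum]
    simp only [hmono]
    have := geom_sum_mul_neg (genericT i)⁻¹ N
    simp only [zpow_neg, zpow_natCast]
    simpa using this
  have hs' : ∀ i, ev (dual (segPoly N i)) * (1 - genericT i) = 1 - genericT i ^ (N : ℤ) := fun i => by
    rw [segPoly, map_sum, map_sum]
    simp only [hmono', zpow_neg, inv_inv, zpow_natCast]
    exact geom_sum_mul_neg _ _
  have key := vertexExpr_cube genericT (fun i => genericT i ^ (N : ℤ))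
    (fun k => ev (legPoly (L k) k)) (fun k => ev (dual (legPoly (L k) k)))
    (fun i => ev (segPoly N i)) (fun i => ev (dual (segPoly N i))) genericT_ne_zero genericT_ne_one
    (fun i => zpow_ne_zero _ (genericT_ne_zero i)) hs hs'
  have hv : ev ∘ var = genericT := funext fun i => evalAt_var _ i
  have hz : (ev ∘ (0 : Fin 3 → LaurentPoly3)) = 0 := funext fun i => map_zero ev
  have h1 : ev (mono 1) = ∏ i, genericT i := by
    rw [← prod_var, map_prod]
    exact Finset.prod_congr rfl fun i _ => evalAt_var _ i
  have hm2 : ∀ i j : Fin 3, ev (mono (Pi.single i (1 - N : ℤ) + Pi.single j (N : ℤ))) =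
      genericT i * genericT j ^ (N : ℤ) * (genericT i ^ (N : ℤ))⁻¹ := fun i j => by
    rw [← mono_mul, map_mul, hmono, hmono, sub_eq_add_neg, zpow_add₀ (genericT_ne_zero i), zpow_one,
      zpow_neg]
    ring
  have hvar : ∀ i, ev (var i) = genericT i := fun i => evalAt_var _ i
  simp only [map_add, map_vertexExpr, map_sub, map_sum, map_mul, map_one, hv, hz, h1, hm2, hmono,
    hmono', hvar, map_prod]
  exact key

end Partition3D

/-! ### The index formula -/

namespace Partition3D

variable {lam mu nu : YoungDiagram} {N : ℕ}

/-- A weight function on which only the comparison of the first two coordinates matters, away from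
the weights of the form `(n, n, m)` with `m ≤ n`. -/
structure IsSlopeFn (φ : (Fin 3 → ℤ) → ℤ) (s : ℤ) : Prop where
  odd : ∀ w, φ (1 - w) = -φ w
  lt : ∀ w, w 0 < w 1 → φ w = -s
  gt : ∀ w, w 1 < w 0 → φ w = s
  eq : ∀ w, w 0 = w 1 → w 0 < w 2 → φ w = s

theorem isSlopeFn_slopeSign : IsSlopeFn slopeSign 1 where
  odd := slopeSign_one_sub
  lt w h := by
    rw [slopeSign, if_neg h.ne, Int.sign_eq_neg_one_of_neg (by omega)]
  gt w h := by
    rw [slopeSign, if_neg h.ne', Int.sign_eq_one_of_pos (by omega)]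
  eq w h h' := by
    rw [slopeSign, if_pos h, Int.sign_eq_one_of_pos (by omega)]

/-- A weight function that is nonzero only at the two weights `κ ^ n` and `κ ^ (1 - n)`. -/
theorem isSlopeFn_kappa (n : ℤ) : IsSlopeFn (fun w =>
    (if w = fun _ => n then 1 else 0) - if w = fun _ => 1 - n then 1 else 0) 0 where
  odd w := by
    simp only [one_sub_eq_const_iff, sub_sub_cancel]
    ring
  lt w h := by
    rw [if_neg (by rintro rfl; exact lt_irrefl _ h), if_neg (by rintro rfl; exact lt_irrefl _ h)]
    rfl
  gt w h := by
    rw [if_neg (by rintro rfl; exact lt_irrefl _ h), if_neg (by rintro rfl; exact lt_irrefl _ h)]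
    rfl
  eq w h h' := by
    rw [if_neg (by rintro rfl; exact lt_irrefl _ h'), if_neg (by rintro rfl; exact lt_irrefl _ h')]
    rfl

variable {φ : (Fin 3 → ℤ) → ℤ} {s : ℤ}

theorem sum_range_trichotomy (f : ℕ → ℤ) (s : ℤ) {m N : ℕ} (hm : m < N) (h1 : ∀ n < m, f n = -s)
    (h2 : f m = -s) (h3 : ∀ n, m < n → n < N → f n = s) :
    ∑ n ∈ Finset.range N, f n = s * (N - 2 * (m + 1)) := by
  obtain ⟨j, rfl⟩ := Nat.exists_eq_add_of_lt hm
  rw [show m + j + 1 = (m + 1) + j by omega, Finset.sum_range_add, Finset.sum_range_succ, h2,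
    Finset.sum_congr rfl fun n hn => h1 n (Finset.mem_range.1 hn),
    Finset.sum_congr rfl fun n hn => h3 (m + 1 + n) (by omega)
      (by have := Finset.mem_range.1 hn; omega)]
  simp
  ring

theorem IsSlopeFn.weightSum_leg_zero (hφ : IsSlopeFn φ s) (hl : FitsIn lam N) :
    weightSum φ (legPoly lam 0 * segPoly N 0 * (mono (Pi.single 1 (N : ℤ)) *
      mono (Pi.single 2 (N : ℤ)) - mono (Pi.single 1 (N : ℤ)) - mono (Pi.single 2 (N : ℤ)))) =
      s * ∑ c ∈ lam.cells, ((N : ℤ) - 2 * (c.1 + 1)) := by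
  rw [legPoly, segPoly, Finset.sum_mul_sum, Finset.sum_mul, map_sum, Finset.mul_sum]
  refine Finset.sum_congr rfl fun c hc => ?_
  have hb := hl c hc
  rw [Finset.sum_mul, map_sum]
  refine sum_range_trichotomy _ s hb.1 (fun n hn => ?_) ?_ (fun n hn hnN => ?_)
  all_goals
    simp only [mono_mul, mul_sub, map_sub]
    simp only [weightSum_mono]
    rw [hφ.lt _ (by simp; omega), hφ.lt _ (by simp; omega)]
  · rw [hφ.gt _ (by simp; omega)]
    ring
  · rw [hφ.eq _ (by simp) (by simp; omega)]
    ring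
  · rw [hφ.lt _ (by simp; omega)]
    ring

theorem IsSlopeFn.weightSum_leg_one (hφ : IsSlopeFn φ s) (hm : FitsIn mu N) :
    weightSum φ (legPoly mu 1 * segPoly N 1 * (mono (Pi.single 2 (N : ℤ)) *
      mono (Pi.single 0 (N : ℤ)) - mono (Pi.single 2 (N : ℤ)) - mono (Pi.single 0 (N : ℤ)))) =
      s * ∑ c ∈ mu.cells, (2 * (c.2 : ℤ) - N) := by
  rw [legPoly, segPoly, Finset.sum_mul_sum, Finset.sum_mul, map_sum, Finset.mul_sum]
  refine Finset.sum_congr rfl fun c hc => ?_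
  have hb := hm c hc
  have e12 : (1 : Fin 3) + 1 = 2 := rfl
  have e10 : (1 : Fin 3) + 2 = 0 := rfl
  rw [Finset.sum_mul, map_sum, ← Finset.sum_range_reflect]
  rw [sum_range_trichotomy _ s (m := N - 1 - c.2) (N := N) (by omega) (fun n hn => ?_) ?_
    (fun n hn hnN => ?_)]
  · rw [show ((N - 1 - c.2 : ℕ) : ℤ) = N - 1 - c.2 by omega]
    ring
  all_goals
    simp only [mono_mul, mul_sub, map_sub]
    simp only [weightSum_mono, e12, e10]
    rw [hφ.gt (_ + (Pi.single 2 _ + _)) (by simp; omega), hφ.gt (_ + Pi.single 0 _) (by simp; omega)]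
  · rw [hφ.eq _ (by simp; omega) (by simp; omega)]
    ring
  · rw [hφ.gt _ (by simp; omega)]
    ring
  · rw [hφ.lt _ (by simp; omega)]
    ring


theorem IsSlopeFn.weightSum_cross {lam mu : YoungDiagram} (k l m : Fin 3) (v : Fin 3 → ℤ) (a : ℤ)
    (h : ∀ c ∈ lam.cells, ∀ d ∈ mu.cells, ∀ e : ℤ, 0 ≤ e → e ≤ 1 →
      φ (v + (Pi.single (k + 1) (-(c.1 : ℤ)) + Pi.single (k + 2) (-(c.2 : ℤ))) +
        (Pi.single (l + 1) (d.1 : ℤ) + Pi.single (l + 2) (d.2 : ℤ)) + Pi.single m e) = a) :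
    weightSum φ (mono v * legPoly lam k * dual (legPoly mu l) * (1 - var m)) = 0 := by
  rw [legPoly, legPoly, map_sum, Finset.mul_sum _ _ (mono v), Finset.sum_mul_sum, Finset.sum_mul, map_sum]
  refine Finset.sum_eq_zero fun c hc => ?_
  rw [Finset.sum_mul, map_sum]
  refine Finset.sum_eq_zero fun d hd => ?_
  have h0 := h c hc d hd 0 le_rfl zero_le_one
  have h1 := h c hc d hd 1 zero_le_one le_rfl
  rw [Pi.single_zero, add_zero] at h0
  rw [dual_mono, neg_add, ← Pi.single_neg, ← Pi.single_neg, neg_neg, neg_neg, mono_mul, mono_mul,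
    mul_sub, mul_one, map_sub, var, mono_mul, weightSum_mono, weightSum_mono, h0, h1, sub_self]

theorem IsSlopeFn.weightSum_full_sub (hφ : IsSlopeFn φ s) {B : ℕ} (hl : FitsIn lam B)
    (hm : FitsIn mu B) (hn : FitsIn nu B) (hBN : 2 * B ≤ N) :
    weightSum φ (full lam mu nu N).vertexPoly - weightSum φ (full ⊥ ⊥ nu N).vertexPoly =
      2 * s * (∑ c ∈ lam.cells, ((N : ℤ) - 2 * (c.1 + 1)) +
        ∑ c ∈ mu.cells, (2 * (c.2 : ℤ) - N)) := by
  have fit : ∀ {x : YoungDiagram}, FitsIn x B → FitsIn x N := fun h c hc =>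
    ⟨by have := (h c hc).1; omega, by have := (h c hc).2; omega⟩
  have e11 : (1 : Fin 3) + 1 = 2 := rfl
  have e12 : (1 : Fin 3) + 2 = 0 := rfl
  have e21 : (2 : Fin 3) + 1 = 0 := rfl
  have e22 : (2 : Fin 3) + 2 = 1 := rfl
  have hbot : ∀ k, legPoly ⊥ k = 0 := fun k => by simp [legPoly]
  rw [full_vertexPoly (fit hl) (fit hm) (fit hn), full_vertexPoly (fitsIn_bot N) (fitsIn_bot N) (fit hn)]
  obtain ⟨f0, f1, f2⟩ := full_asymp B hl hm hn N
  obtain ⟨g0, g1, g2⟩ := full_asymp B (fitsIn_bot B) (fitsIn_bot B) hn N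
  simp only [Fin.sum_univ_three, Fin.isValue, zero_add, e11, e12, e21, e22, f0, f1, f2, g0, g1, g2,
    hbot, zero_mul, mul_zero, map_zero, sub_zero, add_zero]
  simp only [map_add, add_mul]
  rw [map_sub (weightSum φ) _ (mono 1 * _), map_sub (weightSum φ) _ (mono 1 * _)]
  simp only [weightSum_kappa_dual hφ.odd, hφ.weightSum_leg_zero (fit hl),
    hφ.weightSum_leg_one (fit hm)]
  rw [IsSlopeFn.weightSum_cross 0 1 2 _ (-s), IsSlopeFn.weightSum_cross 1 0 2 _ s,
    IsSlopeFn.weightSum_cross 1 2 0 _ s, IsSlopeFn.weightSum_cross 2 1 0 _ (-s),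
    IsSlopeFn.weightSum_cross 2 0 1 _ s, IsSlopeFn.weightSum_cross 0 2 1 _ (-s)]
  · ring
  all_goals
    intro c hc d hd e he he'
    simp only [Fin.isValue, zero_add, e11, e12, e21, e22]
  · have := hl c hc
    have := hn d hd
    exact hφ.lt _ (by simp; omega)
  · have := hn c hc
    have := hl d hd
    exact hφ.gt _ (by simp; omega)
  · have := hn c hc
    have := hm d hd
    exact hφ.lt _ (by simp; omega)
  · have := hm c hc
    have := hn d hd
    exact hφ.gt _ (by simp; omega)
  · have := hm c hc
    have := hl d hd
    exact hφ.gt _ (by simp; omega)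
  · have := hl c hc
    have := hm d hd
    exact hφ.lt _ (by simp; omega)

theorem full_zero_vertexPoly (nu : YoungDiagram) : (full ⊥ ⊥ nu 0).vertexPoly = 0 := by
  have hnu : ∃ B, FitsIn nu B := by
    refine ⟨nu.cells.sup (fun c => c.1 + c.2 + 1), fun c hc => ?_⟩
    have := Finset.le_sup (f := fun c : ℕ × ℕ => c.1 + c.2 + 1) hc
    omega
  obtain ⟨B, hB⟩ := hnu
  have hcut := full_isCutoff (fitsIn_bot B) (fitsIn_bot B) hB ⟨fitsIn_bot B, fitsIn_bot B, hB⟩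
    (Nat.zero_le B)
  obtain ⟨g0, g1, g2⟩ := full_asymp B (fitsIn_bot B) (fitsIn_bot B) hB 0
  have hcore : (full ⊥ ⊥ nu 0).corePoly = 0 := by
    rw [corePoly_eq hcut]
    refine Finset.sum_eq_zero fun s hs => ?_
    have hs := (mem_coreBoxes.1 hs).2
    have : (full ⊥ ⊥ nu 0).legCount s = 1 := by
      rw [legCount, Finset.card_filter, Fin.sum_univ_three]
      have h2 : (s 0, s 1) ∈ nu := by
        rcases mem_full.1 hs with h | h | h | h
        · exact absurd (h 0) (Nat.not_lt_zero _)
        · exact absurd h (YoungDiagram.notMem_bot _)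
        · exact absurd h (YoungDiagram.notMem_bot _)
        · exact h
      simp [g0, g1, g2, show (1 : Fin 3) + 1 = 2 from rfl, show (2 : Fin 3) + 1 = 0 from rfl,
        show (2 : Fin 3) + 2 = 1 from rfl, h2]
    simp [this]
  have hbot : ∀ k, legPoly ⊥ k = 0 := fun k => by simp [legPoly]
  simp [vertexPoly, vertexExpr, hcore, Fin.sum_univ_three, g0, g1, hbot,
    show (2 : Fin 3) + 1 = 0 from rfl, show (1 : Fin 3) + 1 = 2 from rfl]

/-- The index formula: additive functionals of the vertex character are sums over boxes outside
the third leg, up to a contribution of the first two legs. -/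
theorem IsCutoff.weightSum_eq {g : ℤ → ℤ} (hφ : IsSlopeFn φ s)
    (hg : ∀ π b π', IsInsert π b π' → π.asymp 2 = nu →
      weightSum φ π'.vertexPoly - weightSum φ π.vertexPoly = g ((b 0 : ℤ) - b 1))
    {π : Partition3D} (hπ : π ∈ withAsymp lam mu nu) {B : ℕ} (hl : FitsIn lam B)
    (hm : FitsIn mu B) (hn : FitsIn nu B) (hBN : 2 * B ≤ N) (hN : π.IsCutoff N) :
    weightSum φ π.vertexPoly = 2 * s * (∑ c ∈ lam.cells, ((N : ℤ) - 2 * (c.1 + 1)) +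
        ∑ c ∈ mu.cells, (2 * (c.2 : ℤ) - N)) +
      ∑ b ∈ π.coreBoxes N with (b 0, b 1) ∉ nu, g ((b 0 : ℤ) - b 1) := by
  have fit : ∀ {x : YoungDiagram}, FitsIn x B → FitsIn x N := fun h c hc =>
    ⟨by have := (h c hc).1; omega, by have := (h c hc).2; omega⟩
  have core_full : ∀ lam mu nu : YoungDiagram, (full lam mu nu N).coreBoxes N = cube N := by
    intro lam mu nu
    ext s
    rw [mem_coreBoxes, mem_cube]
    exact ⟨fun h => h.1, fun h => ⟨h, Or.inl h⟩⟩
  obtain ⟨p0, p1, p2⟩ := hπ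
  obtain ⟨f0, f1, f2⟩ := full_asymp B hl hm hn N
  obtain ⟨g0, g1, g2⟩ := full_asymp B (fitsIn_bot B) (fitsIn_bot B) hn N
  obtain ⟨k0, k1, k2⟩ := full_asymp B (fitsIn_bot B) (fitsIn_bot B) hn 0
  have h1 := sub_eq_sum_sdiff (F := fun π => weightSum φ π.vertexPoly) hg _ (π := π)
    (π' := full lam mu nu N) (N := N) rfl
    (fun s hs => by
      by_cases h : ∀ i, s i < N
      · exact Or.inl h
      · push Not at h
        obtain ⟨k, hk⟩ := h
        have := (mem_of_fin_three π s).1 ⟨k, hN.1 s hs k hk⟩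
        rw [p0, p1, p2] at this
        exact Or.inr this)
    (fun k => by fin_cases k <;> simp [p0, p1, p2, f0, f1, f2]) f2
    (full_isCutoff hl hm hn ⟨fit hl, fit hm, fit hn⟩ le_rfl)
  have h2 := sub_eq_sum_sdiff (F := fun π => weightSum φ π.vertexPoly) hg _ (π := full ⊥ ⊥ nu 0)
    (π' := full ⊥ ⊥ nu N) (N := N) rfl
    (fun s hs => Or.inr (hs.resolve_left fun h => Nat.not_lt_zero _ (h 0)))
    (fun k => by fin_cases k <;> simp [k0, k1, k2, g0, g1, g2]) g2
    (full_isCutoff (fitsIn_bot B) (fitsIn_bot B) hn ⟨fitsIn_bot N, fitsIn_bot N, fit hn⟩ le_rfl)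
  have h3 := hφ.weightSum_full_sub hl hm hn hBN
  have e2 : cube N \ (full ⊥ ⊥ nu 0).coreBoxes N = (cube N).filter fun b => (b 0, b 1) ∉ nu := by
    ext s
    rw [Finset.mem_sdiff, Finset.mem_filter, mem_coreBoxes, mem_cube, mem_full]
    constructor
    · rintro ⟨h, h'⟩
      exact ⟨h, fun h'' => h' ⟨h, by tauto⟩⟩
    · rintro ⟨h, h'⟩
      refine ⟨h, fun h'' => ?_⟩
      rcases h''.2 with h4 | h4 | h4 | h4
      · exact Nat.not_lt_zero _ (h4 0)
      · exact YoungDiagram.notMem_bot _ h4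
      · exact YoungDiagram.notMem_bot _ h4
      · exact h' h4
  have e1 : (cube N).filter (fun b => (b 0, b 1) ∉ nu) =
      (cube N \ π.coreBoxes N) ∪ (π.coreBoxes N).filter fun b => (b 0, b 1) ∉ nu := by
    ext s
    rw [Finset.mem_union, Finset.mem_sdiff, Finset.mem_filter, Finset.mem_filter, mem_coreBoxes,
      mem_cube]
    have : (s 0, s 1) ∈ nu → s ∈ π.boxes := fun h => by
      refine mem_boxes_of_mem_asymp (k := 2) ?_
      rw [p2]
      exact h
    tauto
  have hd : Disjoint (cube N \ π.coreBoxes N)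
      ((π.coreBoxes N).filter fun b => (b 0, b 1) ∉ nu) :=
    Finset.sdiff_disjoint.mono_right (Finset.filter_subset _ _)
  simp only [core_full] at h1 h2
  rw [e2, e1, Finset.sum_union hd, full_zero_vertexPoly, map_zero] at h2
  linarith

/-- Serre duality for the coefficients of the vertex character. -/
theorem coeff_kappa_sub (π : Partition3D) (w : Fin 3 → ℤ) :
    π.vertexPoly.coeff (1 - w) = -π.vertexPoly.coeff w := by
  have := π.dual_vertexPoly
  rw [prod_var] at this
  rw [← coeff_mono_mul_dual, this]
  rfl

theorem exists_fitsIn (lam mu nu : YoungDiagram) : ∃ B, FitsIn lam B ∧ FitsIn mu B ∧ FitsIn nu B := by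
  refine ⟨(lam.cells ∪ mu.cells ∪ nu.cells).sup (fun c => c.1 + c.2 + 1), ?_⟩
  refine ⟨fun c hc => ?_, fun c hc => ?_, fun c hc => ?_⟩
  all_goals
    have := Finset.le_sup (s := lam.cells ∪ mu.cells ∪ nu.cells)
      (f := fun c : ℕ × ℕ => c.1 + c.2 + 1) (b := c) (by simp [hc])
    omega

/-- The powers of `κ = t₁t₂t₃` do not occur in the vertex character. -/
theorem coeff_const (π : Partition3D) (n : ℤ) : (π.vertexPoly.coeff fun _ => n) = 0 := by
  obtain ⟨B, hl, hm, hn⟩ := exists_fitsIn (π.asymp 0) (π.asymp 1) (π.asymp 2)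
  obtain ⟨N, hN⟩ := π.exists_isCutoff
  have hws : ∀ f : LaurentPoly3, weightSum (fun w =>
      (if w = fun _ => n then 1 else 0) - if w = fun _ => 1 - n then 1 else 0) f =
        (f.coeff fun _ => n) - f.coeff fun _ => 1 - n := by
    intro f
    rw [← weightSum_indicator, ← weightSum_indicator]
    induction f using AddMonoidAlgebra.induction_linear with
    | zero => simp
    | add x y hx hy => rw [map_add, map_add, map_add, hx, hy]; ring
    | single w m => simp only [weightSum_single]; ring
  have h := (hN.mono (le_max_left N (2 * B))).weightSum_eq (isSlopeFn_kappa n) (g := fun _ => 0)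
    (lam := π.asymp 0) (mu := π.asymp 1) (nu := π.asymp 2)
    (fun π b π' hins _ => by rw [hws, hws, hins.kappa_vertexPoly]; simp) ⟨rfl, rfl, rfl⟩ hl hm hn
    (le_max_right _ _)
  rw [hws] at h
  have h1 := π.coeff_kappa_sub fun _ => n
  rw [show (1 - fun _ => n : Fin 3 → ℤ) = fun _ => 1 - n from rfl] at h1
  simp at h
  omega

theorem legCount_sum_coreBoxes {π : Partition3D} (hN : π.IsCutoff N) :
    ∑ s ∈ π.coreBoxes N, (π.legCount s : ℤ) = ∑ k, (N : ℤ) * (π.asymp k).card := by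
  have hleg : ∀ s, (π.legCount s : ℤ) =
      ∑ k, if (s (k + 1), s (k + 2)) ∈ (π.asymp k).cells then 1 else 0 := by
    intro s
    rw [legCount, Finset.card_filter]
    push_cast
    rfl
  simp only [hleg]
  rw [Finset.sum_comm]
  refine Finset.sum_congr rfl fun k _ => ?_
  have : (π.coreBoxes N).filter (fun s => (s (k + 1), s (k + 2)) ∈ (π.asymp k).cells) =
      (cube N).filter fun s => (s (k + 1), s (k + 2)) ∈ (π.asymp k).cells := by
    ext s
    rw [Finset.mem_filter, Finset.mem_filter, mem_coreBoxes, mem_cube]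
    exact ⟨fun h => ⟨h.1.1, h.2⟩, fun h => ⟨⟨h.1, mem_boxes_of_mem_asymp h.2⟩, h.2⟩⟩
  rw [← Finset.sum_filter, this, sum_cube_leg (hN.2 k)]
  simp [mul_comm]

theorem IsCutoff.chi_eq_card {π : Partition3D} (hN : π.IsCutoff N) :
    π.chi = ((π.coreBoxes N).filter fun b => (b 0, b 1) ∉ π.asymp 2).card -
      N * (π.asymp 0).card - N * (π.asymp 1).card := by
  rw [chi_eq hN, Finset.sum_sub_distrib, legCount_sum_coreBoxes hN, Fin.sum_univ_three]
  have h1 := Finset.card_filter_add_card_filter_not (s := π.coreBoxes N)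
    (fun b => (b 0, b 1) ∈ π.asymp 2)
  have h2 : ((π.coreBoxes N).filter fun b => (b 0, b 1) ∈ π.asymp 2).card =
      N * (π.asymp 2).card := by
    have : (π.coreBoxes N).filter (fun b => (b 0, b 1) ∈ π.asymp 2) =
        (cube N).filter fun s => (s ((2 : Fin 3) + 1), s ((2 : Fin 3) + 2)) ∈ (π.asymp 2).cells := by
      ext s
      rw [Finset.mem_filter, Finset.mem_filter, mem_coreBoxes, mem_cube]
      exact ⟨fun h => ⟨h.1.1, h.2⟩, fun h => ⟨⟨h.1, mem_boxes_of_mem_asymp (k := 2) h.2⟩, h.2⟩⟩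
    rw [this, Finset.card_eq_sum_ones, sum_cube_leg (hN.2 2)]
    simp [mul_comm]
  simp only [Finset.sum_const, nsmul_eq_mul, mul_one]
  zify at h1 h2
  linarith

/-- The index of the vertex character: the total multiplicity of the weights that are attracting
along the preferred slopes. -/
noncomputable def index (π : Partition3D) : ℤ :=
  ∑ w ∈ π.vertexPoly.coeff.support with 0 < slopeSign w, π.vertexPoly.coeff w

theorem mem_support_one_sub (π : Partition3D) {w : Fin 3 → ℤ} :
    1 - w ∈ π.vertexPoly.coeff.support ↔ w ∈ π.vertexPoly.coeff.support := by
  rw [Finsupp.mem_support_iff, Finsupp.mem_support_iff, coeff_kappa_sub, neg_ne_zero]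

theorem slopeSign_ne_zero_of_mem_support (π : Partition3D) {w : Fin 3 → ℤ}
    (hw : w ∈ π.vertexPoly.coeff.support) : slopeSign w ≠ 0 := by
  intro h
  have : w = fun _ => w 0 := by
    have h' : w 1 = w 0 ∧ w 2 = w 0 := by
      rw [slopeSign] at h
      split_ifs at h with h1
      · rw [Int.sign_eq_zero_iff_zero] at h
        omega
      · rw [Int.sign_eq_zero_iff_zero] at h
        omega
    funext i
    fin_cases i
    · rfl
    · exact h'.1
    · exact h'.2
  rw [this] at hw
  exact Finsupp.mem_support_iff.1 hw (π.coeff_const _)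

theorem slopeSign_of_pos {w : Fin 3 → ℤ} (h : 0 < slopeSign w) : slopeSign w = 1 := by
  rw [slopeSign] at *
  split_ifs at * <;> exact Int.sign_eq_one_of_pos (Int.sign_pos_iff.1 h)

theorem weightSum_slopeSign (π : Partition3D) :
    weightSum slopeSign π.vertexPoly = 2 * π.index := by
  have h1 : weightSum slopeSign π.vertexPoly =
      ∑ w ∈ π.vertexPoly.coeff.support, π.vertexPoly.coeff w * slopeSign w := rfl
  rw [h1, ← Finset.sum_filter_add_sum_filter_not _ (fun w => 0 < slopeSign w), index, two_mul]
  congr 1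
  · refine Finset.sum_congr rfl fun w hw => ?_
    rw [slopeSign_of_pos (Finset.mem_filter.1 hw).2, mul_one]
  · refine Finset.sum_bij' (fun w _ => 1 - w) (fun w _ => 1 - w) ?_ ?_ ?_ ?_ ?_
    · intro w hw
      rw [Finset.mem_filter] at hw ⊢
      rw [mem_support_one_sub, slopeSign_one_sub]
      exact ⟨hw.1, by have := π.slopeSign_ne_zero_of_mem_support hw.1; omega⟩
    · intro w hw
      rw [Finset.mem_filter] at hw ⊢
      rw [mem_support_one_sub, slopeSign_one_sub]
      exact ⟨hw.1, by omega⟩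
    · intro w _
      exact sub_sub_cancel 1 w
    · intro w _
      exact sub_sub_cancel 1 w
    · intro w hw
      rw [Finset.mem_filter] at hw
      have h2 : 0 < slopeSign (1 - w) := by
        rw [slopeSign_one_sub]
        have := π.slopeSign_ne_zero_of_mem_support hw.1
        omega
      have h3 := slopeSign_of_pos h2
      rw [slopeSign_one_sub] at h3
      rw [coeff_kappa_sub, show slopeSign w = -1 by omega]
      ring

theorem index_eq {π : Partition3D} (hπ : π ∈ withAsymp lam mu nu) {B : ℕ} (hl : FitsIn lam B)
    (hm : FitsIn mu B) (hn : FitsIn nu B) (hBN : 2 * B ≤ N) (hN : π.IsCutoff N) :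
    π.index = ∑ c ∈ lam.cells, ((N : ℤ) - 2 * (c.1 + 1)) + ∑ c ∈ mu.cells, (2 * (c.2 : ℤ) - N) +
      ∑ b ∈ π.coreBoxes N with (b 0, b 1) ∉ nu, (1 - 2 * ((nu.path ((b 0 : ℤ) - b 1) : ℤ) -
        nu.path ((b 0 : ℤ) - b 1 - 1))) := by
  have h := hN.weightSum_eq isSlopeFn_slopeSign (g := fun c => 2 * (1 - 2 * ((nu.path c : ℤ) -
        nu.path (c - 1)))) (fun π b π' hins h => by rw [hins.slopeSign_vertexPoly, h]) hπ hl hm hn hBN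
  rw [weightSum_slopeSign, ← Finset.mul_sum] at h
  linarith

end Partition3D

/-! ### Convergence in the field of Laurent series -/

namespace LaurentSeries

variable {K : Type*} [Field K]

/-- The additive subgroup of Laurent series without terms of degree less than `n`. -/
def lowSubgroup (K : Type*) [Field K] (n : ℤ) : AddSubgroup (LaurentSeries K) where
  carrier := {f | ∀ j < n, f.coeff j = 0}
  zero_mem' := fun _ _ => rfl
  add_mem' := fun hf hg j hj => by rw [HahnSeries.coeff_add, hf j hj, hg j hj, add_zero]
  neg_mem' := fun hf j hj => by rw [HahnSeries.coeff_neg, hf j hj, neg_zero]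

theorem mem_lowSubgroup {n : ℤ} {f : LaurentSeries K} :
    f ∈ lowSubgroup K n ↔ ∀ j < n, f.coeff j = 0 := Iff.rfl

theorem lowSubgroup_mem_nhds (n : ℤ) : (lowSubgroup K n : Set (LaurentSeries K)) ∈ 𝓝 0 := by
  rw [Valued.mem_nhds_zero]
  have h0 : Valued.v.restrict (HahnSeries.single n (1 : K) : LaurentSeries K) ≠ 0 := by
    intro h
    have h := MonoidWithZeroHom.ValueGroup₀.restrict₀_eq_zero_iff.1 h
    rw [Valuation.coe_ofClass, Valuation.zero_iff] at h
    exact one_ne_zero (HahnSeries.single_eq_zero_iff.1 h)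
  refine ⟨Units.mk0 _ h0, fun f hf => ?_⟩
  have hf : Valued.v f < Valued.v (HahnSeries.single n (1 : K) : LaurentSeries K) :=
    Valued.v.restrict_lt_iff.1 hf
  exact (valuation_le_iff_coeff_lt_eq_zero K).1 (hf.le.trans ((valuation_le_iff_coeff_lt_eq_zero K).2
    fun j hj => HahnSeries.coeff_single_of_ne hj.ne))

theorem exists_lowSubgroup_subset {s : Set (LaurentSeries K)} (hs : s ∈ 𝓝 0) :
    ∃ n, (lowSubgroup K n : Set (LaurentSeries K)) ⊆ s := by
  obtain ⟨γ, hγ⟩ := Valued.mem_nhds_zero.1 hs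
  obtain ⟨x, hx⟩ := MonoidWithZeroHom.ValueGroup₀.restrict₀_surjective _ γ.1
  have hx0 : x ≠ 0 := by
    rintro rfl
    exact γ.ne_zero (hx.symm.trans (map_zero _))
  have hlt : WithZero.exp (-(x.order + 1)) < Valued.v x := by
    rw [← not_le, valuation_le_iff_coeff_lt_eq_zero]
    exact fun h => HahnSeries.coeff_order_eq_zero.not.2 hx0 (h _ (lt_add_one _))
  refine ⟨x.order + 1, fun f hf => hγ ?_⟩
  change Valued.v.restrict f < γ.1
  rw [← hx]
  exact Valued.v.restrict_lt_iff.2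
    (((valuation_le_iff_coeff_lt_eq_zero K).2 (mem_lowSubgroup.1 hf)).trans_lt hlt)

theorem tendsto_iff {ι : Type*} {l : Filter ι} {f : ι → LaurentSeries K} {g : LaurentSeries K} :
    Tendsto f l (𝓝 g) ↔ ∀ n : ℤ, ∀ᶠ i in l, ∀ j < n, (f i).coeff j = g.coeff j := by
  rw [tendsto_sub_nhds_zero_iff.symm]
  constructor
  · intro h n
    filter_upwards [h (lowSubgroup_mem_nhds n)] with i hi j hj
    have := hi j hj
    rwa [HahnSeries.coeff_sub, sub_eq_zero] at this
  · intro h s hs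
    obtain ⟨n, hn⟩ := exists_lowSubgroup_subset hs
    refine mem_map.2 ?_
    filter_upwards [h n] with i hi
    refine hn fun j hj => ?_
    rw [HahnSeries.coeff_sub, hi j hj, sub_self]

/-- The valuation topology has the basis of neighbourhoods `lowSubgroup`; this makes the
summability criterion of nonarchimedean groups available. -/
instance nonarchimedeanRing : NonarchimedeanRing (LaurentSeries K) where
  is_nonarchimedean U hU := by
    obtain ⟨n, hn⟩ := exists_lowSubgroup_subset hU
    exact ⟨⟨lowSubgroup K n, AddSubgroup.isOpen_of_mem_nhds _ (lowSubgroup_mem_nhds n)⟩, hn⟩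

theorem summable_of_finite {ι : Type*} {f : ι → LaurentSeries K}
    (h : ∀ n : ℤ, {i | ∃ j < n, (f i).coeff j ≠ 0}.Finite) : Summable f := by
  refine NonarchimedeanAddGroup.summable_of_tendsto_cofinite_zero (tendsto_iff.2 fun n => ?_)
  rw [eventually_cofinite]
  refine (h n).subset fun i hi => ?_
  simpa using hi

theorem coeff_of_hasSum {ι : Type*} {f : ι → LaurentSeries K} {a : LaurentSeries K}
    (h : HasSum f a) (j : ℤ) (s : Finset ι) (hs : ∀ i ∉ s, (f i).coeff j = 0) :
    a.coeff j = ∑ i ∈ s, (f i).coeff j := by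
  have h1 := tendsto_iff.1 h (j + 1)
  obtain ⟨t, ht⟩ := h1.exists_forall_of_atTop
  classical
  have h2 := ht (t ∪ s) Finset.subset_union_left j (lt_add_one j)
  rw [← h2, HahnSeries.coeff_sum]
  exact (Finset.sum_subset Finset.subset_union_right fun i _ hi => hs i hi).symm

end LaurentSeries

/-! ### Finiteness of the set of partitions of bounded volume -/

namespace Partition3D

variable {lam mu nu : YoungDiagram} {N : ℕ}

theorem full_zero_subset {π : Partition3D} (hπ : π ∈ withAsymp lam mu nu) :
    (full lam mu nu 0).boxes ⊆ π.boxes := by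
  obtain ⟨p0, p1, p2⟩ := hπ
  rintro s (hs | hs | hs | hs)
  · exact absurd (hs 0) (Nat.not_lt_zero _)
  · exact mem_boxes_of_mem_asymp (k := 0) (by rw [p0]; exact hs)
  · exact mem_boxes_of_mem_asymp (k := 1) (by rw [p1]; exact hs)
  · exact mem_boxes_of_mem_asymp (k := 2) (by rw [p2]; exact hs)

theorem coreBoxes_mono {π π' : Partition3D} (h : π.boxes ⊆ π'.boxes) (N : ℕ) :
    π.coreBoxes N ⊆ π'.coreBoxes N := fun s hs => by
  rw [mem_coreBoxes] at hs ⊢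
  exact ⟨hs.1, h hs.2⟩

/-- The difference of the renormalized volumes of nested partitions is a number of boxes. -/
theorem chi_sub_eq_card {π π' : Partition3D} (h : π.boxes ⊆ π'.boxes)
    (ha : ∀ k, π.asymp k = π'.asymp k) (hN : π.IsCutoff N) (hN' : π'.IsCutoff N) :
    π'.chi - π.chi = (π'.coreBoxes N \ π.coreBoxes N).card := by
  have hsub := coreBoxes_mono h N
  have h1 := Finset.sum_sdiff (f := fun s => (1 - (π'.legCount s : ℤ))) hsub
  have h2 : ∀ s, π'.legCount s = π.legCount s := fun s => by simp only [legCount, ha]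
  have h3 : ∑ s ∈ π'.coreBoxes N \ π.coreBoxes N, (1 - (π'.legCount s : ℤ)) =
      (π'.coreBoxes N \ π.coreBoxes N).card := by
    rw [Finset.card_eq_sum_ones]
    push_cast
    refine Finset.sum_congr rfl fun s hs => ?_
    rw [Finset.mem_sdiff, mem_coreBoxes, mem_coreBoxes] at hs
    rw [h2, legCount_of_notMem fun h => hs.2 ⟨hs.1.1, h⟩]
    simp
  rw [chi_eq hN, chi_eq hN', ← h1, h3]
  simp [h2]

theorem exists_isCutoff_of_chi_le (lam mu nu : YoungDiagram) (m : ℤ) :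
    ∃ N, ∀ π ∈ withAsymp lam mu nu, π.chi ≤ m → π.IsCutoff N := by
  obtain ⟨B, hl, hm, hn⟩ := exists_fitsIn lam mu nu
  obtain ⟨f0, f1, f2⟩ := full_asymp B hl hm hn 0
  set n := (m - (full lam mu nu 0).chi).toNat with hn'
  refine ⟨B + n + 1, fun π hπ hχ => ?_⟩
  have fit : ∀ {x : YoungDiagram} {n}, FitsIn x B → FitsIn x (B + n) := fun h c hc =>
    ⟨by have := (h c hc).1; omega, by have := (h c hc).2; omega⟩
  have ha : ∀ k, (full lam mu nu 0).asymp k = π.asymp k := fun k => by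
    fin_cases k <;> simp [f0, f1, f2, hπ.1, hπ.2.1, hπ.2.2]
  have hfit : ∀ k, FitsIn (π.asymp k) B := fun k => by
    fin_cases k <;> simp [hπ.1, hπ.2.1, hπ.2.2, hl, hm, hn]
  refine ⟨fun s hs k hk => ?_, fun k => fit (n := n + 1) (hfit k)⟩
  by_contra hleg
  -- the boxes of the segment from `s` down to the height `B` do not belong to the legs
  obtain ⟨N', hN'⟩ := π.exists_isCutoff
  set N := max N' B + s k + 1 with hN
  have hcut : π.IsCutoff N := hN'.mono (by omega)
  have hB' : FitsIn lam N ∧ FitsIn mu N ∧ FitsIn nu N := by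
    rw [show N = B + (N - B) by omega]
    exact ⟨fit hl, fit hm, fit hn⟩
  have h1 := chi_sub_eq_card (full_zero_subset hπ) ha (full_isCutoff hl hm hn hB' (Nat.zero_le N)) hcut
  have h2 : ∀ j, B ≤ j → j ≤ s k → linePoint k j (s (k + 1), s (k + 2)) ∈
      π.coreBoxes N \ (full lam mu nu 0).coreBoxes N := by
    intro j hj hjs
    have hmem : linePoint k j (s (k + 1), s (k + 2)) ∈ π.boxes := by
      refine π.lower ?_ hs
      intro i
      rw [congrFun (eq_linePoint k s) i]
      simp only [linePoint]
      split_ifs <;> omega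
    rw [Finset.mem_sdiff, mem_coreBoxes, mem_coreBoxes]
    refine ⟨⟨?_, hmem⟩, fun h => ?_⟩
    · intro i
      by_contra hi
      have := hN'.1 _ hs
      by_cases hik : i = k
      · subst hik
        rw [linePoint_self] at hi
        omega
      · have hi' : N' ≤ s i := by
          have : linePoint k j (s (k + 1), s (k + 2)) i = s i := by
            conv_rhs => rw [eq_linePoint k s]
            simp only [linePoint, if_neg hik]
          omega
        have h3 := this i hi'
        have h4 := hfit i _ h3
        have : k = i + 1 ∨ k = i + 2 := by
          revert hik
          fin_cases k <;> fin_cases i <;> decide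
        rcases this with rfl | rfl <;> omega
    · have h3 := h.2.resolve_left fun h => Nat.not_lt_zero _ (h 0)
      have h4 : ∃ i, (linePoint k j (s (k + 1), s (k + 2)) (i + 1),
          linePoint k j (s (k + 1), s (k + 2)) (i + 2)) ∈ (π.asymp i).cells := by
        rw [mem_of_fin_three, hπ.1, hπ.2.1, hπ.2.2]
        exact h3
      obtain ⟨i, hi⟩ := h4
      by_cases hik : i = k
      · subst hik
        rw [linePoint_one, linePoint_two] at hi
        exact hleg hi
      · have h5 := hfit i _ hi
        have h6 := linePoint_self k j (s (k + 1), s (k + 2))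
        have : k = i + 1 ∨ k = i + 2 := by
          revert hik
          fin_cases k <;> fin_cases i <;> decide
        rcases this with h | h <;> rw [h] at h6 <;> rw [← h] at h6 <;> simp only [← h] at h5 <;> omega
  have h3 : (Finset.Icc B (s k)).card ≤ (π.coreBoxes N \ (full lam mu nu 0).coreBoxes N).card :=
    Finset.card_le_card_of_injOn (fun j => linePoint k j (s (k + 1), s (k + 2)))
      (fun j hj => h2 j (Finset.mem_Icc.1 hj).1 (Finset.mem_Icc.1 hj).2)
      (fun j _ j' _ h => by
        have := congrFun h k
        simpa only [linePoint_self] using this)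
  rw [Nat.card_Icc] at h3
  omega

theorem IsCutoff.boxes_eq {π : Partition3D} (hN : π.IsCutoff N) (s : Fin 3 → ℕ) :
    s ∈ π.boxes ↔ s ∈ π.coreBoxes N ∨ ∃ k, (s (k + 1), s (k + 2)) ∈ (π.asymp k).cells := by
  constructor
  · intro hs
    by_cases h : ∀ i, s i < N
    · exact Or.inl (mem_coreBoxes.2 ⟨h, hs⟩)
    · push Not at h
      obtain ⟨k, hk⟩ := h
      exact Or.inr ⟨k, hN.1 s hs k hk⟩
  · rintro (h | ⟨k, h⟩)
    · exact (mem_coreBoxes.1 h).2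
    · exact mem_boxes_of_mem_asymp h

theorem finite_isCutoff (lam mu nu : YoungDiagram) (N : ℕ) :
    {π ∈ withAsymp lam mu nu | π.IsCutoff N}.Finite := by
  refine Set.Finite.of_finite_image ((cube N).powerset.finite_toSet.subset ?_)
    (f := fun π => π.coreBoxes N) ?_
  · rintro _ ⟨π, _, rfl⟩
    rw [Finset.mem_coe, Finset.mem_powerset]
    intro s hs
    exact mem_cube.2 (mem_coreBoxes.1 hs).1
  · rintro π ⟨hπ, hN⟩ π' ⟨hπ', hN'⟩ h
    refine ext_boxes (Set.ext fun s => ?_)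
    rw [hN.boxes_eq, hN'.boxes_eq, mem_of_fin_three, mem_of_fin_three, hπ.1, hπ.2.1, hπ.2.2, hπ'.1,
      hπ'.2.1, hπ'.2.2]
    simp only at h
    rw [h]

/-- Only finitely many partitions contribute to a given power of `Q`. -/
theorem finite_chi_le (lam mu nu : YoungDiagram) (m : ℤ) :
    {π : withAsymp lam mu nu | π.1.chi ≤ m}.Finite := by
  obtain ⟨N, hN⟩ := exists_isCutoff_of_chi_le lam mu nu m
  refine Set.Finite.of_finite_image ((finite_isCutoff lam mu nu N).subset ?_)
    Subtype.val_injective.injOn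
  rintro _ ⟨π, hπ, rfl⟩
  exact ⟨π.2, hN _ π.2 hπ⟩

end Partition3D

/-! ### Coefficients of quotients of Laurent series -/

namespace LaurentSeries

variable {K : Type*} [Field K]

theorem coeff_mul_eq_sum_Icc {f g : LaurentSeries K} {a b : ℤ} (hf : ∀ j < a, f.coeff j = 0)
    (hg : ∀ j < b, g.coeff j = 0) (m : ℤ) :
    (f * g).coeff m = ∑ j ∈ Finset.Icc a (m - b), f.coeff j * g.coeff (m - j) := by
  rw [HahnSeries.coeff_mul]
  refine Finset.sum_of_injOn Prod.fst ?_ ?_ ?_ ?_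
  · intro p hp q hq h
    simp only [Finset.mem_coe, Finset.mem_antidiagonal] at hp hq
    have := hp.2.2.trans hq.2.2.symm
    ext
    · exact h
    · rw [h] at this
      exact add_left_cancel this
  · intro p hp
    simp only [Finset.mem_coe, Finset.mem_antidiagonal, HahnSeries.mem_support] at hp
    rw [Finset.mem_coe, Finset.mem_Icc]
    constructor
    · by_contra h
      exact hp.1 (hf _ (not_le.1 h))
    · by_contra h
      exact hp.2.1 (hg _ (by omega))
  · intro j _ hj
    by_contra hne
    refine hj ⟨(j, m - j), ?_, rfl⟩
    simp only [Finset.mem_coe, Finset.mem_antidiagonal, HahnSeries.mem_support]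
    exact ⟨left_ne_zero_of_mul hne, right_ne_zero_of_mul hne, by ring⟩
  · intro p hp
    simp only [Finset.mem_antidiagonal] at hp
    rw [← hp.2.2]
    simp

theorem coeff_div_eq_zero {f g : LaurentSeries K} {a : ℤ} (hf : ∀ j < a, f.coeff j = 0)
    (hg : ∀ j < 0, g.coeff j = 0) (hg0 : g.coeff 0 = 1) : ∀ j < a, (f / g).coeff j = 0 := by
  intro j hj
  have hgne : g ≠ 0 := by
    rintro rfl
    simp at hg0
  by_cases hfg : f / g = 0
  · rw [hfg]
    rfl
  have hf0 : f ≠ 0 := fun h => hfg (by rw [h, zero_div])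
  have h1 := HahnSeries.order_mul hfg hgne
  rw [div_mul_cancel₀ _ hgne] at h1
  have h2 : g.order ≤ 0 := HahnSeries.order_le_of_coeff_ne_zero (by rw [hg0]; exact one_ne_zero)
  have h3 : a ≤ f.order := by
    by_contra h
    exact HahnSeries.coeff_order_eq_zero.not.2 hf0 (hf _ (not_le.1 h))
  exact HahnSeries.coeff_eq_zero_of_lt_order (by omega)

theorem coeff_div_eq {f g : LaurentSeries K} {a : ℤ} (hf : ∀ j < a, f.coeff j = 0)
    (hg : ∀ j < 0, g.coeff j = 0) (hg0 : g.coeff 0 = 1) {m : ℤ} (hm : a ≤ m) :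
    (f / g).coeff m = f.coeff m -
      ∑ j ∈ Finset.Ico a m, (f / g).coeff j * g.coeff (m - j) := by
  have hgne : g ≠ 0 := by
    rintro rfl
    simp at hg0
  have h := coeff_mul_eq_sum_Icc (coeff_div_eq_zero hf hg hg0) hg m
  rw [div_mul_cancel₀ _ hgne, sub_zero, ← Finset.Ico_insert_right hm,
    Finset.sum_insert Finset.right_notMem_Ico, sub_self, hg0, mul_one] at h
  rw [h]
  ring

theorem tendsto_coeff_div [TopologicalSpace K] [IsTopologicalRing K] {ι : Type*} {l : Filter ι}
    {f g : ι → LaurentSeries K}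
    {f₀ g₀ : LaurentSeries K} {a : ℤ} (hf : ∀ z, ∀ j < a, (f z).coeff j = 0)
    (hf₀ : ∀ j < a, f₀.coeff j = 0) (hg : ∀ z, ∀ j < 0, (g z).coeff j = 0)
    (hg₀ : ∀ j < 0, g₀.coeff j = 0) (hg1 : ∀ z, (g z).coeff 0 = 1) (hg₀1 : g₀.coeff 0 = 1)
    (m : ℤ) (hfl : ∀ j ≤ m, Tendsto (fun z => (f z).coeff j) l (𝓝 (f₀.coeff j)))
    (hgl : ∀ j ≤ m - a, Tendsto (fun z => (g z).coeff j) l (𝓝 (g₀.coeff j))) :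
    ∀ j ≤ m, Tendsto (fun z => (f z / g z).coeff j) l (𝓝 ((f₀ / g₀).coeff j)) := by
  intro j
  by_cases hj : j < a
  · intro _
    simp only [fun z => coeff_div_eq_zero (hf z) (hg z) (hg1 z) j hj,
      coeff_div_eq_zero hf₀ hg₀ hg₀1 j hj]
    exact tendsto_const_nhds
  · intro hjm
    obtain ⟨n, hn⟩ := Int.eq_ofNat_of_zero_le (sub_nonneg.2 (not_lt.1 hj))
    obtain rfl : j = a + n := by omega
    clear hj hn
    induction n using Nat.strong_induction_on with
    | _ n ih =>
      have ha : a ≤ a + (n : ℤ) := by omega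
      simp only [fun z => coeff_div_eq (hf z) (hg z) (hg1 z) ha, coeff_div_eq hf₀ hg₀ hg₀1 ha]
      refine (hfl _ hjm).sub (tendsto_finsetSum _ fun i hi => ?_)
      obtain ⟨hi1, hi2⟩ := Finset.mem_Ico.1 hi
      obtain ⟨n', hn'⟩ := Int.eq_ofNat_of_zero_le (sub_nonneg.2 hi1)
      obtain rfl : i = a + n' := by omega
      exact (ih n' (by omega) (by omega)).mul (hgl _ (by omega))

/-- Sums of monomials, only finitely many of which have bounded degree. -/
theorem summable_single {ι : Type*} {e : ι → ℤ} (a : ι → K) (hfin : ∀ m, {i | e i ≤ m}.Finite) :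
    Summable fun i => (HahnSeries.single (e i) (a i) : LaurentSeries K) := by
  refine summable_of_finite fun n => (hfin n).subset ?_
  rintro i ⟨j, hj, hne⟩
  by_contra h
  refine hne (HahnSeries.coeff_single_of_ne ?_)
  rintro rfl
  exact h hj.le

theorem coeff_tsum_single {ι : Type*} {e : ι → ℤ} (a : ι → K) (hfin : ∀ m, {i | e i ≤ m}.Finite)
    {j m : ℤ} (hj : j ≤ m) :
    (∑' i, (HahnSeries.single (e i) (a i) : LaurentSeries K)).coeff j =
      ∑ i ∈ (hfin m).toFinset, if e i = j then a i else 0 := by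
  rw [coeff_of_hasSum (summable_single a hfin).hasSum j (hfin m).toFinset fun i hi => ?_]
  · refine Finset.sum_congr rfl fun i _ => ?_
    by_cases h : e i = j
    · rw [if_pos h, ← h, HahnSeries.coeff_single_same]
    · rw [if_neg h, HahnSeries.coeff_single_of_ne (Ne.symm h)]
  · refine HahnSeries.coeff_single_of_ne ?_
    rintro rfl
    exact hi ((hfin m).mem_toFinset.2 hj)

end LaurentSeries

/-! ### The limit of a factor `â(V)` -/

namespace Partition3D

theorem laurentMonomial_zpow_mul {x : Fin 3 → ℂ} (z : ℂ) (hz : z ≠ 0) (r w : Fin 3 → ℤ) :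
    laurentMonomial (fun i => z ^ r i * x i) w = z ^ (∑ i, r i * w i) * laurentMonomial x w := by
  simp only [laurentMonomial, Fin.prod_univ_three, Fin.sum_univ_three, mul_zpow, ← zpow_mul,
    zpow_add₀ hz]
  ring

theorem tendsto_pair {x : Fin 3 → ℂ} (hx : ∀ i, x i ≠ 0) {r w : Fin 3 → ℤ}
    (hr : r 0 + r 1 + r 2 = 0) (hw : 0 < ∑ i, r i * w i) :
    Tendsto (fun z : ℂ => (laurentMonomial (fun i => z ^ r i * x i) (1 - w) -
      (laurentMonomial (fun i => z ^ r i * x i) (1 - w))⁻¹) /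
      (laurentMonomial (fun i => z ^ r i * x i) w -
      (laurentMonomial (fun i => z ^ r i * x i) w)⁻¹)) (𝓝[≠] 0) (𝓝 (-(x 0 * x 1 * x 2))) := by
  set c := laurentMonomial x w with hc
  have hc0 : c ≠ 0 := laurentMonomial_ne_zero hx w
  set k := x 0 * x 1 * x 2 with hk
  have hk0 : k ≠ 0 := mul_ne_zero (mul_ne_zero (hx 0) (hx 1)) (hx 2)
  obtain ⟨n, hn⟩ := Int.eq_ofNat_of_zero_le hw.le
  have hn0 : n ≠ 0 := by rintro rfl; omega
  have hM : Tendsto (fun z : ℂ => z ^ n * c) (𝓝[≠] 0) (𝓝 0) := by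
    have : Continuous fun z : ℂ => z ^ n * c := by fun_prop
    have h := this.tendsto 0
    rw [zero_pow hn0, zero_mul] at h
    exact h.mono_left nhdsWithin_le_nhds
  have hlim : Tendsto (fun z : ℂ => (k - (z ^ n * c) ^ 2 / k) / ((z ^ n * c) ^ 2 - 1)) (𝓝[≠] 0)
      (𝓝 ((k - 0 ^ 2 / k) / (0 ^ 2 - 1))) :=
    (tendsto_const_nhds.sub ((hM.pow 2).div_const k)).div ((hM.pow 2).sub tendsto_const_nhds)
      (by norm_num)
  rw [show (k - 0 ^ 2 / k) / (0 ^ 2 - 1) = -k by norm_num [div_neg]] at hlim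
  refine hlim.congr' ?_
  filter_upwards [self_mem_nhdsWithin] with z hz
  have hz : z ≠ 0 := hz
  have e1 : laurentMonomial (fun i => z ^ r i * x i) w = z ^ n * c := by
    rw [laurentMonomial_zpow_mul z hz, hn]
    simp [hc]
  have e2 : laurentMonomial (fun i => z ^ r i * x i) (1 - w) = k / (z ^ n * c) := by
    have hy : ∀ i, z ^ r i * x i ≠ 0 := fun i => mul_ne_zero (zpow_ne_zero _ hz) (hx i)
    have h1 := laurentMonomial_add hy (1 - w) w
    rw [sub_add_cancel, e1, laurentMonomial_zpow_mul z hz] at h1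
    have h2 : ∑ i, r i * (1 : Fin 3 → ℤ) i = 0 := by
      simp [Fin.sum_univ_three, hr]
    rw [h2, zpow_zero, one_mul] at h1
    have h3 : laurentMonomial x 1 = k := by simp [laurentMonomial, Fin.prod_univ_three, hk]
    rw [eq_div_iff (mul_ne_zero (pow_ne_zero _ hz) hc0), ← h1, h3]
  rw [e1, e2]
  have hm0 : z ^ n * c ≠ 0 := mul_ne_zero (pow_ne_zero _ hz) hc0
  generalize z ^ n * c = M at hm0 ⊢
  by_cases h1 : M ^ 2 = 1
  · rw [h1, sub_self, div_zero, show M - M⁻¹ = (M ^ 2 - 1) / M by field_simp, h1, sub_self,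
      zero_div, div_zero]
  · have h2 : M ^ 2 - 1 ≠ 0 := sub_ne_zero.2 h1
    rw [show M - M⁻¹ = (M ^ 2 - 1) / M by field_simp]
    field_simp

/-- Each factor of `â(V)` is paired with the factor of the Serre dual weight. -/
theorem tendsto_aHat_of_finset (π : Partition3D) {x : Fin 3 → ℂ} (hx : ∀ i, x i ≠ 0)
    {r : Fin 3 → ℤ} (hr : r 0 + r 1 + r 2 = 0) (p : (Fin 3 → ℤ) → Prop) [DecidablePred p]
    (hp : ∀ w ∈ π.vertexPoly.coeff.support, p (1 - w) ↔ ¬ p w)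
    (hpos : ∀ w ∈ π.vertexPoly.coeff.support, p w → 0 < ∑ i, r i * w i) :
    Tendsto (fun z : ℂ => aHat π.vertexChar fun i => z ^ r i * x i) (𝓝[≠] 0)
      (𝓝 ((-(x 0 * x 1 * x 2)) ^
        (∑ w ∈ π.vertexPoly.coeff.support with p w, π.vertexPoly.coeff w))) := by
  have hk0 : -(x 0 * x 1 * x 2) ≠ 0 := neg_ne_zero.2 (mul_ne_zero (mul_ne_zero (hx 0) (hx 1)) (hx 2))
  have hzs : ∀ (s : Finset (Fin 3 → ℤ)) (f : (Fin 3 → ℤ) → ℤ),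
      (-(x 0 * x 1 * x 2)) ^ (∑ w ∈ s, f w) = ∏ w ∈ s, (-(x 0 * x 1 * x 2)) ^ f w := by
    intro s f
    induction s using Finset.cons_induction with
    | empty => simp
    | cons a s ha ih => rw [Finset.sum_cons, Finset.prod_cons, zpow_add₀ hk0, ih]
  rw [hzs]
  have hlim := tendsto_finsetProd (π.vertexPoly.coeff.support.filter p) fun w hw =>
    (tendsto_pair hx hr (hpos w (Finset.mem_filter.1 hw).1 (Finset.mem_filter.1 hw).2)).zpow₀
      (π.vertexPoly.coeff w) (Or.inl hk0)
  refine hlim.congr fun z => ?_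
  rw [aHat, vertexChar_eq, Finsupp.prod,
    ← Finset.prod_filter_mul_prod_filter_not π.vertexPoly.coeff.support p]
  have h2 : ∀ g : (Fin 3 → ℤ) → ℂ, ∏ w ∈ π.vertexPoly.coeff.support with ¬ p w, g w =
      ∏ w ∈ π.vertexPoly.coeff.support with p w, g (1 - w) := by
    intro g
    refine Finset.prod_bij' (fun w _ => 1 - w) (fun w _ => 1 - w) ?_ ?_ ?_ ?_ ?_
    · intro w hw
      rw [Finset.mem_filter] at hw ⊢
      rw [mem_support_one_sub]
      exact ⟨hw.1, (hp w hw.1).2 hw.2⟩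
    · intro w hw
      rw [Finset.mem_filter] at hw ⊢
      rw [mem_support_one_sub, hp w hw.1]
      exact ⟨hw.1, not_not.2 hw.2⟩
    · intro w _
      exact sub_sub_cancel 1 w
    · intro w _
      exact sub_sub_cancel 1 w
    · intro w _
      rw [sub_sub_cancel]
  rw [h2, ← Finset.prod_mul_distrib]
  refine Finset.prod_congr rfl fun w _ => ?_
  rw [coeff_kappa_sub, neg_neg, div_zpow, zpow_neg, div_eq_mul_inv, mul_comm]

/-- The limit of `â(V_π)` in the chamber of `slopeSign`; here `x` consists of square roots of the
torus coordinates, so that `x 0 * x 1 * x 2` is `κ^{1/2}`. -/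
theorem tendsto_aHat_of_pos (π : Partition3D) {x : Fin 3 → ℂ} (hx : ∀ i, x i ≠ 0)
    {r : Fin 3 → ℤ} (hr : r 0 + r 1 + r 2 = 0)
    (hpos : ∀ w ∈ π.vertexPoly.coeff.support, 0 < slopeSign w → 0 < ∑ i, r i * w i) :
    Tendsto (fun z : ℂ => aHat π.vertexChar fun i => z ^ r i * x i) (𝓝[≠] 0)
      (𝓝 ((-(x 0 * x 1 * x 2)) ^ π.index)) :=
  π.tendsto_aHat_of_finset hx hr (fun w => 0 < slopeSign w)
    (fun w hw => by
      have := π.slopeSign_ne_zero_of_mem_support hw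
      rw [slopeSign_one_sub]
      omega) hpos

/-- The limit of `â(V_π)` in the chamber opposite to that of `slopeSign`. -/
theorem tendsto_aHat_of_neg (π : Partition3D) {x : Fin 3 → ℂ} (hx : ∀ i, x i ≠ 0)
    {r : Fin 3 → ℤ} (hr : r 0 + r 1 + r 2 = 0)
    (hneg : ∀ w ∈ π.vertexPoly.coeff.support, 0 < slopeSign w → ∑ i, r i * w i < 0) :
    Tendsto (fun z : ℂ => aHat π.vertexChar fun i => z ^ r i * x i) (𝓝[≠] 0)
      (𝓝 ((-(x 0 * x 1 * x 2)) ^ (-π.index))) := by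
  have h := π.tendsto_aHat_of_finset hx hr (fun w => slopeSign w < 0)
    (fun w hw => by
      have := π.slopeSign_ne_zero_of_mem_support hw
      rw [slopeSign_one_sub]
      omega)
    (fun w hw hlt => by
      have h1 := hneg (1 - w) (π.mem_support_one_sub.2 hw) (by rw [slopeSign_one_sub]; omega)
      simp only [Pi.sub_apply, Pi.one_apply, mul_sub, mul_one, Finset.sum_sub_distrib] at h1
      rw [Fin.sum_univ_three r] at h1
      omega)
  convert h using 3
  rw [index, ← Finset.sum_neg_distrib]
  refine Finset.sum_bij' (fun w _ => 1 - w) (fun w _ => 1 - w) ?_ ?_ ?_ ?_ ?_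
  · intro w hw
    rw [Finset.mem_filter] at hw ⊢
    rw [mem_support_one_sub, slopeSign_one_sub]
    exact ⟨hw.1, by omega⟩
  · intro w hw
    rw [Finset.mem_filter] at hw ⊢
    rw [mem_support_one_sub, slopeSign_one_sub]
    exact ⟨hw.1, by omega⟩
  · intro w _
    exact sub_sub_cancel 1 w
  · intro w _
    exact sub_sub_cancel 1 w
  · intro w _
    rw [coeff_kappa_sub]

/-- A slope deep in the chamber detects the sign of the finitely many weights of `π`. -/
theorem exists_slope_bound (π : Partition3D) : ∃ M₀ : ℕ, ∀ M ≥ M₀, ∀ r : Fin 3 → ℤ,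
    r 0 + r 1 + r 2 = 0 → M * |r 2| < r 0 → 0 < r 2 →
      ∀ w ∈ π.vertexPoly.coeff.support, 0 < slopeSign w → 0 < ∑ i, r i * w i := by
  refine ⟨∑ w ∈ π.vertexPoly.coeff.support, (w 2 - w 1).natAbs, fun M hM r hr hM0 hr2 w hw hs => ?_⟩
  have h1 : (w 2 - w 1).natAbs ≤ M :=
    (Finset.single_le_sum (f := fun w : Fin 3 → ℤ => (w 2 - w 1).natAbs)
      (fun _ _ => Nat.zero_le _) hw).trans hM
  have h2 : ∑ i, r i * w i = r 0 * (w 0 - w 1) + r 2 * (w 2 - w 1) := by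
    rw [Fin.sum_univ_three, show r 1 = -r 0 - r 2 by omega]
    ring
  rw [h2]
  rw [abs_of_pos hr2] at hM0
  rw [slopeSign] at hs
  split_ifs at hs with h
  · rw [h, sub_self, mul_zero, zero_add]
    rw [Int.sign_pos_iff, h] at hs
    exact mul_pos hr2 hs
  · rw [Int.sign_pos_iff] at hs
    have h3 : r 0 ≤ r 0 * (w 0 - w 1) := by
      have : 0 ≤ (M : ℤ) * r 2 := by positivity
      exact le_mul_of_one_le_right (by omega) (by omega)
    have h4 : -((M : ℤ) * r 2) ≤ r 2 * (w 2 - w 1) := by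
      have : -(M : ℤ) ≤ w 2 - w 1 := by omega
      nlinarith
    omega

end Partition3D

/-! ### The limit of the normalized vertex -/

namespace Partition3D

variable {lam mu nu : YoungDiagram} {N : ℕ}

/-- By this parity the sign `(-1) ^ index` in the limit of `â(V_π)` combines with `Q ^ χ` to a
monomial in `t = -Qκ^{1/2}` and `q = -Qκ^{-1/2}`. -/
theorem even_chi_add_index (π : Partition3D) : Even (π.chi + π.index) := by
  obtain ⟨B, hl, hm, hn⟩ := exists_fitsIn (π.asymp 0) (π.asymp 1) (π.asymp 2)
  obtain ⟨N, hN⟩ := π.exists_isCutoff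
  have hN := hN.mono (le_max_left N (2 * B))
  rw [hN.chi_eq_card, index_eq ⟨rfl, rfl, rfl⟩ hl hm hn (le_max_right _ _) hN]
  simp only [Finset.sum_sub_distrib, ← Finset.mul_sum, Finset.sum_const, nsmul_eq_mul, mul_one,
    YoungDiagram.card]
  simp only [Int.even_add, Int.even_sub, Int.even_mul, even_two, true_or, true_iff, iff_true]
  tauto

/-- The union of the three legs is the unique partition of minimal `χ`. -/
theorem chi_full_le {π : Partition3D} (hπ : π ∈ withAsymp lam mu nu) :
    (full lam mu nu 0).chi ≤ π.chi ∧
      (π.chi = (full lam mu nu 0).chi → π = full lam mu nu 0) := by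
  obtain ⟨B, hl, hm, hn⟩ := exists_fitsIn lam mu nu
  obtain ⟨f0, f1, f2⟩ := full_asymp B hl hm hn 0
  have ha : ∀ k, (full lam mu nu 0).asymp k = π.asymp k := fun k => by
    fin_cases k <;> simp [f0, f1, f2, hπ.1, hπ.2.1, hπ.2.2]
  obtain ⟨N, hN⟩ := π.exists_isCutoff
  have hcut : (full lam mu nu 0).IsCutoff (max N B) :=
    (full_isCutoff hl hm hn ⟨hl, hm, hn⟩ (Nat.zero_le B)).mono (le_max_right _ _)
  have hN := hN.mono (le_max_left N B)
  have hsub := full_zero_subset hπ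
  have h := chi_sub_eq_card hsub ha hcut hN
  refine ⟨by omega, fun he => ext_boxes (Set.ext fun s => ?_)⟩
  rw [he, sub_self] at h
  have h1 : π.coreBoxes (max N B) ⊆ (full lam mu nu 0).coreBoxes (max N B) := by
    rw [← Finset.sdiff_eq_empty_iff_subset, ← Finset.card_eq_zero]
    omega
  rw [hN.boxes_eq, hcut.boxes_eq, (coreBoxes_mono hsub _).antisymm h1]
  simp only [ha]

/-- The limit of the vertex series along a preferred slope, with `κ^{1/2} = k²`. -/
noncomputable def limitSeries (lam mu nu : YoungDiagram) (k : ℂ) : LaurentSeries ℂ :=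
  ∑' π : withAsymp lam mu nu, HahnSeries.single (2 * π.1.chi) (k ^ (2 * π.1.index))

theorem finite_two_chi_le (lam mu nu : YoungDiagram) (m : ℤ) :
    {π : withAsymp lam mu nu | 2 * π.1.chi ≤ m}.Finite :=
  (finite_chi_le lam mu nu m.natAbs).subset fun π (h : 2 * π.1.chi ≤ m) => by
    change π.1.chi ≤ _
    omega

theorem neg_single_sq_zpow_mul_C (n : ℤ) (a : ℂ) :
    (-(HahnSeries.single 1 1) ^ 2 : LaurentSeries ℂ) ^ n * HahnSeries.C a =
      HahnSeries.single (2 * n) ((-1) ^ n * a) := by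
  have h1 : (-(HahnSeries.single 1 1) ^ 2 : LaurentSeries ℂ) =
      HahnSeries.C (-1) * (HahnSeries.single 1 1) ^ (2 : ℤ) := by
    rw [map_neg HahnSeries.C, map_one HahnSeries.C, neg_one_mul]
    rfl
  rw [h1, mul_zpow, ← zpow_mul, ← map_zpow₀, ← RatFunc.single_zpow, mul_right_comm, ← map_mul,
    HahnSeries.C_apply, HahnSeries.single_mul_single, zero_add, mul_one]

theorem vertexSeries_eq (x : Fin 3 → ℂ) :
    vertexSeries lam mu nu (-(HahnSeries.single 1 1) ^ 2) x =
      ∑' π : withAsymp lam mu nu, (HahnSeries.single (2 * π.1.chi)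
        ((-1) ^ π.1.chi * aHat π.1.vertexChar x) : LaurentSeries ℂ) :=
  tsum_congr fun _ => neg_single_sq_zpow_mul_C _ _

theorem coeff_tsum_eq_zero (a : withAsymp lam mu nu → ℂ) {j : ℤ}
    (hj : j < 2 * (full lam mu nu 0).chi) :
    (∑' π : withAsymp lam mu nu, (HahnSeries.single (2 * π.1.chi) (a π) :
      LaurentSeries ℂ)).coeff j = 0 := by
  rw [LaurentSeries.coeff_tsum_single a (finite_two_chi_le lam mu nu) le_rfl]
  refine Finset.sum_eq_zero fun π _ => if_neg ?_
  have := (chi_full_le π.2).1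
  omega

theorem full_mem_withAsymp (lam mu nu : YoungDiagram) :
    full lam mu nu 0 ∈ withAsymp lam mu nu := by
  obtain ⟨B, hl, hm, hn⟩ := exists_fitsIn lam mu nu
  exact full_asymp B hl hm hn 0

theorem coeff_tsum_chi_full (a : withAsymp lam mu nu → ℂ) :
    (∑' π : withAsymp lam mu nu, (HahnSeries.single (2 * π.1.chi) (a π) :
      LaurentSeries ℂ)).coeff (2 * (full lam mu nu 0).chi) =
        a ⟨full lam mu nu 0, full_mem_withAsymp lam mu nu⟩ := by
  rw [LaurentSeries.coeff_tsum_single a (finite_two_chi_le lam mu nu) le_rfl,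
    Finset.sum_eq_single ⟨full lam mu nu 0, full_mem_withAsymp lam mu nu⟩]
  · rw [if_pos rfl]
  · intro π _ hne
    refine if_neg fun h => hne (Subtype.ext ?_)
    exact (chi_full_le π.2).2 (by omega)
  · intro h
    exact absurd ((finite_two_chi_le lam mu nu _).mem_toFinset.2
      (le_refl (2 * (full lam mu nu 0).chi))) h

theorem chi_empty : (full ⊥ ⊥ ⊥ 0).chi = 0 := by
  obtain ⟨f0, f1, f2⟩ := full_asymp 0 (fitsIn_bot 0) (fitsIn_bot 0) (fitsIn_bot 0) 0
  have hcut := full_isCutoff (fitsIn_bot 0) (fitsIn_bot 0) (fitsIn_bot 0)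
    ⟨fitsIn_bot 0, fitsIn_bot 0, fitsIn_bot 0⟩ (Nat.zero_le 0)
  rw [hcut.chi_eq_card, f0, f1, f2]
  have : (full ⊥ ⊥ ⊥ 0).coreBoxes 0 = ∅ := by
    ext s
    rw [mem_coreBoxes]
    simp only [Finset.notMem_empty, iff_false]
    exact fun h => Nat.not_lt_zero _ (h.1 0)
  rw [this]
  simp

theorem vertexPoly_empty : (full ⊥ ⊥ ⊥ 0).vertexPoly = 0 := full_zero_vertexPoly ⊥

theorem coeff_zero_vertexSeries_empty (x : Fin 3 → ℂ) :
    (vertexSeries ⊥ ⊥ ⊥ (-(HahnSeries.single 1 1) ^ 2) x).coeff 0 = 1 := by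
  have h := coeff_tsum_chi_full (lam := ⊥) (mu := ⊥) (nu := ⊥)
    fun π => (-1) ^ π.1.chi * aHat π.1.vertexChar x
  rw [chi_empty, mul_zero, ← vertexSeries_eq] at h
  rw [h, vertexChar_eq, vertexPoly_empty]
  simp [aHat]

theorem coeff_zero_limitSeries_empty (k : ℂ) : (limitSeries ⊥ ⊥ ⊥ k).coeff 0 = 1 := by
  have h := coeff_tsum_chi_full (lam := ⊥) (mu := ⊥) (nu := ⊥) fun π => k ^ (2 * π.1.index)
  rw [chi_empty, mul_zero] at h
  rw [limitSeries, h, index, vertexPoly_empty]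
  simp

/-- A family of slopes along which every `â(V_π)` has the limit determined by its index. -/
theorem tendsto_coeff_normalizedVertex {l : Filter ℂ} {x : ℂ → Fin 3 → ℂ} {k : ℂ} (m : ℤ)
    (h1 : ∀ π ∈ withAsymp lam mu nu, 2 * π.chi ≤ m →
      Tendsto (fun z => aHat π.vertexChar (x z)) l (𝓝 ((-(k ^ 2)) ^ π.index)))
    (h2 : ∀ π ∈ withAsymp ⊥ ⊥ ⊥, 2 * π.chi ≤ m - 2 * (full lam mu nu 0).chi →
      Tendsto (fun z => aHat π.vertexChar (x z)) l (𝓝 ((-(k ^ 2)) ^ π.index))) :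
    Tendsto (fun z => (normalizedVertex lam mu nu (-(HahnSeries.single 1 1) ^ 2) (x z)).coeff m) l
      (𝓝 ((limitSeries lam mu nu k / limitSeries ⊥ ⊥ ⊥ k).coeff m)) := by
  have key : ∀ (lam mu nu : YoungDiagram) (m : ℤ), (∀ π ∈ withAsymp lam mu nu, 2 * π.chi ≤ m →
      Tendsto (fun z => aHat π.vertexChar (x z)) l (𝓝 ((-(k ^ 2)) ^ π.index))) → ∀ j ≤ m,
      Tendsto (fun z => (vertexSeries lam mu nu (-(HahnSeries.single 1 1) ^ 2) (x z)).coeff j) l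
        (𝓝 ((limitSeries lam mu nu k).coeff j)) := by
    intro lam mu nu m h j hj
    have e : ∀ z, (vertexSeries lam mu nu (-(HahnSeries.single 1 1) ^ 2) (x z)).coeff j =
        ∑ π ∈ (finite_two_chi_le lam mu nu m).toFinset,
          if 2 * π.1.chi = j then (-1) ^ π.1.chi * aHat π.1.vertexChar (x z) else 0 := fun z => by
      rw [vertexSeries_eq, LaurentSeries.coeff_tsum_single _ (finite_two_chi_le lam mu nu) hj]
    simp only [e]
    rw [limitSeries, LaurentSeries.coeff_tsum_single _ (finite_two_chi_le lam mu nu) hj]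
    refine tendsto_finsetSum _ fun π hπ => ?_
    have hπ : 2 * π.1.chi ≤ m := (finite_two_chi_le lam mu nu m).mem_toFinset.1 hπ
    split_ifs
    · have h3 := (h π.1 π.2 hπ).const_mul ((-1) ^ π.1.chi)
      have h4 : (-1 : ℂ) ^ π.1.chi * (-(k ^ 2)) ^ π.1.index = k ^ (2 * π.1.index) := by
        rw [neg_eq_neg_one_mul (k ^ 2), mul_zpow, ← mul_assoc, ← zpow_add₀ (by norm_num),
          π.1.even_chi_add_index.neg_one_zpow, one_mul, zpow_mul]
        rfl
      rwa [h4] at h3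
    · exact tendsto_const_nhds
  refine LaurentSeries.tendsto_coeff_div (a := 2 * (full lam mu nu 0).chi) ?_ ?_ ?_ ?_
    (fun z => coeff_zero_vertexSeries_empty _) (coeff_zero_limitSeries_empty k) m
    (key lam mu nu m h1) (key ⊥ ⊥ ⊥ _ h2) m le_rfl
  · intro z j hj
    rw [vertexSeries_eq]
    exact coeff_tsum_eq_zero _ hj
  · intro j hj
    exact coeff_tsum_eq_zero _ hj
  · intro z j hj
    rw [vertexSeries_eq]
    exact coeff_tsum_eq_zero _ (by rwa [chi_empty])
  · intro j hj
    exact coeff_tsum_eq_zero _ (by rwa [chi_empty])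

theorem exists_uniform_slope_bound (lam mu nu : YoungDiagram) (m : ℤ) : ∃ M : ℕ,
    ∀ π ∈ withAsymp lam mu nu, 2 * π.chi ≤ m → ∀ r : Fin 3 → ℤ,
    r 0 + r 1 + r 2 = 0 → M * |r 2| < r 0 → 0 < r 2 →
      ∀ w ∈ π.vertexPoly.coeff.support, 0 < slopeSign w → 0 < ∑ i, r i * w i := by
  choose M hM using fun π : Partition3D => π.exists_slope_bound
  refine ⟨∑ π ∈ (finite_two_chi_le lam mu nu m).toFinset, M π.1, fun π hπ hχ => hM π _ ?_⟩
  exact Finset.single_le_sum (f := fun π : withAsymp lam mu nu => M π.1) (fun _ _ => Nat.zero_le _)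
    ((finite_two_chi_le lam mu nu m).mem_toFinset.2 (show 2 * (⟨π, hπ⟩ : withAsymp lam mu nu).1.chi ≤ m from hχ))

theorem hasSlopeLimit_of_pos {g : LaurentSeries ℂ → LaurentSeries ℂ → LaurentSeries ℂ}
    (hg : ∀ k : ℂ, k ≠ 0 → g (HahnSeries.single 1 k) (HahnSeries.single 1 k⁻¹) =
      limitSeries lam mu nu k / limitSeries ⊥ ⊥ ⊥ k) :
    HasSlopeLimit (fun M r => M * |r 2| < r 0 ∧ 0 < r 2 ∧ r 1 < -(M * |r 2|))
      (normalizedVertex lam mu nu) g := by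
  intro m
  obtain ⟨M₁, h1⟩ := exists_uniform_slope_bound lam mu nu m
  obtain ⟨M₂, h2⟩ := exists_uniform_slope_bound ⊥ ⊥ ⊥ (m - 2 * (full lam mu nu 0).chi)
  refine ⟨M₁ + M₂, fun r hr hch x k hx hk => ?_⟩
  have hk0 : k ≠ 0 := by
    rintro rfl
    have := mul_ne_zero (mul_ne_zero (hx 0) (hx 1)) (hx 2)
    rw [← hk] at this
    simp at this
  rw [hg k hk0]
  have hr2 := abs_nonneg (r 2)
  obtain ⟨c1, c2, -⟩ := hch
  push_cast at c1
  refine tendsto_coeff_normalizedVertex m (fun π hπ hχ => ?_) fun π hπ hχ => ?_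
  · rw [hk]
    exact π.tendsto_aHat_of_pos hx hr (h1 π hπ hχ r hr (by nlinarith) c2)
  · rw [hk]
    exact π.tendsto_aHat_of_pos hx hr (h2 π hπ hχ r hr (by nlinarith) c2)

theorem hasSlopeLimit_of_neg {g : LaurentSeries ℂ → LaurentSeries ℂ → LaurentSeries ℂ}
    (hg : ∀ k : ℂ, k ≠ 0 → g (HahnSeries.single 1 k) (HahnSeries.single 1 k⁻¹) =
      limitSeries lam mu nu k⁻¹ / limitSeries ⊥ ⊥ ⊥ k⁻¹) :
    HasSlopeLimit (fun M r => M * |r 2| < r 1 ∧ r 2 < 0 ∧ r 0 < -(M * |r 2|))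
      (normalizedVertex lam mu nu) g := by
  intro m
  obtain ⟨M₁, h1⟩ := exists_uniform_slope_bound lam mu nu m
  obtain ⟨M₂, h2⟩ := exists_uniform_slope_bound ⊥ ⊥ ⊥ (m - 2 * (full lam mu nu 0).chi)
  refine ⟨M₁ + M₂, fun r hr hch x k hx hk => ?_⟩
  have hk0 : k ≠ 0 := by
    rintro rfl
    have := mul_ne_zero (mul_ne_zero (hx 0) (hx 1)) (hx 2)
    rw [← hk] at this
    simp at this
  rw [hg k hk0]
  have hr2 := abs_nonneg (r 2)
  obtain ⟨-, c2, c1⟩ := hch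
  push_cast at c1
  have e : ∀ n : ℤ, (-(k⁻¹ ^ 2)) ^ n = (-(x 0 * x 1 * x 2)) ^ (-n) := fun n => by
    rw [← hk, zpow_neg, ← inv_zpow, ← neg_inv, inv_pow]
  have hneg : ∀ w : Fin 3 → ℤ, ∑ i, (-r) i * w i = -∑ i, r i * w i := fun w => by
    simp [Finset.sum_neg_distrib]
  have hr' : (-r) 0 + (-r) 1 + (-r) 2 = 0 := by
    simp only [Pi.neg_apply]
    omega
  refine tendsto_coeff_normalizedVertex m (fun π hπ hχ => ?_) fun π hπ hχ => ?_
  · rw [e]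
    refine π.tendsto_aHat_of_neg hx hr fun w hw hs => ?_
    have := h1 π hπ hχ (-r) hr' (by simp only [Pi.neg_apply, abs_neg]; nlinarith)
      (by simp only [Pi.neg_apply]; omega) w hw hs
    rw [hneg] at this
    omega
  · rw [e]
    refine π.tendsto_aHat_of_neg hx hr fun w hw hs => ?_
    have := h2 π hπ hχ (-r) hr' (by simp only [Pi.neg_apply, abs_neg]; nlinarith)
      (by simp only [Pi.neg_apply]; omega) w hw hs
    rw [hneg] at this
    omega

end Partition3D

/-! ### Reflection -/

namespace LaurentPoly3

/-- The exchange of the first two coordinates. -/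
abbrev swap01 : Equiv.Perm (Fin 3) := Equiv.swap 0 1

theorem swap01_swap01 (i : Fin 3) : swap01 (swap01 i) = i := Equiv.swap_apply_self _ _ _

/-- The automorphism of the ring of Laurent polynomials exchanging the first two variables. -/
noncomputable def reflect : LaurentPoly3 →+* LaurentPoly3 :=
  AddMonoidAlgebra.mapDomainRingHom ℤ
    (⟨⟨fun w => w ∘ swap01, rfl⟩, fun _ _ => rfl⟩ : (Fin 3 → ℤ) →+ (Fin 3 → ℤ))

theorem reflect_single (w : Fin 3 → ℤ) (m : ℤ) :
    reflect (AddMonoidAlgebra.single w m) = AddMonoidAlgebra.single (w ∘ swap01) m := by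
  simp [reflect]

theorem reflect_mono (w : Fin 3 → ℤ) : reflect (mono w) = mono (w ∘ swap01) := reflect_single w 1

theorem single_comp_swap01 (i : Fin 3) (n : ℤ) :
    (Pi.single i n : Fin 3 → ℤ) ∘ swap01 = Pi.single (swap01 i) n := by
  funext j
  fin_cases i <;> fin_cases j <;> rfl

theorem reflect_var (i : Fin 3) : reflect (var i) = var (swap01 i) := by
  rw [var, reflect_mono, single_comp_swap01, var]

theorem reflect_dual (f : LaurentPoly3) : reflect (dual f) = dual (reflect f) := by
  induction f using AddMonoidAlgebra.induction_linear with
  | zero => simp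
  | add x y hx hy => simp only [map_add, hx, hy]
  | single w m =>
    rw [dual_single, reflect_single, reflect_single, dual_single]
    rfl

theorem coeff_reflect (f : LaurentPoly3) (w : Fin 3 → ℤ) :
    (reflect f).coeff (w ∘ swap01) = f.coeff w := by
  have hinj : ∀ v w : Fin 3 → ℤ, v ∘ swap01 = w ∘ swap01 ↔ v = w := fun v w =>
    swap01.surjective.injective_comp_right.eq_iff
  induction f using AddMonoidAlgebra.induction_linear with
  | zero => simp
  | add x y hx hy => simp only [map_add, AddMonoidAlgebra.coeff_add, Finsupp.add_apply, hx, hy]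
  | single v m =>
    rw [reflect_single, AddMonoidAlgebra.coeff_single, AddMonoidAlgebra.coeff_single,
      Finsupp.single_apply, Finsupp.single_apply]
    simp only [hinj]

theorem reflect_legPoly (lam : YoungDiagram) (k : Fin 3) :
    reflect (legPoly lam k) = legPoly lam.transpose (swap01 k) := by
  rw [legPoly, legPoly, map_sum]
  refine Finset.sum_bij' (fun c _ => c.swap) (fun c _ => c.swap) ?_ ?_ ?_ ?_ ?_
  · intro c hc
    exact YoungDiagram.mem_transpose.2 (by simpa using hc)
  · intro c hc
    exact YoungDiagram.mem_transpose.1 hc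
  · intro c _
    rfl
  · intro c _
    rfl
  · intro c _
    rw [reflect_mono]
    congr 1
    funext i
    fin_cases k <;> fin_cases i <;> simp [show swap01 2 = 2 from rfl]

theorem vertexExpr_swap {A : Type*} [CommRing A] (t l l' : Fin 3 → A) (r r' : A) :
    vertexExpr (t ∘ swap01) (l ∘ swap01) (l' ∘ swap01) r r' = vertexExpr t l l' r r' := by
  have h0 : swap01 0 = 1 := rfl
  have h1 : swap01 1 = 0 := rfl
  have h2 : swap01 2 = 2 := rfl
  simp only [vertexExpr, Fin.sum_univ_three, Fin.prod_univ_three, Fin.isValue, zero_add,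
    show (1 : Fin 3) + 1 = 2 from rfl, show (1 : Fin 3) + 2 = 0 from rfl,
    show (2 : Fin 3) + 1 = 0 from rfl, show (2 : Fin 3) + 2 = 1 from rfl, Function.comp_apply,
    h0, h1, h2]
  ring

end LaurentPoly3

namespace Partition3D

variable {lam mu nu : YoungDiagram}

/-- The reflection of a three-dimensional partition, exchanging the first two coordinates. -/
def reflect (π : Partition3D) : Partition3D where
  boxes := {s | s ∘ swap01 ∈ π.boxes}
  lower := fun _ _ hle hs => π.lower (fun i => hle (swap01 i)) hs
  bounded := by
    obtain ⟨B, hB⟩ := π.bounded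
    refine ⟨B, fun s hs i j hi hj => ?_⟩
    have := hB _ hs (swap01 i) (swap01 j) (by simpa using hi) (by simpa using hj)
    exact swap01.injective this

theorem mem_reflect {π : Partition3D} {s : Fin 3 → ℕ} :
    s ∈ π.reflect.boxes ↔ s ∘ swap01 ∈ π.boxes := Iff.rfl

theorem reflect_reflect (π : Partition3D) : π.reflect.reflect = π := by
  refine ext_boxes (Set.ext fun s => ?_)
  rw [mem_reflect, mem_reflect]
  have : (s ∘ swap01) ∘ swap01 = s := funext fun i => by simp
  rw [this]

theorem reflect_asymp (π : Partition3D) (k : Fin 3) :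
    π.reflect.asymp (swap01 k) = (π.asymp k).transpose := by
  apply YoungDiagram.ext
  ext ⟨a, b⟩
  rw [mem_asymp, YoungDiagram.mem_cells, YoungDiagram.mem_transpose, ← YoungDiagram.mem_cells,
    mem_asymp]
  have e : ∀ k : Fin 3, swap01 (k + 1) = swap01 k + 2 ∧ swap01 (k + 2) = swap01 k + 1 := by decide
  constructor
  · intro h s h1 h2
    have := h (s ∘ swap01) (by
      rw [← (e k).2, Function.comp_apply, swap01_swap01]; exact h2) (by
      rw [← (e k).1, Function.comp_apply, swap01_swap01]; exact h1)
    rw [mem_reflect] at this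
    have hs : (s ∘ swap01) ∘ swap01 = s := funext fun i => by simp
    rwa [hs] at this
  · intro h s h1 h2
    refine h (s ∘ swap01) ?_ ?_
    · rw [Function.comp_apply, (e k).1]; exact h2
    · rw [Function.comp_apply, (e k).2]; exact h1

theorem reflect_mem_withAsymp {π : Partition3D} (hπ : π ∈ withAsymp lam mu nu) :
    π.reflect ∈ withAsymp mu.transpose lam.transpose nu.transpose := by
  obtain ⟨p0, p1, p2⟩ := hπ
  refine ⟨?_, ?_, ?_⟩
  · rw [← p1]; exact π.reflect_asymp 1
  · rw [← p0]; exact π.reflect_asymp 0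
  · rw [← p2]; exact π.reflect_asymp 2

theorem reflect_legCount (π : Partition3D) (s : Fin 3 → ℕ) :
    π.reflect.legCount (s ∘ swap01) = π.legCount s := by
  have e : ∀ k : Fin 3, swap01 (swap01 k + 1) = k + 2 ∧ swap01 (swap01 k + 2) = k + 1 := by decide
  rw [legCount, legCount, Finset.card_filter, Finset.card_filter, ← Equiv.sum_comp swap01]
  refine Finset.sum_congr rfl fun k _ => ?_
  rw [reflect_asymp, Function.comp_apply, Function.comp_apply, (e k).1, (e k).2]
  have : ((s (k + 2), s (k + 1)) ∈ (π.asymp k).transpose.cells) =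
      ((s (k + 1), s (k + 2)) ∈ (π.asymp k).cells) := by
    rw [YoungDiagram.mem_cells, YoungDiagram.mem_transpose, YoungDiagram.mem_cells]
    rfl
  simp only [this]

theorem finsum_reflect {M : Type*} [AddCommMonoid M] (π : Partition3D) (f : (Fin 3 → ℕ) → M) :
    ∑ᶠ s ∈ π.reflect.boxes, f s = ∑ᶠ s ∈ π.boxes, f (s ∘ swap01) := by
  refine (finsum_mem_eq_of_bijOn (fun s => s ∘ swap01) ⟨?_, ?_, ?_⟩ fun _ _ => rfl).symm
  · intro s hs
    rw [mem_reflect]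
    have h : (s ∘ swap01) ∘ swap01 = s := funext fun i => by simp
    rwa [h]
  · intro s _ s' _ h
    exact swap01.surjective.injective_comp_right h
  · intro s hs
    exact ⟨s ∘ swap01, hs, funext fun i => by simp⟩

theorem reflect_chi (π : Partition3D) : π.reflect.chi = π.chi := by
  rw [chi, finsum_reflect, chi]
  simp only [reflect_legCount]

theorem reflect_corePoly (π : Partition3D) : π.reflect.corePoly = LaurentPoly3.reflect π.corePoly := by
  obtain ⟨N, hN⟩ := π.exists_isCutoff
  rw [corePoly_eq hN, corePoly, finsum_reflect, finsum_mem_boxes hN _ fun s hs => by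
    rw [reflect_legCount, hs]; simp, map_sum]
  refine Finset.sum_congr rfl fun s _ => ?_
  rw [map_zsmul, reflect_mono, reflect_legCount]
  rfl

theorem reflect_vertexPoly (π : Partition3D) :
    π.reflect.vertexPoly = LaurentPoly3.reflect π.vertexPoly := by
  rw [vertexPoly, vertexPoly, map_vertexExpr, ← vertexExpr_swap, reflect_corePoly, reflect_dual]
  congr 1
  · funext i
    exact (reflect_var i).symm
  · funext k
    rw [Function.comp_apply, Function.comp_apply, reflect_legPoly, reflect_asymp]
  · funext k
    rw [Function.comp_apply, Function.comp_apply, reflect_dual, reflect_legPoly, reflect_asymp]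

theorem aHat_reflect (π : Partition3D) (x : Fin 3 → ℂ) :
    aHat π.reflect.vertexChar (x ∘ swap01) = aHat π.vertexChar x := by
  rw [aHat, aHat, vertexChar_eq, vertexChar_eq, Finsupp.prod, Finsupp.prod, reflect_vertexPoly]
  have hss : ∀ w : Fin 3 → ℤ, (w ∘ swap01) ∘ swap01 = w := fun w => funext fun i => by simp
  have hco : ∀ w, (LaurentPoly3.reflect π.vertexPoly).coeff w = π.vertexPoly.coeff (w ∘ swap01) :=
    fun w => by
      conv_lhs => rw [← hss w]
      exact coeff_reflect _ _
  refine Finset.prod_bij' (fun w _ => w ∘ swap01) (fun w _ => w ∘ swap01) ?_ ?_ ?_ ?_ ?_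
  · intro w hw
    rw [Finsupp.mem_support_iff] at hw ⊢
    rwa [← hco]
  · intro w hw
    rw [Finsupp.mem_support_iff] at hw ⊢
    rwa [coeff_reflect]
  · intro w _
    exact hss w
  · intro w _
    exact hss w
  · intro w _
    have : laurentMonomial (x ∘ swap01) w = laurentMonomial x (w ∘ swap01) := by
      rw [laurentMonomial, laurentMonomial, ← Equiv.prod_comp swap01]
      refine Finset.prod_congr rfl fun i _ => ?_
      rw [Function.comp_apply, Function.comp_apply, swap01_swap01]
    rw [this, hco]

/-- Reflection as a bijection between sets of partitions with given asymptotics. -/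
def reflectEquiv (lam mu nu : YoungDiagram) :
    withAsymp lam mu nu ≃ withAsymp mu.transpose lam.transpose nu.transpose where
  toFun π := ⟨π.1.reflect, reflect_mem_withAsymp π.2⟩
  invFun π := ⟨π.1.reflect, by
    have := reflect_mem_withAsymp π.2
    simpa only [YoungDiagram.transpose_transpose] using this⟩
  left_inv π := Subtype.ext π.1.reflect_reflect
  right_inv π := Subtype.ext π.1.reflect_reflect

theorem vertexSeries_reflect (lam mu nu : YoungDiagram) (Q : LaurentSeries ℂ) (x : Fin 3 → ℂ) :
    vertexSeries mu.transpose lam.transpose nu.transpose Q (x ∘ swap01) =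
      vertexSeries lam mu nu Q x := by
  rw [vertexSeries, vertexSeries, ← (reflectEquiv lam mu nu).tsum_eq]
  refine tsum_congr fun π => ?_
  change Q ^ π.1.reflect.chi * HahnSeries.C (aHat π.1.reflect.vertexChar (x ∘ swap01)) = _
  rw [reflect_chi, aHat_reflect]

theorem normalizedVertex_reflect (lam mu nu : YoungDiagram) (Q : LaurentSeries ℂ) (x : Fin 3 → ℂ) :
    normalizedVertex mu.transpose lam.transpose nu.transpose Q (x ∘ swap01) =
      normalizedVertex lam mu nu Q x := by
  rw [normalizedVertex, normalizedVertex, vertexSeries_reflect]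
  congr 1
  exact vertexSeries_reflect ⊥ ⊥ ⊥ Q x

theorem hasSlopeLimit_reflect {chamber chamber' : ℕ → (Fin 3 → ℤ) → Prop}
    (hch : ∀ M r, chamber' M r → chamber M (r ∘ swap01))
    {g : LaurentSeries ℂ → LaurentSeries ℂ → LaurentSeries ℂ}
    (h : HasSlopeLimit chamber (normalizedVertex mu.transpose lam.transpose nu.transpose) g) :
    HasSlopeLimit chamber' (normalizedVertex lam mu nu) g := by
  intro m
  obtain ⟨M, hM⟩ := h m
  refine ⟨M, fun r hr hc x k hx hk => ?_⟩
  have h0 : swap01 0 = 1 := rfl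
  have h1 : swap01 1 = 0 := rfl
  have h2 : swap01 2 = 2 := rfl
  have := hM (r ∘ swap01) (by simp only [Function.comp_apply, h0, h1, h2]; omega) (hch M r hc)
    (x ∘ swap01) k (fun i => hx _) (by simp only [Function.comp_apply, h0, h1, h2]; rw [hk]; ring)
  refine this.congr fun z => ?_
  rw [← normalizedVertex_reflect lam mu nu]
  rfl

/-- The reduction of the four limits to the computation of the limit series. -/
theorem hasSlopeLimit_of_limitSeries
    (H : ∀ (lam mu nu : YoungDiagram) (k : ℂ), k ≠ 0 →
      refinedC lam mu nu (HahnSeries.single 1 k) (HahnSeries.single 1 k⁻¹) =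
        limitSeries lam mu nu k / limitSeries ⊥ ⊥ ⊥ k) (lam mu nu : YoungDiagram) :
    HasSlopeLimit (fun M r => M * |r 2| < r 0 ∧ 0 < r 2 ∧ r 1 < -(M * |r 2|))
      (normalizedVertex lam mu nu)
      (fun sqrtT sqrtQ => refinedC lam mu nu sqrtT sqrtQ) ∧
    HasSlopeLimit (fun M r => M * |r 2| < r 0 ∧ r 2 < 0 ∧ r 1 < -(M * |r 2|))
      (normalizedVertex lam mu nu)
      (fun sqrtT sqrtQ => refinedC mu.transpose lam.transpose nu.transpose sqrtQ sqrtT) ∧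
    HasSlopeLimit (fun M r => M * |r 2| < r 1 ∧ 0 < r 2 ∧ r 0 < -(M * |r 2|))
      (normalizedVertex lam mu nu)
      (fun sqrtT sqrtQ => refinedC mu.transpose lam.transpose nu.transpose sqrtT sqrtQ) ∧
    HasSlopeLimit (fun M r => M * |r 2| < r 1 ∧ r 2 < 0 ∧ r 0 < -(M * |r 2|))
      (normalizedVertex lam mu nu)
      (fun sqrtT sqrtQ => refinedC lam mu nu sqrtQ sqrtT) := by
  have hneg : ∀ (lam mu nu : YoungDiagram) (k : ℂ), k ≠ 0 →
      refinedC lam mu nu (HahnSeries.single 1 k⁻¹) (HahnSeries.single 1 k) =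
        limitSeries lam mu nu k⁻¹ / limitSeries ⊥ ⊥ ⊥ k⁻¹ := fun lam mu nu k hk => by
    have := H lam mu nu k⁻¹ (inv_ne_zero hk)
    rwa [inv_inv] at this
  exact ⟨hasSlopeLimit_of_pos (H lam mu nu),
    hasSlopeLimit_reflect (fun _ _ h => h) (hasSlopeLimit_of_neg (hneg _ _ _)),
    hasSlopeLimit_reflect (fun _ _ h => h) (hasSlopeLimit_of_pos (H _ _ _)),
    hasSlopeLimit_of_neg (hneg lam mu nu)⟩

end Partition3D

/-! ### Interlacing partitions -/

namespace YoungDiagram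

theorem ext_rowLen {α β : YoungDiagram} (h : ∀ i, α.rowLen i = β.rowLen i) : α = β := by
  apply YoungDiagram.ext
  ext ⟨i, j⟩
  rw [mem_cells, mem_cells, mem_iff_lt_rowLen, mem_iff_lt_rowLen, h]

theorem rowLen_eq_zero (α : YoungDiagram) {i : ℕ} (hi : α.colLen 0 ≤ i) : α.rowLen i = 0 := by
  by_contra h
  have h1 : (i, 0) ∈ α := mem_iff_lt_rowLen.2 (Nat.pos_of_ne_zero h)
  have := mem_iff_lt_colLen.1 h1
  omega

/-- The Young diagram with given row lengths. -/
noncomputable def ofRows (f : ℕ → ℕ) (hf : Antitone f) (h0 : ∃ M, f M = 0) : YoungDiagram where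
  cells := (Finset.range h0.choose ×ˢ Finset.range (f 0)).filter fun c => c.2 < f c.1
  isLowerSet := by
    rintro ⟨i, j⟩ ⟨i', j'⟩ hle h
    obtain ⟨hi, hj⟩ := Prod.mk_le_mk.1 hle
    simp only [Finset.coe_filter, Finset.mem_product, Finset.mem_range, Set.mem_ofPred_eq] at h ⊢
    have := hf hi
    omega

theorem rowLen_ofRows (f : ℕ → ℕ) (hf : Antitone f) (h0 : ∃ M, f M = 0) (i : ℕ) :
    (ofRows f hf h0).rowLen i = f i := by
  have key : ∀ j, j < (ofRows f hf h0).rowLen i ↔ j < f i := by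
    intro j
    rw [← mem_iff_lt_rowLen, ← mem_cells]
    change (i, j) ∈ Finset.filter _ _ ↔ _
    rw [Finset.mem_filter, Finset.mem_product, Finset.mem_range, Finset.mem_range]
    refine ⟨fun h => h.2, fun h => ⟨⟨?_, h.trans_le (hf (Nat.zero_le i))⟩, h⟩⟩
    by_contra hi
    have h1 : f i ≤ f h0.choose := hf (not_lt.1 hi)
    rw [h0.choose_spec] at h1
    exact absurd h (by omega)
  exact le_antisymm (Nat.le_of_not_lt fun h => lt_irrefl _ ((key _).1 h))
    (Nat.le_of_not_lt fun h => lt_irrefl _ ((key _).2 h))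

theorem card_eq_sum_rowLen (α : YoungDiagram) {M : ℕ} (hM : α.rowLen M = 0) :
    α.card = ∑ i ∈ Finset.range M, α.rowLen i := by
  rw [YoungDiagram.card, Finset.card_eq_sum_card_fiberwise (f := Prod.fst) (t := Finset.range M)]
  · refine Finset.sum_congr rfl fun i _ => ?_
    rw [rowLen_eq_card]
    rfl
  · rintro ⟨i, j⟩ h
    rw [Finset.mem_coe, Finset.mem_range]
    by_contra hi
    have h1 : j < α.rowLen i := mem_iff_lt_rowLen.1 h
    have : α.rowLen i ≤ α.rowLen M := α.rowLen_anti _ _ (not_lt.1 hi)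
    omega

/-- The partitions `α` and `β` interlace: `α ⊆ β` and `β / α` is a horizontal strip. -/
def Interlace (α β : YoungDiagram) : Prop :=
  (∀ i, α.rowLen i ≤ β.rowLen i) ∧ ∀ i, β.rowLen (i + 1) ≤ α.rowLen i

variable {α β : YoungDiagram}

/-- The involution on the partitions between `α` and `β`: every row length is reflected in the
interval in which it can vary. -/
noncomputable def middleToggle (ρ : {ρ // Interlace α ρ ∧ Interlace ρ β}) :
    {ρ // Interlace α ρ ∧ Interlace ρ β} :=
  let f : ℕ → ℕ := fun i => match i with
    | 0 => max (α.rowLen 0) (β.rowLen (0 + 1)) + β.rowLen 0 - ρ.1.rowLen 0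
    | i + 1 => max (α.rowLen (i + 1)) (β.rowLen (i + 1 + 1)) + min (β.rowLen (i + 1)) (α.rowLen i) -
        ρ.1.rowLen (i + 1)
  have hb : ∀ i, max (α.rowLen i) (β.rowLen (i + 1)) ≤ f i ∧ f i ≤ β.rowLen i := by
    intro i
    have h1 := ρ.2.1.1 i
    have h2 := ρ.2.2.1 i
    have h3 := ρ.2.2.2 i
    rcases i with _ | i
    · simp only [f]
      omega
    · have h4 := ρ.2.1.2 i
      simp only [f]
      omega
  have hb' : ∀ i, f (i + 1) ≤ α.rowLen i := by
    intro i
    have h1 := ρ.2.1.1 (i + 1)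
    have h3 := ρ.2.2.2 (i + 1)
    simp only [f]
    omega
  have hf : Antitone f := antitone_nat_of_succ_le fun i => by
    have := hb' i
    have := (hb i).1
    omega
  have h0 : ∃ M, f M = 0 := ⟨β.colLen 0, by
    have := (hb (β.colLen 0)).2
    rw [β.rowLen_eq_zero le_rfl] at this
    omega⟩
  ⟨ofRows f hf h0, by
    refine ⟨⟨fun i => ?_, fun i => ?_⟩, fun i => ?_, fun i => ?_⟩ <;> rw [rowLen_ofRows]
    · exact (le_max_left _ _).trans (hb i).1
    · exact hb' i
    · exact (hb i).2
    · exact (le_max_right _ _).trans (hb i).1⟩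

theorem middleToggle_zero (ρ : {ρ // Interlace α ρ ∧ Interlace ρ β}) :
    (middleToggle ρ).1.rowLen 0 = max (α.rowLen 0) (β.rowLen (0 + 1)) + β.rowLen 0 - ρ.1.rowLen 0 := by
  simp only [middleToggle, rowLen_ofRows]

theorem middleToggle_succ (ρ : {ρ // Interlace α ρ ∧ Interlace ρ β}) (i : ℕ) :
    (middleToggle ρ).1.rowLen (i + 1) = max (α.rowLen (i + 1)) (β.rowLen (i + 1 + 1)) +
      min (β.rowLen (i + 1)) (α.rowLen i) - ρ.1.rowLen (i + 1) := by
  simp only [middleToggle, rowLen_ofRows]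

theorem middleToggle_middleToggle (ρ : {ρ // Interlace α ρ ∧ Interlace ρ β}) :
    middleToggle (middleToggle ρ) = ρ := by
  refine Subtype.ext (ext_rowLen fun i => ?_)
  have h1 := ρ.2.1.1 i
  have h2 := ρ.2.2.1 i
  have h3 := ρ.2.2.2 i
  rcases i with _ | i
  · rw [middleToggle_zero, middleToggle_zero]
    omega
  · have h4 := ρ.2.1.2 i
    rw [middleToggle_succ, middleToggle_succ]
    omega

theorem exists_rowLen_eq_zero (l : List YoungDiagram) : ∃ M, ∀ α ∈ l, ∀ i ≥ M, α.rowLen i = 0 := by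
  induction l with
  | nil => exact ⟨0, by simp⟩
  | cons a l ih =>
    obtain ⟨M, hM⟩ := ih
    refine ⟨max M (a.colLen 0), fun α hα i hi => ?_⟩
    rcases List.mem_cons.1 hα with rfl | h
    · exact α.rowLen_eq_zero ((le_max_right _ _).trans hi)
    · exact hM α h i ((le_max_left _ _).trans hi)

theorem card_middleToggle (ρ : {ρ // Interlace α ρ ∧ Interlace ρ β}) :
    ρ.1.card + (middleToggle ρ).1.card = α.card + β.card := by
  obtain ⟨M, hM⟩ := exists_rowLen_eq_zero [α, β, ρ.1, (middleToggle ρ).1]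
  simp only [List.forall_mem_cons, List.not_mem_nil, false_implies, implies_true, and_true] at hM
  obtain ⟨h1, h2, h3, h4⟩ := hM
  rw [card_eq_sum_rowLen ρ.1 (h3 (M + 1) (by omega)),
    card_eq_sum_rowLen (middleToggle ρ).1 (h4 (M + 1) (by omega)),
    card_eq_sum_rowLen α (h1 M le_rfl), card_eq_sum_rowLen β (h2 (M + 1) (by omega)),
    Finset.sum_range_succ', Finset.sum_range_succ', Finset.sum_range_succ']
  have e1 : ∑ i ∈ Finset.range M, ρ.1.rowLen (i + 1) +
      ∑ i ∈ Finset.range M, (middleToggle ρ).1.rowLen (i + 1) =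
      ∑ i ∈ Finset.range M, (max (α.rowLen (i + 1)) (β.rowLen (i + 1 + 1)) +
      min (β.rowLen (i + 1)) (α.rowLen i)) := by
    rw [← Finset.sum_add_distrib]
    refine Finset.sum_congr rfl fun i _ => ?_
    have h1 := ρ.2.1.1 (i + 1)
    have h2 := ρ.2.2.1 (i + 1)
    have h3 := ρ.2.2.2 (i + 1)
    have h4 := ρ.2.1.2 i
    rw [middleToggle_succ]
    omega
  have e2 : ∑ i ∈ Finset.range M, (max (α.rowLen (i + 1)) (β.rowLen (i + 1 + 1)) +
      min (β.rowLen (i + 1)) (α.rowLen i)) + max (α.rowLen 0) (β.rowLen (0 + 1)) =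
      ∑ i ∈ Finset.range M, α.rowLen i + ∑ i ∈ Finset.range M, β.rowLen (i + 1) := by
    have e3 := Finset.sum_range_succ' (fun i => max (α.rowLen i) (β.rowLen (i + 1))) M
    rw [Finset.sum_range_succ, h1 M le_rfl, h2 (M + 1) (by omega), max_self, add_zero] at e3
    rw [Finset.sum_add_distrib, add_right_comm, ← e3, ← Finset.sum_add_distrib,
      ← Finset.sum_add_distrib]
    refine Finset.sum_congr rfl fun i _ => ?_
    omega
  have h5 := ρ.2.1.1 0
  have h6 := ρ.2.2.1 0
  have h7 := ρ.2.2.2 0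
  rw [middleToggle_zero]
  omega

theorem interlace_finite_support {ρ : YoungDiagram} (f : ℕ → ℕ) (h : ∀ i, f i ≤ ρ.rowLen i) :
    ∃ M, f M = 0 := ⟨ρ.colLen 0, by
  have := h (ρ.colLen 0)
  rw [ρ.rowLen_eq_zero le_rfl] at this
  omega⟩

/-- The toggle of a local maximum `ρ` of a sequence of interlacing partitions to a local minimum:
every row length except for the first one is reflected in the interval in which it can vary, and
the excess of the first row is recorded. -/
noncomputable def peakToggle (ρ : {ρ // Interlace α ρ ∧ Interlace β ρ}) :
    {η // Interlace η α ∧ Interlace η β} × ℕ :=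
  let f : ℕ → ℕ := fun i => max (α.rowLen (i + 1)) (β.rowLen (i + 1)) +
    min (α.rowLen i) (β.rowLen i) - ρ.1.rowLen (i + 1)
  have hb : ∀ i, max (α.rowLen (i + 1)) (β.rowLen (i + 1)) ≤ f i ∧
      f i ≤ min (α.rowLen i) (β.rowLen i) := by
    intro i
    have h1 := ρ.2.1.1 (i + 1)
    have h2 := ρ.2.2.1 (i + 1)
    have h3 := ρ.2.1.2 i
    have h4 := ρ.2.2.2 i
    simp only [f]
    omega
  have hf : Antitone f := antitone_nat_of_succ_le fun i => by
    have := (hb i).1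
    have := (hb (i + 1)).2
    omega
  ⟨⟨ofRows f hf (interlace_finite_support f fun i => (hb i).2.trans (min_le_left _ _)), by
    refine ⟨⟨fun i => ?_, fun i => ?_⟩, fun i => ?_, fun i => ?_⟩ <;> rw [rowLen_ofRows] <;>
      have := hb i <;> omega⟩, ρ.1.rowLen 0 - max (α.rowLen 0) (β.rowLen 0)⟩

theorem peakToggle_rowLen (ρ : {ρ // Interlace α ρ ∧ Interlace β ρ}) (i : ℕ) :
    (peakToggle ρ).1.1.rowLen i = max (α.rowLen (i + 1)) (β.rowLen (i + 1)) +
      min (α.rowLen i) (β.rowLen i) - ρ.1.rowLen (i + 1) := by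
  simp only [peakToggle, rowLen_ofRows]

theorem peakToggle_snd (ρ : {ρ // Interlace α ρ ∧ Interlace β ρ}) :
    (peakToggle ρ).2 = ρ.1.rowLen 0 - max (α.rowLen 0) (β.rowLen 0) := rfl

/-- The inverse of `peakToggle`. -/
noncomputable def valleyToggle (p : {η // Interlace η α ∧ Interlace η β} × ℕ) :
    {ρ // Interlace α ρ ∧ Interlace β ρ} :=
  let f : ℕ → ℕ := fun i => match i with
    | 0 => p.2 + max (α.rowLen 0) (β.rowLen 0)
    | i + 1 => max (α.rowLen (i + 1)) (β.rowLen (i + 1)) + min (α.rowLen i) (β.rowLen i) -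
        p.1.1.rowLen i
  have hb : ∀ i, max (α.rowLen (i + 1)) (β.rowLen (i + 1)) ≤ f (i + 1) ∧
      f (i + 1) ≤ min (α.rowLen i) (β.rowLen i) := by
    intro i
    have h1 := p.1.2.1.1 i
    have h2 := p.1.2.2.1 i
    have h3 := p.1.2.1.2 i
    have h4 := p.1.2.2.2 i
    simp only [f]
    omega
  have hb' : ∀ i, max (α.rowLen i) (β.rowLen i) ≤ f i := by
    intro i
    rcases i with _ | i
    · simp only [f]
      omega
    · exact (hb i).1
  have hf : Antitone f := antitone_nat_of_succ_le fun i => by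
    have := (hb i).2
    have := hb' i
    omega
  ⟨ofRows f hf ⟨α.colLen 0 + 1, by
    have := (hb (α.colLen 0)).2
    rw [α.rowLen_eq_zero le_rfl] at this
    omega⟩, by
    refine ⟨⟨fun i => ?_, fun i => ?_⟩, fun i => ?_, fun i => ?_⟩ <;> rw [rowLen_ofRows]
    · exact (le_max_left _ _).trans (hb' i)
    · exact (hb i).2.trans (min_le_left _ _)
    · exact (le_max_right _ _).trans (hb' i)
    · exact (hb i).2.trans (min_le_right _ _)⟩

theorem valleyToggle_zero (p : {η // Interlace η α ∧ Interlace η β} × ℕ) :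
    (valleyToggle p).1.rowLen 0 = p.2 + max (α.rowLen 0) (β.rowLen 0) := by
  simp only [valleyToggle, rowLen_ofRows]

theorem valleyToggle_succ (p : {η // Interlace η α ∧ Interlace η β} × ℕ) (i : ℕ) :
    (valleyToggle p).1.rowLen (i + 1) = max (α.rowLen (i + 1)) (β.rowLen (i + 1)) +
      min (α.rowLen i) (β.rowLen i) - p.1.1.rowLen i := by
  simp only [valleyToggle, rowLen_ofRows]

/-- The bijection between local maxima and local minima. -/
noncomputable def peakEquiv (α β : YoungDiagram) :
    {ρ // Interlace α ρ ∧ Interlace β ρ} ≃ {η // Interlace η α ∧ Interlace η β} × ℕ where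
  toFun := peakToggle
  invFun := valleyToggle
  left_inv ρ := by
    refine Subtype.ext (ext_rowLen fun i => ?_)
    rcases i with _ | i
    · have h1 := ρ.2.1.1 0
      have h2 := ρ.2.2.1 0
      rw [valleyToggle_zero, peakToggle_snd]
      omega
    · have h1 := ρ.2.1.1 (i + 1)
      have h2 := ρ.2.2.1 (i + 1)
      have h3 := ρ.2.1.2 i
      have h4 := ρ.2.2.2 i
      rw [valleyToggle_succ, peakToggle_rowLen]
      omega
  right_inv p := by
    refine Prod.ext (Subtype.ext (ext_rowLen fun i => ?_)) ?_
    · have h1 := p.1.2.1.1 i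
      have h2 := p.1.2.2.1 i
      have h3 := p.1.2.1.2 i
      have h4 := p.1.2.2.2 i
      rw [peakToggle_rowLen, valleyToggle_succ]
      omega
    · rw [peakToggle_snd, valleyToggle_zero]
      omega

theorem card_peakToggle (ρ : {ρ // Interlace α ρ ∧ Interlace β ρ}) :
    ρ.1.card + (peakToggle ρ).1.1.card = α.card + β.card + (peakToggle ρ).2 := by
  obtain ⟨M, hM⟩ := exists_rowLen_eq_zero [α, β, ρ.1, (peakToggle ρ).1.1]
  simp only [List.forall_mem_cons, List.not_mem_nil, false_implies, implies_true, and_true] at hM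
  obtain ⟨h1, h2, h3, h4⟩ := hM
  rw [card_eq_sum_rowLen ρ.1 (h3 (M + 1) (by omega)),
    card_eq_sum_rowLen (peakToggle ρ).1.1 (h4 M le_rfl),
    card_eq_sum_rowLen α (h1 M le_rfl), card_eq_sum_rowLen β (h2 M le_rfl),
    Finset.sum_range_succ', ← Finset.sum_add_distrib]
  have e1 : ∑ i ∈ Finset.range M, ρ.1.rowLen (i + 1) +
      ∑ i ∈ Finset.range M, (peakToggle ρ).1.1.rowLen i =
      ∑ i ∈ Finset.range M, max (α.rowLen (i + 1)) (β.rowLen (i + 1)) +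
      ∑ i ∈ Finset.range M, min (α.rowLen i) (β.rowLen i) := by
    rw [← Finset.sum_add_distrib, ← Finset.sum_add_distrib]
    refine Finset.sum_congr rfl fun i _ => ?_
    have h1 := ρ.2.1.1 (i + 1)
    have h2 := ρ.2.2.1 (i + 1)
    have h3 := ρ.2.1.2 i
    have h4 := ρ.2.2.2 i
    rw [peakToggle_rowLen]
    omega
  have e3 := Finset.sum_range_succ' (fun i => max (α.rowLen i) (β.rowLen i)) M
  rw [Finset.sum_range_succ, h1 M le_rfl, h2 M le_rfl, max_self, add_zero] at e3
  have e4 : ∑ i ∈ Finset.range M, (α.rowLen i + β.rowLen i) =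
      ∑ i ∈ Finset.range M, max (α.rowLen i) (β.rowLen i) +
      ∑ i ∈ Finset.range M, min (α.rowLen i) (β.rowLen i) := by
    rw [← Finset.sum_add_distrib]
    refine Finset.sum_congr rfl fun i _ => ?_
    omega
  have h5 := ρ.2.1.1 0
  have h6 := ρ.2.2.1 0
  rw [peakToggle_snd]
  omega

end YoungDiagram

/-! ### Weighted sums over chains of interlacing partitions -/

namespace YoungDiagram

/-- A step of a chain: the next partition is obtained by adding a horizontal strip (if `d` is
`true`) or by removing one (if `d` is `false`). -/
def Step : Bool → YoungDiagram → YoungDiagram → Prop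
  | true, α, β => Interlace α β
  | false, α, β => Interlace β α

/-- Chains of partitions from `α` to `β` whose steps have the directions prescribed by a word. The
second components of the letters are the variables recording the sizes of the strips. -/
def Chain {F : Type*} : List (Bool × F) → YoungDiagram → YoungDiagram → Type
  | [], α, β => PLift (α = β)
  | p :: w, α, β => Σ γ : {γ // Step p.1 α γ}, Chain w γ.1 β

/-- The weight of a chain: the product of the variables, raised to the decrease of the size. -/
noncomputable def chainWeight {F : Type*} [Field F] :
    ∀ (w : List (Bool × F)) (α β : YoungDiagram), Chain w α β → F
  | [], _, _, _ => 1
  | p :: w, α, β, c => p.2 ^ ((α.card : ℤ) - c.1.1.card) * chainWeight w c.1.1 β c.2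

theorem chainWeight_cons {F : Type*} [Field F] (p : Bool × F) (w : List (Bool × F))
    (α β : YoungDiagram) (c : Chain (p :: w) α β) :
    chainWeight (p :: w) α β c =
      p.2 ^ ((α.card : ℤ) - c.1.1.card) * chainWeight w c.1.1 β c.2 := rfl

variable {K : Type*} [Field K]

/-- The chains with word `w` are in bijection with pairs of a chain with word `w'` and of an index,
in such a way that the weights are multiplied by factors depending on the index only, whose sum
is `G`. -/
def ChainReduces (w w' : List (Bool × LaurentSeries K)) (G : LaurentSeries K) : Prop :=
  ∃ (ι : Type) (g : ι → LaurentSeries K), HasSum g G ∧ ∀ α β, ∃ e : Chain w α β ≃ Chain w' α β × ι,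
    ∀ c, chainWeight w α β c = chainWeight w' α β (e c).1 * g (e c).2

theorem ChainReduces.refl (w : List (Bool × LaurentSeries K)) : ChainReduces w w 1 :=
  ⟨Unit, fun _ => 1, hasSum_unique _, fun _ _ => ⟨(Equiv.prodPUnit _).symm, fun _ => (mul_one _).symm⟩⟩

theorem ChainReduces.trans {w w' w'' : List (Bool × LaurentSeries K)} {G G' : LaurentSeries K}
    (h : ChainReduces w w' G) (h' : ChainReduces w' w'' G') : ChainReduces w w'' (G' * G) := by
  obtain ⟨ι, g, hg, he⟩ := h
  obtain ⟨ι', g', hg', he'⟩ := h'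
  refine ⟨ι' × ι, fun i => g' i.1 * g i.2, hg'.mul_of_nonarchimedean hg, fun α β => ?_⟩
  obtain ⟨e, he⟩ := he α β
  obtain ⟨e', he'⟩ := he' α β
  refine ⟨(e.trans (e'.prodCongr (Equiv.refl ι))).trans (Equiv.prodAssoc _ _ _), fun c => ?_⟩
  rw [he c, he' (e c).1, mul_assoc]
  rfl

theorem ChainReduces.cons {w w' : List (Bool × LaurentSeries K)} {G : LaurentSeries K}
    (p : Bool × LaurentSeries K) (h : ChainReduces w w' G) : ChainReduces (p :: w) (p :: w') G := by
  obtain ⟨ι, g, hg, he⟩ := h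
  choose e he using he
  refine ⟨ι, g, hg, fun α β => ⟨(Equiv.sigmaCongrRight fun γ : {γ // Step p.1 α γ} => e γ.1 β).trans
    (Equiv.sigmaProdDistrib _ _).symm, fun c => ?_⟩⟩
  rw [chainWeight_cons, he, ← mul_assoc]
  rfl

theorem ChainReduces.append_left {w w' : List (Bool × LaurentSeries K)} {G : LaurentSeries K}
    (l : List (Bool × LaurentSeries K)) (h : ChainReduces w w' G) :
    ChainReduces (l ++ w) (l ++ w') G := by
  induction l with
  | nil => exact h
  | cons p l ih => exact ih.cons p

theorem ChainReduces.hasSum {w w' : List (Bool × LaurentSeries K)} {G S : LaurentSeries K}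
    (h : ChainReduces w w' G) {α β : YoungDiagram} (hS : HasSum (chainWeight w' α β) S) :
    HasSum (chainWeight w α β) (S * G) := by
  obtain ⟨ι, g, hg, he⟩ := h
  obtain ⟨e, he⟩ := he α β
  have h1 := hS.mul_of_nonarchimedean hg
  rw [← e.hasSum_iff] at h1
  exact h1.congr_fun he

/-- The bijection of chains induced by a bijection of the partitions in the second position. -/
def chainEquiv {F : Type*} {d e d' e' : Bool} {ι : Type} {α : YoungDiagram}
    (T : ∀ γ, {ρ // Step d α ρ ∧ Step e ρ γ} ≃ {ρ // Step d' α ρ ∧ Step e' ρ γ} × ι)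
    (u v u' v' : F) (w : List (Bool × F)) (β : YoungDiagram) :
    Chain ((d, u) :: (e, v) :: w) α β ≃ Chain ((d', u') :: (e', v') :: w) α β × ι where
  toFun c :=
    let x := T c.2.1.1 ⟨c.1.1, c.1.2, c.2.1.2⟩
    (⟨⟨x.1.1, x.1.2.1⟩, ⟨⟨c.2.1.1, x.1.2.2⟩, c.2.2⟩⟩, x.2)
  invFun c :=
    let x := (T c.1.2.1.1).symm (⟨c.1.1.1, c.1.1.2, c.1.2.1.2⟩, c.2)
    ⟨⟨x.1, x.2.1⟩, ⟨⟨c.1.2.1.1, x.2.2⟩, c.1.2.2⟩⟩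
  left_inv := fun ⟨⟨ρ, h⟩, ⟨⟨γ, h'⟩, c⟩⟩ =>
    congrArg (fun y : {ρ // Step d α ρ ∧ Step e ρ γ} =>
      (⟨⟨y.1, y.2.1⟩, ⟨⟨γ, y.2.2⟩, c⟩⟩ : Chain ((d, u) :: (e, v) :: w) α β))
      ((T γ).symm_apply_apply ⟨ρ, h, h'⟩)
  right_inv := fun ⟨⟨⟨ρ, h⟩, ⟨⟨γ, h'⟩, c⟩⟩, n⟩ =>
    congrArg (fun y : {ρ // Step d' α ρ ∧ Step e' ρ γ} × ι =>
      ((⟨⟨y.1.1, y.1.2.1⟩, ⟨⟨γ, y.1.2.2⟩, c⟩⟩ : Chain ((d', u') :: (e', v') :: w) α β), y.2))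
      ((T γ).apply_symm_apply (⟨ρ, h, h'⟩, n))

theorem chainReduces_of_equiv {d e d' e' : Bool} {ι : Type} {u v u' v' : LaurentSeries K}
    (T : ∀ α γ, {ρ // Step d α ρ ∧ Step e ρ γ} ≃ {ρ // Step d' α ρ ∧ Step e' ρ γ} × ι)
    (g : ι → LaurentSeries K) {G : LaurentSeries K} (hg : HasSum g G)
    (hT : ∀ α γ ρ, u ^ ((α.card : ℤ) - ρ.1.card) * v ^ ((ρ.1.card : ℤ) - γ.card) =
      u' ^ ((α.card : ℤ) - (T α γ ρ).1.1.card) * v' ^ (((T α γ ρ).1.1.card : ℤ) - γ.card) *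
        g (T α γ ρ).2) (w : List (Bool × LaurentSeries K)) :
    ChainReduces ((d, u) :: (e, v) :: w) ((d', u') :: (e', v') :: w) G := by
  refine ⟨ι, g, hg, fun α β => ⟨chainEquiv (T α) u v u' v' w β, ?_⟩⟩
  rintro ⟨⟨ρ, h⟩, ⟨⟨γ, h'⟩, c⟩⟩
  have := hT α γ ⟨ρ, h, h'⟩
  change u ^ ((α.card : ℤ) - ρ.card) * (v ^ ((ρ.card : ℤ) - γ.card) * chainWeight w γ β c) =
    u' ^ ((α.card : ℤ) - (T α γ ⟨ρ, h, h'⟩).1.1.card) *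
      (v' ^ (((T α γ ⟨ρ, h, h'⟩).1.1.card : ℤ) - γ.card) * chainWeight w γ β c) *
        g (T α γ ⟨ρ, h, h'⟩).2
  linear_combination chainWeight w γ β c * this

theorem hasSum_geometric {x : LaurentSeries K} (hx : ∀ j ≤ 0, x.coeff j = 0) :
    HasSum (fun n : ℕ => x ^ n) (1 - x)⁻¹ := by
  have hpow : ∀ n : ℕ, ∀ j < (n : ℤ), (x ^ n).coeff j = 0 := by
    intro n
    induction n with
    | zero =>
      intro j hj
      rw [pow_zero]
      exact HahnSeries.coeff_single_of_ne (by push_cast at hj; omega)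
    | succ n ih =>
      intro j hj
      rw [pow_succ, LaurentSeries.coeff_mul_eq_sum_Icc ih (b := 1) (fun j hj => hx j (by omega))]
      refine Finset.sum_eq_zero fun i hi => ?_
      rw [Finset.mem_Icc] at hi
      push_cast at hj
      omega
  have hs : Summable fun n : ℕ => x ^ n := by
    refine LaurentSeries.summable_of_finite fun m => (Set.finite_Iio m.toNat).subset ?_
    rintro n ⟨j, hj, hne⟩
    have : ¬ j < n := fun h => hne (hpow n j h)
    simp only [Set.mem_Iio]
    omega
  have h1 := hs.tsum_eq_zero_add
  simp only [pow_succ', pow_zero] at h1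
  rw [tsum_mul_left] at h1
  have h2 : (1 - x) * ∑' n : ℕ, x ^ n = 1 := by
    linear_combination h1
  rw [← eq_inv_of_mul_eq_one_right h2]
  exact hs.hasSum

/-- `peakEquiv` in terms of the steps of a chain. -/
noncomputable def upDownEquiv (α γ : YoungDiagram) :
    {ρ // Step true α ρ ∧ Step false ρ γ} ≃ {ρ // Step false α ρ ∧ Step true ρ γ} × ℕ :=
  peakEquiv α γ

/-- The exchange of an ascending step with a descending step. -/
theorem chainReduces_up_down {u v : LaurentSeries K} (hu : u ≠ 0) (hv : v ≠ 0)
    (huv : ∀ j ≤ 0, (v / u).coeff j = 0) (w : List (Bool × LaurentSeries K)) :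
    ChainReduces ((true, u) :: (false, v) :: w) ((false, v) :: (true, u) :: w) (1 - v / u)⁻¹ := by
  refine chainReduces_of_equiv upDownEquiv (fun n => (v / u) ^ n)
    (hasSum_geometric huv) (fun α γ ρ => ?_) w
  have h : (ρ.1.card : ℤ) + (upDownEquiv α γ ρ).1.1.card =
      α.card + γ.card + (upDownEquiv α γ ρ).2 := by
    exact_mod_cast card_peakToggle (α := α) (β := γ) ρ
  generalize ((upDownEquiv α γ ρ).1.1.card : ℤ) = b at h ⊢
  generalize (upDownEquiv α γ ρ).2 = n at h ⊢
  generalize (ρ.1.card : ℤ) = a at h ⊢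
  obtain rfl : a = α.card + γ.card + n - b := by omega
  rw [show (α.card : ℤ) - (α.card + γ.card + n - b) = (b - γ.card) - n by ring,
    show (α.card : ℤ) + γ.card + n - b - γ.card = (α.card - b) + n by ring, zpow_sub₀ hu,
    zpow_add₀ hv, zpow_natCast, zpow_natCast, div_pow]
  ring

/-- `middleToggle` in terms of two ascending steps of a chain. -/
noncomputable def upUpEquiv (α γ : YoungDiagram) :
    {ρ // Step true α ρ ∧ Step true ρ γ} ≃ {ρ // Step true α ρ ∧ Step true ρ γ} × Unit :=
  Equiv.trans (β := {ρ // Interlace α ρ ∧ Interlace ρ γ})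
    ⟨fun ρ => middleToggle ρ, fun ρ => middleToggle ρ, fun ρ => middleToggle_middleToggle ρ,
      fun ρ => middleToggle_middleToggle ρ⟩ (Equiv.prodPUnit _).symm

/-- The exchange of two ascending steps. -/
theorem chainReduces_up_up {u v : LaurentSeries K} (w : List (Bool × LaurentSeries K)) :
    ChainReduces ((true, u) :: (true, v) :: w) ((true, v) :: (true, u) :: w) 1 := by
  refine chainReduces_of_equiv upUpEquiv (fun _ => 1) (hasSum_unique _) (fun α γ ρ => ?_) w
  have h : (ρ.1.card : ℤ) + (upUpEquiv α γ ρ).1.1.card = α.card + γ.card := by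
    exact_mod_cast card_middleToggle (α := α) (β := γ) ρ
  generalize ((upUpEquiv α γ ρ).1.1.card : ℤ) = b at h ⊢
  generalize (ρ.1.card : ℤ) = a at h ⊢
  rw [show (α.card : ℤ) - a = b - γ.card by omega, show a - (γ.card : ℤ) = α.card - b by omega,
    mul_one, mul_comm]

/-- `middleToggle` in terms of two descending steps of a chain. -/
noncomputable def downDownEquiv (α γ : YoungDiagram) :
    {ρ // Step false α ρ ∧ Step false ρ γ} ≃ {ρ // Step false α ρ ∧ Step false ρ γ} × Unit :=
  let s : {ρ // Step false α ρ ∧ Step false ρ γ} ≃ {ρ // Step true γ ρ ∧ Step true ρ α} :=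
    Equiv.subtypeEquivRight fun _ => and_comm
  (s.trans (upUpEquiv γ α)).trans (s.symm.prodCongr (Equiv.refl Unit))

/-- The exchange of two descending steps. -/
theorem chainReduces_down_down {u v : LaurentSeries K} (w : List (Bool × LaurentSeries K)) :
    ChainReduces ((false, u) :: (false, v) :: w) ((false, v) :: (false, u) :: w) 1 := by
  refine chainReduces_of_equiv downDownEquiv (fun _ => 1) (hasSum_unique _) (fun α γ ρ => ?_) w
  have h : (ρ.1.card : ℤ) + (downDownEquiv α γ ρ).1.1.card = γ.card + α.card := by
    exact_mod_cast card_middleToggle (α := γ) (β := α) ⟨ρ.1, ρ.2.2, ρ.2.1⟩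
  generalize ((downDownEquiv α γ ρ).1.1.card : ℤ) = b at h ⊢
  generalize (ρ.1.card : ℤ) = a at h ⊢
  rw [show (α.card : ℤ) - a = b - γ.card by omega, show a - (γ.card : ℤ) = α.card - b by omega,
    mul_one, mul_comm]

theorem chainReduces_move {p : Bool × LaurentSeries K} {f : Bool × LaurentSeries K → LaurentSeries K}
    (r l : List (Bool × LaurentSeries K))
    (h : ∀ q ∈ l, ∀ w, ChainReduces (p :: q :: w) (q :: p :: w) (f q)) :
    ChainReduces (p :: (l ++ r)) (l ++ p :: r) (l.map f).prod := by
  induction l with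
  | nil => exact ChainReduces.refl _
  | cons q l ih =>
    have h1 := h q (by simp) (l ++ r)
    have h2 := (ih fun q hq => h q (by simp [hq])).cons q
    rw [List.map_cons, List.prod_cons, mul_comm]
    exact h1.trans h2

/-- The product of the factors arising from the inversions of a word, which are the pairs of an
ascending step and a later descending step. -/
noncomputable def invProd : List (Bool × LaurentSeries K) → LaurentSeries K
  | [] => 1
  | p :: w => (if p.1 = true then
      ((w.filter fun q => !q.1).map fun q => (1 - q.2 / p.2)⁻¹).prod else 1) * invProd w

/-- The letters of a word, with the descending steps in front, and with the order of the steps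
of each direction reversed. -/
def sortWord {F : Type*} (w : List (Bool × F)) : List (Bool × F) :=
  (w.filter fun q => !q.1).reverse ++ (w.filter fun q => q.1).reverse

/-- Sorting a word: every inversion is removed by exchanging a local maximum with a local minimum,
which contributes a geometric series, and steps of equal direction are permuted at no cost. The
hypothesis on the coefficients makes the geometric series converge. -/
theorem chainReduces_sortWord (w : List (Bool × LaurentSeries K)) (h0 : ∀ p ∈ w, p.2 ≠ 0)
    (h : w.Pairwise fun p q => p.1 = true → q.1 = false → ∀ j ≤ 0, (q.2 / p.2).coeff j = 0) :
    ChainReduces w (sortWord w) (invProd w) := by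
  induction w with
  | nil => exact ChainReduces.refl _
  | cons p w ih =>
    rw [List.pairwise_cons] at h
    have h1 := (ih (fun q hq => h0 q (by simp [hq])) h.2).cons p
    obtain ⟨d, u⟩ := p
    cases d
    · have h2 := chainReduces_move (p := (false, u)) (f := fun _ => 1)
        (w.filter fun q => q.1).reverse (w.filter fun q => !q.1).reverse fun q hq w' => by
          obtain ⟨e, v⟩ := q
          have : e = false := by simpa using (List.mem_filter.1 (List.mem_reverse.1 hq)).2
          subst this
          exact chainReduces_down_down w'
      have h3 := h1.trans h2
      simpa [invProd, sortWord] using h3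
    · have h2 := chainReduces_move (p := (true, u)) (f := fun q => (1 - q.2 / u)⁻¹)
        ((w.filter fun q => q.1).reverse) (w.filter fun q => !q.1).reverse fun q hq w' => by
          have hq := List.mem_filter.1 (List.mem_reverse.1 hq)
          obtain ⟨e, v⟩ := q
          have : e = false := by simpa using hq.2
          subst this
          exact chainReduces_up_down (h0 _ (by simp)) (h0 _ (by simp [hq.1])) (h.1 _ hq.1 rfl rfl) w'
      have h3 := h1.trans h2
      rw [List.map_reverse, List.prod_reverse] at h3
      have h4 := chainReduces_move (p := (true, u)) (f := fun _ => 1) []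
        (w.filter fun q => q.1).reverse fun q hq w' => by
          obtain ⟨e, v⟩ := q
          have : e = true := by simpa using (List.mem_filter.1 (List.mem_reverse.1 hq)).2
          subst this
          exact chainReduces_up_up w'
      have h5 := h3.trans ((by simpa using h4 : ChainReduces _ _ _).append_left _)
      simpa [invProd, sortWord] using h5

end YoungDiagram

namespace YoungDiagram

/-- Sequences of partitions that start at `α`, are equal to `β` from the index `n` on, and whose
first `n` steps have the directions prescribed by the letters `f`. -/
def Seq {F : Type*} (f : ℕ → Bool × F) (n : ℕ) (α β : YoungDiagram) : Type :=
  {ρ : ℕ → YoungDiagram // ρ 0 = α ∧ (∀ j ≥ n, ρ j = β) ∧ ∀ j < n, Step (f j).1 (ρ j) (ρ (j + 1))}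

/-- The decomposition of a sequence into its first step and the remaining sequence. -/
def seqSuccEquiv {F : Type*} (f : ℕ → Bool × F) (n : ℕ) (α β : YoungDiagram) :
    Seq f (n + 1) α β ≃
      Σ γ : {γ // Step (f 0).1 α γ}, Seq (fun j => f (j + 1)) n γ.1 β where
  toFun ρ := ⟨⟨ρ.1 1, by
      have := ρ.2.2.2 0 (Nat.succ_pos n)
      rwa [ρ.2.1] at this⟩,
    ⟨fun j => ρ.1 (j + 1), rfl, fun j hj => ρ.2.2.1 (j + 1) (Nat.succ_le_succ hj),
      fun j hj => ρ.2.2.2 (j + 1) (Nat.succ_lt_succ hj)⟩⟩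
  invFun c := ⟨fun j => Nat.casesOn j α c.2.1, rfl, fun j hj => by
      obtain ⟨j, rfl⟩ : ∃ i, j = i + 1 := ⟨j - 1, by omega⟩
      exact c.2.2.2.1 j (by omega), fun j hj => by
      rcases j with _ | j
      · have := c.1.2
        rwa [← c.2.2.1] at this
      · exact c.2.2.2.2 j (by omega)⟩
  left_inv ρ := by
    refine Subtype.ext (funext fun j => ?_)
    rcases j with _ | j
    · exact ρ.2.1.symm
    · rfl
  right_inv := by
    rintro ⟨⟨γ, hγ⟩, ⟨ρ, h0, h⟩⟩
    dsimp only at h0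
    subst h0
    rfl

/-- Sequences of partitions are chains, whose recursive definition is the one suited to
inductions over the word. -/
theorem exists_seqEquiv {F : Type*} [Field F] (f : ℕ → Bool × F) (n : ℕ) (α β : YoungDiagram) :
    ∃ e : Seq f n α β ≃ Chain ((List.range n).map f) α β, ∀ ρ,
      chainWeight _ α β (e ρ) =
        ∏ j ∈ Finset.range n, (f j).2 ^ (((ρ.1 j).card : ℤ) - (ρ.1 (j + 1)).card) := by
  induction n generalizing f α with
  | zero =>
    refine ⟨⟨fun ρ => ⟨ρ.2.1.symm.trans (ρ.2.2.1 0 le_rfl)⟩,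
      fun h => ⟨fun _ => α, rfl, fun _ _ => h.down, fun j hj => absurd hj (Nat.not_lt_zero j)⟩,
      fun ρ => Subtype.ext (funext fun j => ?_), fun _ => rfl⟩, fun ρ => ?_⟩
    · exact (ρ.2.1.symm.trans (ρ.2.2.1 0 le_rfl)).trans (ρ.2.2.1 j (Nat.zero_le j)).symm
    · rw [Finset.prod_range_zero]
      rfl
  | succ n ih =>
    choose e he using ih (fun j => f (j + 1))
    rw [List.range_succ_eq_map, List.map_cons, List.map_map]
    refine ⟨(seqSuccEquiv f n α β).trans
      (Equiv.sigmaCongrRight fun γ : {γ // Step (f 0).1 α γ} => e γ.1), fun ρ => ?_⟩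
    rw [Finset.prod_range_succ', mul_comm]
    have h := he (ρ.1 1) (seqSuccEquiv f n α β ρ).2
    have h0 := ρ.2.1
    exact (chainWeight_cons _ _ _ _ _).trans (congrArg₂ _ (by rw [h0]; rfl) h)

end YoungDiagram

/-! ### Diagonal slices -/

namespace YoungDiagram

theorem interlace_iff {α β : YoungDiagram} : Interlace α β ↔
    (∀ i j, (i, j) ∈ α.cells → (i, j) ∈ β.cells) ∧
      ∀ i j, (i + 1, j) ∈ β.cells → (i, j) ∈ α.cells := by
  have key : ∀ (γ δ : YoungDiagram) (i k : ℕ), γ.rowLen i ≤ δ.rowLen k ↔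
      ∀ j, (i, j) ∈ γ.cells → (k, j) ∈ δ.cells := by
    intro γ δ i k
    simp only [mem_cells, mem_iff_lt_rowLen]
    exact ⟨fun h j hj => hj.trans_le h, fun h => Nat.le_of_not_lt fun h' => lt_irrefl _ (h _ h')⟩
  simp only [Interlace, key]

theorem interlace_refl (α : YoungDiagram) : Interlace α α :=
  ⟨fun _ => le_rfl, fun i => α.rowLen_anti _ _ (Nat.le_succ i)⟩

theorem step_refl (d : Bool) (α : YoungDiagram) : Step d α α := by
  cases d <;> exact interlace_refl α

variable (nu : YoungDiagram)

theorem mem_cells_iff_lt_path (x y : ℕ) : (x, y) ∈ nu.cells ↔ x < nu.path ((x : ℤ) - y) := by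
  rw [← not_le, nu.path_le_iff, mem_cells, mem_iff_lt_rowLen]
  omega

theorem le_path (c : ℤ) : c ≤ nu.path c := by
  have := (nu.path_le_iff c _).1 le_rfl
  omega

theorem path_of_le {B : ℕ} {nu : YoungDiagram} (h : Partition3D.FitsIn nu B) {c : ℤ}
    (hc : c ≤ -B) : nu.path c = 0 := by
  rw [← Nat.le_zero, nu.path_le_iff]
  have : nu.rowLen 0 ≤ B := Nat.le_of_not_lt fun h' =>
    absurd (h (0, B) (mem_iff_lt_rowLen.2 h')).2 (lt_irrefl _)
  push_cast
  omega

theorem path_of_ge {B : ℕ} {nu : YoungDiagram} (h : Partition3D.FitsIn nu B) {c : ℤ}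
    (hc : B ≤ c) : (nu.path c : ℤ) = c := by
  refine le_antisymm ?_ (nu.le_path c)
  obtain ⟨k, rfl⟩ := Int.eq_ofNat_of_zero_le (by omega : 0 ≤ c)
  rw [Nat.cast_le, nu.path_le_iff]
  have : nu.rowLen k = 0 := by
    by_contra h'
    have := (h (k, 0) (mem_iff_lt_rowLen.2 (Nat.pos_of_ne_zero h'))).1
    omega
  omega

/-- The direction of the step of the boundary path of `nu` from content `c` to content `c + 1`:
`true` if only the second coordinate changes. -/
noncomputable def pathDir (c : ℤ) : Bool := decide (nu.path (c + 1) = nu.path c)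

variable {nu}

theorem step_pathDir_iff {c : ℤ} {α β : YoungDiagram} : Step (nu.pathDir c) α β ↔
    (nu.path (c + 1) = nu.path c → Interlace α β) ∧
      (nu.path (c + 1) = nu.path c + 1 → Interlace β α) := by
  rcases nu.path_succ c with h | h <;> simp [pathDir, h, Step]

end YoungDiagram

namespace Partition3D

variable {lam mu nu : YoungDiagram} {N : ℕ}

/-- The point with third coordinate `z` on the diagonal with content `c`, at the distance `i` from
the boundary path of `nu`. -/
noncomputable def diagPoint (nu : YoungDiagram) (c : ℤ) (i z : ℕ) : Fin 3 → ℕ :=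
  ![nu.path c + i, ((nu.path c : ℤ) + i - c).toNat, z]

theorem diagPoint_content (nu : YoungDiagram) (c : ℤ) (i z : ℕ) :
    (diagPoint nu c i z 0 : ℤ) - diagPoint nu c i z 1 = c := by
  have := nu.le_path c
  simp only [diagPoint, Matrix.cons_val_zero, Matrix.cons_val_one]
  omega

theorem diagPoint_notMem (nu : YoungDiagram) (c : ℤ) (i z : ℕ) :
    (diagPoint nu c i z 0, diagPoint nu c i z 1) ∉ nu.cells := by
  rw [YoungDiagram.mem_cells_iff_lt_path, diagPoint_content]
  simp [diagPoint]

theorem eq_diagPoint {s : Fin 3 → ℕ} (h : (s 0, s 1) ∉ nu.cells) :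
    s = diagPoint nu ((s 0 : ℤ) - s 1) (s 0 - nu.path ((s 0 : ℤ) - s 1)) (s 2) := by
  rw [YoungDiagram.mem_cells_iff_lt_path] at h
  funext i
  fin_cases i <;> simp [diagPoint] <;> omega

theorem vec3_le {s s' : Fin 3 → ℕ} (h0 : s 0 ≤ s' 0) (h1 : s 1 ≤ s' 1) (h2 : s 2 ≤ s' 2) :
    s ≤ s' := by
  intro i
  fin_cases i <;> assumption

theorem IsCutoff.bounds {π : Partition3D} (hN : π.IsCutoff N) {s : Fin 3 → ℕ} (hs : s ∈ π.boxes)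
    (h : (s 0, s 1) ∉ (π.asymp 2).cells) :
    s 2 < N ∧ (N ≤ s 0 → (s 1, s 2) ∈ (π.asymp 0).cells) ∧
      (N ≤ s 1 → (s 2, s 0) ∈ (π.asymp 1).cells) :=
  ⟨Nat.lt_of_not_le fun h' => h (hN.1 s hs 2 h'), hN.1 s hs 0, hN.1 s hs 1⟩

/-- The diagonal slice of `π` with content `c`, outside of the leg along the third axis. -/
noncomputable def slice (π : Partition3D) (c : ℤ) : YoungDiagram where
  cells := Set.Finite.toFinset (s := {p : ℕ × ℕ | diagPoint (π.asymp 2) c p.1 p.2 ∈ π.boxes}) (by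
    obtain ⟨N, hN⟩ := π.exists_isCutoff
    refine (Finset.range (N + c.natAbs) ×ˢ Finset.range N).finite_toSet.subset ?_
    rintro ⟨i, z⟩ h
    have hb := hN.bounds h (diagPoint_notMem _ _ _ _)
    have hc := diagPoint_content (π.asymp 2) c i z
    have h1 : diagPoint (π.asymp 2) c i z 0 = (π.asymp 2).path c + i := rfl
    have h2 : diagPoint (π.asymp 2) c i z 2 = z := rfl
    rw [Finset.coe_product, Set.mem_prod, Finset.coe_range, Finset.coe_range, Set.mem_Iio,
      Set.mem_Iio]
    refine ⟨?_, h2 ▸ hb.1⟩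
    rcases Nat.lt_or_ge (diagPoint (π.asymp 2) c i z 0) N with h0 | h0
    · dsimp only
      omega
    · have := (hN.2 0 _ (hb.2.1 h0)).1
      dsimp only at this ⊢
      omega)
  isLowerSet := by
    rw [Set.Finite.coe_toFinset]
    rintro ⟨i, z⟩ ⟨i', z'⟩ hle h
    obtain ⟨hi, hz⟩ := Prod.mk_le_mk.1 hle
    refine π.lower (vec3_le ?_ ?_ ?_) h <;> simp [diagPoint] <;> omega

theorem mem_slice {π : Partition3D} {c : ℤ} {i z : ℕ} :
    (i, z) ∈ (π.slice c).cells ↔ diagPoint (π.asymp 2) c i z ∈ π.boxes := by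
  simp [slice]

theorem mem_boxes_iff_slice {π : Partition3D} {s : Fin 3 → ℕ} : s ∈ π.boxes ↔
    (s 0, s 1) ∈ (π.asymp 2).cells ∨ (s 0, s 1) ∉ (π.asymp 2).cells ∧
      (s 0 - (π.asymp 2).path ((s 0 : ℤ) - s 1), s 2) ∈ (π.slice ((s 0 : ℤ) - s 1)).cells := by
  by_cases h : (s 0, s 1) ∈ (π.asymp 2).cells
  · exact ⟨fun _ => Or.inl h, fun _ => mem_boxes_of_mem_asymp (k := 2) h⟩
  · rw [mem_slice, ← eq_diagPoint h]
    simp [h]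

theorem step_slice (π : Partition3D) (c : ℤ) :
    YoungDiagram.Step ((π.asymp 2).pathDir c) (π.slice c) (π.slice (c + 1)) := by
  have := (π.asymp 2).le_path c
  have := (π.asymp 2).le_path (c + 1)
  simp only [YoungDiagram.step_pathDir_iff, YoungDiagram.interlace_iff, mem_slice]
  refine ⟨fun h => ⟨fun i z hb => ?_, fun i z hb => ?_⟩,
    fun h => ⟨fun i z hb => ?_, fun i z hb => ?_⟩⟩ <;>
  refine π.lower (vec3_le ?_ ?_ ?_) hb <;> simp [diagPoint, h] <;> omega

/-- Every box of `π` of content at least `N` belongs to the leg along the first axis, and every box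
of content at most `-N` belongs to the leg along the second axis. -/
def IsContentCutoff (π : Partition3D) (N : ℕ) : Prop :=
  ∀ s ∈ π.boxes, ((N : ℤ) ≤ (s 0 : ℤ) - s 1 → (s 1, s 2) ∈ (π.asymp 0).cells) ∧
    ((s 0 : ℤ) - s 1 ≤ -N → (s 2, s 0) ∈ (π.asymp 1).cells)

theorem IsCutoff.isContentCutoff {π : Partition3D} (hN : π.IsCutoff N) : π.IsContentCutoff N :=
  fun s hs => ⟨fun h => hN.1 s hs 0 (by omega), fun h => hN.1 s hs 1 (by omega)⟩

theorem IsContentCutoff.slice_of_ge {π : Partition3D} (hN : π.IsContentCutoff N)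
    (hB : FitsIn (π.asymp 2) N) {c : ℤ} (hc : N ≤ c) : π.slice c = π.asymp 0 := by
  have hp := YoungDiagram.path_of_ge hB hc
  refine YoungDiagram.ext ?_
  ext ⟨i, z⟩
  rw [mem_slice]
  have h1 : diagPoint (π.asymp 2) c i z 1 = i := by simp [diagPoint, hp]
  refine ⟨fun h => ?_, fun h => ?_⟩
  · have := (hN _ h).1 (by rwa [diagPoint_content])
    rwa [h1] at this
  · exact mem_asymp.1 h _ h1 rfl

theorem IsContentCutoff.slice_of_le {π : Partition3D} (hN : π.IsContentCutoff N)
    (hB : FitsIn (π.asymp 2) N) {c : ℤ} (hc : c ≤ -N) : π.slice c = (π.asymp 1).transpose := by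
  have hp := YoungDiagram.path_of_le hB hc
  refine YoungDiagram.ext ?_
  ext ⟨i, z⟩
  rw [mem_slice, YoungDiagram.mem_cells, YoungDiagram.mem_transpose, ← YoungDiagram.mem_cells]
  have h1 : diagPoint (π.asymp 2) c i z 0 = i := by simp [diagPoint, hp]
  refine ⟨fun h => ?_, fun h => ?_⟩
  · have := (hN _ h).2 (by rwa [diagPoint_content])
    rwa [h1] at this
  · exact mem_asymp.1 h _ rfl h1

/-- The set of boxes with given diagonal slices. -/
def sliceBoxes (nu : YoungDiagram) (ρ : ℤ → YoungDiagram) : Set (Fin 3 → ℕ) :=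
  {s | (s 0, s 1) ∈ nu.cells ∨ (s 0, s 1) ∉ nu.cells ∧
      (s 0 - nu.path ((s 0 : ℤ) - s 1), s 2) ∈ (ρ ((s 0 : ℤ) - s 1)).cells}

theorem isLowerSet_of_succ {S : Set (Fin 3 → ℕ)}
    (h0 : ∀ a b c, ![a + 1, b, c] ∈ S → ![a, b, c] ∈ S)
    (h1 : ∀ a b c, ![a, b + 1, c] ∈ S → ![a, b, c] ∈ S)
    (h2 : ∀ a b c, ![a, b, c + 1] ∈ S → ![a, b, c] ∈ S) : IsLowerSet S := by
  intro s s' hle hs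
  have e : ∀ v : Fin 3 → ℕ, v = ![v 0, v 1, v 2] := fun v => by
    funext i
    fin_cases i <;> rfl
  rw [e s] at hs
  rw [e s']
  have a0 : ∀ n b c, ![s' 0 + n, b, c] ∈ S → ![s' 0, b, c] ∈ S := by
    intro n b c
    induction n with
    | zero => exact id
    | succ n ih => exact fun h => ih (h0 _ _ _ h)
  have a1 : ∀ n a c, ![a, s' 1 + n, c] ∈ S → ![a, s' 1, c] ∈ S := by
    intro n a c
    induction n with
    | zero => exact id
    | succ n ih => exact fun h => ih (h1 _ _ _ h)
  have a2 : ∀ n a b, ![a, b, s' 2 + n] ∈ S → ![a, b, s' 2] ∈ S := by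
    intro n a b
    induction n with
    | zero => exact id
    | succ n ih => exact fun h => ih (h2 _ _ _ h)
  obtain ⟨n0, hn0⟩ := Nat.exists_eq_add_of_le (hle 0)
  obtain ⟨n1, hn1⟩ := Nat.exists_eq_add_of_le (hle 1)
  obtain ⟨n2, hn2⟩ := Nat.exists_eq_add_of_le (hle 2)
  rw [hn0, hn1, hn2] at hs
  exact a0 _ _ _ (a1 _ _ _ (a2 _ _ _ hs))

theorem isLowerSet_sliceBoxes {ρ : ℤ → YoungDiagram}
    (hρ : ∀ c, YoungDiagram.Step (nu.pathDir c) (ρ c) (ρ (c + 1))) :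
    IsLowerSet (sliceBoxes nu ρ) := by
  simp only [YoungDiagram.step_pathDir_iff, YoungDiagram.interlace_iff] at hρ
  refine isLowerSet_of_succ ?_ ?_ ?_ <;> intro a b c h <;>
    simp only [sliceBoxes, Set.mem_ofPred_eq, Matrix.cons_val_zero, Matrix.cons_val_one,
      Matrix.cons_val_two, Matrix.tail_cons, Matrix.head_cons] at h ⊢ <;>
    by_cases hn : (a, b) ∈ nu.cells
  · exact Or.inl hn
  · refine Or.inr ⟨hn, ?_⟩
    rcases h with h | ⟨h', h⟩
    · exact absurd (nu.isLowerSet (Prod.mk_le_mk.2 ⟨Nat.le_succ a, le_rfl⟩) h) hn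
    · rw [YoungDiagram.mem_cells_iff_lt_path] at hn h'
      have e : ((a + 1 : ℕ) : ℤ) - b = (a : ℤ) - b + 1 := by push_cast; ring
      rw [e] at h h'
      rcases nu.path_succ ((a : ℤ) - b) with hp | hp
      · refine ((hρ _).1 hp).2 _ _ ?_
        rw [hp] at h
        rwa [show a - nu.path ((a : ℤ) - b) + 1 = a + 1 - nu.path ((a : ℤ) - b) by omega]
      · have := ((hρ _).2 hp).1 _ _ h
        rw [hp] at this
        rwa [show a - nu.path ((a : ℤ) - b) = a + 1 - (nu.path ((a : ℤ) - b) + 1) by omega]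
  · exact Or.inl hn
  · refine Or.inr ⟨hn, ?_⟩
    rcases h with h | ⟨h', h⟩
    · exact absurd (nu.isLowerSet (Prod.mk_le_mk.2 ⟨le_rfl, Nat.le_succ b⟩) h) hn
    · rw [YoungDiagram.mem_cells_iff_lt_path] at hn h'
      have e : (a : ℤ) - b = (a : ℤ) - ((b + 1 : ℕ) : ℤ) + 1 := by push_cast; ring
      rw [e] at hn ⊢
      generalize (a : ℤ) - ((b + 1 : ℕ) : ℤ) = c' at *
      rcases nu.path_succ c' with hp | hp
      · have := ((hρ _).1 hp).1 _ _ h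
        rwa [hp]
      · refine ((hρ _).2 hp).2 _ _ ?_
        rwa [hp, show a - (nu.path c' + 1) + 1 = a - nu.path c' by omega]
  · exact Or.inl hn
  · refine Or.inr ⟨hn, ?_⟩
    rcases h with h | ⟨h', h⟩
    · exact absurd h hn
    · exact (ρ _).isLowerSet (Prod.mk_le_mk.2 ⟨le_rfl, Nat.le_succ c⟩) h

end Partition3D

namespace Partition3D

variable {lam mu nu : YoungDiagram} {N : ℕ} {ρ : ℤ → YoungDiagram}

theorem mem_sliceBoxes_of_ge (hge : ∀ c ≥ (N : ℤ), ρ c = lam) (hB : FitsIn nu N)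
    {s : Fin 3 → ℕ} (hs : (N : ℤ) ≤ (s 0 : ℤ) - s 1) :
    s ∈ sliceBoxes nu ρ ↔ (s 1, s 2) ∈ lam.cells := by
  have hp := YoungDiagram.path_of_ge hB hs
  have hn : (s 0, s 1) ∉ nu.cells := fun h => by
    have := (hB _ h).1
    dsimp only at this
    omega
  rw [sliceBoxes, Set.mem_ofPred_eq, hge _ hs,
    show s 0 - nu.path ((s 0 : ℤ) - s 1) = s 1 by omega]
  simp [hn]

theorem mem_sliceBoxes_of_le (hle : ∀ c ≤ -(N : ℤ), ρ c = mu.transpose) (hB : FitsIn nu N)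
    {s : Fin 3 → ℕ} (hs : (s 0 : ℤ) - s 1 ≤ -N) :
    s ∈ sliceBoxes nu ρ ↔ (s 2, s 0) ∈ mu.cells := by
  have hp := YoungDiagram.path_of_le hB hs
  have hn : (s 0, s 1) ∉ nu.cells := fun h => by
    have := (hB _ h).2
    dsimp only at this
    omega
  rw [sliceBoxes, Set.mem_ofPred_eq, hle _ hs, hp, Nat.sub_zero, YoungDiagram.mem_cells (c := (s 0, s 2)),
    YoungDiagram.mem_transpose]
  simp [hn]

theorem exists_fitsIn_slices (hle : ∀ c ≤ -(N : ℤ), ρ c = mu.transpose)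
    (hge : ∀ c ≥ (N : ℤ), ρ c = lam) : ∃ R, ∀ c, FitsIn (ρ c) R := by
  have h1 : ∀ α : YoungDiagram, ∃ R, FitsIn α R := fun α => by
    obtain ⟨R, h, -⟩ := exists_fitsIn α ⊥ ⊥
    exact ⟨R, h⟩
  choose r hr using h1
  refine ⟨(Finset.Icc (-(N : ℤ)) N).sup fun c => r (ρ c), fun c x hx => ?_⟩
  obtain ⟨c', hc', e⟩ : ∃ c' ∈ Finset.Icc (-(N : ℤ)) N, ρ c' = ρ c := by
    rcases le_total c (-N) with h | h
    · exact ⟨-N, Finset.mem_Icc.2 ⟨le_rfl, by omega⟩, by rw [hle c h, hle _ le_rfl]⟩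
    · rcases le_total c N with h' | h'
      · exact ⟨c, Finset.mem_Icc.2 ⟨h, h'⟩, rfl⟩
      · exact ⟨N, Finset.mem_Icc.2 ⟨by omega, le_rfl⟩, by rw [hge c h', hge _ le_rfl]⟩
  have h2 := hr _ x hx
  have h3 := Finset.le_sup (f := fun c => r (ρ c)) hc'
  simp only [e] at h3
  omega

/-- The three-dimensional partition with given diagonal slices. -/
def ofSlices (hρ : ∀ c, YoungDiagram.Step (nu.pathDir c) (ρ c) (ρ (c + 1)))
    (hle : ∀ c ≤ -(N : ℤ), ρ c = mu.transpose) (hge : ∀ c ≥ (N : ℤ), ρ c = lam)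
    (hB : FitsIn nu N) : Partition3D where
  boxes := sliceBoxes nu ρ
  lower := isLowerSet_sliceBoxes hρ
  bounded := by
    obtain ⟨R, hR⟩ := exists_fitsIn_slices hle hge
    refine ⟨N + R, fun s hs => ?_⟩
    have h01 : s 0 ≤ N + R ∨ s 1 ≤ N + R := by
      by_contra! hc
      have hn : (s 0, s 1) ∉ nu.cells := fun h => by
        have := (hB _ h).1
        dsimp only at this
        omega
      have h1 := (hs.resolve_left hn).2
      have h2 := (hR _ _ h1).1
      rw [YoungDiagram.mem_cells_iff_lt_path] at hn
      dsimp only at h2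
      rcases le_total (N : ℤ) ((s 0 : ℤ) - s 1) with h | h
      · have := YoungDiagram.path_of_ge hB h
        omega
      · have := (nu.path_le_iff ((s 0 : ℤ) - s 1) N).2 (by
          have := YoungDiagram.path_of_ge hB (c := N) le_rfl
          have := (nu.path_le_iff N N).1 (by omega)
          omega)
        omega
    have h2 : s 2 ≤ R ∨ (s 0 ≤ N + R ∧ s 1 ≤ N + R) := by
      rcases hs with h | h
      · have := hB _ h
        dsimp only at this
        omega
      · have := hR _ _ h.2
        dsimp only at this
        omega
    intro i j
    fin_cases i <;> fin_cases j <;> simp <;> omega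

variable (hρ : ∀ c, YoungDiagram.Step (nu.pathDir c) (ρ c) (ρ (c + 1)))
  (hle : ∀ c ≤ -(N : ℤ), ρ c = mu.transpose) (hge : ∀ c ≥ (N : ℤ), ρ c = lam) (hB : FitsIn nu N)

theorem ofSlices_mem_withAsymp : ofSlices hρ hle hge hB ∈ withAsymp lam mu nu := by
  refine ⟨YoungDiagram.ext ?_, YoungDiagram.ext ?_, YoungDiagram.ext ?_⟩ <;> ext ⟨a, b⟩ <;>
    rw [mem_asymp]
  · refine ⟨fun h => ?_, fun h s h1 h2 => ?_⟩
    · have := h ![a + N, a, b] rfl rfl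
      exact (mem_sliceBoxes_of_ge hge hB (by simp)).1 this
    · change s 1 = a at h1
      change s 2 = b at h2
      refine (ofSlices hρ hle hge hB).lower (a := ![s 0 + s 1 + N, s 1, s 2])
        (vec3_le (by simp; omega) le_rfl le_rfl) ?_
      refine (mem_sliceBoxes_of_ge hge hB (by simp; omega)).2 ?_
      simpa [h1, h2] using h
  · refine ⟨fun h => ?_, fun h s h1 h2 => ?_⟩
    · have := h ![b, b + N, a] rfl rfl
      exact (mem_sliceBoxes_of_le hle hB (by simp)).1 this
    · change s 2 = a at h1
      change s 0 = b at h2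
      refine (ofSlices hρ hle hge hB).lower (a := ![s 0, s 1 + s 0 + N, s 2])
        (vec3_le le_rfl (by simp; omega) le_rfl) ?_
      refine (mem_sliceBoxes_of_le hle hB (by simp)).2 ?_
      simpa [h1, h2] using h
  · refine ⟨fun h => ?_, fun h s h1 h2 => ?_⟩
    · obtain ⟨R, hR⟩ := exists_fitsIn_slices hle hge
      rcases h ![a, b, R] rfl rfl with h | h
      · exact h
      · exact absurd (hR _ _ h.2).2 (lt_irrefl R)
    · change s 0 = a at h1
      change s 1 = b at h2
      rw [← h1, ← h2] at h
      exact Or.inl h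

theorem ofSlices_isContentCutoff : (ofSlices hρ hle hge hB).IsContentCutoff N := by
  obtain ⟨e0, e1, -⟩ := ofSlices_mem_withAsymp hρ hle hge hB
  refine fun s hs => ⟨fun h => ?_, fun h => ?_⟩
  · rw [e0]
    exact (mem_sliceBoxes_of_ge hge hB h).1 hs
  · rw [e1]
    exact (mem_sliceBoxes_of_le hle hB h).1 hs

theorem slice_ofSlices (c : ℤ) : (ofSlices hρ hle hge hB).slice c = ρ c := by
  obtain ⟨-, -, e2⟩ := ofSlices_mem_withAsymp hρ hle hge hB
  refine YoungDiagram.ext ?_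
  ext ⟨i, z⟩
  rw [mem_slice, e2]
  change diagPoint nu c i z ∈ sliceBoxes nu ρ ↔ _
  rw [sliceBoxes, Set.mem_ofPred_eq, or_iff_right (diagPoint_notMem _ _ _ _),
    and_iff_right (diagPoint_notMem _ _ _ _), diagPoint_content]
  simp [diagPoint]

theorem slice_injective {π π' : Partition3D} (h2 : π.asymp 2 = π'.asymp 2)
    (h : ∀ c, π.slice c = π'.slice c) : π = π' := by
  refine ext_boxes (Set.ext fun s => ?_)
  rw [mem_boxes_iff_slice, mem_boxes_iff_slice, h2, h]

/-- Three-dimensional partitions correspond to the sequences of their diagonal slices. -/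
theorem exists_sliceEquiv {F : Type*} (lam mu : YoungDiagram) (hB : FitsIn nu N) (u : ℤ → F) :
    ∃ e : {π // π ∈ withAsymp lam mu nu ∧ π.IsContentCutoff N} ≃
      YoungDiagram.Seq (fun j : ℕ => (nu.pathDir ((j : ℤ) - N), u ((j : ℤ) - N))) (2 * N)
        mu.transpose lam, ∀ π j, (e π).1 j = π.1.slice ((j : ℤ) - N) := by
  have hfit : ∀ {π : Partition3D}, π ∈ withAsymp lam mu nu → FitsIn (π.asymp 2) N :=
    fun h => h.2.2 ▸ hB
  let f : {π // π ∈ withAsymp lam mu nu ∧ π.IsContentCutoff N} →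
      YoungDiagram.Seq (fun j : ℕ => (nu.pathDir ((j : ℤ) - N), u ((j : ℤ) - N))) (2 * N)
        mu.transpose lam := fun π => ⟨fun j => π.1.slice ((j : ℤ) - N), by
      dsimp only
      rw [π.2.2.slice_of_le (hfit π.2.1) (by simp), π.2.1.2.1], fun j hj => by
      dsimp only
      rw [π.2.2.slice_of_ge (hfit π.2.1) (by omega), π.2.1.1], fun j _ => by
      have := π.1.step_slice ((j : ℤ) - N)
      rw [π.2.1.2.2] at this
      dsimp only
      rwa [show (((j + 1 : ℕ) : ℤ) - N) = (j : ℤ) - N + 1 by push_cast; ring]⟩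
  have hf : Function.Bijective f := by
    constructor
    · intro π π' h
      have h' : ∀ j : ℕ, π.1.slice ((j : ℤ) - N) = π'.1.slice ((j : ℤ) - N) := fun j =>
        congrFun (congrArg Subtype.val h) j
      refine Subtype.ext (slice_injective (π.2.1.2.2.trans π'.2.1.2.2.symm) fun c => ?_)
      rcases le_total c (-N) with hc | hc
      · rw [π.2.2.slice_of_le (hfit π.2.1) hc, π'.2.2.slice_of_le (hfit π'.2.1) hc, π.2.1.2.1,
          π'.2.1.2.1]
      · have := h' (c + N).toNat
        rwa [show (((c + N).toNat : ℕ) : ℤ) - N = c by omega] at this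
    · intro σ
      have hge : ∀ c ≥ (N : ℤ), σ.1 (c + N).toNat = lam := fun c hc => σ.2.2.1 _ (by omega)
      have hle : ∀ c ≤ -(N : ℤ), σ.1 (c + N).toNat = mu.transpose := fun c hc => by
        rw [show (c + N).toNat = 0 by omega, σ.2.1]
      have hρ : ∀ c, YoungDiagram.Step (nu.pathDir c) (σ.1 (c + N).toNat)
          (σ.1 (c + 1 + N).toNat) := fun c => by
        rcases lt_or_ge c (-N) with hc | hc
        · rw [hle c hc.le, hle (c + 1) (by omega)]
          exact YoungDiagram.step_refl _ _
        · rcases lt_or_ge c N with hc' | hc'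
          · have := σ.2.2.2 (c + N).toNat (by omega)
            dsimp only at this
            rwa [show (c + N).toNat + 1 = (c + 1 + N).toNat by omega,
              show (((c + N).toNat : ℕ) : ℤ) - N = c by omega] at this
          · rw [hge c hc', hge (c + 1) (by omega)]
            exact YoungDiagram.step_refl _ _
      refine ⟨⟨ofSlices (ρ := fun c => σ.1 (c + N).toNat) hρ hle hge hB, ofSlices_mem_withAsymp _ _ _ _,
        ofSlices_isContentCutoff _ _ _ _⟩, Subtype.ext (funext fun j => ?_)⟩
      refine (slice_ofSlices (ρ := fun c => σ.1 (c + N).toNat) hρ hle hge hB _).trans ?_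
      dsimp only
      rw [show ((j : ℤ) - N + N).toNat = j by omega]
  exact ⟨Equiv.ofBijective f hf, fun _ _ => rfl⟩

end Partition3D

/-! ### The weight of a partition in terms of its slices -/

namespace Partition3D

variable {lam mu nu : YoungDiagram} {N : ℕ} {π : Partition3D}

theorem sum_Ico_mul_sub {a b : ℤ} (hab : a ≤ b) (g s : ℤ → ℤ) :
    ∑ c ∈ Finset.Ico a b, g c * (s c - s (c + 1)) =
      g (a - 1) * s a - g (b - 1) * s b + ∑ c ∈ Finset.Ico a b, (g c - g (c - 1)) * s c := by
  induction b, hab using Int.leInduction with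
  | base => simp
  | succ b hab ih =>
    rw [← Finset.insert_Ico_right_eq_Ico_add_one hab, Finset.sum_insert (by simp),
      Finset.sum_insert (by simp), ih, add_sub_cancel_right]
    ring

theorem sum_slice (hN : π.IsCutoff N) (h : ℤ → ℤ) :
    ∑ c ∈ Finset.Ico (-(N : ℤ)) N, h c * (π.slice c).card =
      ∑ s ∈ π.coreBoxes (2 * N + 1) with (s 0, s 1) ∉ (π.asymp 2).cells ∧
        -(N : ℤ) ≤ (s 0 : ℤ) - s 1 ∧ (s 0 : ℤ) - s 1 < N, h ((s 0 : ℤ) - s 1) := by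
  have e : ∀ c, h c * ((π.slice c).card : ℤ) = ∑ _p ∈ (π.slice c).cells, h c := fun c => by
    rw [Finset.sum_const, nsmul_eq_mul, mul_comm]
  simp only [e]
  rw [Finset.sum_sigma']
  refine Finset.sum_bij' (fun p _ => diagPoint (π.asymp 2) p.1 p.2.1 p.2.2)
    (fun s _ => ⟨(s 0 : ℤ) - s 1, (s 0 - (π.asymp 2).path ((s 0 : ℤ) - s 1), s 2)⟩) ?_ ?_ ?_ ?_ ?_
  · rintro ⟨c, i, z⟩ hp
    obtain ⟨hc, hp⟩ := Finset.mem_sigma.1 hp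
    rw [Finset.mem_Ico] at hc
    rw [mem_slice] at hp
    have hb := hN.bounds hp (diagPoint_notMem _ _ _ _)
    have h1 := diagPoint_content (π.asymp 2) c i z
    rw [Finset.mem_filter, mem_coreBoxes]
    refine ⟨⟨?_, hp⟩, diagPoint_notMem _ _ _ _, by simpa only [diagPoint_content] using hc⟩
    dsimp only at hc hb ⊢
    have h2 : diagPoint (π.asymp 2) c i z 0 < 2 * N ∧ diagPoint (π.asymp 2) c i z 1 < 2 * N + 1 := by
      rcases Nat.lt_or_ge (diagPoint (π.asymp 2) c i z 0) N with h0 | h0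
      · omega
      · have := (hN.2 0 _ (hb.2.1 h0)).1
        dsimp only at this
        omega
    intro k
    fin_cases k
    · exact h2.1.trans (Nat.lt_succ_self _)
    · exact h2.2
    · exact hb.1.trans (by omega)
  · intro s hs
    obtain ⟨hs, hn, hc⟩ := Finset.mem_filter.1 hs
    rw [Finset.mem_sigma, Finset.mem_Ico]
    exact ⟨hc, ((mem_boxes_iff_slice.1 (mem_coreBoxes.1 hs).2).resolve_left hn).2⟩
  · rintro ⟨c, i, z⟩ _
    have := diagPoint_content (π.asymp 2) c i z
    simp only [this]
    simp [diagPoint]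
  · intro s hs
    exact (eq_diagPoint (Finset.mem_filter.1 hs).2.1).symm
  · rintro ⟨c, i, z⟩ _
    dsimp only
    rw [diagPoint_content]

/-- A weighted sum of the sizes of the slices as a sum over boxes. The last two sums account for the
boxes of the legs that are counted by the slices but do not lie in the cube `[0, N)³`. -/
theorem sum_slice_eq (hN : π.IsCutoff N) (h2 : FitsIn (π.asymp 2) N) (h : ℤ → ℤ) :
    ∑ c ∈ Finset.Ico (-(N : ℤ)) N, h c * (π.slice c).card =
      ∑ b ∈ π.coreBoxes N with (b 0, b 1) ∉ (π.asymp 2).cells, h ((b 0 : ℤ) - b 1) +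
      ∑ c ∈ (π.asymp 0).cells, ∑ n ∈ Finset.range c.1, h ((N : ℤ) + n - c.1) +
      ∑ c ∈ (π.asymp 1).cells, ∑ n ∈ Finset.range (c.2 + 1), h ((c.2 : ℤ) - (N + n)) := by
  rw [sum_slice hN]
  obtain ⟨E, hE⟩ : ∃ E, E = (π.coreBoxes (2 * N + 1)).filter fun s => (s 0, s 1) ∉
      (π.asymp 2).cells ∧ -(N : ℤ) ≤ (s 0 : ℤ) - s 1 ∧ (s 0 : ℤ) - s 1 < N := ⟨_, rfl⟩
  rw [← hE]
  rw [← Finset.sum_filter_add_sum_filter_not E (fun s => N ≤ s 0),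
    ← Finset.sum_filter_add_sum_filter_not (E.filter fun s => ¬ N ≤ s 0) (fun s => N ≤ s 1)]
  subst hE
  have e0 : ∀ s : Fin 3 → ℕ, (∀ i, s i < N) ↔ s 0 < N ∧ s 1 < N ∧ s 2 < N := fun s => by
    simp [Fin.forall_fin_succ]
  have e1 : ∀ s : Fin 3 → ℕ, (∀ i, s i < 2 * N + 1) ↔
      s 0 < 2 * N + 1 ∧ s 1 < 2 * N + 1 ∧ s 2 < 2 * N + 1 := fun s => by
    simp [Fin.forall_fin_succ]
  have h10 : ∀ s, (s 1, s 2) ∈ (π.asymp 0).cells → s ∈ π.boxes := fun s =>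
    mem_boxes_of_mem_asymp (k := 0)
  have h20 : ∀ s, (s 2, s 0) ∈ (π.asymp 1).cells → s ∈ π.boxes := fun s =>
    mem_boxes_of_mem_asymp (k := 1)
  rw [show ∀ a b c : ℤ, a + (b + c) = c + a + b from fun a b c => by ring]
  congr 1
  · congr 1
    · refine Finset.sum_congr ?_ fun _ _ => rfl
      ext s
      simp only [Finset.mem_filter, mem_coreBoxes, e0, e1]
      constructor
      · rintro ⟨⟨⟨⟨-, hs⟩, hn, -⟩, h0⟩, h1⟩
        exact ⟨⟨⟨by omega, by omega, (hN.bounds hs hn).1⟩, hs⟩, hn⟩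
      · rintro ⟨⟨⟨h0, h1, h2⟩, hs⟩, hn⟩
        exact ⟨⟨⟨⟨by omega, hs⟩, hn, by omega⟩, by omega⟩, by omega⟩
    · rw [Finset.sum_sigma']
      refine Finset.sum_bij' (fun s _ => ⟨(s 1, s 2), s 0 - N⟩) (fun p _ => ![N + p.2, p.1.1, p.1.2])
        ?_ ?_ ?_ ?_ ?_
      · intro s hs
        simp only [Finset.mem_filter, mem_coreBoxes, e1] at hs
        obtain ⟨⟨⟨-, hs⟩, hn, hc⟩, h0⟩ := hs
        rw [Finset.mem_sigma, Finset.mem_range]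
        exact ⟨(hN.bounds hs hn).2.1 h0, by dsimp only; omega⟩
      · rintro ⟨⟨x, y⟩, n⟩ hp
        obtain ⟨hc, hn⟩ := Finset.mem_sigma.1 hp
        rw [Finset.mem_range] at hn
        dsimp only at hc hn
        have := hN.2 0 _ hc
        dsimp only at this
        simp only [Finset.mem_filter, mem_coreBoxes, e1, Matrix.cons_val_zero, Matrix.cons_val_one,
          Matrix.cons_val_two, Matrix.tail_cons, Matrix.head_cons]
        refine ⟨⟨⟨by omega, h10 _ hc⟩, fun h => ?_, by omega⟩, by omega⟩
        have := (h2 _ h).1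
        dsimp only at this
        omega
      · intro s hs
        have := (Finset.mem_filter.1 hs).2
        funext i
        fin_cases i <;> simp
        omega
      · rintro ⟨⟨x, y⟩, n⟩ _
        simp
      · intro s hs
        have := (Finset.mem_filter.1 hs).2
        dsimp only
        congr 1
        omega
  · rw [Finset.sum_sigma']
    refine Finset.sum_bij' (fun s _ => ⟨(s 2, s 0), s 1 - N⟩) (fun p _ => ![p.1.2, N + p.2, p.1.1])
      ?_ ?_ ?_ ?_ ?_
    · intro s hs
      simp only [Finset.mem_filter, mem_coreBoxes, e1] at hs
      obtain ⟨⟨⟨⟨-, hs⟩, hn, hc⟩, h0⟩, h1⟩ := hs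
      rw [Finset.mem_sigma, Finset.mem_range]
      exact ⟨(hN.bounds hs hn).2.2 h1, by dsimp only; omega⟩
    · rintro ⟨⟨x, y⟩, n⟩ hp
      obtain ⟨hc, hn⟩ := Finset.mem_sigma.1 hp
      rw [Finset.mem_range] at hn
      dsimp only at hc hn
      have := hN.2 1 _ hc
      dsimp only at this
      simp only [Finset.mem_filter, mem_coreBoxes, e1, Matrix.cons_val_zero, Matrix.cons_val_one,
        Matrix.cons_val_two, Matrix.tail_cons, Matrix.head_cons]
      refine ⟨⟨⟨⟨by omega, h20 _ hc⟩, fun h => ?_, by omega⟩, by omega⟩, by omega⟩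
      have := (h2 _ h).2
      dsimp only at this
      omega
    · intro s hs
      have := (Finset.mem_filter.1 hs).2
      funext i
      fin_cases i <;> simp
      omega
    · rintro ⟨⟨x, y⟩, n⟩ _
      simp
    · intro s hs
      have := (Finset.mem_filter.1 hs).2
      dsimp only
      congr 1
      omega

end Partition3D

namespace Partition3D

variable {lam mu nu : YoungDiagram} {B N : ℕ} {π : Partition3D}

/-- Summation by parts: the volume and the index are expressed by the changes in size between
successive slices. -/
theorem IsCutoff.sum_path (hπ : π ∈ withAsymp lam mu nu) (hl : FitsIn lam B) (hm : FitsIn mu B)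
    (hn : FitsIn nu B) (hB : 2 * B ≤ N) (h0 : 0 < N) (hN : π.IsCutoff N) :
    2 * ∑ c ∈ Finset.Ico (-(N : ℤ)) N,
        (nu.path c : ℤ) * (((π.slice c).card : ℤ) - (π.slice (c + 1)).card) =
      π.chi - π.index + 2 * ∑ c ∈ mu.cells, (c.2 : ℤ) ∧
    2 * ∑ c ∈ Finset.Ico (-(N : ℤ)) N,
        (c - nu.path c) * (((π.slice c).card : ℤ) - (π.slice (c + 1)).card) =
      π.chi + π.index + 2 * ∑ c ∈ lam.cells, ((c.1 : ℤ) + 1) := by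
  have hn' : FitsIn nu N := fun c hc => by
    have := hn c hc
    omega
  rw [index_eq hπ hl hm hn hB hN, hN.chi_eq_card]
  obtain ⟨rfl, rfl, rfl⟩ := hπ
  rw [sum_Ico_mul_sub (by omega) _ fun c => ((π.slice c).card : ℤ),
    sum_Ico_mul_sub (by omega) _ fun c => ((π.slice c).card : ℤ),
    sum_slice_eq hN hn' fun c => ((π.asymp 2).path c : ℤ) - (π.asymp 2).path (c - 1),
    sum_slice_eq hN hn' fun c => (c - (π.asymp 2).path c) - ((c - 1) - (π.asymp 2).path (c - 1)),
    hN.isContentCutoff.slice_of_ge hn' le_rfl, hN.isContentCutoff.slice_of_le hn' le_rfl,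
    YoungDiagram.path_of_le hn' (c := -(N : ℤ) - 1) (by omega),
    YoungDiagram.path_of_ge hn (c := (N : ℤ) - 1) (by omega)]
  have e1 : ∀ c ∈ (π.asymp 0).cells, ∀ n ∈ Finset.range c.1,
      ((π.asymp 2).path ((N : ℤ) + n - c.1) : ℤ) = (N : ℤ) + n - c.1 ∧
      ((π.asymp 2).path ((N : ℤ) + n - c.1 - 1) : ℤ) = (N : ℤ) + n - c.1 - 1 := fun c hc n hn1 => by
    have := (hl c hc).1
    exact ⟨YoungDiagram.path_of_ge hn (by omega), YoungDiagram.path_of_ge hn (by omega)⟩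
  have e2 : ∀ c ∈ (π.asymp 1).cells, ∀ n ∈ Finset.range (c.2 + 1),
      (π.asymp 2).path ((c.2 : ℤ) - (N + n)) = 0 ∧
      (π.asymp 2).path ((c.2 : ℤ) - (N + n) - 1) = 0 := fun c hc n hn1 => by
    have := (hm c hc).2
    exact ⟨YoungDiagram.path_of_le hn (by omega), YoungDiagram.path_of_le hn (by omega)⟩
  have s1 : ∑ c ∈ (π.asymp 0).cells, ∑ n ∈ Finset.range c.1,
      (((π.asymp 2).path ((N : ℤ) + n - c.1) : ℤ) - (π.asymp 2).path ((N : ℤ) + n - c.1 - 1)) =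
      ∑ c ∈ (π.asymp 0).cells, (c.1 : ℤ) := Finset.sum_congr rfl fun c hc => by
    rw [Finset.sum_congr rfl fun n hn1 => by rw [(e1 c hc n hn1).1, (e1 c hc n hn1).2, sub_sub_cancel]]
    simp
  have s2 : ∑ c ∈ (π.asymp 0).cells, ∑ n ∈ Finset.range c.1,
      (((N : ℤ) + n - c.1 - (π.asymp 2).path ((N : ℤ) + n - c.1)) -
        ((N : ℤ) + n - c.1 - 1 - (π.asymp 2).path ((N : ℤ) + n - c.1 - 1))) = 0 :=
    Finset.sum_eq_zero fun c hc => Finset.sum_eq_zero fun n hn1 => by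
      rw [(e1 c hc n hn1).1, (e1 c hc n hn1).2]
      ring
  have s3 : ∑ c ∈ (π.asymp 1).cells, ∑ n ∈ Finset.range (c.2 + 1),
      (((π.asymp 2).path ((c.2 : ℤ) - (N + n)) : ℤ) - (π.asymp 2).path ((c.2 : ℤ) - (N + n) - 1)) = 0 :=
    Finset.sum_eq_zero fun c hc => Finset.sum_eq_zero fun n hn1 => by
      rw [(e2 c hc n hn1).1, (e2 c hc n hn1).2, sub_self]
  have s4 : ∑ c ∈ (π.asymp 1).cells, ∑ n ∈ Finset.range (c.2 + 1),
      (((c.2 : ℤ) - (N + n) - (π.asymp 2).path ((c.2 : ℤ) - (N + n))) -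
        ((c.2 : ℤ) - (N + n) - 1 - (π.asymp 2).path ((c.2 : ℤ) - (N + n) - 1))) =
      ∑ c ∈ (π.asymp 1).cells, ((c.2 : ℤ) + 1) := Finset.sum_congr rfl fun c hc => by
    rw [Finset.sum_congr rfl fun n hn1 => by
      rw [(e2 c hc n hn1).1, (e2 c hc n hn1).2, Nat.cast_zero, sub_zero, sub_zero, sub_sub_cancel]]
    simp
  have c0 : ((π.asymp 0).card : ℤ) = ∑ _c ∈ (π.asymp 0).cells, (1 : ℤ) := by simp
  have c1 : ((π.asymp 1).card : ℤ) = ∑ _c ∈ (π.asymp 1).cells, (1 : ℤ) := by simp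
  have ct : (π.asymp 1).transpose.card = (π.asymp 1).card := by
    simp [YoungDiagram.card, YoungDiagram.transpose]
  have cX : ∀ S : Finset (Fin 3 → ℕ), (S.card : ℤ) = ∑ _c ∈ S, (1 : ℤ) := by simp
  rw [s1, s2, s3, s4, ct, c0, c1, cX]
  simp only [YoungDiagram.mem_cells]
  have cN : ∀ S : Finset (ℕ × ℕ), ∑ _c ∈ S, (N : ℤ) = N * ∑ _c ∈ S, (1 : ℤ) := by
    simp [mul_comm]
  simp only [Finset.sum_sub_distrib, Finset.sum_add_distrib, ← Finset.mul_sum, cN, Nat.cast_zero]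
  constructor <;> ring

theorem IsContentCutoff.sum_Ico_eq {M : ℕ} (hN : π.IsContentCutoff N) (hn : FitsIn (π.asymp 2) N)
    (hNM : N ≤ M) (g : ℤ → ℤ) :
    ∑ c ∈ Finset.Ico (-(M : ℤ)) M, g c * (((π.slice c).card : ℤ) - (π.slice (c + 1)).card) =
      ∑ c ∈ Finset.Ico (-(N : ℤ)) N, g c * (((π.slice c).card : ℤ) - (π.slice (c + 1)).card) := by
  refine (Finset.sum_subset (Finset.Ico_subset_Ico (by omega) (by omega)) fun c _ hc => ?_).symm
  rw [Finset.mem_Ico, not_and_or, not_le, not_lt] at hc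
  rcases hc with hc | hc
  · rw [hN.slice_of_le hn hc.le, hN.slice_of_le hn (by omega), sub_self, mul_zero]
  · rw [hN.slice_of_ge hn hc, hN.slice_of_ge hn (by omega), sub_self, mul_zero]

/-- The formula of `IsCutoff.sum_path` with a cutoff on the contents only. The cutoff can be lowered,
since the slices are constant beyond the contents `±N`. -/
theorem IsContentCutoff.sum_path (hπ : π ∈ withAsymp lam mu nu) (hn : FitsIn nu N)
    (hN : π.IsContentCutoff N) :
    2 * ∑ c ∈ Finset.Ico (-(N : ℤ)) N,
        (nu.path c : ℤ) * (((π.slice c).card : ℤ) - (π.slice (c + 1)).card) =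
      π.chi - π.index + 2 * ∑ c ∈ mu.cells, (c.2 : ℤ) ∧
    2 * ∑ c ∈ Finset.Ico (-(N : ℤ)) N,
        (c - nu.path c) * (((π.slice c).card : ℤ) - (π.slice (c + 1)).card) =
      π.chi + π.index + 2 * ∑ c ∈ lam.cells, ((c.1 : ℤ) + 1) := by
  obtain ⟨B, hl, hm, hn'⟩ := exists_fitsIn lam mu nu
  obtain ⟨N', hN'⟩ := π.exists_isCutoff
  have h := IsCutoff.sum_path (N := N' + 2 * B + N + 1) hπ hl hm hn' (by omega) (by omega)
    (hN'.mono (by omega))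
  have hn2 := hn
  rw [← hπ.2.2] at hn2
  rwa [hN.sum_Ico_eq hn2 (by omega) fun c => (nu.path c : ℤ),
    hN.sum_Ico_eq hn2 (by omega) fun c => c - nu.path c] at h

/-- The monomial in `a = t^{1/2}` and `b = q^{1/2}` attached to the step of the boundary path from
content `c` to content `c + 1`. -/
noncomputable def stepVar {F : Type*} [Field F] (nu : YoungDiagram) (a b : F) (c : ℤ) : F :=
  a ^ (2 * (c - nu.path c)) * b ^ (2 * (nu.path c : ℤ))

theorem sum_Ico_eq_sum_range {M : Type*} [AddCommMonoid M] (N : ℕ) (f : ℤ → M) :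
    ∑ c ∈ Finset.Ico (-(N : ℤ)) N, f c = ∑ j ∈ Finset.range (2 * N), f ((j : ℤ) - N) := by
  refine Finset.sum_bij' (fun c _ => (c + N).toNat) (fun j _ => (j : ℤ) - N) ?_ ?_ ?_ ?_ ?_
  · intro c hc
    rw [Finset.mem_Ico] at hc
    rw [Finset.mem_range]
    omega
  · intro j hj
    rw [Finset.mem_range] at hj
    rw [Finset.mem_Ico]
    omega
  · intro c hc
    rw [Finset.mem_Ico] at hc
    omega
  · intro j _
    omega
  · intro c hc
    rw [Finset.mem_Ico] at hc
    congr 1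
    omega

/-- The contribution of `π` to the limit of the vertex, in terms of the diagonal slices. -/
theorem IsContentCutoff.zpow_eq_prod {F : Type*} [Field F] {a b : F} (ha : a ≠ 0) (hb : b ≠ 0)
    (hπ : π ∈ withAsymp lam mu nu) (hn : FitsIn nu N) (hN : π.IsContentCutoff N) :
    a ^ (π.chi + π.index) * b ^ (π.chi - π.index) =
      a ^ (-(2 * ∑ c ∈ lam.cells, ((c.1 : ℤ) + 1))) * b ^ (-(2 * ∑ c ∈ mu.cells, (c.2 : ℤ))) *
        ∏ j ∈ Finset.range (2 * N), stepVar nu a b ((j : ℤ) - N) ^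
          (((π.slice ((j : ℤ) - N)).card : ℤ) - (π.slice (((j + 1 : ℕ) : ℤ) - N)).card) := by
  obtain ⟨h1, h2⟩ := hN.sum_path hπ hn
  have hprod : ∀ (x : F) (g : ℕ → ℤ) (n : ℕ), x ≠ 0 →
      ∏ j ∈ Finset.range n, x ^ g j = x ^ ∑ j ∈ Finset.range n, g j := fun x g n hx => by
    induction n with
    | zero => simp
    | succ n ih => rw [Finset.prod_range_succ, ih, Finset.sum_range_succ, zpow_add₀ hx]
  simp only [stepVar, mul_zpow, Finset.prod_mul_distrib, ← zpow_mul]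
  rw [hprod a _ _ ha, hprod b _ _ hb]
  rw [sum_Ico_eq_sum_range, Finset.mul_sum] at h1 h2
  have e : ∀ j : ℕ, (((j + 1 : ℕ) : ℤ) - N) = (j : ℤ) - N + 1 := fun j => by push_cast; ring
  simp only [e, mul_assoc]
  rw [h1, h2, zpow_add₀ ha _ (2 * _), zpow_add₀ hb _ (2 * _), zpow_neg, zpow_neg]
  have := zpow_ne_zero (2 * ∑ c ∈ lam.cells, ((c.1 : ℤ) + 1)) ha
  have := zpow_ne_zero (2 * ∑ c ∈ mu.cells, (c.2 : ℤ)) hb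
  field_simp

end Partition3D

/-! ### The limit series as a limit of sums over chains -/

namespace LaurentSeries

variable {K : Type*} [Field K]

theorem tendsto_tsum_subtype {ι : Type*} {f : ι → LaurentSeries K} {S : Set ι} {T : ℕ → Set ι}
    (hT : ∀ N, T N ⊆ S) (hfin : ∀ n : ℤ, {i | i ∈ S ∧ ∃ j < n, (f i).coeff j ≠ 0}.Finite)
    (h : ∀ n : ℤ, ∀ᶠ N in atTop, ∀ i ∈ S, (∃ j < n, (f i).coeff j ≠ 0) → i ∈ T N) :
    Tendsto (fun N => ∑' i : T N, f i) atTop (𝓝 (∑' i : S, f i)) := by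
  classical
  have key : ∀ U ⊆ S, ∀ n : ℤ, ∀ j < n, (∑' i : U, f i).coeff j =
      ∑ i ∈ (hfin n).toFinset, if i ∈ U then (f i).coeff j else 0 := by
    intro U hU n j hj
    have hs : Summable (U.indicator f) := by
      refine summable_of_finite fun m => (hfin m).subset ?_
      rintro i ⟨j, hj, hne⟩
      have hi : i ∈ U := by
        by_contra hi
        rw [Set.indicator_of_notMem hi] at hne
        exact hne rfl
      rw [Set.indicator_of_mem hi] at hne
      exact ⟨hU hi, j, hj, hne⟩
    rw [tsum_subtype, coeff_of_hasSum hs.hasSum j (hfin n).toFinset]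
    · refine Finset.sum_congr rfl fun i _ => ?_
      split_ifs with hi
      · rw [Set.indicator_of_mem hi]
      · rw [Set.indicator_of_notMem hi]
        rfl
    · intro i hi
      by_cases hiU : i ∈ U
      · rw [Set.indicator_of_mem hiU]
        by_contra hne
        exact hi ((hfin n).mem_toFinset.2 ⟨hU hiU, j, hj, hne⟩)
      · rw [Set.indicator_of_notMem hiU]
        rfl
  refine tendsto_iff.2 fun n => ?_
  filter_upwards [h n] with N hN j hj
  rw [key _ (hT N) n j hj, key _ subset_rfl n j hj]
  refine Finset.sum_congr rfl fun i hi => ?_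
  obtain ⟨hi, hne⟩ := (hfin n).mem_toFinset.1 hi
  rw [if_pos hi, if_pos (hN i hi hne)]

end LaurentSeries

namespace Partition3D

variable {lam mu nu : YoungDiagram} {N : ℕ} {k : ℂ}

/-- The part of the limit series that comes from the partitions with a given content cutoff. -/
noncomputable def cutoffSeries (lam mu nu : YoungDiagram) (k : ℂ) (N : ℕ) : LaurentSeries ℂ :=
  ∑' π : {π : Partition3D | π ∈ withAsymp lam mu nu ∧ π.IsContentCutoff N},
    HahnSeries.single (2 * π.1.chi) (k ^ (2 * π.1.index))

theorem two_chi_lt_of_coeff_ne_zero {π : Partition3D} {n : ℤ} (h : ∃ j < n,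
    (HahnSeries.single (2 * π.chi) (k ^ (2 * π.index)) : LaurentSeries ℂ).coeff j ≠ 0) :
    π.chi ≤ n.natAbs := by
  obtain ⟨j, hj, hne⟩ := h
  have : j = 2 * π.chi := by
    by_contra h
    exact hne (HahnSeries.coeff_single_of_ne h)
  omega

/-- Every partition has a content cutoff, so that the sums with cutoff exhaust the limit series. -/
theorem tendsto_cutoffSeries (lam mu nu : YoungDiagram) (k : ℂ) :
    Tendsto (cutoffSeries lam mu nu k) atTop (𝓝 (limitSeries lam mu nu k)) := by
  refine LaurentSeries.tendsto_tsum_subtype (S := withAsymp lam mu nu) (T := fun N => {π |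
    π ∈ withAsymp lam mu nu ∧ π.IsContentCutoff N}) (f := fun π : Partition3D =>
    HahnSeries.single (2 * π.chi) (k ^ (2 * π.index))) (fun N π h => h.1) (fun n => ?_) fun n => ?_
  · refine ((finite_chi_le lam mu nu n.natAbs).image Subtype.val).subset ?_
    rintro π ⟨hπ, h⟩
    exact ⟨⟨π, hπ⟩, two_chi_lt_of_coeff_ne_zero h, rfl⟩
  · obtain ⟨N₀, hN₀⟩ := exists_isCutoff_of_chi_le lam mu nu n.natAbs
    filter_upwards [eventually_ge_atTop N₀] with N hN π hπ h
    exact ⟨hπ, ((hN₀ π hπ (two_chi_lt_of_coeff_ne_zero h)).mono hN).isContentCutoff⟩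

theorem single_one_zpow (x : ℂ) (m : ℤ) :
    (HahnSeries.single 1 x : LaurentSeries ℂ) ^ m = HahnSeries.single m (x ^ m) := by
  have h : (HahnSeries.single 1 x : LaurentSeries ℂ) = HahnSeries.C x * HahnSeries.single 1 1 := by
    rw [HahnSeries.C_apply, HahnSeries.single_mul_single, zero_add, mul_one]
  rw [h, mul_zpow, ← map_zpow₀, ← RatFunc.single_zpow, HahnSeries.C_apply,
    HahnSeries.single_mul_single, zero_add, mul_one]

theorem single_zpow_mul_single_zpow (hk : k ≠ 0) (m n : ℤ) :
    (HahnSeries.single 1 k : LaurentSeries ℂ) ^ m * HahnSeries.single 1 k⁻¹ ^ n =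
      HahnSeries.single (m + n) (k ^ (m - n)) := by
  rw [single_one_zpow, single_one_zpow, HahnSeries.single_mul_single, inv_zpow, ← zpow_neg,
    ← zpow_add₀ hk, ← sub_eq_add_neg]

theorem stepVar_single (hk : k ≠ 0) (c : ℤ) :
    stepVar nu (HahnSeries.single 1 k : LaurentSeries ℂ) (HahnSeries.single 1 k⁻¹) c =
      HahnSeries.single (2 * c) (k ^ (2 * (c - 2 * nu.path c))) := by
  rw [stepVar, single_zpow_mul_single_zpow hk]
  congr 2 <;> ring

/-- The word formed by the steps of the boundary path of `nu` from content `-N` to content `N`. -/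
noncomputable def stepWord {F : Type*} [Field F] (nu : YoungDiagram) (a b : F) (N : ℕ) :
    List (Bool × F) :=
  (List.range (2 * N)).map fun j : ℕ => (nu.pathDir ((j : ℤ) - N), stepVar nu a b ((j : ℤ) - N))

theorem chainReduces_stepWord (nu : YoungDiagram) (hk : k ≠ 0) (N : ℕ) :
    YoungDiagram.ChainReduces
      (stepWord nu (HahnSeries.single 1 k : LaurentSeries ℂ) (HahnSeries.single 1 k⁻¹) N)
      (YoungDiagram.sortWord (stepWord nu (HahnSeries.single 1 k) (HahnSeries.single 1 k⁻¹) N))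
      (YoungDiagram.invProd (stepWord nu (HahnSeries.single 1 k) (HahnSeries.single 1 k⁻¹) N)) := by
  refine YoungDiagram.chainReduces_sortWord _ ?_ ?_
  · intro p hp
    obtain ⟨j, -, rfl⟩ := List.mem_map.1 hp
    rw [stepVar_single hk]
    exact HahnSeries.single_ne_zero (zpow_ne_zero _ hk)
  · refine List.pairwise_map.2 (List.pairwise_lt_range.imp fun {i j} hij _ _ n hn => ?_)
    rw [stepVar_single hk, stepVar_single hk, HahnSeries.single_div_single]
    exact HahnSeries.coeff_single_of_ne (by omega)

/-- The sum with cutoff is a sum over chains; after sorting the word it becomes a product of a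
monomial, a sum over sorted chains, and the product over the inversions. -/
theorem cutoffSeries_eq (hk : k ≠ 0) (hn : FitsIn nu N) {S : LaurentSeries ℂ}
    (hS : HasSum (YoungDiagram.chainWeight (YoungDiagram.sortWord
      (stepWord nu (HahnSeries.single 1 k) (HahnSeries.single 1 k⁻¹) N)) mu.transpose lam) S) :
    cutoffSeries lam mu nu k N =
      HahnSeries.single 1 k ^ (-(2 * ∑ c ∈ lam.cells, ((c.1 : ℤ) + 1))) *
        HahnSeries.single 1 k⁻¹ ^ (-(2 * ∑ c ∈ mu.cells, (c.2 : ℤ))) *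
        (S * YoungDiagram.invProd
          (stepWord nu (HahnSeries.single 1 k) (HahnSeries.single 1 k⁻¹) N)) := by
  have h1 := (chainReduces_stepWord nu hk N).hasSum hS
  set a : LaurentSeries ℂ := HahnSeries.single 1 k with ha
  set b : LaurentSeries ℂ := HahnSeries.single 1 k⁻¹ with hb
  have ha0 : a ≠ 0 := HahnSeries.single_ne_zero hk
  have hb0 : b ≠ 0 := HahnSeries.single_ne_zero (inv_ne_zero hk)
  obtain ⟨e, he⟩ := exists_sliceEquiv lam mu hn (stepVar nu a b)
  obtain ⟨e', he'⟩ := YoungDiagram.exists_seqEquiv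
    (fun j : ℕ => (nu.pathDir ((j : ℤ) - N), stepVar nu a b ((j : ℤ) - N))) (2 * N) mu.transpose lam
  have h2 := (((e.trans e').hasSum_iff).2 h1).mul_left
    (a ^ (-(2 * ∑ c ∈ lam.cells, ((c.1 : ℤ) + 1))) * b ^ (-(2 * ∑ c ∈ mu.cells, (c.2 : ℤ))))
  refine HasSum.tsum_eq (h2.congr_fun fun π => ?_)
  have h3 := IsContentCutoff.zpow_eq_prod ha0 hb0 π.2.1 hn π.2.2
  rw [ha, hb, single_zpow_mul_single_zpow hk, ← ha, ← hb,
    show π.1.chi + π.1.index + (π.1.chi - π.1.index) = 2 * π.1.chi by ring,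
    show π.1.chi + π.1.index - (π.1.chi - π.1.index) = 2 * π.1.index by ring] at h3
  refine h3.trans (congrArg _ ?_)
  refine Eq.trans ?_ (he' (e π)).symm
  simp only [he]

end Partition3D

/-! ### The product over the inversions of the boundary path -/

namespace YoungDiagram

theorem invProd_map_range {K : Type*} [Field K] (f : ℕ → Bool × LaurentSeries K) (n : ℕ) :
    invProd ((List.range n).map f) = ∏ i ∈ Finset.range n, ∏ d ∈ Finset.range n,
      if i + d + 1 < n ∧ (f i).1 = true ∧ (f (i + d + 1)).1 = false then
        (1 - (f (i + d + 1)).2 / (f i).2)⁻¹ else 1 := by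
  induction n generalizing f with
  | zero => simp [invProd]
  | succ n ih =>
    have hfil : ∀ (m : ℕ) (g : ℕ → Bool × LaurentSeries K) (F : Bool × LaurentSeries K →
        LaurentSeries K), ((((List.range m).map g).filter fun q => !q.1).map F).prod =
          ∏ d ∈ Finset.range m, if (g d).1 = false then F (g d) else 1 := by
      intro m g F
      induction m with
      | zero => simp
      | succ m ih =>
        rw [List.range_succ, List.map_append, List.filter_append, List.map_append, List.prod_append,
          ih, Finset.prod_range_succ]
        congr 1
        rcases h : (g m).1 <;> simp [h]
    rw [List.range_succ_eq_map, List.map_cons, List.map_map, invProd, hfil,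
      show invProd ((List.range n).map (f ∘ Nat.succ)) = _ from ih fun j => f (j + 1),
      Finset.prod_range_succ', mul_comm]
    congr 1
    · refine Finset.prod_congr rfl fun i _ => ?_
      rw [Finset.prod_range_succ, if_neg (c := i + 1 + n + 1 < n + 1 ∧ _) (by omega), mul_one]
      refine Finset.prod_congr rfl fun d _ => ?_
      simp only [Nat.add_lt_add_iff_right, show i + 1 + d = i + d + 1 by omega]
    · rw [Finset.prod_range_succ, if_neg (c := 0 + n + 1 < n + 1 ∧ _) (by omega), mul_one]
      rcases h : (f 0).1
      · simp
      · rw [if_pos rfl]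
        refine Finset.prod_congr rfl fun d hd => ?_
        rw [Finset.mem_range] at hd
        simp only [Function.comp_apply, Nat.succ_eq_add_one, zero_add, true_and,
          Nat.add_lt_add_iff_right, hd]

variable (nu : YoungDiagram)

theorem path_mono {c d : ℤ} (h : c ≤ d) : nu.path c ≤ nu.path d := by
  have := (nu.path_le_iff d (nu.path d)).1 le_rfl
  exact (nu.path_le_iff _ _).2 (h.trans this)

theorem path_add_le (c : ℤ) (L : ℕ) : nu.path (c + L) ≤ nu.path c + L := by
  induction L with
  | zero => simp
  | succ L ih =>
    have := nu.path_succ (c + L)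
    rw [show c + ((L + 1 : ℕ) : ℤ) = c + L + 1 by push_cast; ring]
    omega

theorem pathDir_eq_true {c : ℤ} : nu.pathDir c = true ↔ nu.path (c + 1) = nu.path c := by
  simp [pathDir]

theorem pathDir_eq_false {c : ℤ} : nu.pathDir c = false ↔ nu.path (c + 1) = nu.path c + 1 := by
  have := nu.path_succ c
  simp only [pathDir, decide_eq_false_iff_not]
  omega

/-- The number of steps that change the second coordinate among the `L` steps of the boundary path
of `nu` that follow content `p`. -/
noncomputable def windowUp (L : ℕ) (p : ℤ) : ℕ := L - (nu.path (p + L) - nu.path p)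

theorem windowUp_add (L : ℕ) (p : ℤ) : nu.windowUp L p + nu.path (p + L) = L + nu.path p := by
  have h1 := nu.path_add_le p L
  have h2 := nu.path_mono (c := p) (d := p + L) (by omega)
  rw [windowUp]
  omega

theorem windowUp_le (L : ℕ) (p : ℤ) : nu.windowUp L p ≤ L := Nat.sub_le _ _

section Window

variable {F : Type*} [Field F]

/-- The factor `1 - t ^ j * q ^ (L - j)`, where `t = a ^ 2` and `q = b ^ 2`. -/
def windowFactor (a b : F) (L j : ℕ) : F := 1 - b ^ (2 * (L - j)) * a ^ (2 * j)

/-- The product of the first `j` factors `windowFactor a b L`. -/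
def windowProd (a b : F) (L j : ℕ) : F := ∏ i ∈ Finset.range j, windowFactor a b L (i + 1)

theorem windowProd_ne_zero {a b : F} {L j : ℕ} (hj : j ≤ L)
    (h : ∀ i ≤ L, windowFactor a b L i ≠ 0) : windowProd a b L j ≠ 0 :=
  Finset.prod_ne_zero_iff.2 fun i hi => h _ (by
    rw [Finset.mem_range] at hi
    omega)

/-- When a window of length `L` is moved along the boundary path, the number of the steps in it
that change the second coordinate performs a walk. The products over the descents and over the
ascents of this walk differ by boundary terms. -/
theorem prod_windowFactor (a b : F) (L : ℕ) (h : ∀ i ≤ L, windowFactor a b L i ≠ 0) (p : ℤ)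
    (n : ℕ) :
    ∏ j ∈ Finset.range n, (if nu.pathDir (p + j) = true ∧ nu.pathDir (p + j + L) = false then
        windowFactor a b L (nu.windowUp L (p + j)) else 1) =
      windowProd a b L (nu.windowUp L p) / windowProd a b L (nu.windowUp L (p + n)) *
      ∏ j ∈ Finset.range n, (if nu.pathDir (p + j) = false ∧ nu.pathDir (p + j + L) = true then
        windowFactor a b L (nu.windowUp L (p + j + 1)) else 1) := by
  have hH : ∀ c, windowProd a b L (nu.windowUp L c) ≠ 0 := fun c =>
    windowProd_ne_zero (nu.windowUp_le L c) h
  induction n with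
  | zero =>
    rw [Finset.prod_range_zero, Finset.prod_range_zero, Nat.cast_zero, add_zero, div_self (hH p),
      mul_one]
  | succ n ih =>
    rw [Finset.prod_range_succ, Finset.prod_range_succ, ih,
      show p + ((n + 1 : ℕ) : ℤ) = p + n + 1 by push_cast; ring]
    generalize p + (n : ℤ) = c
    have e1 := nu.windowUp_add L c
    have e2 := nu.windowUp_add L (c + 1)
    rw [show c + 1 + (L : ℤ) = c + L + 1 by ring] at e2
    have h1 := hH c
    have h2 := hH (c + 1)
    have h3 := h _ (nu.windowUp_le L (c + 1))
    rcases nu.path_succ c with s1 | s1 <;> rcases nu.path_succ (c + L) with s2 | s2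
    · have e : nu.windowUp L (c + 1) = nu.windowUp L c := by omega
      simp [pathDir, s1, s2, e]
    · have e : nu.windowUp L c = nu.windowUp L (c + 1) + 1 := by omega
      have h4 := h _ (nu.windowUp_le L c)
      rw [e] at h4
      rw [e, windowProd, Finset.prod_range_succ, ← windowProd] at h1
      rw [e]
      simp only [pathDir, s1, s2]
      simp only [windowProd, Finset.prod_range_succ] at h1 h2 ⊢
      simp
      field_simp
    · have e : nu.windowUp L (c + 1) = nu.windowUp L c + 1 := by omega
      rw [e] at h2 h3
      rw [e]
      simp only [pathDir, s1, s2]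
      simp only [windowProd, Finset.prod_range_succ] at h1 h2 ⊢
      simp
      field_simp
    · have e : nu.windowUp L (c + 1) = nu.windowUp L c := by omega
      simp [pathDir, s1, s2, e]

theorem rowLen_path_of_pathDir_false {c : ℤ} (h : nu.pathDir c = false) :
    (nu.rowLen (nu.path c) : ℤ) = nu.path c - c := by
  rw [pathDir_eq_false] at h
  have h1 := (nu.path_le_iff c (nu.path c)).1 le_rfl
  have h2 := (nu.path_le_iff (c + 1) (nu.path c)).not.1 (by omega)
  omega

theorem colLen_of_pathDir_true {c : ℤ} (h : nu.pathDir c = true) {y : ℕ}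
    (hy : (y : ℤ) = nu.path c - c - 1) : nu.colLen y = nu.path c := by
  rw [pathDir_eq_true] at h
  have h1 := (nu.path_le_iff (c + 1) (nu.path c)).1 (by omega)
  refine le_antisymm (Nat.le_of_not_lt fun hlt => ?_) (Nat.le_of_not_lt fun hlt => ?_)
  · have := mem_iff_lt_rowLen.1 (mem_iff_lt_colLen.2 hlt)
    omega
  · have h2 := (nu.path_le_iff c (nu.path c - 1)).not.1 (by omega)
    have h3 : (nu.path c - 1, y) ∈ nu := mem_iff_lt_rowLen.2 (by omega)
    have := mem_iff_lt_colLen.1 h3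
    omega

theorem path_row (x : ℕ) : nu.path ((x : ℤ) - nu.rowLen x) = x ∧
    nu.path ((x : ℤ) - nu.rowLen x + 1) = x + 1 := by
  have h1 := (nu.path_le_iff ((x : ℤ) - nu.rowLen x) x).2 le_rfl
  have h2 := (nu.path_le_iff ((x : ℤ) - nu.rowLen x + 1) x).not.2 (by omega)
  have := nu.path_succ ((x : ℤ) - nu.rowLen x)
  omega

theorem path_col (y : ℕ) : nu.path ((nu.colLen y : ℤ) - y - 1) = nu.colLen y ∧
    nu.path ((nu.colLen y : ℤ) - y - 1 + 1) = nu.colLen y := by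
  have h0 : nu.rowLen (nu.colLen y) ≤ y := Nat.le_of_not_lt fun h =>
    lt_irrefl _ (mem_iff_lt_colLen.1 (mem_iff_lt_rowLen.2 h))
  have h1 := (nu.path_le_iff ((nu.colLen y : ℤ) - y - 1 + 1) (nu.colLen y)).2 (by omega)
  have h2 : nu.colLen y ≤ nu.path ((nu.colLen y : ℤ) - y - 1) := by
    by_contra! h
    have h3 := (nu.path_le_iff ((nu.colLen y : ℤ) - y - 1) (nu.colLen y - 1)).1 (by omega)
    have h4 : (nu.colLen y - 1, y) ∈ nu := mem_iff_lt_colLen.2 (by omega)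
    have := mem_iff_lt_rowLen.1 h4
    omega
  have := nu.path_mono (c := (nu.colLen y : ℤ) - y - 1) (d := (nu.colLen y : ℤ) - y - 1 + 1)
    (by omega)
  omega

theorem ascent_spec {p : ℤ} {d : ℕ} (h1 : nu.pathDir p = false)
    (h2 : nu.pathDir (p + (d + 1 : ℕ)) = true) :
    ∃ y : ℕ, (y : ℤ) = nu.path (p + (d + 1 : ℕ)) - (p + (d + 1 : ℕ)) - 1 ∧
      (nu.path p, y) ∈ nu.cells ∧ (nu.rowLen (nu.path p) : ℤ) = nu.path p - p ∧
      nu.colLen y = nu.path (p + (d + 1 : ℕ)) ∧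
      nu.windowUp (d + 1) (p + 1) + nu.path (p + (d + 1 : ℕ)) = d + 2 + nu.path p := by
  have h3 := (nu.path_le_iff (p + (d + 1 : ℕ) + 1) (nu.path (p + (d + 1 : ℕ)))).1
    ((nu.pathDir_eq_true.1 h2).le)
  obtain ⟨y, hy⟩ := Int.eq_ofNat_of_zero_le
    (by omega : 0 ≤ (nu.path (p + (d + 1 : ℕ)) : ℤ) - (p + (d + 1 : ℕ)) - 1)
  have hc := nu.colLen_of_pathDir_true h2 hy.symm
  have hm := nu.path_mono (c := p + 1) (d := p + (d + 1 : ℕ)) (by omega)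
  have hp := nu.pathDir_eq_false.1 h1
  have hw := nu.windowUp_add (d + 1) (p + 1)
  rw [show p + 1 + ((d + 1 : ℕ) : ℤ) = p + (d + 1 : ℕ) + 1 by ring, nu.pathDir_eq_true.1 h2] at hw
  exact ⟨y, hy.symm, mem_iff_lt_colLen.2 (by omega), nu.rowLen_path_of_pathDir_false h1, hc,
    by omega⟩

/-- The ascents of the walks of all windows correspond to the boxes of `nu`. -/
theorem prod_ascents (a b : F) {N : ℕ} (hN : Partition3D.FitsIn nu N) :
    ∏ d ∈ Finset.range (2 * N), ∏ j ∈ Finset.range (2 * N - (d + 1)),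
      (if nu.pathDir (-(N : ℤ) + j) = false ∧ nu.pathDir (-(N : ℤ) + j + (d + 1 : ℕ)) = true then
        windowFactor a b (d + 1) (nu.windowUp (d + 1) (-(N : ℤ) + j + 1)) else 1) =
      ∏ c ∈ nu.cells, (1 - b ^ (2 * nu.legLen c) * a ^ (2 * (nu.armLen c + 1))) := by
  rw [Finset.prod_sigma', ← Finset.prod_filter]
  have harm : ∀ x y, (x, y) ∈ nu.cells → y < nu.rowLen x ∧ x < nu.colLen y ∧ nu.rowLen x ≤ N ∧
      nu.colLen y ≤ N := fun x y h => by
    have h1 := mem_iff_lt_rowLen.1 h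
    have h2 := mem_iff_lt_colLen.1 h
    have h3 := (hN (x, nu.rowLen x - 1) (mem_iff_lt_rowLen.2 (by omega))).2
    have h4 := (hN (nu.colLen y - 1, y) (mem_iff_lt_colLen.2 (by omega))).1
    dsimp only at h3 h4
    omega
  refine Finset.prod_bij' (fun p _ => (nu.path (-(N : ℤ) + p.2),
      (nu.path (-(N : ℤ) + p.2 + (p.1 + 1 : ℕ)) - (-(N : ℤ) + p.2 + (p.1 + 1 : ℕ)) - 1).toNat))
    (fun c _ => ⟨nu.armLen c + nu.legLen c, (c.1 - nu.rowLen c.1 + N : ℤ).toNat⟩) ?_ ?_ ?_ ?_ ?_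
  · rintro ⟨d, j⟩ hp
    obtain ⟨-, h1, h2⟩ := Finset.mem_filter.1 hp
    obtain ⟨y, hy, hc, -⟩ := nu.ascent_spec h1 h2
    dsimp only at hy ⊢
    rwa [← hy, Int.toNat_natCast]
  · rintro ⟨x, y⟩ hc
    obtain ⟨h1, h2, h3, h4⟩ := harm x y hc
    have e1 : -(N : ℤ) + ((x - nu.rowLen x + N : ℤ).toNat : ℕ) = x - nu.rowLen x := by omega
    have e2 : (x : ℤ) - nu.rowLen x + (nu.armLen (x, y) + nu.legLen (x, y) + 1 : ℕ) =
        nu.colLen y - y - 1 := by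
      simp only [armLen, legLen]
      omega
    rw [Finset.mem_filter, Finset.mem_sigma, Finset.mem_range, Finset.mem_range]
    refine ⟨⟨?_, ?_⟩, ?_⟩
    · simp only [armLen, legLen]
      omega
    · simp only [armLen, legLen]
      omega
    · dsimp only
      rw [e1, e2, pathDir_eq_false, pathDir_eq_true, (nu.path_row x).1, (nu.path_row x).2,
        (nu.path_col y).1, (nu.path_col y).2]
      exact ⟨rfl, rfl⟩
  · rintro ⟨d, j⟩ hp
    obtain ⟨-, h1, h2⟩ := Finset.mem_filter.1 hp
    obtain ⟨y, hy, hc, hr, hl, -⟩ := nu.ascent_spec h1 h2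
    obtain ⟨h3, h4, -⟩ := harm _ _ hc
    dsimp only at hy hr hl h3 h4 ⊢
    rw [← hy, Int.toNat_natCast, armLen, legLen]
    dsimp only
    congr 1
    · omega
    · omega
  · rintro ⟨x, y⟩ hc
    obtain ⟨h1, h2, h3, h4⟩ := harm x y hc
    have e1 : -(N : ℤ) + ((x - nu.rowLen x + N : ℤ).toNat : ℕ) = x - nu.rowLen x := by omega
    have e2 : (x : ℤ) - nu.rowLen x + (nu.armLen (x, y) + nu.legLen (x, y) + 1 : ℕ) =
        nu.colLen y - y - 1 := by
      simp only [armLen, legLen]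
      omega
    dsimp only
    rw [e1, e2, (nu.path_row x).1, (nu.path_col y).1]
    congr 1
    omega
  · rintro ⟨d, j⟩ hp
    obtain ⟨-, h1, h2⟩ := Finset.mem_filter.1 hp
    obtain ⟨y, hy, hc, hr, hl, hw⟩ := nu.ascent_spec h1 h2
    obtain ⟨h3, h4, -⟩ := harm _ _ hc
    dsimp only at hy hr hl hw h3 h4 ⊢
    rw [← hy, Int.toNat_natCast, armLen, legLen, windowFactor]
    dsimp only
    congr 4 <;> omega

end Window

end YoungDiagram

namespace LaurentSeries

variable {K : Type*} [Field K]

/-- The Laurent series `f` is equal to `1` up to terms of degree at least `n`. -/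
def IsOneUnit (n : ℤ) (f : LaurentSeries K) : Prop := f - 1 ∈ lowSubgroup K n

theorem mul_mem_lowSubgroup {m n : ℤ} {f g : LaurentSeries K} (hf : f ∈ lowSubgroup K m)
    (hg : g ∈ lowSubgroup K n) : f * g ∈ lowSubgroup K (m + n) := by
  intro j hj
  rw [coeff_mul_eq_sum_Icc hf hg, Finset.Icc_eq_empty (by omega), Finset.sum_empty]

theorem coeff_one_of_ne {j : ℤ} (hj : j ≠ 0) : (1 : LaurentSeries K).coeff j = 0 :=
  HahnSeries.coeff_single_of_ne hj

theorem isOneUnit_iff {n : ℤ} {f : LaurentSeries K} :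
    IsOneUnit n f ↔ ∀ j < n, f.coeff j = (1 : LaurentSeries K).coeff j := by
  simp [IsOneUnit, mem_lowSubgroup, sub_eq_zero]

theorem isOneUnit_one (n : ℤ) : IsOneUnit n (1 : LaurentSeries K) := isOneUnit_iff.2 fun _ _ => rfl

variable {n : ℤ} {f g : LaurentSeries K}

theorem IsOneUnit.mono {m : ℤ} (hf : IsOneUnit n f) (h : m ≤ n) : IsOneUnit m f :=
  fun j hj => hf j (hj.trans_le h)

theorem IsOneUnit.mem_lowSubgroup_zero (hn : 0 ≤ n) (hf : IsOneUnit n f) :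
    f ∈ lowSubgroup K 0 := fun j hj => by
  rw [isOneUnit_iff.1 hf j (by omega), coeff_one_of_ne hj.ne]

theorem IsOneUnit.mul (hn : 0 ≤ n) (hf : IsOneUnit n f) (hg : IsOneUnit n g) :
    IsOneUnit n (f * g) := by
  have h1 := mul_mem_lowSubgroup hf (hg.mem_lowSubgroup_zero hn)
  rw [add_zero] at h1
  have h2 := add_mem h1 hg
  rwa [show (f - 1) * g + (g - 1) = f * g - 1 by ring] at h2

theorem IsOneUnit.ne_zero (hn : 0 < n) (hf : IsOneUnit n f) : f ≠ 0 := by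
  rintro rfl
  have := isOneUnit_iff.1 hf 0 hn
  rw [HahnSeries.coeff_one, if_pos rfl] at this
  exact zero_ne_one this

theorem IsOneUnit.inv (hn : 0 < n) (hf : IsOneUnit n f) : IsOneUnit n f⁻¹ := by
  have h0 : f.coeff 0 = 1 := by
    rw [isOneUnit_iff.1 hf 0 hn, HahnSeries.coeff_one, if_pos rfl]
  have h1 : f⁻¹ ∈ lowSubgroup K 0 := by
    rw [← one_div]
    exact coeff_div_eq_zero (fun j hj => coeff_one_of_ne hj.ne) (hf.mem_lowSubgroup_zero hn.le) h0
  have h2 := neg_mem (mul_mem_lowSubgroup hf h1)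
  rw [add_zero] at h2
  have h3 : -((f - 1) * f⁻¹) = f⁻¹ - 1 := by
    have := hf.ne_zero hn
    field_simp
    ring
  rwa [h3] at h2

theorem IsOneUnit.div (hn : 0 < n) (hf : IsOneUnit n f) (hg : IsOneUnit n g) :
    IsOneUnit n (f / g) := by
  rw [div_eq_mul_inv]
  exact hf.mul hn.le (hg.inv hn)

theorem IsOneUnit.prod {ι : Type*} (hn : 0 ≤ n) {s : Finset ι} {F : ι → LaurentSeries K}
    (h : ∀ i ∈ s, IsOneUnit n (F i)) : IsOneUnit n (∏ i ∈ s, F i) := by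
  classical
  induction s using Finset.induction_on with
  | empty => exact isOneUnit_one n
  | insert i s hi ih =>
    rw [Finset.prod_insert hi]
    exact (h i (Finset.mem_insert_self i s)).mul hn
      (ih fun j hj => h j (Finset.mem_insert_of_mem hj))

end LaurentSeries

namespace Partition3D

open YoungDiagram LaurentSeries

variable {nu : YoungDiagram} {B N : ℕ} {k : ℂ}

theorem isOneUnit_windowFactor (hk : k ≠ 0) {L j : ℕ} (hj : j ≤ L) :
    IsOneUnit (2 * L) (windowFactor (HahnSeries.single 1 k : LaurentSeries ℂ)
      (HahnSeries.single 1 k⁻¹) L j) := by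
  have h := single_zpow_mul_single_zpow hk ((2 * j : ℕ) : ℤ) ((2 * (L - j) : ℕ) : ℤ)
  rw [zpow_natCast, zpow_natCast, mul_comm] at h
  rw [windowFactor, h, IsOneUnit, sub_sub_cancel_left]
  refine neg_mem fun i hi => HahnSeries.coeff_single_of_ne ?_
  push_cast [hj]
  omega

theorem windowFactor_ne_zero (hk : k ≠ 0) {L : ℕ} (hL : 0 < L) {j : ℕ} (hj : j ≤ L) :
    windowFactor (HahnSeries.single 1 k : LaurentSeries ℂ) (HahnSeries.single 1 k⁻¹) L j ≠ 0 :=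
  (isOneUnit_windowFactor hk hj).ne_zero (by omega)

theorem isOneUnit_windowProd (hk : k ≠ 0) {L j : ℕ} (hj : j ≤ L) :
    IsOneUnit (2 * L) (windowProd (HahnSeries.single 1 k : LaurentSeries ℂ)
      (HahnSeries.single 1 k⁻¹) L j) :=
  IsOneUnit.prod (by omega) fun i hi => isOneUnit_windowFactor hk (by
    rw [Finset.mem_range] at hi
    omega)

theorem one_sub_stepVar_div {F : Type*} [Field F] {a b : F} (ha : a ≠ 0) (hb : b ≠ 0) (c : ℤ)
    (L : ℕ) : 1 - stepVar nu a b (c + L) / stepVar nu a b c =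
      windowFactor a b L (nu.windowUp L c) := by
  have h1 := nu.windowUp_add L c
  have h2 := nu.path_mono (c := c) (d := c + L) (by omega)
  obtain ⟨m, hm⟩ := Nat.exists_eq_add_of_le h2
  obtain ⟨w, hw⟩ : ∃ w, nu.windowUp L c = w := ⟨_, rfl⟩
  rw [hw] at h1 ⊢
  rw [windowFactor, stepVar, stepVar, hm, show L - w = m by omega]
  have e1 : (2 * (c + L - (nu.path c + m : ℕ)) : ℤ) = 2 * (c - nu.path c) + ((2 * w : ℕ) : ℤ) := by
    push_cast
    omega
  have e2 : (2 * ((nu.path c + m : ℕ) : ℤ)) = 2 * nu.path c + ((2 * m : ℕ) : ℤ) := by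
    push_cast
    omega
  rw [e1, e2, zpow_add₀ ha, zpow_add₀ hb, zpow_natCast, zpow_natCast]
  have := zpow_ne_zero (2 * (c - nu.path c)) ha
  have := zpow_ne_zero (2 * (nu.path c : ℤ)) hb
  field_simp

/-- The product of the boundary terms of the walks of all windows between content `-N` and
content `N`. -/
noncomputable def boundaryProd {F : Type*} [Field F] (nu : YoungDiagram) (a b : F) (N : ℕ) : F :=
  ∏ d ∈ Finset.range (2 * N), windowProd a b (d + 1) (nu.windowUp (d + 1) (-(N : ℤ))) /
    windowProd a b (d + 1) (nu.windowUp (d + 1) (-(N : ℤ) + (2 * N - (d + 1) : ℕ)))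

theorem invProd_stepWord (hk : k ≠ 0) (hN : FitsIn nu N) :
    invProd (stepWord nu (HahnSeries.single 1 k : LaurentSeries ℂ) (HahnSeries.single 1 k⁻¹) N) =
      (boundaryProd nu (HahnSeries.single 1 k) (HahnSeries.single 1 k⁻¹) N *
        ∏ c ∈ nu.cells, (1 - HahnSeries.single 1 k⁻¹ ^ (2 * nu.legLen c) *
          HahnSeries.single 1 k ^ (2 * (nu.armLen c + 1))))⁻¹ := by
  have ha0 : (HahnSeries.single 1 k : LaurentSeries ℂ) ≠ 0 := HahnSeries.single_ne_zero hk
  have hb0 : (HahnSeries.single 1 k⁻¹ : LaurentSeries ℂ) ≠ 0 :=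
    HahnSeries.single_ne_zero (inv_ne_zero hk)
  rw [stepWord, invProd_map_range, Finset.prod_comm, ← prod_ascents nu _ _ hN, boundaryProd,
    ← Finset.prod_mul_distrib, ← Finset.prod_inv_distrib]
  refine Finset.prod_congr rfl fun d hd => ?_
  rw [Finset.mem_range] at hd
  rw [← prod_windowFactor nu _ _ (d + 1) (fun i hi => windowFactor_ne_zero hk (Nat.succ_pos d) hi),
    ← Finset.prod_inv_distrib]
  rw [← Finset.prod_subset (Finset.range_mono (Nat.sub_le (2 * N) (d + 1)))]
  · refine Finset.prod_congr rfl fun j hj => ?_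
    rw [Finset.mem_range] at hj
    have e1 : -(N : ℤ) + j = (j : ℤ) - N := by ring
    have e2 : ((j + d + 1 : ℕ) : ℤ) - N = (j : ℤ) - N + (d + 1 : ℕ) := by push_cast; ring
    dsimp only
    rw [e1, e2, one_sub_stepVar_div ha0 hb0, apply_ite Inv.inv, inv_one]
    refine if_congr ?_ rfl rfl
    exact ⟨fun h => h.2, fun h => ⟨by omega, h⟩⟩
  · intro j _ hj
    rw [Finset.mem_range] at hj
    exact if_neg fun h => hj (by omega)

/-- The windows of length at most `N - B` at the two ends of the path do not meet the square that
contains `nu`, so that their contributions to the quotient cancel; all factors belonging to longer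
windows are close to `1`. -/
theorem isOneUnit_boundaryProd_div (hk : k ≠ 0) (hB : FitsIn nu B) (hBN : B < N) :
    IsOneUnit (2 * ((N : ℤ) - B))
      (boundaryProd nu (HahnSeries.single 1 k : LaurentSeries ℂ) (HahnSeries.single 1 k⁻¹) N /
        boundaryProd ⊥ (HahnSeries.single 1 k) (HahnSeries.single 1 k⁻¹) N) := by
  rw [boundaryProd, boundaryProd, ← Finset.prod_div_distrib]
  refine IsOneUnit.prod (by omega) fun d hd => ?_
  rw [Finset.mem_range] at hd
  have hu : ∀ (α : YoungDiagram) (p : ℤ), IsOneUnit (2 * (d + 1 : ℕ))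
      (windowProd (HahnSeries.single 1 k : LaurentSeries ℂ) (HahnSeries.single 1 k⁻¹) (d + 1)
        (α.windowUp (d + 1) p)) := fun α p => isOneUnit_windowProd hk (α.windowUp_le _ _)
  rcases le_or_gt (d + 1 + B) N with h | h
  · have e : ∀ α : YoungDiagram, FitsIn α B → α.windowUp (d + 1) (-(N : ℤ)) = d + 1 ∧
        α.windowUp (d + 1) (-(N : ℤ) + (2 * N - (d + 1) : ℕ)) = 0 := fun α hα => by
      have h1 := α.windowUp_add (d + 1) (-(N : ℤ))
      have h2 := α.windowUp_add (d + 1) (-(N : ℤ) + (2 * N - (d + 1) : ℕ))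
      rw [path_of_le hα (by omega), path_of_le hα (by omega)] at h1
      have h3 := path_of_ge hα (c := -(N : ℤ) + (2 * N - (d + 1) : ℕ)) (by omega)
      have h4 := path_of_ge hα (c := -(N : ℤ) + (2 * N - (d + 1) : ℕ) + (d + 1 : ℕ)) (by omega)
      omega
    rw [(e nu hB).1, (e nu hB).2, (e ⊥ (fitsIn_bot B)).1, (e ⊥ (fitsIn_bot B)).2, div_self]
    · exact isOneUnit_one _
    · exact ((isOneUnit_windowProd hk le_rfl).div (by omega)
        (isOneUnit_windowProd hk (Nat.zero_le _))).ne_zero (by omega)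
  · exact (((hu _ _).div (by omega) (hu _ _)).div (by omega)
      ((hu _ _).div (by omega) (hu _ _))).mono (by omega)

theorem boundaryProd_ne_zero (hk : k ≠ 0) (nu : YoungDiagram) (N : ℕ) :
    boundaryProd nu (HahnSeries.single 1 k : LaurentSeries ℂ) (HahnSeries.single 1 k⁻¹) N ≠ 0 :=
  Finset.prod_ne_zero_iff.2 fun d _ => ((isOneUnit_windowProd hk (nu.windowUp_le _ _)).div (by omega)
    (isOneUnit_windowProd hk (nu.windowUp_le _ _))).ne_zero (by omega : (0 : ℤ) < 2 * (d + 1 : ℕ))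

/-- The product over the inversions, normalized by the case `nu = ⊥`, tends to the prefactor of the
refined vertex. -/
theorem tendsto_invProd_div (hk : k ≠ 0) (nu : YoungDiagram) :
    Tendsto (fun N : ℕ =>
      invProd (stepWord nu (HahnSeries.single 1 k : LaurentSeries ℂ) (HahnSeries.single 1 k⁻¹) N) /
        invProd (stepWord ⊥ (HahnSeries.single 1 k) (HahnSeries.single 1 k⁻¹) N)) atTop
      (𝓝 (∏ c ∈ nu.cells, (1 - HahnSeries.single 1 k⁻¹ ^ (2 * nu.legLen c) *
          HahnSeries.single 1 k ^ (2 * (nu.armLen c + 1))))⁻¹) := by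
  obtain ⟨B, hB, -⟩ := exists_fitsIn nu ⊥ ⊥
  have h1 : Tendsto (fun N : ℕ =>
      (boundaryProd nu (HahnSeries.single 1 k : LaurentSeries ℂ) (HahnSeries.single 1 k⁻¹) N /
        boundaryProd ⊥ (HahnSeries.single 1 k) (HahnSeries.single 1 k⁻¹) N)⁻¹) atTop (𝓝 1) := by
    refine tendsto_iff.2 fun n => ?_
    filter_upwards [eventually_ge_atTop (n.toNat + B + 1)] with N hN
    refine isOneUnit_iff.1 (((isOneUnit_boundaryProd_div hk hB (by omega)).inv (by omega)).mono ?_)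
    omega
  have h2 := h1.mul_const (∏ c ∈ nu.cells, (1 - HahnSeries.single 1 k⁻¹ ^ (2 * nu.legLen c) *
          HahnSeries.single 1 k ^ (2 * (nu.armLen c + 1))) : LaurentSeries ℂ)⁻¹
  rw [one_mul] at h2
  refine h2.congr' ?_
  filter_upwards [eventually_ge_atTop B] with N hN
  rw [invProd_stepWord hk fun c hc => by have := hB c hc; omega,
    invProd_stepWord hk (fitsIn_bot N)]
  have := boundaryProd_ne_zero hk nu N
  have := boundaryProd_ne_zero hk ⊥ N
  rw [show (⊥ : YoungDiagram).cells = ∅ from rfl, Finset.prod_empty, mul_one, mul_inv, inv_div,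
    div_inv_eq_mul, div_eq_mul_inv]
  ring

end Partition3D

/-! ### The sorted boundary word -/

namespace Partition3D

open YoungDiagram

variable {nu : YoungDiagram} {N : ℕ} {F : Type*} [Field F]

theorem stepVar_of_pathDir_false {a b : F} {c : ℤ} (h : nu.pathDir c = false) :
    stepVar nu a b c = a ^ (-(2 * (nu.rowLen (nu.path c) : ℤ))) * b ^ (2 * (nu.path c : ℤ)) := by
  rw [stepVar, nu.rowLen_path_of_pathDir_false h]
  congr 2
  ring

theorem stepVar_of_pathDir_true {a b : F} {c : ℤ} (h : nu.pathDir c = true) {y : ℕ}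
    (hy : (y : ℤ) = nu.path c - c - 1) :
    stepVar nu a b c = a ^ (-(2 * ((y : ℤ) + 1))) * b ^ (2 * (nu.colLen y : ℤ)) := by
  rw [stepVar, nu.colLen_of_pathDir_true h hy, hy]
  congr 2
  ring

theorem filter_stepWord {a b : F} (hN : FitsIn nu N) (n : ℕ) (hn : n ≤ 2 * N) :
    (((List.range n).map fun j : ℕ => (nu.pathDir ((j : ℤ) - N), stepVar nu a b ((j : ℤ) - N))).filter
        fun q => !q.1) = (List.range (nu.path ((n : ℤ) - N))).map (fun k : ℕ =>
          (false, a ^ (-(2 * (nu.rowLen k : ℤ))) * b ^ (2 * (k : ℤ)))) ∧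
    (((List.range n).map fun j : ℕ => (nu.pathDir ((j : ℤ) - N), stepVar nu a b ((j : ℤ) - N))).filter
        fun q => q.1) = (List.range (n - nu.path ((n : ℤ) - N))).map (fun m : ℕ =>
          (true, a ^ (-(2 * (((N - 1 - m : ℕ) : ℤ) + 1))) * b ^ (2 * (nu.colLen (N - 1 - m) : ℤ)))) := by
  induction n with
  | zero =>
    rw [path_of_le hN (by omega)]
    simp
  | succ n ih =>
    obtain ⟨ih1, ih2⟩ := ih (by omega)
    have e : ((n + 1 : ℕ) : ℤ) - N = (n : ℤ) - N + 1 := by push_cast; ring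
    rw [List.range_succ, List.map_append, List.filter_append, List.filter_append, ih1, ih2, e]
    have hle : nu.path ((n : ℤ) - N) ≤ n := by
      have := nu.path_add_le (-(N : ℤ)) n
      rw [path_of_le hN le_rfl, neg_add_eq_sub] at this
      omega
    rcases h : nu.pathDir ((n : ℤ) - N) with _ | _
    · have hp := nu.pathDir_eq_false.1 h
      rw [hp, Nat.add_sub_add_right, List.range_succ]
      simp [h, stepVar_of_pathDir_false h]
    · have hp := nu.pathDir_eq_true.1 h
      have h3 := (nu.path_le_iff ((n : ℤ) - N + 1) (nu.path ((n : ℤ) - N))).1 hp.le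
      have hy : (((N - 1 - (n - nu.path ((n : ℤ) - N)) : ℕ) : ℕ) : ℤ) =
          nu.path ((n : ℤ) - N) - ((n : ℤ) - N) - 1 := by omega
      rw [hp, Nat.sub_add_comm hle, List.range_succ]
      simp [h, stepVar_of_pathDir_true h hy]

theorem reverse_map_range {α : Type*} (f : ℕ → α) (N : ℕ) :
    ((List.range N).map fun m => f (N - 1 - m)).reverse = (List.range N).map f := by
  refine List.ext_getElem (by simp) fun i h1 h2 => ?_
  simp only [List.length_map, List.length_range] at h2
  simp only [List.getElem_reverse, List.getElem_map, List.getElem_range, List.length_map,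
    List.length_range]
  congr 1
  omega

theorem sortWord_stepWord {a b : F} (hN : FitsIn nu N) :
    sortWord (stepWord nu a b N) =
      ((List.range N).map fun k : ℕ =>
        (false, a ^ (-(2 * (nu.rowLen k : ℤ))) * b ^ (2 * (k : ℤ)))).reverse ++
      (List.range N).map fun i : ℕ =>
        (true, a ^ (-(2 * ((i : ℤ) + 1))) * b ^ (2 * (nu.colLen i : ℤ))) := by
  obtain ⟨h1, h2⟩ := filter_stepWord (a := a) (b := b) hN (2 * N) le_rfl
  have hp : nu.path (((2 * N : ℕ) : ℤ) - N) = N := by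
    have := path_of_ge hN (c := ((2 * N : ℕ) : ℤ) - N) (by omega)
    omega
  rw [hp] at h1 h2
  rw [show 2 * N - N = N by omega] at h2
  rw [sortWord, stepWord, h1, h2, ← reverse_map_range (fun i : ℕ =>
        (true, a ^ (-(2 * ((i : ℤ) + 1))) * b ^ (2 * (nu.colLen i : ℤ)))) N]

end Partition3D

/-! ### Chains of horizontal strips and tableaux -/

namespace YoungDiagram

/-- The decomposition of a chain at an intermediate partition. -/
theorem exists_chainAppendEquiv {F : Type*} [Field F] (w w' : List (Bool × F)) (α β : YoungDiagram) :
    ∃ e : Chain (w ++ w') α β ≃ Σ η, Chain w α η × Chain w' η β, ∀ c,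
      chainWeight (w ++ w') α β c =
        chainWeight w α (e c).1 (e c).2.1 * chainWeight w' (e c).1 β (e c).2.2 := by
  induction w generalizing α with
  | nil =>
    refine ⟨⟨fun c => ⟨α, ⟨rfl⟩, c⟩, fun x => x.2.1.down.symm ▸ x.2.2, fun c => rfl, ?_⟩, fun c => ?_⟩
    · rintro ⟨η, ⟨⟨h⟩, c⟩⟩
      subst h
      rfl
    · exact (one_mul _).symm
  | cons p w ih =>
    choose e he using ih
    let g : (Σ γ : {γ // Step p.1 α γ}, Σ η, Chain w γ.1 η × Chain w' η β) ≃
        Σ η, Chain (p :: w) α η × Chain w' η β :=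
      ⟨fun x => ⟨x.2.1, ⟨x.1, x.2.2.1⟩, x.2.2.2⟩, fun x => ⟨x.2.1.1, x.1, x.2.1.2, x.2.2⟩,
        fun _ => rfl, fun _ => rfl⟩
    refine ⟨(Equiv.sigmaCongrRight fun γ : {γ // Step p.1 α γ} => e γ.1).trans g, fun c => ?_⟩
    have h := he c.1.1 c.2
    change p.2 ^ _ * chainWeight (w ++ w') c.1.1 β c.2 = p.2 ^ _ * _ * _
    rw [h, mul_assoc]
    rfl

/-- The reversal of a chain. -/
theorem exists_chainReverseEquiv {F : Type*} [Field F] (w : List (Bool × F)) (α β : YoungDiagram) :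
    ∃ e : Chain w α β ≃ Chain (w.map fun p => (!p.1, p.2⁻¹)).reverse β α, ∀ c,
      chainWeight w α β c = chainWeight _ β α (e c) := by
  induction w generalizing α with
  | nil => exact ⟨⟨fun h => ⟨h.down.symm⟩, fun h => ⟨h.down.symm⟩, fun _ => rfl, fun _ => rfl⟩,
      fun _ => rfl⟩
  | cons p w ih =>
    choose e he using ih
    rw [List.map_cons, List.reverse_cons]
    obtain ⟨e', he'⟩ := exists_chainAppendEquiv (w.map fun p => (!p.1, p.2⁻¹)).reverse
      [(!p.1, p.2⁻¹)] β α
    have hstep : ∀ γ δ, Step (!p.1) γ δ ↔ Step p.1 δ γ := fun γ δ => by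
      cases p.1 <;> rfl
    let g : (Σ γ : {γ // Step p.1 α γ}, Chain (w.map fun p => (!p.1, p.2⁻¹)).reverse β γ.1) ≃
        Σ η, Chain (w.map fun p => (!p.1, p.2⁻¹)).reverse β η × Chain [(!p.1, p.2⁻¹)] η α :=
      ⟨fun x => ⟨x.1.1, x.2, ⟨⟨α, (hstep _ _).2 x.1.2⟩, ⟨rfl⟩⟩⟩,
        fun x => ⟨⟨x.1, by
          have := (hstep _ _).1 x.2.2.1.2
          rwa [x.2.2.2.down] at this⟩, x.2.1⟩, fun _ => rfl, by
        rintro ⟨η, c, ⟨⟨δ, hδ⟩, ⟨h⟩⟩⟩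
        dsimp only at h
        subst h
        rfl⟩
    refine ⟨((Equiv.sigmaCongrRight fun γ : {γ // Step p.1 α γ} => e γ.1).trans g).trans e'.symm,
      fun c => ?_⟩
    have h := he' (e'.symm (g ⟨c.1, e c.1.1 c.2⟩))
    rw [Equiv.apply_symm_apply] at h
    refine Eq.trans ?_ h.symm
    rw [chainWeight_cons, he, mul_comm]
    change _ = chainWeight _ β c.1.1 (e c.1.1 c.2) * (p.2⁻¹ ^ ((c.1.1.card : ℤ) - α.card) * 1)
    rw [mul_one, inv_zpow, ← zpow_neg, neg_sub]

section Tableau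

variable {α η : YoungDiagram} {n : ℕ}

/-- The boxes of `eta` and the boxes of `lam / eta` with entries less than `j`. -/
def tableauLevel (T : {c : ℕ × ℕ // c ∈ α.cells \ η.cells} → ℕ)
    (hT : IsSkewTableau α η T) (j : ℕ) : YoungDiagram where
  cells := α.cells.filter fun c => c ∈ η.cells ∨ ∃ h : c ∈ α.cells \ η.cells, T ⟨c, h⟩ < j
  isLowerSet := by
    rintro ⟨x, y⟩ ⟨x', y'⟩ hxy h
    obtain ⟨hx, hy⟩ := Prod.mk_le_mk.1 hxy
    simp only [Finset.coe_filter, Set.mem_ofPred_eq] at h ⊢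
    obtain ⟨hα, h⟩ := h
    refine ⟨α.isLowerSet hxy hα, ?_⟩
    by_cases hη : (x', y') ∈ η.cells
    · exact Or.inl hη
    refine Or.inr ?_
    rcases h with h | ⟨hc, h⟩
    · exact absurd (η.isLowerSet hxy h) hη
    · have h1 : (x', y') ∈ α.cells \ η.cells := Finset.mem_sdiff.2 ⟨α.isLowerSet hxy hα, hη⟩
      have h2 : (x', y) ∈ α.cells \ η.cells := Finset.mem_sdiff.2
        ⟨α.isLowerSet (Prod.mk_le_mk.2 ⟨hx, le_rfl⟩) hα,
          fun h => hη (η.isLowerSet (Prod.mk_le_mk.2 ⟨le_rfl, hy⟩) h)⟩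
      refine ⟨h1, (hT.1 ⟨_, h1⟩ ⟨_, h2⟩ rfl hy).trans_lt (lt_of_le_of_lt ?_ h)⟩
      rcases hx.eq_or_lt with rfl | hlt
      · exact le_rfl
      · exact (hT.2 ⟨_, h2⟩ ⟨_, hc⟩ rfl hlt).le

theorem mem_tableauLevel (hle : η ≤ α) {T : {c : ℕ × ℕ // c ∈ α.cells \ η.cells} → ℕ}
    {hT : IsSkewTableau α η T} {j : ℕ} {c : ℕ × ℕ} : c ∈ (tableauLevel T hT j).cells ↔
      c ∈ η.cells ∨ ∃ h : c ∈ α.cells \ η.cells, T ⟨c, h⟩ < j := by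
  simp only [tableauLevel, Finset.mem_filter, and_iff_right_iff_imp]
  rintro (h | ⟨h, -⟩)
  · exact hle h
  · exact (Finset.mem_sdiff.1 h).1

theorem tableauLevel_zero (hle : η ≤ α) {T : {c : ℕ × ℕ // c ∈ α.cells \ η.cells} → ℕ}
    (hT : IsSkewTableau α η T) : tableauLevel T hT 0 = η := by
  refine YoungDiagram.ext (Finset.ext fun c => ?_)
  simp [mem_tableauLevel hle]

theorem tableauLevel_of_ge (hle : η ≤ α) {T : {c : ℕ × ℕ // c ∈ α.cells \ η.cells} → ℕ}
    (hT : IsSkewTableau α η T) {j : ℕ} (hj : ∀ c, T c < j) : tableauLevel T hT j = α := by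
  refine YoungDiagram.ext (Finset.ext fun c => ?_)
  rw [mem_tableauLevel hle]
  refine ⟨?_, fun h => ?_⟩
  · rintro (h | ⟨h, -⟩)
    · exact hle h
    · exact (Finset.mem_sdiff.1 h).1
  · by_cases hη : c ∈ η.cells
    · exact Or.inl hη
    · exact Or.inr ⟨Finset.mem_sdiff.2 ⟨h, hη⟩, hj _⟩

theorem interlace_tableauLevel (hle : η ≤ α) {T : {c : ℕ × ℕ // c ∈ α.cells \ η.cells} → ℕ}
    (hT : IsSkewTableau α η T) (j : ℕ) :
    Interlace (tableauLevel T hT j) (tableauLevel T hT (j + 1)) := by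
  rw [interlace_iff]
  simp only [mem_tableauLevel hle]
  constructor
  · rintro x y (h | ⟨h, h'⟩)
    · exact Or.inl h
    · exact Or.inr ⟨h, h'.trans (Nat.lt_succ_self j)⟩
  · rintro x y (h | ⟨h, h'⟩)
    · exact Or.inl (η.isLowerSet (Prod.mk_le_mk.2 ⟨Nat.le_succ x, le_rfl⟩) h)
    · by_cases hη : (x, y) ∈ η.cells
      · exact Or.inl hη
      · have h1 : (x, y) ∈ α.cells \ η.cells := Finset.mem_sdiff.2
          ⟨α.isLowerSet (Prod.mk_le_mk.2 ⟨Nat.le_succ x, le_rfl⟩) (Finset.mem_sdiff.1 h).1, hη⟩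
        have := hT.2 ⟨_, h1⟩ ⟨_, h⟩ rfl (Nat.lt_succ_self x)
        exact Or.inr ⟨h1, by omega⟩

theorem card_tableauLevel (hle : η ≤ α) {T : {c : ℕ × ℕ // c ∈ α.cells \ η.cells} → ℕ}
    (hT : IsSkewTableau α η T) (j : ℕ) :
    ((tableauLevel T hT (j + 1)).card : ℤ) - (tableauLevel T hT j).card =
      (Finset.univ.filter fun c => T c = j).card := by
  have h1 : (tableauLevel T hT (j + 1)).cells = (tableauLevel T hT j).cells ∪
      (Finset.univ.filter fun c => T c = j).map (Function.Embedding.subtype _) := by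
    ext c
    rw [Finset.mem_union, mem_tableauLevel hle, mem_tableauLevel hle]
    simp only [Finset.mem_map, Finset.mem_filter, Finset.mem_univ, true_and,
      Function.Embedding.coe_subtype, Subtype.exists, exists_and_right, exists_eq_right,
      Nat.lt_succ_iff_lt_or_eq, exists_or, or_assoc]
  have h2 : Disjoint (tableauLevel T hT j).cells
      ((Finset.univ.filter fun c => T c = j).map (Function.Embedding.subtype _)) := by
    rw [Finset.disjoint_left]
    intro c hc h
    obtain ⟨d, hd, rfl⟩ := Finset.mem_map.1 h
    rcases (mem_tableauLevel hle).1 hc with h | ⟨h, h'⟩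
    · exact (Finset.mem_sdiff.1 d.2).2 h
    · have := (Finset.mem_filter.1 hd).2
      exact absurd h' (by
        change ¬ T d < j
        omega)
  rw [YoungDiagram.card, YoungDiagram.card, h1, Finset.card_union_of_disjoint h2, Finset.card_map]
  push_cast
  ring

/-- Semistandard tableaux with entries less than `n` correspond to sequences of `n` horizontal
strips. -/
theorem exists_tableauEquiv {F : Type*} [Field F] (hle : η ≤ α) (u : ℕ → F) (n : ℕ) :
    ∃ e : {T : {c : ℕ × ℕ // c ∈ α.cells \ η.cells} → ℕ // IsSkewTableau α η T ∧ ∀ c, T c < n} ≃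
      Seq (fun i => (true, u i)) n η α, ∀ T, ∏ j ∈ Finset.range n,
        u j ^ ((((e T).1 j).card : ℤ) - ((e T).1 (j + 1)).card) = ∏ c, (u (T.1 c))⁻¹ := by
  let f : {T : {c : ℕ × ℕ // c ∈ α.cells \ η.cells} → ℕ // IsSkewTableau α η T ∧ ∀ c, T c < n} →
      Seq (fun i => (true, u i)) n η α := fun T => ⟨tableauLevel T.1 T.2.1,
    tableauLevel_zero hle T.2.1, fun j hj => tableauLevel_of_ge hle T.2.1 fun c =>
      (T.2.2 c).trans_le hj, fun j _ => interlace_tableauLevel hle T.2.1 j⟩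
  have hf : Function.Bijective f := by
    constructor
    · intro T T' h
      have h' : ∀ j, tableauLevel T.1 T.2.1 j = tableauLevel T'.1 T'.2.1 j := fun j =>
        congrFun (congrArg Subtype.val h) j
      have key : ∀ c j, T.1 c < j ↔ T'.1 c < j := fun c j => by
        have hc := (Finset.mem_sdiff.1 c.2).2
        have h1 := congrArg (fun δ : YoungDiagram => c.1 ∈ δ.cells) (h' j)
        simp only [mem_tableauLevel hle, hc, false_or, eq_iff_iff] at h1
        exact ⟨fun h => (h1.1 ⟨c.2, h⟩).2, fun h => (h1.2 ⟨c.2, h⟩).2⟩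
      refine Subtype.ext (funext fun c => ?_)
      have h1 := (key c (T.1 c + 1)).1 (Nat.lt_succ_self _)
      have h2 := (key c (T'.1 c + 1)).2 (Nat.lt_succ_self _)
      omega
    · intro ρ
      have hstep : ∀ j, Interlace (ρ.1 j) (ρ.1 (j + 1)) := fun j => by
        rcases lt_or_ge j n with h | h
        · exact ρ.2.2.2 j h
        · rw [ρ.2.2.1 j h, ρ.2.2.1 (j + 1) (by omega)]
          exact interlace_refl α
      have hmono : ∀ i j, i ≤ j → ∀ c ∈ (ρ.1 i).cells, c ∈ (ρ.1 j).cells := fun i j hij c hc =>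
        Nat.le_induction hc (fun j _ ih => (interlace_iff.1 (hstep j)).1 _ _ ih) j hij
      have hex : ∀ c : {c : ℕ × ℕ // c ∈ α.cells \ η.cells}, ∃ j, c.1 ∈ (ρ.1 (j + 1)).cells :=
        fun c => ⟨n, by
          rw [ρ.2.2.1 _ (Nat.le_succ n)]
          exact (Finset.mem_sdiff.1 c.2).1⟩
      have hpos : ∀ (c : {c : ℕ × ℕ // c ∈ α.cells \ η.cells}) j, c.1 ∈ (ρ.1 j).cells → 0 < j :=
        fun c j h => by
          rcases j with _ | j
          · rw [ρ.2.1] at h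
            exact absurd h (Finset.mem_sdiff.1 c.2).2
          · exact Nat.succ_pos j
      classical
      let T : {c : ℕ × ℕ // c ∈ α.cells \ η.cells} → ℕ := fun c => Nat.find (hex c)
      have hTlt : ∀ c j, T c < j ↔ c.1 ∈ (ρ.1 j).cells := fun c j => by
        constructor
        · intro h
          exact hmono _ _ h _ (Nat.find_spec (hex c))
        · intro h
          have := hpos c j h
          have h1 : T c ≤ j - 1 := Nat.find_min' (hex c) (by
            rwa [Nat.sub_add_cancel this])
          omega
      have hT : IsSkewTableau α η T := by
        constructor
        · rintro ⟨⟨x, y⟩, hc⟩ ⟨⟨x', y'⟩, hd⟩ h1 h2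
          refine Nat.le_of_lt_succ ((hTlt _ _).2 ?_)
          exact (ρ.1 _).isLowerSet (Prod.mk_le_mk.2 ⟨h1.le, h2⟩)
            ((hTlt ⟨(x', y'), hd⟩ _).1 (Nat.lt_succ_self _))
        · rintro ⟨⟨x, y⟩, hc⟩ ⟨⟨x', y'⟩, hd⟩ h1 h2
          dsimp only at h1 h2
          subst h1
          rw [hTlt]
          refine (interlace_iff.1 (hstep _)).2 x y ?_
          exact (ρ.1 _).isLowerSet (Prod.mk_le_mk.2 ⟨h2, le_rfl⟩)
            ((hTlt ⟨(x', y), hd⟩ _).1 (Nat.lt_succ_self _))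
      refine ⟨⟨T, hT, fun c => ?_⟩, Subtype.ext (funext fun j => YoungDiagram.ext
        (Finset.ext fun c => ?_))⟩
      · rw [hTlt, ρ.2.2.1 n le_rfl]
        exact (Finset.mem_sdiff.1 c.2).1
      · change c ∈ (tableauLevel T hT j).cells ↔ _
        rw [mem_tableauLevel hle]
        constructor
        · rintro (h | ⟨h, h'⟩)
          · refine hmono 0 j (Nat.zero_le j) c ?_
            rwa [ρ.2.1]
          · exact (hTlt ⟨c, h⟩ j).1 h'
        · intro h
          by_cases hη : c ∈ η.cells
          · exact Or.inl hη
          · have hc : c ∈ α.cells := by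
              have := hmono j (max j n) (le_max_left _ _) c h
              rwa [ρ.2.2.1 _ (le_max_right _ _)] at this
            exact Or.inr ⟨Finset.mem_sdiff.2 ⟨hc, hη⟩, (hTlt ⟨c, _⟩ j).2 h⟩
  refine ⟨Equiv.ofBijective f hf, fun T => ?_⟩
  rw [← Finset.prod_fiberwise_of_maps_to (s := Finset.univ) (t := Finset.range n) (g := T.1)
    (fun c _ => Finset.mem_range.2 (T.2.2 c))]
  refine Finset.prod_congr rfl fun j _ => ?_
  rw [Finset.prod_congr rfl fun c hc => by rw [(Finset.mem_filter.1 hc).2], Finset.prod_const,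
    ← zpow_natCast, ← card_tableauLevel hle T.2.1 j, inv_zpow, ← zpow_neg, neg_sub]
  rfl

theorem le_of_seq {F : Type*} {u : ℕ → F} (ρ : Seq (fun i => (true, u i)) n η α) : η ≤ α := by
  have h : ∀ j ≤ n, η ≤ ρ.1 j := fun j => by
    induction j with
    | zero => exact fun _ => ρ.2.1.ge
    | succ j ih => exact fun hj => (ih (by omega)).trans fun c hc =>
        (interlace_iff.1 (ρ.2.2.2 j (by omega))).1 _ _ hc
  exact (h n le_rfl).trans (ρ.2.2.1 n le_rfl).le

end Tableau

end YoungDiagram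

/-! ### Sums over sorted chains -/

namespace YoungDiagram

variable {K : Type*} [Field K] {α β η : YoungDiagram} {n : ℕ}

theorem finite_bounded_tableaux (α η : YoungDiagram) (n : ℕ) :
    Finite {T : {c : ℕ × ℕ // c ∈ α.cells \ η.cells} → ℕ // IsSkewTableau α η T ∧ ∀ c, T c < n} :=
  Finite.of_injective (β := {c : ℕ × ℕ // c ∈ α.cells \ η.cells} → Fin n)
    (fun T c => ⟨T.1 c, T.2.2 c⟩) fun _ _ h => Subtype.ext (funext fun c =>
      congrArg Fin.val (congrFun h c))

open Classical in
/-- The skew Schur polynomial in the first `n` variables; it is zero unless `η` is contained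
in `α`. -/
noncomputable def schurPoly (α η : YoungDiagram) (y : ℕ → LaurentSeries K) (n : ℕ) :
    LaurentSeries K :=
  if η ≤ α then ∑' T : {T : {c : ℕ × ℕ // c ∈ α.cells \ η.cells} → ℕ //
    IsSkewTableau α η T ∧ ∀ c, T c < n}, ∏ c, y (T.1 c) else 0

theorem finite_chain_up {F : Type*} [Field F] (u : ℕ → F) (n : ℕ) (η α : YoungDiagram) :
    Finite (Chain ((List.range n).map fun i => (true, u i)) η α) := by
  obtain ⟨e, -⟩ := exists_seqEquiv (fun i => (true, u i)) n η α
  by_cases h : η ≤ α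
  · obtain ⟨e', -⟩ := exists_tableauEquiv h u n
    have := finite_bounded_tableaux α η n
    exact Finite.of_equiv _ (e'.trans e)
  · have : IsEmpty (Chain ((List.range n).map fun i => (true, u i)) η α) :=
      ⟨fun c => h (le_of_seq (e.symm c))⟩
    infer_instance

theorem hasSum_chain_up (u : ℕ → LaurentSeries K) (n : ℕ) (η α : YoungDiagram) :
    HasSum (chainWeight ((List.range n).map fun i => (true, u i)) η α)
      (schurPoly α η (fun i => (u i)⁻¹) n) := by
  obtain ⟨e, he⟩ := exists_seqEquiv (fun i => (true, u i)) n η α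
  rw [schurPoly]
  split_ifs with h
  · obtain ⟨e', he'⟩ := exists_tableauEquiv h u n
    have := finite_bounded_tableaux α η n
    rw [← (e'.trans e).hasSum_iff]
    have h1 : Summable fun T : {T : {c : ℕ × ℕ // c ∈ α.cells \ η.cells} → ℕ //
      IsSkewTableau α η T ∧ ∀ c, T c < n} => ∏ c, (u (T.1 c))⁻¹ := Summable.of_finite
    refine h1.hasSum.congr_fun fun T => ?_
    exact (he (e' T)).trans (he' T)
  · have : IsEmpty (Chain ((List.range n).map fun i => (true, u i)) η α) :=
      ⟨fun c => h (le_of_seq (e.symm c))⟩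
    exact hasSum_empty

/-- The descending chains with a given word are the reversed ascending chains. -/
theorem exists_chainDownEquiv {F : Type*} [Field F] (d : ℕ → F) (n : ℕ) (α η : YoungDiagram) :
    ∃ e : Chain ((List.range n).map fun i => (true, (d i)⁻¹)) η α ≃
      Chain ((List.range n).map fun i => (false, d i)).reverse α η, ∀ c,
        chainWeight ((List.range n).map fun i => (true, (d i)⁻¹)) η α c =
          chainWeight _ α η (e c) := by
  have h := exists_chainReverseEquiv ((List.range n).map fun i => (true, (d i)⁻¹)) η α
  have e : (fun p : Bool × F => (!p.1, p.2⁻¹)) ∘ (fun i => (true, (d i)⁻¹)) =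
      fun i => (false, d i) := funext fun i => by simp
  rwa [List.map_map, e] at h

theorem hasSum_chain_down (d : ℕ → LaurentSeries K) (n : ℕ) (α η : YoungDiagram) :
    HasSum (chainWeight ((List.range n).map fun i => (false, d i)).reverse α η)
      (schurPoly α η d n) := by
  obtain ⟨e, he⟩ := exists_chainDownEquiv d n α η
  have h := hasSum_chain_up (fun i => (d i)⁻¹) n η α
  simp only [inv_inv] at h
  rw [← e.hasSum_iff]
  exact h.congr_fun fun c => (he c).symm

theorem finite_le (α : YoungDiagram) : {η : YoungDiagram | η ≤ α}.Finite :=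
  Set.Finite.of_finite_image (f := YoungDiagram.cells)
    ((α.cells.powerset.finite_toSet).subset (by
      rintro _ ⟨η, h, rfl⟩
      exact Finset.mem_coe.2 (Finset.mem_powerset.2 h)))
    fun η _ η' _ h => YoungDiagram.ext h

/-- A sorted chain descends from `α` to some `η` and then ascends to `β`. -/
theorem hasSum_sorted_chain (d u : ℕ → LaurentSeries K) (n : ℕ) (α β : YoungDiagram) :
    HasSum (chainWeight (((List.range n).map fun i => (false, d i)).reverse ++
        (List.range n).map fun i => (true, u i)) α β)
      (∑ η ∈ (finite_le α).toFinset, schurPoly α η d n * schurPoly β η (fun i => (u i)⁻¹) n) := by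
  obtain ⟨e, he⟩ := exists_chainAppendEquiv ((List.range n).map fun i => (false, d i)).reverse
    ((List.range n).map fun i => (true, u i)) α β
  have hfd : ∀ η, Finite (Chain ((List.range n).map fun i => (false, d i)).reverse α η) := fun η => by
    obtain ⟨e, -⟩ := exists_chainDownEquiv d n α η
    have := finite_chain_up (fun i => (d i)⁻¹) n η α
    exact Finite.of_equiv _ e
  have hfu := fun η => finite_chain_up u n η β
  have hle : ∀ η, Nonempty (Chain ((List.range n).map fun i => (false, d i)).reverse α η) → η ≤ α := by
    rintro η ⟨c⟩
    obtain ⟨e, -⟩ := exists_chainDownEquiv d n α η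
    obtain ⟨e', -⟩ := exists_seqEquiv (fun i => (true, (d i)⁻¹)) n η α
    exact le_of_seq (e'.symm (e.symm c))
  have hfin : Finite (Σ η, Chain ((List.range n).map fun i => (false, d i)).reverse α η ×
      Chain ((List.range n).map fun i => (true, u i)) η β) := by
    have := (finite_le α).to_subtype
    refine Finite.of_surjective (α := Σ η : {η : YoungDiagram | η ≤ α},
      Chain ((List.range n).map fun i => (false, d i)).reverse α η.1 ×
      Chain ((List.range n).map fun i => (true, u i)) η.1 β) (fun x => ⟨x.1.1, x.2⟩) ?_
    rintro ⟨η, x⟩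
    exact ⟨⟨⟨η, hle η ⟨x.1⟩⟩, x⟩, rfl⟩
  rw [← e.symm.hasSum_iff]
  refine HasSum.sigma_of_hasSum (g := fun η => schurPoly α η d n *
    schurPoly β η (fun i => (u i)⁻¹) n) (hasSum_sum_of_ne_finset_zero fun η hη => ?_) (fun η => ?_)
    Summable.of_finite
  · have h : ¬ η ≤ α := fun h => hη ((finite_le α).mem_toFinset.2 h)
    rw [schurPoly, if_neg h, zero_mul]
  · refine ((hasSum_chain_down d n α η).mul_of_nonarchimedean (hasSum_chain_up u n η β)).congr_fun
      fun c => ?_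
    have h := he (e.symm ⟨η, c⟩)
    rw [Equiv.apply_symm_apply] at h
    exact h

theorem exists_mem_lowSubgroup {y : ℕ → LaurentSeries K}
    (hy : ∀ n : ℤ, ∀ᶠ i in atTop, y i ∈ LaurentSeries.lowSubgroup K n) :
    ∃ m : ℕ, ∀ i, y i ∈ LaurentSeries.lowSubgroup K (-(m : ℤ)) := by
  obtain ⟨I, hI⟩ := eventually_atTop.1 (hy 0)
  refine ⟨(Finset.range I).sup fun i => (y i).order.natAbs, fun i j hj => ?_⟩
  rcases lt_or_ge i I with h | h
  · have h1 := Finset.le_sup (f := fun i => (y i).order.natAbs) (Finset.mem_range.2 h)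
    exact HahnSeries.coeff_eq_zero_of_lt_order (by omega)
  · exact hI i h j (by omega)

/-- The skew Schur function is the limit of the skew Schur polynomials, if the variables tend to
zero. -/
theorem tendsto_schurPoly (α η : YoungDiagram) {y : ℕ → LaurentSeries K}
    (hy : ∀ n : ℤ, ∀ᶠ i in atTop, y i ∈ LaurentSeries.lowSubgroup K n) :
    Tendsto (schurPoly α η y) atTop (𝓝 (skewSchur α η y)) := by
  by_cases hle : η ≤ α
  · obtain ⟨m, hm⟩ := exists_mem_lowSubgroup hy
    have hprod : ∀ (T : {c : ℕ × ℕ // c ∈ α.cells \ η.cells} → ℕ)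
        (s : Finset {c : ℕ × ℕ // c ∈ α.cells \ η.cells}),
        ∏ c ∈ s, y (T c) ∈ LaurentSeries.lowSubgroup K (-(m * s.card : ℕ) : ℤ) := by
      intro T s
      classical
      induction s using Finset.induction_on with
      | empty => exact fun j hj => LaurentSeries.coeff_one_of_ne (by
          simp only [Finset.card_empty] at hj
          omega)
      | insert c s hc ih =>
        rw [Finset.prod_insert hc, Finset.card_insert_of_notMem hc]
        have := LaurentSeries.mul_mem_lowSubgroup (hm (T c)) ih
        rwa [show (-(m : ℤ) + (-(m * s.card : ℕ) : ℤ)) = (-(m * (s.card + 1) : ℕ) : ℤ) by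
          push_cast; ring] at this
    -- a tableau with a large entry only contributes terms of large degree
    have key : ∀ n : ℤ, ∃ I, ∀ T : {c : ℕ × ℕ // c ∈ α.cells \ η.cells} → ℕ,
        (∃ j < n, (∏ c, y (T c)).coeff j ≠ 0) → ∀ c, T c < I := by
      intro n
      obtain ⟨I, hI⟩ := eventually_atTop.1
        (hy (n + (m * Fintype.card {c : ℕ × ℕ // c ∈ α.cells \ η.cells} : ℕ)))
      refine ⟨I, fun T ⟨j, hj, hne⟩ c => ?_⟩
      by_contra! h
      refine hne ?_
      classical
      rw [← Finset.mul_prod_erase _ _ (Finset.mem_univ c)]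
      refine LaurentSeries.mul_mem_lowSubgroup (hI _ h) (hprod T (Finset.univ.erase c)) j ?_
      have : m * (Finset.univ.erase c).card ≤
          m * Fintype.card {c : ℕ × ℕ // c ∈ α.cells \ η.cells} :=
        Nat.mul_le_mul_left m (Finset.card_le_univ _)
      omega
    have h1 : schurPoly α η y = fun n => ∑' T : {T : {c : ℕ × ℕ // c ∈ α.cells \ η.cells} → ℕ |
        IsSkewTableau α η T ∧ ∀ c, T c < n}, ∏ c, y (T.1 c) := funext fun n => if_pos hle
    rw [h1, skewSchur, if_pos hle]
    refine LaurentSeries.tendsto_tsum_subtype (S := {T | IsSkewTableau α η T})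
      (f := fun T => ∏ c, y (T c)) (fun _ _ h => And.left h) (fun n => ?_) fun n => ?_
    · obtain ⟨I, hI⟩ := key n
      refine (Set.finite_coe_iff.1 (finite_bounded_tableaux α η I)).subset ?_
      rintro T ⟨hT, h⟩
      exact ⟨hT, hI T h⟩
    · obtain ⟨I, hI⟩ := key n
      filter_upwards [eventually_ge_atTop I] with N hN T hT h
      exact ⟨hT, fun c => (hI T h c).trans_le hN⟩
  · have h1 : schurPoly α η y = fun _ => 0 := funext fun n => if_neg hle
    rw [h1, skewSchur, if_neg hle]
    exact tendsto_const_nhds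

theorem schurPoly_smul (α η : YoungDiagram) (x : LaurentSeries K) (y : ℕ → LaurentSeries K) (n : ℕ) :
    schurPoly α η (fun i => x * y i) n = x ^ ((α.card : ℤ) - η.card) * schurPoly α η y n := by
  rw [schurPoly, schurPoly]
  split_ifs with h
  · rw [← tsum_mul_left]
    refine tsum_congr fun T => ?_
    have hc : Fintype.card {c : ℕ × ℕ // c ∈ α.cells \ η.cells} + η.card = α.card := by
      rw [Fintype.card_coe]
      exact Finset.card_sdiff_add_card_eq_card h
    rw [Finset.prod_mul_distrib, Finset.prod_const, Finset.card_univ, ← hc, ← zpow_natCast]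
    congr 2
    push_cast
    ring
  · rw [mul_zero]

end YoungDiagram

/-! ### The refined vertex as the limit -/

namespace YoungDiagram

theorem sum_cells_snd (mu : YoungDiagram) : ∑ c ∈ mu.cells, (2 * (c.2 : ℤ) + 1) = mu.normSq := by
  have hodd : ∀ n : ℕ, ∑ j ∈ Finset.range n, (2 * (j : ℤ) + 1) = (n : ℤ) ^ 2 := fun n => by
    induction n with
    | zero => simp
    | succ n ih =>
      rw [Finset.sum_range_succ, ih]
      push_cast
      ring
  have hmaps : ∀ c ∈ mu.cells, c.1 ∈ Finset.range (mu.colLen 0) := fun c hc => by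
    rw [Finset.mem_range]
    exact mem_iff_lt_colLen.1 (mu.up_left_mem (le_refl c.1) (Nat.zero_le c.2) hc)
  rw [← Finset.sum_fiberwise_of_maps_to hmaps]
  have hrow : ∀ i, ∑ c ∈ mu.cells with c.1 = i, (2 * (c.2 : ℤ) + 1) = (mu.rowLen i : ℤ) ^ 2 :=
    fun i => by
    rw [show mu.cells.filter (fun c => c.1 = i) = mu.row i from rfl, row_eq_prod,
      Finset.sum_product, Finset.sum_singleton, hodd]
  simp only [hrow]
  rw [normSq, rowLens, List.map_map]
  have hl : ∀ m : ℕ, ((((List.range m).map ((fun a => a ^ 2) ∘ mu.rowLen)).sum : ℕ) : ℤ) =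
      ∑ i ∈ Finset.range m, (mu.rowLen i : ℤ) ^ 2 := fun m => by
    induction m with
    | zero => simp
    | succ m ih =>
      rw [List.range_succ, List.map_append, List.sum_append, Finset.sum_range_succ, Nat.cast_add, ih]
      simp
  exact (hl _).symm

theorem sum_cells_fst (lam : YoungDiagram) :
    ∑ c ∈ lam.cells, (2 * (c.1 : ℤ) + 1) = lam.transpose.normSq := by
  rw [← sum_cells_snd]
  refine Finset.sum_bij' (fun c _ => c.swap) (fun c _ => c.swap) ?_ ?_ ?_ ?_ ?_
  · intro c hc
    rw [mem_cells, mem_transpose]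
    exact hc
  · intro c hc
    rwa [mem_cells, mem_transpose] at hc
  · intro c _
    rfl
  · intro c _
    rfl
  · intro c _
    rfl

theorem transpose_bot : (⊥ : YoungDiagram).transpose = ⊥ := by
  refine YoungDiagram.ext (Finset.ext fun c => ?_)
  rw [mem_cells, mem_transpose]
  simp

theorem schurPoly_self {K : Type*} [Field K] (α : YoungDiagram) (y : ℕ → LaurentSeries K) (n : ℕ) :
    schurPoly α α y n = 1 := by
  have : IsEmpty {c : ℕ × ℕ // c ∈ α.cells \ α.cells} := ⟨fun c => by simpa using c.2⟩
  rw [schurPoly, if_pos le_rfl]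
  let T₀ : {T : {c : ℕ × ℕ // c ∈ α.cells \ α.cells} → ℕ // IsSkewTableau α α T ∧ ∀ c, T c < n} :=
    ⟨isEmptyElim, ⟨fun c => isEmptyElim c, fun c => isEmptyElim c⟩, fun c => isEmptyElim c⟩
  have : Unique {T : {c : ℕ × ℕ // c ∈ α.cells \ α.cells} → ℕ //
      IsSkewTableau α α T ∧ ∀ c, T c < n} :=
    ⟨⟨T₀⟩, fun T => Subtype.ext (funext fun c => isEmptyElim c)⟩
  rw [(hasSum_unique _).tsum_eq, Finset.univ_eq_empty, Finset.prod_empty]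

end YoungDiagram

namespace Partition3D

open YoungDiagram

variable {lam mu nu : YoungDiagram} {k : ℂ}

theorem eventually_mem_lowSubgroup (x y : ℕ → ℤ) {M : ℕ} (hy : ∀ i, y i ≤ M)
    (hx : ∀ i : ℕ, (i : ℤ) ≤ x i) (hk : k ≠ 0) (n : ℤ) : ∀ᶠ i : ℕ in atTop,
      (HahnSeries.single 1 k : LaurentSeries ℂ) ^ x i * HahnSeries.single 1 k⁻¹ ^ (-(2 * y i)) ∈
        LaurentSeries.lowSubgroup ℂ n := by
  filter_upwards [eventually_ge_atTop (n.natAbs + 2 * M)] with i hi j hj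
  rw [single_zpow_mul_single_zpow hk]
  refine HahnSeries.coeff_single_of_ne ?_
  have := hy i
  have := hx i
  omega

/-- The normalized sum over the sorted chains for a finite boundary word. -/
noncomputable def finiteSchurSum {F : Type*} [Field F] (lam mu nu : YoungDiagram)
    (a b : LaurentSeries F) (N : ℕ) : LaurentSeries F :=
  ∑ η ∈ (finite_le mu.transpose).toFinset, (b / a) ^ η.card *
    schurPoly lam η (fun i => a ^ (2 * i + 1) * b ^ (-(2 * (nu.transpose.rowLen i : ℤ)))) N *
    schurPoly mu.transpose η (fun i => b ^ (2 * i + 1) * a ^ (-(2 * (nu.rowLen i : ℤ)))) N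

/-- The sum with cutoff as the refined vertex in finitely many variables, apart from the product over
the inversions. The variables of the sorted word differ from those of the refined vertex by a factor
`a` or `b⁻¹`, which is moved into the prefactor by homogeneity. -/
theorem cutoffSeries_eq_finiteSchurSum (hk : k ≠ 0) {N : ℕ} (hN : FitsIn nu N) :
    cutoffSeries lam mu nu k N =
      HahnSeries.single 1 k ^ (-(lam.transpose.normSq : ℤ)) *
        HahnSeries.single 1 k⁻¹ ^ (-(mu.normSq : ℤ)) *
        finiteSchurSum lam mu nu (HahnSeries.single 1 k) (HahnSeries.single 1 k⁻¹) N *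
        invProd (stepWord nu (HahnSeries.single 1 k) (HahnSeries.single 1 k⁻¹) N) := by
  have ha : (HahnSeries.single 1 k : LaurentSeries ℂ) ≠ 0 := HahnSeries.single_ne_zero hk
  have hb : (HahnSeries.single 1 k⁻¹ : LaurentSeries ℂ) ≠ 0 :=
    HahnSeries.single_ne_zero (inv_ne_zero hk)
  have hS := hasSum_sorted_chain
    (fun i : ℕ => (HahnSeries.single 1 k : LaurentSeries ℂ) ^ (-(2 * (nu.rowLen i : ℤ))) *
      HahnSeries.single 1 k⁻¹ ^ (2 * (i : ℤ)))
    (fun i : ℕ => HahnSeries.single 1 k ^ (-(2 * ((i : ℤ) + 1))) *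
      HahnSeries.single 1 k⁻¹ ^ (2 * (nu.colLen i : ℤ))) N mu.transpose lam
  rw [← sortWord_stepWord hN] at hS
  rw [cutoffSeries_eq hk hN hS]
  generalize (HahnSeries.single 1 k : LaurentSeries ℂ) = a at ha ⊢
  generalize (HahnSeries.single 1 k⁻¹ : LaurentSeries ℂ) = b at hb ⊢
  have e1 : (fun i : ℕ => a ^ (-(2 * (nu.rowLen i : ℤ))) * b ^ (2 * (i : ℤ))) =
      fun i => b⁻¹ * (b ^ (2 * i + 1) * a ^ (-(2 * (nu.rowLen i : ℤ)))) := funext fun i => by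
    rw [show (2 * (i : ℤ)) = ((2 * i : ℕ) : ℤ) by push_cast; ring, zpow_natCast, pow_succ]
    field_simp
  have e2 : (fun i : ℕ => (a ^ (-(2 * ((i : ℤ) + 1))) * b ^ (2 * (nu.colLen i : ℤ)))⁻¹) =
      fun i => a * (a ^ (2 * i + 1) * b ^ (-(2 * (nu.transpose.rowLen i : ℤ)))) := funext fun i => by
    rw [rowLen_transpose, mul_inv, ← zpow_neg, ← zpow_neg, neg_neg,
      show (2 * ((i : ℤ) + 1)) = ((2 * i + 1 + 1 : ℕ) : ℤ) by push_cast; ring, zpow_natCast,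
      pow_succ' _ (2 * i + 1), mul_assoc]
  rw [e1, e2]
  simp only [schurPoly_smul]
  rw [finiteSchurSum, ← mul_assoc, Finset.mul_sum (finite_le mu.transpose).toFinset,
    Finset.mul_sum (finite_le mu.transpose).toFinset]
  refine congrArg (· * _) (Finset.sum_congr rfl fun η _ => ?_)
  have hcT : mu.transpose.card = mu.card := by
    simp [YoungDiagram.card, YoungDiagram.transpose]
  have h1 : (lam.transpose.normSq : ℤ) = 2 * ∑ c ∈ lam.cells, ((c.1 : ℤ) + 1) - lam.card := by
    rw [← sum_cells_fst, Finset.mul_sum, YoungDiagram.card, Finset.card_eq_sum_ones, Nat.cast_sum,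
      ← Finset.sum_sub_distrib]
    refine Finset.sum_congr rfl fun c _ => ?_
    push_cast
    ring
  have h2 : (mu.normSq : ℤ) = 2 * ∑ c ∈ mu.cells, (c.2 : ℤ) + mu.card := by
    rw [← sum_cells_snd, Finset.mul_sum, YoungDiagram.card, Finset.card_eq_sum_ones, Nat.cast_sum,
      ← Finset.sum_add_distrib]
    refine Finset.sum_congr rfl fun c _ => ?_
    push_cast
    ring
  rw [h1, h2, hcT]
  have e3 : a ^ (-(2 * ∑ c ∈ lam.cells, ((c.1 : ℤ) + 1))) * a ^ ((lam.card : ℤ) - η.card) =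
      a ^ (-(2 * ∑ c ∈ lam.cells, ((c.1 : ℤ) + 1) - lam.card)) * (a ^ η.card)⁻¹ := by
    rw [← zpow_natCast a η.card, ← zpow_neg, ← zpow_add₀ ha, ← zpow_add₀ ha]
    congr 1
    ring
  have e4 : b ^ (-(2 * ∑ c ∈ mu.cells, (c.2 : ℤ))) * b⁻¹ ^ ((mu.card : ℤ) - η.card) =
      b ^ (-(2 * ∑ c ∈ mu.cells, (c.2 : ℤ) + mu.card)) * b ^ η.card := by
    rw [← zpow_natCast b η.card, inv_zpow', ← zpow_add₀ hb, ← zpow_add₀ hb]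
    congr 1
    ring
  rw [div_pow, div_eq_mul_inv]
  linear_combination
    schurPoly lam η (fun i => a ^ (2 * i + 1) * b ^ (-(2 * (nu.transpose.rowLen i : ℤ)))) N *
    schurPoly mu.transpose η (fun i => b ^ (2 * i + 1) * a ^ (-(2 * (nu.rowLen i : ℤ)))) N *
    (a ^ (-(2 * ∑ c ∈ lam.cells, ((c.1 : ℤ) + 1))) * a ^ ((lam.card : ℤ) - η.card) * e4 +
      b ^ (-(2 * ∑ c ∈ mu.cells, (c.2 : ℤ) + mu.card)) * b ^ η.card * e3)

theorem finiteSchurSum_bot {F : Type*} [Field F] (a b : LaurentSeries F) (N : ℕ) :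
    finiteSchurSum ⊥ ⊥ ⊥ a b N = 1 := by
  have hs : (finite_le (⊥ : YoungDiagram)).toFinset = {⊥} := by
    ext η
    simp
  simp only [finiteSchurSum, transpose_bot, hs, Finset.sum_singleton, schurPoly_self]
  simp [YoungDiagram.card]

theorem tendsto_finiteSchurSum (hk : k ≠ 0) (lam mu nu : YoungDiagram) :
    Tendsto (finiteSchurSum lam mu nu (HahnSeries.single 1 k : LaurentSeries ℂ)
      (HahnSeries.single 1 k⁻¹)) atTop
      (𝓝 (∑ᶠ η : YoungDiagram, (HahnSeries.single 1 k⁻¹ / HahnSeries.single 1 k) ^ η.card *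
        skewSchur lam η (fun i => HahnSeries.single 1 k ^ (2 * i + 1) *
          HahnSeries.single 1 k⁻¹ ^ (-(2 * (nu.transpose.rowLen i : ℤ)))) *
        skewSchur mu.transpose η (fun i => HahnSeries.single 1 k⁻¹ ^ (2 * i + 1) *
          HahnSeries.single 1 k ^ (-(2 * (nu.rowLen i : ℤ)))))) := by
  rw [finsum_eq_sum_of_support_subset (s := (finite_le mu.transpose).toFinset)]
  · refine tendsto_finsetSum _ fun η _ => ((tendsto_schurPoly _ _ fun n => ?_).const_mul _).mul
      (tendsto_schurPoly _ _ fun n => ?_)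
    · have := eventually_mem_lowSubgroup (fun i => ((2 * i + 1 : ℕ) : ℤ))
        (fun i => (nu.transpose.rowLen i : ℤ)) (M := nu.transpose.rowLen 0)
        (fun i => Nat.cast_le.2 (nu.transpose.rowLen_anti _ _ (Nat.zero_le i)))
        (fun i => by push_cast; omega) hk n
      simpa only [zpow_natCast] using this
    · have := eventually_mem_lowSubgroup (fun i => ((2 * i + 1 : ℕ) : ℤ))
        (fun i => (nu.rowLen i : ℤ)) (M := nu.rowLen 0)
        (fun i => Nat.cast_le.2 (nu.rowLen_anti _ _ (Nat.zero_le i)))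
        (fun i => by push_cast; omega) (inv_ne_zero hk) n
      simpa only [zpow_natCast, inv_inv] using this
  · intro η hη
    rw [Set.Finite.coe_toFinset]
    by_contra h
    refine hη ?_
    dsimp only
    have h' : ¬ η ≤ mu.transpose := h
    rw [skewSchur.eq_def mu.transpose, if_neg h', mul_zero]

/-- The limit of the normalized vertex along a preferred slope is the refined vertex. -/
theorem refinedC_eq_limitSeries_div (lam mu nu : YoungDiagram) (k : ℂ) (hk : k ≠ 0) :
    refinedC lam mu nu (HahnSeries.single 1 k) (HahnSeries.single 1 k⁻¹) =
      limitSeries lam mu nu k / limitSeries ⊥ ⊥ ⊥ k := by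
  have hne : limitSeries ⊥ ⊥ ⊥ k ≠ 0 := by
    intro h
    have := coeff_zero_limitSeries_empty k
    rw [h] at this
    exact zero_ne_one this
  have h1 := (tendsto_cutoffSeries lam mu nu k).div (tendsto_cutoffSeries ⊥ ⊥ ⊥ k) hne
  have h2 := ((tendsto_finiteSchurSum hk lam mu nu).const_mul
    ((HahnSeries.single 1 k : LaurentSeries ℂ) ^ (-(lam.transpose.normSq : ℤ)) *
        HahnSeries.single 1 k⁻¹ ^ (-(mu.normSq : ℤ)))).mul (tendsto_invProd_div hk nu)
  refine Eq.trans ?_ (tendsto_nhds_unique (h2.congr' ?_) h1)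
  · rw [refinedC, div_mul_eq_mul_div, div_eq_mul_inv]
  · obtain ⟨B, hB, -⟩ := exists_fitsIn nu ⊥ ⊥
    filter_upwards [eventually_ge_atTop B] with N hN
    rw [Pi.div_apply, cutoffSeries_eq_finiteSchurSum hk fun c hc => by have := hB c hc; omega,
      cutoffSeries_eq_finiteSchurSum hk (fitsIn_bot N), finiteSchurSum_bot]
    have hz : (⊥ : YoungDiagram).normSq = 0 := by
      have := sum_cells_snd ⊥
      simpa using this.symm
    rw [transpose_bot, hz]
    simp only [Nat.cast_zero, neg_zero, zpow_zero, one_mul]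
    rw [mul_div_assoc]

end Partition3D

theorem mainTheorem9 (lam mu nu : YoungDiagram) :
    -- r₁ ≫ r₃ > 0 ≫ r₂
    HasSlopeLimit (fun M r => M * |r 2| < r 0 ∧ 0 < r 2 ∧ r 1 < -(M * |r 2|))
      (normalizedVertex lam mu nu)
      (fun sqrtT sqrtQ => refinedC lam mu nu sqrtT sqrtQ) ∧
    -- r₁ ≫ 0 > r₃ ≫ r₂
    HasSlopeLimit (fun M r => M * |r 2| < r 0 ∧ r 2 < 0 ∧ r 1 < -(M * |r 2|))
      (normalizedVertex lam mu nu)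
      (fun sqrtT sqrtQ => refinedC mu.transpose lam.transpose nu.transpose sqrtQ sqrtT) ∧
    -- r₂ ≫ r₃ > 0 ≫ r₁
    HasSlopeLimit (fun M r => M * |r 2| < r 1 ∧ 0 < r 2 ∧ r 0 < -(M * |r 2|))
      (normalizedVertex lam mu nu)
      (fun sqrtT sqrtQ => refinedC mu.transpose lam.transpose nu.transpose sqrtT sqrtQ) ∧
    -- r₂ ≫ 0 > r₃ ≫ r₁
    HasSlopeLimit (fun M r => M * |r 2| < r 1 ∧ r 2 < 0 ∧ r 0 < -(M * |r 2|))
      (normalizedVertex lam mu nu)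
      (fun sqrtT sqrtQ => refinedC lam mu nu sqrtQ sqrtT) :=
  Partition3D.hasSlopeLimit_of_limitSeries Partition3D.refinedC_eq_limitSeries_div lam mu nu
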